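/- Conventions. Manifolds are smooth, finite-dimensional, Hausdorff and second countable, without boundary. An exterior differential system (EDS) on a manifold $M$ is a homogeneous ideal $\mathcal I\subset\Omega^*(M)$ that is closed under $d$. For a set $\mathcal A$ of forms, $\langle\mathcal A\rangle_{\rm alg}$ and $\langle\mathcal A\rangle_{\rm diff}$ are the ideal and the differential ideal generated by $\mathcal A$, and for a subbundle $J\subset T^*M$ we write $\mathcal S(J)$ for its smooth sections. A Pfaffian system is an EDS of the form $\langle\mathcal S(I)\rangle_{\rm diff}$ with $I\subset T^*M$ a subbundle of constant rank. For a smooth submersion $p:M\to N$ the reduction of $\mathcal I$ is $\mathcal I/p=\{\theta\in\Omega^*(N)\mid p^*\theta\in\mathcal I\}$. A map of EDS $f:(M,\mathcal I)\to(N,\mathcal J)$ is a smooth map with $f^*\mathcal J\subset\mathcal I$. A surjective submersion $p:M\to N$, with EDS $\mathcal E$ on $M$ and $\mathcal J$ on $N$, is an integrable extension if there is a subbundle $J\subset T^*M$ of rank $\dim M-\dim N$ with $\mathrm{ann}(J)\cap\ker p_*=0$ and $\mathcal E=\langle p^*(\mathcal J)\cup\mathcal S(J)\rangle_{\rm alg}$.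 An EDS $\mathcal B$ is a Bäcklund transformation between $\mathcal J_1$ and $\mathcal J_2$ if there are maps $\pi_1,\pi_2$ which are integrable extensions from $\mathcal B$ to $\mathcal J_1$ and from $\mathcal B$ to $\mathcal J_2$. A Lie group $G$ acting smoothly on $M$ is a symmetry group of $\mathcal I$ if $g^*\mathcal I=\mathcal I$ for all $g\in G$. It is transverse to $\mathcal I$ if $\mathrm{ann}(\mathcal I^1)\cap\mathbf\Gamma_G=0$, where $\mathcal I^1$ consists of the 1-forms in $\mathcal I$ and $\mathbf\Gamma_G\subset TM$ is the distribution spanned by the infinitesimal generators of the action. The orbit space $M/G$ is a smooth quotient if, with the quotient topology, it is equipped with the structure of a smooth manifold for which $\mathbf q_G:M\to M/G$ is a smooth submersion; one then writes $\mathcal I/G=\mathcal I/\mathbf q_G$. Theorem. Let $\mathcal I$ be a Pfaffian system on a manifold $M$, let $G_1$ and $G_2$ be Lie groups acting smoothly on $M$ that are symmetry groups of $\mathcal I$, and let $H$ be a common subgroup of $G_1$ and $G_2$ (the two induced actions of $H$ on $M$ agree). Suppose that $M/H$, $M/G_1$ and $M/G_2$ are smooth quotients. (i) The orbit maps $\mathbf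 p_a:M/H\to M/G_a$, $\mathbf p_a(Hx)=G_ax$ ($a=1,2$), are well-defined surjective smooth submersions with $\mathbf p_a\circ\mathbf q_H=\mathbf q_{G_a}$. Moreover $\mathcal I/H$, $\mathcal I/G_1$, $\mathcal I/G_2$ are EDS, the maps $\mathbf q_H:(M,\mathcal I)\to(M/H,\mathcal I/H)$, $\mathbf q_{G_a}:(M,\mathcal I)\to(M/G_a,\mathcal I/G_a)$ and $\mathbf p_a:(M/H,\mathcal I/H)\to(M/G_a,\mathcal I/G_a)$ are maps of EDS, so that they form a commutative diagram of EDS, and $\mathcal I/G_a=(\mathcal I/H)/\mathbf p_a$. (ii) If the actions of $G_1$ and $G_2$ are transverse to $\mathcal I$, then $\mathbf q_H$, $\mathbf q_{G_1}$, $\mathbf q_{G_2}$, $\mathbf p_1$ and $\mathbf p_2$ are all integrable extensions, and $\mathcal I/H$ is a Bäcklund transformation between $\mathcal I/G_1$ and $\mathcal I/G_2$. -/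

import Mathlib

open scoped Manifold ContDiff Topology

noncomputable section

/-! ### Differential forms on manifolds

All manifolds are modelled on finite-dimensional real normed spaces `E`, without boundary. -/

section Forms

/-- The exterior product `a ∧ b` of alternating forms, with the shuffle normalisation
`(a ∧ b)(v₁, …, vₖ₊ₗ) = ∑ sign(σ) a(v_σ(1), …, v_σ(k)) b(v_σ(k+1), …, v_σ(k+l))`,
the sum being over `(k, l)`-shuffles. -/
def altWedge {V : Type*} [TopologicalSpace V] [AddCommGroup V] [Module ℝ V] {k l : ℕ}
    (a : V [⋀^Fin k]→L[ℝ] ℝ) (b : V [⋀^Fin l]→L[ℝ] ℝ) : V [⋀^Fin (k + l)]→L[ℝ] ℝ :=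
  { ((LinearMap.mul' ℝ ℝ).compAlternatingMap
      (a.toAlternatingMap.domCoprod b.toAlternatingMap)).domDomCongr finSumFinEquiv with
    cont := by
      have h : ∀ σ : Equiv.Perm.ModSumCongr (Fin k) (Fin l),
          Continuous fun v : Fin k ⊕ Fin l → V =>
            (LinearMap.mul' ℝ ℝ) (AlternatingMap.domCoprod.summand
              a.toAlternatingMap b.toAlternatingMap σ v) := by
        intro σ
        induction σ using Quotient.inductionOn' with
        | h σ =>
          simp only [AlternatingMap.domCoprod.summand_mk'']
          have h2 : Continuous fun v : Fin k ⊕ Fin l → V =>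
              (Equiv.Perm.sign σ : ℤ) • (a (fun i => v (σ (Sum.inl i))) *
                b (fun i => v (σ (Sum.inr i)))) := by
            have ha : Continuous fun v : Fin k ⊕ Fin l → V => a (fun i => v (σ (Sum.inl i))) :=
              (map_continuous a).comp (continuous_pi fun i => continuous_apply _)
            have hb : Continuous fun v : Fin k ⊕ Fin l → V => b (fun i => v (σ (Sum.inr i))) :=
              (map_continuous b).comp (continuous_pi fun i => continuous_apply _)
            exact (continuous_const_smul (Equiv.Perm.sign σ : ℤ)).comp (ha.mul hb)
          refine h2.congr fun v => ?_
          rw [smul_apply, Units.smul_def, map_zsmul]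
          simp
      have h3 : Continuous fun v : Fin (k + l) → V => ∑ σ, (LinearMap.mul' ℝ ℝ)
          (AlternatingMap.domCoprod.summand a.toAlternatingMap b.toAlternatingMap σ
            (fun i => v (finSumFinEquiv i))) :=
        continuous_finsetSum _ fun σ _ => (h σ).comp (continuous_pi fun i => continuous_apply _)
      refine h3.congr fun v => ?_
      simp [AlternatingMap.domCoprod_apply, Function.comp_def] }

variable {E : Type*} [NormedAddCommGroup E] [NormedSpace ℝ E]
  {F : Type*} [NormedAddCommGroup F] [NormedSpace ℝ F]

/-- A (not necessarily smooth) differential `k`-form on a manifold modelled on `E`. -/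
abbrev DForm (E : Type*) [NormedAddCommGroup E] [NormedSpace ℝ E]
    (M : Type*) [TopologicalSpace M] [ChartedSpace E M] (k : ℕ) : Type _ :=
  (x : M) → (TangentSpace 𝓘(ℝ, E) x) [⋀^Fin k]→L[ℝ] ℝ

variable {M : Type*} [TopologicalSpace M] [ChartedSpace E M]
  {N : Type*} [TopologicalSpace N] [ChartedSpace F N]

/-- The pullback `f^* β`. -/
def formPullback (f : M → N) {k : ℕ} (β : DForm F N k) : DForm E M k :=
  fun x => (β (f x)).compContinuousLinearMap (mfderiv 𝓘(ℝ, E) 𝓘(ℝ, F) f x)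

/-- The wedge product of differential forms. -/
def formWedge {k l : ℕ} (β : DForm E M k) (η : DForm E M l) : DForm E M (k + l) :=
  fun x => altWedge (β x) (η x)

/-- The local representative of `β` in the preferred chart at `x₀`, i.e. the pullback of `β` by the
inverse of the chart; it is meaningful on the target of the chart. -/
def localRep (x₀ : M) {k : ℕ} (β : DForm E M k) : E → E [⋀^Fin k]→L[ℝ] ℝ :=
  formPullback (E := E) (F := E) (M := E) (extChartAt 𝓘(ℝ, E) x₀).symm β

/-- Smoothness of a differential form: all its local representatives are smooth. -/
def IsSmoothForm {k : ℕ} (β : DForm E M k) : Prop :=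
  ∀ x₀ : M, ContDiffOn ℝ ∞ (localRep x₀ β) (extChartAt 𝓘(ℝ, E) x₀).target

/-- The exterior derivative, computed at `x` in the preferred chart at `x`. -/
def extD {k : ℕ} (β : DForm E M k) : DForm E M (k + 1) :=
  fun x => (extDeriv (localRep x β) (extChartAt 𝓘(ℝ, E) x x)).compContinuousLinearMap
    (mfderiv 𝓘(ℝ, E) 𝓘(ℝ, E) (extChartAt 𝓘(ℝ, E) x) x)

end Forms

/-! ### Exterior differential systems -/

section EDS

variable {E : Type*} [NormedAddCommGroup E] [NormedSpace ℝ E]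
  {F : Type*} [NormedAddCommGroup F] [NormedSpace ℝ F]
  {F' : Type*} [NormedAddCommGroup F'] [NormedSpace ℝ F']
  {M : Type*} [TopologicalSpace M] [ChartedSpace E M]
  {N : Type*} [TopologicalSpace N] [ChartedSpace F N]
  {N' : Type*} [TopologicalSpace N'] [ChartedSpace F' N']

/-- A set of homogeneous forms on `M`, given by its part in each degree. -/
abbrev FormSet (E : Type*) [NormedAddCommGroup E] [NormedSpace ℝ E]
    (M : Type*) [TopologicalSpace M] [ChartedSpace E M] : Type _ :=
  (k : ℕ) → Set (DForm E M k)

/-- An exterior differential system: a homogeneous ideal of the algebra `Ω^*(M)` of smooth forms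
which is closed under the exterior derivative, given by its homogeneous components. -/
structure IsEDS (S : FormSet E M) : Prop where
  smooth : ∀ {k : ℕ} {β : DForm E M k}, β ∈ S k → IsSmoothForm β
  zero_mem : ∀ k : ℕ, (0 : DForm E M k) ∈ S k
  add_mem : ∀ {k : ℕ} {β η : DForm E M k}, β ∈ S k → η ∈ S k → β + η ∈ S k
  wedge_right : ∀ {k l : ℕ} {β : DForm E M k} {α : DForm E M l},
    β ∈ S k → IsSmoothForm α → formWedge β α ∈ S (k + l)
  wedge_left : ∀ {k l : ℕ} {β : DForm E M k} {α : DForm E M l},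
    β ∈ S k → IsSmoothForm α → formWedge α β ∈ S (l + k)
  d_mem : ∀ {k : ℕ} {β : DForm E M k}, β ∈ S k → extD β ∈ S (k + 1)

/-- Membership in the algebraic ideal of `Ω^*(M)` generated by `A`. -/
inductive AlgGen (A : FormSet E M) : (k : ℕ) → DForm E M k → Prop
  | of {k : ℕ} {β : DForm E M k} (h : β ∈ A k) : AlgGen A k β
  | zero (k : ℕ) : AlgGen A k 0
  | add {k : ℕ} {β η : DForm E M k} (h₁ : AlgGen A k β) (h₂ : AlgGen A k η) : AlgGen A k (β + η)
  | wedge_right {k l : ℕ} {β : DForm E M k} {α : DForm E M l} (h : AlgGen A k β)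
      (hα : IsSmoothForm α) : AlgGen A (k + l) (formWedge β α)
  | wedge_left {k l : ℕ} {β : DForm E M k} {α : DForm E M l} (h : AlgGen A k β)
      (hα : IsSmoothForm α) : AlgGen A (l + k) (formWedge α β)

/-- Membership in the differential ideal of `Ω^*(M)` generated by `A`. -/
inductive DiffGen (A : FormSet E M) : (k : ℕ) → DForm E M k → Prop
  | of {k : ℕ} {β : DForm E M k} (h : β ∈ A k) : DiffGen A k β
  | zero (k : ℕ) : DiffGen A k 0
  | add {k : ℕ} {β η : DForm E M k} (h₁ : DiffGen A k β) (h₂ : DiffGen A k η) :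
      DiffGen A k (β + η)
  | wedge_right {k l : ℕ} {β : DForm E M k} {α : DForm E M l} (h : DiffGen A k β)
      (hα : IsSmoothForm α) : DiffGen A (k + l) (formWedge β α)
  | wedge_left {k l : ℕ} {β : DForm E M k} {α : DForm E M l} (h : DiffGen A k β)
      (hα : IsSmoothForm α) : DiffGen A (l + k) (formWedge α β)
  | d {k : ℕ} {β : DForm E M k} (h : DiffGen A k β) : DiffGen A (k + 1) (extD β)

/-- `⟨A⟩_alg`, the algebraic ideal generated by a set `A` of smooth forms. -/
def algIdeal (A : FormSet E M) : FormSet E M := fun k => {β | AlgGen A k β}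

/-- `⟨A⟩_diff`, the differential ideal generated by a set `A` of smooth forms. -/
def diffIdeal (A : FormSet E M) : FormSet E M := fun k => {β | DiffGen A k β}

/-- A family `J` of subspaces `J_x ⊆ T_x^*M` is a smooth subbundle of `T^*M` of constant rank `r`:
near every point it is framed by `r` smooth 1-forms. (On a Hausdorff manifold, a local frame can be
taken to consist of restrictions of globally defined smooth 1-forms.) -/
def IsSubbundle (J : (x : M) → Submodule ℝ ((TangentSpace 𝓘(ℝ, E) x) [⋀^Fin 1]→L[ℝ] ℝ))
    (r : ℕ) : Prop :=
  ∀ x₀ : M, ∃ θ : Fin r → DForm E M 1, (∀ i, IsSmoothForm (θ i)) ∧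
    ∀ᶠ x in 𝓝 x₀, LinearIndependent ℝ (fun i => θ i x) ∧
      Submodule.span ℝ (Set.range fun i => θ i x) = J x

/-- The smooth sections of `J ⊆ T^*M`, as a set of forms concentrated in degree one. -/
inductive SectionOf (J : (x : M) → Submodule ℝ ((TangentSpace 𝓘(ℝ, E) x) [⋀^Fin 1]→L[ℝ] ℝ)) :
    (k : ℕ) → DForm E M k → Prop
  | mk {β : DForm E M 1} (hβ : IsSmoothForm β) (h : ∀ x, β x ∈ J x) : SectionOf J 1 β

/-- `𝒮(J)`. -/
def sectionsOf (J : (x : M) → Submodule ℝ ((TangentSpace 𝓘(ℝ, E) x) [⋀^Fin 1]→L[ℝ] ℝ)) :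
    FormSet E M := fun k => {β | SectionOf J k β}

/-- A (constant rank) Pfaffian differential system: the differential ideal generated by the sections
of a constant rank subbundle of `T^*M`. -/
def IsPfaffianSystem (S : FormSet E M) : Prop :=
  ∃ (r : ℕ) (J : (x : M) → Submodule ℝ ((TangentSpace 𝓘(ℝ, E) x) [⋀^Fin 1]→L[ℝ] ℝ)),
    IsSubbundle J r ∧ S = diffIdeal (sectionsOf J)

/-- `p^*(S)`, the set of pullbacks of the elements of `S`. -/
def pullbackSet (p : M → N) (S : FormSet F N) : FormSet E M :=
  fun k => (fun β : DForm F N k => (formPullback p β : DForm E M k)) '' S k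

/-- The reduced system `S / p = {θ ∈ Ω^*(N) | p^* θ ∈ S}`. -/
def reduction (p : M → N) (S : FormSet E M) : FormSet F N :=
  fun k => {θ | IsSmoothForm θ ∧ (formPullback p θ : DForm E M k) ∈ S k}

/-- A smooth submersion (of manifolds of finite dimension). -/
def IsSmoothSubmersion (p : M → N) : Prop :=
  ContMDiff 𝓘(ℝ, E) 𝓘(ℝ, F) ∞ p ∧
    ∀ x, Function.Surjective (mfderiv 𝓘(ℝ, E) 𝓘(ℝ, F) p x)

/-- A map of exterior differential systems `(M, S) → (N, T)`: a smooth map `f : M → N` with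
`f^* T ⊆ S`. -/
def IsEDSMap (f : M → N) (S : FormSet E M) (T : FormSet F N) : Prop :=
  ContMDiff 𝓘(ℝ, E) 𝓘(ℝ, F) ∞ f ∧ ∀ k, pullbackSet f T k ⊆ S k

/-- `p : (M, S) → (N, T)` is an integrable extension: `p` is a surjective submersion, `S` and `T` are
exterior differential systems, and there is an admissible subbundle, i.e. a smooth subbundle
`J ⊆ T^*M` of rank `dim M - dim N` with `ann(J) ∩ ker(p_*) = 0` and `S = ⟨p^*(T) + 𝒮(J)⟩_alg`. -/
def IsIntegrableExtension (p : M → N) (S : FormSet E M) (T : FormSet F N) : Prop :=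
  Function.Surjective p ∧ IsSmoothSubmersion (E := E) (F := F) p ∧ IsEDS S ∧ IsEDS T ∧
  ∃ J : (x : M) → Submodule ℝ ((TangentSpace 𝓘(ℝ, E) x) [⋀^Fin 1]→L[ℝ] ℝ),
    IsSubbundle J (Module.finrank ℝ E - Module.finrank ℝ F) ∧
    (∀ (x : M) (v : TangentSpace 𝓘(ℝ, E) x), (∀ θ ∈ J x, θ (fun _ => v) = 0) →
      mfderiv 𝓘(ℝ, E) 𝓘(ℝ, F) p x v = 0 → v = 0) ∧
    S = algIdeal (fun k => pullbackSet p T k ∪ sectionsOf J k)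

/-- `B` is a Bäcklund transformation between `T₁` and `T₂`: it is simultaneously an integrable
extension of both. -/
def IsBacklundTransformation (B : FormSet E M) (T₁ : FormSet F N) (T₂ : FormSet F' N') : Prop :=
  ∃ (π₁ : M → N) (π₂ : M → N'), IsIntegrableExtension π₁ B T₁ ∧ IsIntegrableExtension π₂ B T₂

end EDS

/-! ### Group actions -/

section Actions

variable {E : Type*} [NormedAddCommGroup E] [NormedSpace ℝ E]
  {M : Type*} [TopologicalSpace M] [ChartedSpace E M]

/-- `G` is a symmetry group of `S`: `g^* S = S` for all `g ∈ G`. -/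
def IsSymmetryGroup (G : Type*) [Group G] [MulAction G M] (S : FormSet E M) : Prop :=
  ∀ g : G, pullbackSet (fun x : M => g • x) S = S

/-- `𝚪_G` at `x`: the values at `x` of the infinitesimal generators of the action, i.e. the
tangent vectors `d/dt|₀ (c(t) • x)` with `c` a curve in `G` through the identity. Here
`T_{1 • x} M` and `T_x M` are identified, as `1 • x = x`. -/
def generatorSpace {V : Type*} [NormedAddCommGroup V] [NormedSpace ℝ V]
    (G : Type*) [TopologicalSpace G] [ChartedSpace V G] [Group G] [MulAction G M] (x : M) :
    Set (TangentSpace 𝓘(ℝ, E) x) :=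
  {v | ∃ ξ : TangentSpace 𝓘(ℝ, V) (1 : G),
    v = (mfderiv 𝓘(ℝ, V) 𝓘(ℝ, E) (fun g : G => g • x) 1 : V →L[ℝ] E) ξ}

/-- The action of `G` is transverse to `S`: `ann(S¹) ∩ 𝚪_G = 0`, where `S¹` consists of the
1-forms in `S`. -/
def IsTransverse {V : Type*} [NormedAddCommGroup V] [NormedSpace ℝ V]
    (G : Type*) [TopologicalSpace G] [ChartedSpace V G] [Group G] [MulAction G M]
    (S : FormSet E M) : Prop :=
  ∀ (x : M) (v : TangentSpace 𝓘(ℝ, E) x), (∀ θ ∈ S 1, θ x (fun _ => v) = 0) →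
    v ∈ generatorSpace (V := V) G x → v = 0

/-- The projection `q_G : M → M/G` to the space of orbits. -/
def orbitProj (G : Type*) (M : Type*) [Group G] [MulAction G M] :
    M → MulAction.orbitRel.Quotient G M :=
  Quotient.mk _

end Actions

end

noncomputable section

/-! ### Algebra of the exterior product -/

section Antisymmetrization

variable {V : Type*}

/-! Write `q : M → N` for one of the quotient maps. A Pfaffian system has a finite global family `θ`
of 1-forms of constant rank such that `S` is the algebraic ideal of the forms `θ i` and `dθ i`
(`exists_isPfaffianFrame`). Call a tangent vector integral if every `θ i` vanishes on it.

Part (i) is formal. Pullback commutes with `∧` and `d`, so a reduction of an EDS is an EDS; reducing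
along a composite is reducing twice (`reduction_comp`); and the maps between quotients are smooth
submersions because the map out of `M` has local sections (`IsSmoothSubmersion.of_comp`).

For part (ii), let `q` be the quotient by a Lie group `G`. Its vertical vectors are the values of
the infinitesimal generators (`exists_tangentField_orbitMap_eq`, by comparing dimensions of orbit
and fibre). Transversality therefore says that no nonzero vertical vector is integral, and there is
a smooth field `Q` of projections onto the vertical spaces that kills the integral vectors
(`exists_splitting`). The admissible bundle `J` consists of the 1-forms that factor through `Q`
(`splitBundle`). The content is the inclusion of `S` in the ideal generated by `q^*(S/G)` and the
sections of `J`, checked on the generators. For a local section `s` of `q`, the form `θ i` is pulled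
back by `(1 - Q) ∘ s_*` to a form on `N` (`sectionPull`). Since `G` moves integral vectors along the
fibres, the `q`-pullback of this form lies in the span of `θ`, and such forms together with the `θ i
∘ Q` span it. For `dθ j`, write `x = γ(x) • s (q x)` with `γ` smooth (`exists_slice`). The
endomorphism `γ(x)_* (1 - Q) s_* q_*` fixes integral vectors, so pulling back by it changes `dθ j`
only by the ideal of `θ`. The invariance relation `g^* θ j = ∑ c i θ i`, differentiated with `g =
γ(x)` frozen (`exists_twist`), expresses the result through descended forms. This gives
`eq_extensionIdeal`.

The common subgroup `H` is an abstract group, so no smooth slices are available for it. With `q` now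
the projection to `M/H` and `p` that from `M/H` to `M/G`, the equality for `p ∘ q` implies the one
for `q` (`eq_extensionIdeal_of_comp`). For `p` itself, pulling back by local sections of `q`
composed with `1 - Q` carries `p ∘ q`-pullbacks to `p`-pullbacks and kills `J`, so it transports the
equality from `M` to `M/H` (`reduction_eq_extensionIdeal`).

Membership in an algebraic ideal allows finite sums only, so local statements are glued with
finitely many functions, each accompanied by a locally constant choice of local data on its support
(`exists_colouring`). Such colourings come from covers of bounded order, which the Besicovitch
covering theorem provides. -/

/-- The sum of the signed permutations of a function of `n` vectors. -/
def signedSum {n : ℕ} (h : (Fin n → V) → ℝ) (v : Fin n → V) : ℝ :=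
  ∑ σ : Equiv.Perm (Fin n), ((Equiv.Perm.sign σ : ℤ) : ℝ) * h (fun i => v (σ i))

/-- The product of two functions, the first one evaluated on the first `k` vectors. -/
def juxt {k l : ℕ} (f : (Fin k → V) → ℝ) (g : (Fin l → V) → ℝ) (v : Fin (k + l) → V) : ℝ :=
  f (fun i => v (Fin.castAdd l i)) * g (fun j => v (Fin.natAdd k j))

/-- The product of a function of one vector and a function of `k` vectors. -/
def consMul {k : ℕ} (c : V → ℝ) (g : (Fin k → V) → ℝ) (v : Fin (k + 1) → V) : ℝ :=
  c (v 0) * g (fun j => v j.succ)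

theorem signedSum_perm {n : ℕ} (h : (Fin n → V) → ℝ) (τ : Equiv.Perm (Fin n)) (v : Fin n → V) :
    signedSum (fun w => h (fun i => w (τ i))) v =
      ((Equiv.Perm.sign τ : ℤ) : ℝ) * signedSum h v := by
  unfold signedSum
  rw [Finset.mul_sum]
  refine Fintype.sum_equiv (Equiv.mulRight τ) _ _ fun σ => ?_
  simp only [Equiv.coe_mulRight, Equiv.Perm.sign_mul, Units.val_mul, Int.cast_mul,
    Equiv.Perm.coe_mul, Function.comp_apply]
  have : ((Equiv.Perm.sign τ : ℤ) : ℝ) * ((Equiv.Perm.sign τ : ℤ) : ℝ) = 1 := by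
    rcases Int.units_eq_one_or (Equiv.Perm.sign τ) with h | h <;> simp [h]
  linear_combination (-((Equiv.Perm.sign σ : ℤ) : ℝ) * h (fun i => v (σ (τ i)))) * this

theorem signedSum_smul {n : ℕ} (c : ℝ) (h : (Fin n → V) → ℝ) (v : Fin n → V) :
    signedSum (fun w => c * h w) v = c * signedSum h v := by
  unfold signedSum
  rw [Finset.mul_sum]
  exact Finset.sum_congr rfl fun σ _ => by ring

theorem signedSum_sum {n : ℕ} {ι : Type*} (s : Finset ι) (h : ι → (Fin n → V) → ℝ)
    (v : Fin n → V) :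
    signedSum (fun w => ∑ i ∈ s, h i w) v = ∑ i ∈ s, signedSum (h i) v := by
  unfold signedSum
  rw [Finset.sum_comm]
  exact Finset.sum_congr rfl fun σ _ => by rw [Finset.mul_sum]

theorem sign_sq_real {n : ℕ} (τ : Equiv.Perm (Fin n)) :
    ((Equiv.Perm.sign τ : ℤ) : ℝ) * ((Equiv.Perm.sign τ : ℤ) : ℝ) = 1 := by
  rcases Int.units_eq_one_or (Equiv.Perm.sign τ) with h | h <;> simp [h]

/-- Antisymmetrization absorbs an antisymmetrization over a subgroup of the permutations. -/
theorem signedSum_absorb {m n : ℕ} (e : Equiv.Perm (Fin m) → Equiv.Perm (Fin n))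
    (he : ∀ τ, Equiv.Perm.sign (e τ) = Equiv.Perm.sign τ) (H : (Fin n → V) → ℝ) (v : Fin n → V) :
    signedSum (fun w => ∑ τ : Equiv.Perm (Fin m), ((Equiv.Perm.sign τ : ℤ) : ℝ) *
      H (fun i => w (e τ i))) v = (m.factorial : ℝ) * signedSum H v := by
  rw [signedSum_sum]
  have : ∀ τ : Equiv.Perm (Fin m), signedSum (fun w => ((Equiv.Perm.sign τ : ℤ) : ℝ) *
      H (fun i => w (e τ i))) v = signedSum H v := by
    intro τ
    rw [signedSum_smul _ (fun w => H (fun i => w (e τ i))), signedSum_perm, he, ← mul_assoc,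
      sign_sq_real, one_mul]
  simp [this, Fintype.card_perm]

/-- The permutation of `Fin (k + l)` which permutes the first `k` elements. -/
def permLeft {k : ℕ} (l : ℕ) (τ : Equiv.Perm (Fin k)) : Equiv.Perm (Fin (k + l)) :=
  finSumFinEquiv.permCongr (Equiv.Perm.sumCongr τ 1)

/-- The permutation of `Fin (k + l)` which permutes the last `l` elements. -/
def permRight (k : ℕ) {l : ℕ} (τ : Equiv.Perm (Fin l)) : Equiv.Perm (Fin (k + l)) :=
  finSumFinEquiv.permCongr (Equiv.Perm.sumCongr 1 τ)

theorem signedSum_juxt_left {k l : ℕ} (f : (Fin k → V) → ℝ) (g : (Fin l → V) → ℝ)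
    (v : Fin (k + l) → V) :
    signedSum (juxt (signedSum f) g) v = (k.factorial : ℝ) * signedSum (juxt f g) v := by
  rw [← signedSum_absorb (permLeft l) (fun τ => by simp [permLeft])]
  congr 1
  funext w
  unfold juxt signedSum
  rw [Finset.sum_mul]
  refine Finset.sum_congr rfl fun τ _ => ?_
  simp [permLeft, mul_assoc, Equiv.permCongr_apply]

theorem signedSum_juxt_right {k l : ℕ} (f : (Fin k → V) → ℝ) (g : (Fin l → V) → ℝ)
    (v : Fin (k + l) → V) :
    signedSum (juxt f (signedSum g)) v = (l.factorial : ℝ) * signedSum (juxt f g) v := by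
  rw [← signedSum_absorb (permRight k) (fun τ => by simp [permRight])]
  congr 1
  funext w
  unfold juxt signedSum
  rw [Finset.mul_sum]
  refine Finset.sum_congr rfl fun τ _ => ?_
  simp [permRight, Equiv.permCongr_apply]
  ring

theorem signedSum_consMul {k : ℕ} (c : V → ℝ) (g : (Fin k → V) → ℝ) (v : Fin (k + 1) → V) :
    signedSum (consMul c (signedSum g)) v = (k.factorial : ℝ) * signedSum (consMul c g) v := by
  -- A permutation of the last `k` slots is extended by fixing slot `0`, which keeps its sign.
  rw [← signedSum_absorb (fun τ : Equiv.Perm (Fin k) => Equiv.Perm.decomposeFin.symm (0, τ))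
    (fun τ => by simp)]
  congr 1
  funext w
  unfold consMul signedSum
  rw [Finset.mul_sum]
  refine Finset.sum_congr rfl fun τ _ => ?_
  simp
  ring

theorem signedSum_cast {k l : ℕ} (h : k = l) (f : (Fin l → V) → ℝ) (v : Fin k → V) :
    signedSum (fun w : Fin k → V => f (fun i => w (Fin.cast h.symm i))) v =
      signedSum f (fun i => v (Fin.cast h.symm i)) := by
  subst h; rfl

end Antisymmetrization

/-! ### Exterior products as normalized antisymmetrizations -/

section Wedge

variable {V : Type*} [NormedAddCommGroup V] [NormedSpace ℝ V]
  {V' : Type*} [NormedAddCommGroup V'] [NormedSpace ℝ V']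

theorem signedSum_alternating {k : ℕ} (a : V [⋀^Fin k]→L[ℝ] ℝ) :
    signedSum (⇑a) = fun v => (k.factorial : ℝ) * a v := by
  funext v
  unfold signedSum
  have : ∀ σ : Equiv.Perm (Fin k), ((Equiv.Perm.sign σ : ℤ) : ℝ) * a (fun i => v (σ i)) = a v := by
    intro σ
    have h := a.toAlternatingMap.map_perm v σ
    have h' : a (fun i => v (σ i)) = ((Equiv.Perm.sign σ : ℤ) : ℝ) * a v := by
      have : a (fun i => v (σ i)) = Equiv.Perm.sign σ • a v := h
      rw [this, Units.smul_def, zsmul_eq_mul]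
    rw [h', ← mul_assoc, sign_sq_real, one_mul]
  simp [this, Fintype.card_perm]

/-- Shuffles represent the cosets of the permutations preserving both blocks of arguments, whence
the factor `k! l!`. Identities for the shuffle product are obtained below as identities of full
signed sums. -/
theorem altWedge_eq_signedSum {k l : ℕ} (a : V [⋀^Fin k]→L[ℝ] ℝ) (b : V [⋀^Fin l]→L[ℝ] ℝ)
    (v : Fin (k + l) → V) :
    (k.factorial : ℝ) * l.factorial * altWedge a b v = signedSum (juxt a b) v := by
  have h := MultilinearMap.domCoprod_alternization_eq a.toAlternatingMap b.toAlternatingMap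
  have h2 := congrArg (fun F => (LinearMap.mul' ℝ ℝ) (F (fun i => v (finSumFinEquiv i)))) h
  simp only [Fintype.card_fin] at h2
  have e1 : altWedge a b v = (LinearMap.mul' ℝ ℝ)
      ((a.toAlternatingMap.domCoprod b.toAlternatingMap) (fun i => v (finSumFinEquiv i))) := rfl
  rw [e1]
  have e2 : (LinearMap.mul' ℝ ℝ) (((k.factorial * l.factorial) •
      a.toAlternatingMap.domCoprod b.toAlternatingMap) (fun i => v (finSumFinEquiv i))) =
      (k.factorial : ℝ) * l.factorial * (LinearMap.mul' ℝ ℝ)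
      ((a.toAlternatingMap.domCoprod b.toAlternatingMap) (fun i => v (finSumFinEquiv i))) := by
    rw [AlternatingMap.smul_apply, map_nsmul, nsmul_eq_mul, Nat.cast_mul]
  rw [← e2, ← h2, MultilinearMap.alternatization_apply, map_sum]
  unfold signedSum
  refine Fintype.sum_equiv finSumFinEquiv.permCongr _ _ fun σ => ?_
  rw [Units.smul_def, map_zsmul, zsmul_eq_mul]
  simp [juxt, Equiv.permCongr_apply]

theorem altWedge_apply {k l : ℕ} (a : V [⋀^Fin k]→L[ℝ] ℝ) (b : V [⋀^Fin l]→L[ℝ] ℝ)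
    (v : Fin (k + l) → V) :
    altWedge a b v = ((k.factorial : ℝ) * l.factorial)⁻¹ * signedSum (juxt a b) v := by
  rw [← altWedge_eq_signedSum, inv_mul_cancel_left₀]
  positivity

theorem altWedge_add_left {k l : ℕ} (a a' : V [⋀^Fin k]→L[ℝ] ℝ) (b : V [⋀^Fin l]→L[ℝ] ℝ) :
    altWedge (a + a') b = altWedge a b + altWedge a' b := by
  ext v
  simp only [altWedge_apply, ContinuousAlternatingMap.add_apply, ← mul_add]
  congr 1
  simp [signedSum, juxt, ← Finset.sum_add_distrib, add_mul, mul_add]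

theorem altWedge_add_right {k l : ℕ} (a : V [⋀^Fin k]→L[ℝ] ℝ) (b b' : V [⋀^Fin l]→L[ℝ] ℝ) :
    altWedge a (b + b') = altWedge a b + altWedge a b' := by
  ext v
  simp only [altWedge_apply, ContinuousAlternatingMap.add_apply, ← mul_add]
  congr 1
  simp [signedSum, juxt, ← Finset.sum_add_distrib, mul_add]

theorem altWedge_smul_left {k l : ℕ} (c : ℝ) (a : V [⋀^Fin k]→L[ℝ] ℝ)
    (b : V [⋀^Fin l]→L[ℝ] ℝ) : altWedge (c • a) b = c • altWedge a b := by
  ext v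
  simp only [altWedge_apply, ContinuousAlternatingMap.smul_apply, smul_eq_mul]
  rw [mul_left_comm]
  congr 1
  rw [← signedSum_smul c]
  congr 1
  funext w
  simp [juxt, mul_assoc]

theorem altWedge_smul_right {k l : ℕ} (c : ℝ) (a : V [⋀^Fin k]→L[ℝ] ℝ)
    (b : V [⋀^Fin l]→L[ℝ] ℝ) : altWedge a (c • b) = c • altWedge a b := by
  ext v
  simp only [altWedge_apply, ContinuousAlternatingMap.smul_apply, smul_eq_mul]
  rw [mul_left_comm]
  congr 1
  rw [← signedSum_smul c]
  congr 1
  funext w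
  simp [juxt, mul_left_comm]

theorem altWedge_zero_left {k l : ℕ} (b : V [⋀^Fin l]→L[ℝ] ℝ) :
    altWedge (0 : V [⋀^Fin k]→L[ℝ] ℝ) b = 0 := by
  simpa using altWedge_smul_left 0 (0 : V [⋀^Fin k]→L[ℝ] ℝ) b

theorem altWedge_zero_right {k l : ℕ} (a : V [⋀^Fin k]→L[ℝ] ℝ) :
    altWedge a (0 : V [⋀^Fin l]→L[ℝ] ℝ) = 0 := by
  simpa using altWedge_smul_right 0 a (0 : V [⋀^Fin l]→L[ℝ] ℝ)

theorem altWedge_comp {k l : ℕ} (a : V [⋀^Fin k]→L[ℝ] ℝ) (b : V [⋀^Fin l]→L[ℝ] ℝ)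
    (L : V' →L[ℝ] V) :
    (altWedge a b).compContinuousLinearMap L =
      altWedge (a.compContinuousLinearMap L) (b.compContinuousLinearMap L) := by
  ext v
  simp [altWedge_apply, signedSum, juxt, Function.comp_def]

/-- The exterior product of `c` and `a`, in degree `k + 1`. -/
def consWedge {k : ℕ} (c : V →L[ℝ] ℝ) (a : V [⋀^Fin k]→L[ℝ] ℝ) : V [⋀^Fin (k + 1)]→L[ℝ] ℝ :=
  ContinuousAlternatingMap.alternatizeUncurryFin (c.smulRight a)

theorem consWedge_apply {k : ℕ} (c : V →L[ℝ] ℝ) (a : V [⋀^Fin k]→L[ℝ] ℝ) (v : Fin (k + 1) → V) :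
    consWedge c a v = ∑ i : Fin (k + 1), (-1) ^ i.val * (c (v i) * a (i.removeNth v)) := by
  simp [consWedge, ContinuousAlternatingMap.alternatizeUncurryFin_apply]

/-- The cycle that brings slot `i` to the front has sign `(-1)^i`, so after antisymmetrization the
`k + 1` terms of the expansion all coincide. Antisymmetrizing the alternating left side gives `(k +
1)!`, and one factor `k + 1` cancels. -/
theorem consWedge_eq_signedSum {k : ℕ} (c : V →L[ℝ] ℝ) (a : V [⋀^Fin k]→L[ℝ] ℝ)
    (v : Fin (k + 1) → V) :
    (k.factorial : ℝ) * consWedge c a v = signedSum (consMul c a) v := by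
  have h := signedSum_alternating (consWedge c a)
  have key : ∀ i : Fin (k + 1), signedSum (fun w : Fin (k + 1) → V =>
      (-1) ^ i.val * (c (w i) * a (i.removeNth w))) v = signedSum (consMul c a) v := by
    intro i
    rw [signedSum_smul]
    have : (fun w : Fin (k + 1) → V => c (w i) * a (i.removeNth w)) =
        fun w => consMul c a (fun j => w (i.cycleRange.symm j)) := by
      funext w
      simp [consMul, Fin.cycleRange_symm_zero, Fin.cycleRange_symm_succ]
      exact Or.inl rfl
    rw [this, signedSum_perm, Equiv.Perm.sign_symm, Fin.sign_cycleRange, ← mul_assoc]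
    simp [← mul_pow]
  have h2 : signedSum (⇑(consWedge c a)) v = (k + 1) * signedSum (consMul c a) v := by
    have : (⇑(consWedge c a)) = fun w : Fin (k + 1) → V =>
      ∑ i : Fin (k + 1), (-1) ^ i.val * (c (w i) * a (i.removeNth w)) := by
      funext w; exact consWedge_apply c a w
    rw [this, signedSum_sum]
    simp [key]
  rw [h] at h2
  simp only [Nat.factorial_succ, Nat.cast_mul, Nat.cast_succ] at h2
  have hk : ((k : ℝ) + 1) ≠ 0 := by positivity
  apply mul_left_cancel₀ hk
  rw [← h2]; ring

theorem consWedge_apply' {k : ℕ} (c : V →L[ℝ] ℝ) (a : V [⋀^Fin k]→L[ℝ] ℝ)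
    (v : Fin (k + 1) → V) :
    consWedge c a v = (k.factorial : ℝ)⁻¹ * signedSum (consMul c a) v := by
  rw [← consWedge_eq_signedSum, inv_mul_cancel_left₀]
  positivity

/-- Transport of a form along an equality of degrees. -/
def degCast {k l : ℕ} (h : k = l) (a : V [⋀^Fin k]→L[ℝ] ℝ) : V [⋀^Fin l]→L[ℝ] ℝ :=
  h ▸ a

@[simp] theorem degCast_apply {k l : ℕ} (h : k = l) (a : V [⋀^Fin k]→L[ℝ] ℝ) (v : Fin l → V) :
    degCast h a v = a (fun i => v (Fin.cast h i)) := by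
  subst h; rfl

/-- Associativity in the case needed for the Leibniz rule: both sides are multiples of the same
signed sum over `k + l + 1` slots. -/
theorem consWedge_altWedge_left {k l : ℕ} (c : V →L[ℝ] ℝ) (a : V [⋀^Fin k]→L[ℝ] ℝ)
    (b : V [⋀^Fin l]→L[ℝ] ℝ) :
    consWedge c (altWedge a b) =
      degCast (by omega : k + 1 + l = k + l + 1) (altWedge (consWedge c a) b) := by
  ext v
  rw [degCast_apply, altWedge_apply, consWedge_apply']
  have e1 : (⇑(altWedge a b)) = fun v => ((k.factorial : ℝ) * l.factorial)⁻¹ *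
      signedSum (juxt a b) v := funext fun v => altWedge_apply a b v
  have e2 : (⇑(consWedge c a)) = fun v => (k.factorial : ℝ)⁻¹ *
      signedSum (consMul c a) v := funext fun v => consWedge_apply' c a v
  have e3 : consMul c (⇑(altWedge a b)) = fun v => ((k.factorial : ℝ) * l.factorial)⁻¹ *
      consMul c (signedSum (juxt a b)) v := by
    funext w; rw [e1]; simp only [consMul]; ring
  have e4 : juxt (⇑(consWedge c a)) (⇑b) = fun v => (k.factorial : ℝ)⁻¹ *
      juxt (signedSum (consMul c a)) b v := by
    funext w; rw [e2]; simp only [juxt]; ring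
  rw [e3, e4, signedSum_smul, signedSum_smul, signedSum_consMul, signedSum_juxt_left]
  rw [← signedSum_cast (by omega : k + l + 1 = k + 1 + l)]
  have e5 : (fun w : Fin (k + l + 1) → V => juxt (consMul (⇑c) (⇑a)) (⇑b)
      (fun i => w (Fin.cast (by omega) i))) = consMul c (juxt a b) := by
    funext w
    simp only [juxt, consMul, mul_assoc]
    congr 1
    congr 2
    funext j
    congr 1
    ext
    simp
    omega
  rw [e5]
  have := Nat.factorial_pos k
  have := Nat.factorial_pos l
  have := Nat.factorial_pos (k + l)
  have := Nat.factorial_pos (k + 1)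
  field_simp

/-- The sign is that of the cycle carrying the argument of `c` from slot `k` to slot `0`, past the
`k` arguments of `a`. -/
theorem consWedge_altWedge_right {k l : ℕ} (c : V →L[ℝ] ℝ) (a : V [⋀^Fin k]→L[ℝ] ℝ)
    (b : V [⋀^Fin l]→L[ℝ] ℝ) :
    altWedge a (consWedge c b) = (-1 : ℝ) ^ k • consWedge c (altWedge a b) := by
  ext v
  rw [ContinuousAlternatingMap.smul_apply, smul_eq_mul]
  rw [altWedge_apply, consWedge_apply']
  have e1 : (⇑(altWedge a b)) = fun v => ((k.factorial : ℝ) * l.factorial)⁻¹ *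
      signedSum (juxt a b) v := funext fun v => altWedge_apply a b v
  have e2 : (⇑(consWedge c b)) = fun v => (l.factorial : ℝ)⁻¹ *
      signedSum (consMul c b) v := funext fun v => consWedge_apply' c b v
  have e3 : consMul c (⇑(altWedge a b)) = fun v => ((k.factorial : ℝ) * l.factorial)⁻¹ *
      consMul c (signedSum (juxt a b)) v := by
    funext w; rw [e1]; simp only [consMul]; ring
  have e4 : juxt (⇑a) (⇑(consWedge c b)) = fun v => (l.factorial : ℝ)⁻¹ *
      juxt a (signedSum (consMul c b)) v := by
    funext w; rw [e2]; simp only [juxt]; ring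
  rw [e3, e4, signedSum_smul, signedSum_smul, signedSum_consMul, signedSum_juxt_right]
  have e5 : signedSum (juxt (⇑a) (consMul c b)) v =
      (-1 : ℝ) ^ k * signedSum (consMul c (juxt a b)) v := by
    have hp := signedSum_perm (consMul c (juxt a b))
      ((⟨k, by omega⟩ : Fin (k + l + 1)).cycleRange.symm) v
    rw [Equiv.Perm.sign_symm, Fin.sign_cycleRange] at hp
    simp only [Units.val_pow_eq_pow_val, Units.val_neg, Units.val_one, Int.cast_pow, Int.cast_neg,
      Int.cast_one] at hp
    rw [← hp]
    congr 1
    funext w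
    simp only [juxt, consMul, Fin.cycleRange_symm_zero, Fin.cycleRange_symm_succ]
    rw [mul_left_comm]
    congr 1
    congr 1
    · congr 1
      funext i
      congr 1
      rw [Fin.succAbove_of_castSucc_lt]
      · ext; simp
      · rw [Fin.lt_def]; simp
    · congr 1
      funext i
      congr 1
      rw [Fin.succAbove_of_le_castSucc]
      · ext; simp; omega
      · rw [Fin.le_def]; simp
  rw [e5]
  have := Nat.factorial_pos k
  have := Nat.factorial_pos l
  have := Nat.factorial_pos (k + l)
  have := Nat.factorial_pos (l + 1)
  field_simp

/-- The exterior product with a form of degree one. -/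
theorem altWedge_ofSubsingleton {k : ℕ} (c : V →L[ℝ] ℝ) (a : V [⋀^Fin k]→L[ℝ] ℝ) :
    consWedge c a = degCast (add_comm 1 k)
      (altWedge (ContinuousAlternatingMap.ofSubsingleton ℝ V ℝ (0 : Fin 1) c) a) := by
  ext v
  rw [degCast_apply, altWedge_apply, consWedge_apply', ← signedSum_cast (add_comm k 1)]
  congr 1
  · simp
  · congr 1
    funext w
    simp only [juxt, consMul, ContinuousAlternatingMap.ofSubsingleton_apply_apply]
    congr 1
    congr 1
    funext j
    congr 1
    ext
    simp

theorem altWedge_const_right {k : ℕ} (a : V [⋀^Fin k]→L[ℝ] ℝ) (b : V [⋀^Fin 0]→L[ℝ] ℝ) :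
    altWedge a b = b 0 • a := by
  ext v
  rw [altWedge_apply, ContinuousAlternatingMap.smul_apply, smul_eq_mul]
  have : juxt (⇑a) (⇑b) = fun w => b 0 * a w := by
    funext w
    simp only [juxt]
    rw [mul_comm]
    congr 1
    congr 1
    exact Subsingleton.elim _ _
  have h2 : signedSum (fun w : Fin (k + 0) → V => b 0 * a w) v = b 0 * (k.factorial * a v) :=
    (signedSum_smul (b 0) (⇑a) v).trans (by rw [signedSum_alternating])
  rw [this]
  refine (congrArg _ h2).trans ?_
  have := Nat.factorial_pos k
  simp
  field_simp

/-- Euler's identity. -/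
theorem sum_consWedge_curryLeft {k : ℕ} (a : V [⋀^Fin (k + 1)]→L[ℝ] ℝ) {ι : Type*}
    (s : Finset ι) (c : ι → V →L[ℝ] ℝ) (y : ι → V) (h : ∀ v, ∑ i ∈ s, c i v • y i = v) :
    ∑ i ∈ s, consWedge (c i) (a.curryLeft (y i)) = ((k : ℝ) + 1) • a := by
  ext v
  rw [ContinuousAlternatingMap.sum_apply]
  simp only [consWedge_apply]
  rw [Finset.sum_comm]
  -- For a fixed slot `i` the sum over the frame restores the argument `v i`, and moving it back
  -- into place cancels the sign; so each of the `k + 1` slots contributes `a v`.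
  have : ∀ i : Fin (k + 1), ∑ j ∈ s, (-1) ^ i.val * (c j (v i) *
      (a.curryLeft (y j)) (i.removeNth v)) = a v := by
    intro i
    rw [← Finset.mul_sum]
    have e : ∑ j ∈ s, c j (v i) * (a.curryLeft (y j)) (i.removeNth v) =
        a.curryLeft (v i) (i.removeNth v) := by
      conv_rhs => rw [← h (v i)]
      simp [ContinuousAlternatingMap.sum_apply]
    rw [e, ContinuousAlternatingMap.curryLeft_apply_apply]
    have e2 := a.toAlternatingMap.neg_one_pow_smul_map_insertNth i (v i) (i.removeNth v)
    rw [Fin.insertNth_self_removeNth] at e2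
    have e3 : a v = (-1 : ℝ) ^ i.val * a (Matrix.vecCons (v i) (i.removeNth v)) := by
      have e4 : (-1 : ℤ) ^ i.val • a v = a (Matrix.vecCons (v i) (i.removeNth v)) := e2
      rw [← e4, zsmul_eq_mul, ← mul_assoc]
      simp [← mul_pow]
    exact e3.symm
  rw [Finset.sum_congr rfl fun i _ => this i]
  simp

variable [FiniteDimensional ℝ V]

theorem clm_eq_sum_smulRight {W : Type*} [NormedAddCommGroup W] [NormedSpace ℝ W]
    (A : V →L[ℝ] W) :
    A = ∑ j, ((Module.finBasis ℝ V).coord j).toContinuousLinearMap.smulRight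
      (A (Module.finBasis ℝ V j)) := by
  ext v
  rw [_root_.sum_apply]
  conv_lhs => rw [← (Module.finBasis ℝ V).sum_repr v, map_sum]
  simp

/-- The exterior derivative is the alternatization of the derivative, so this lemma and the next are
the two halves of the Leibniz rule. Expanding the linear map in a basis reduces them to products
with a single covector. -/
theorem alternatizeUncurryFin_altWedge_left {k l : ℕ} (A : V →L[ℝ] V [⋀^Fin k]→L[ℝ] ℝ)
    (b : V [⋀^Fin l]→L[ℝ] ℝ) (C : V →L[ℝ] V [⋀^Fin (k + l)]→L[ℝ] ℝ)
    (hC : ∀ v, C v = altWedge (A v) b) :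
    ContinuousAlternatingMap.alternatizeUncurryFin C = degCast (by omega : k + 1 + l = k + l + 1)
      (altWedge (ContinuousAlternatingMap.alternatizeUncurryFin A) b) := by
  have hU : ∀ {n : ℕ} (A : V →L[ℝ] V [⋀^Fin n]→L[ℝ] ℝ),
      ContinuousAlternatingMap.alternatizeUncurryFin A =
        ∑ j, consWedge ((Module.finBasis ℝ V).coord j).toContinuousLinearMap
          (A (Module.finBasis ℝ V j)) := by
    intro n A
    conv_lhs => rw [clm_eq_sum_smulRight A]
    rw [← ContinuousAlternatingMap.alternatizeUncurryFinCLM_apply, map_sum]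
    rfl
  rw [hU A, hU C]
  simp only [hC, consWedge_altWedge_left]
  have hs : ∀ (s : Finset (Fin (Module.finrank ℝ V))) (f : _ → V [⋀^Fin (k + 1)]→L[ℝ] ℝ),
      altWedge (∑ j ∈ s, f j) b = ∑ j ∈ s, altWedge (f j) b := by
    intro s f
    induction s using Finset.induction_on with
    | empty => simp [altWedge_zero_left]
    | insert i s hi ih => rw [Finset.sum_insert hi, Finset.sum_insert hi, altWedge_add_left, ih]
  rw [hs]
  ext v
  simp

theorem alternatizeUncurryFin_altWedge_right {k l : ℕ} (a : V [⋀^Fin k]→L[ℝ] ℝ)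
    (B : V →L[ℝ] V [⋀^Fin l]→L[ℝ] ℝ) (C : V →L[ℝ] V [⋀^Fin (k + l)]→L[ℝ] ℝ)
    (hC : ∀ v, C v = altWedge a (B v)) :
    ContinuousAlternatingMap.alternatizeUncurryFin C =
      (-1 : ℝ) ^ k • altWedge a (ContinuousAlternatingMap.alternatizeUncurryFin B) := by
  have hU : ∀ {n : ℕ} (A : V →L[ℝ] V [⋀^Fin n]→L[ℝ] ℝ),
      ContinuousAlternatingMap.alternatizeUncurryFin A =
        ∑ j, consWedge ((Module.finBasis ℝ V).coord j).toContinuousLinearMap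
          (A (Module.finBasis ℝ V j)) := by
    intro n A
    conv_lhs => rw [clm_eq_sum_smulRight A]
    rw [← ContinuousAlternatingMap.alternatizeUncurryFinCLM_apply, map_sum]
    rfl
  rw [hU B, hU C]
  simp only [hC]
  have hs : ∀ (s : Finset (Fin (Module.finrank ℝ V))) (f : _ → V [⋀^Fin (l + 1)]→L[ℝ] ℝ),
      altWedge a (∑ j ∈ s, f j) = ∑ j ∈ s, altWedge a (f j) := by
    intro s f
    induction s using Finset.induction_on with
    | empty => simp [altWedge_zero_right]
    | insert i s hi ih => rw [Finset.sum_insert hi, Finset.sum_insert hi, altWedge_add_right, ih]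
  rw [hs, Finset.smul_sum]
  refine Finset.sum_congr rfl fun j _ => ?_
  rw [consWedge_altWedge_right, smul_smul, ← mul_pow]
  simp

end Wedge
end

noncomputable section

set_option linter.unusedSectionVars false

/-! ### Smooth families of alternating forms -/

section VectorCalculus

variable {P : Type*} [NormedAddCommGroup P] [NormedSpace ℝ P]
  {V : Type*} [NormedAddCommGroup V] [NormedSpace ℝ V] [FiniteDimensional ℝ V]
  {V' : Type*} [NormedAddCommGroup V'] [NormedSpace ℝ V'] [FiniteDimensional ℝ V']
  {n : WithTop ℕ∞} {k l : ℕ} {p : P}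

/-- Evaluation on tuples of basis vectors is an injective linear map to a finite product. It has a
linear left inverse, so smoothness can be tested on each evaluation. -/
theorem contDiffAt_alternating_iff {f : P → V [⋀^Fin k]→L[ℝ] ℝ} :
    ContDiffAt ℝ n f p ↔ ∀ v : Fin k → V, ContDiffAt ℝ n (fun q => f q v) p := by
  constructor
  · intro h v
    exact (ContinuousAlternatingMap.apply ℝ V ℝ v).contDiff.contDiffAt.comp p h
  · intro h
    let b := Module.finBasis ℝ V
    let ev : (V [⋀^Fin k]→L[ℝ] ℝ) →ₗ[ℝ] ((Fin k → Fin (Module.finrank ℝ V)) → ℝ) :=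
      { toFun := fun a s => a (fun i => b (s i))
        map_add' := fun a c => rfl
        map_smul' := fun c a => rfl }
    have hinj : Function.Injective ev := by
      intro a c hac
      apply ContinuousAlternatingMap.toAlternatingMap_injective
      apply AlternatingMap.coe_multilinearMap_injective
      refine Module.Basis.ext_multilinear (fun _ => b) fun s => ?_
      exact congrFun hac s
    have : FiniteDimensional ℝ (V [⋀^Fin k]→L[ℝ] ℝ) := FiniteDimensional.of_injective ev hinj
    obtain ⟨g, hg⟩ := ev.exists_leftInverse_of_injective (LinearMap.ker_eq_bot.2 hinj)
    have h1 : ContDiffAt ℝ n (fun q => ev (f q)) p := contDiffAt_pi.2 fun s => h _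
    have h2 := (LinearMap.toContinuousLinearMap g).contDiff.contDiffAt.comp p h1
    refine h2.congr_of_eventuallyEq (Filter.Eventually.of_forall fun q => ?_)
    exact (LinearMap.congr_fun hg (f q)).symm

theorem ContDiffAt.alternating_apply {f : P → V [⋀^Fin k]→L[ℝ] ℝ} {w : Fin k → P → V}
    (hf : ContDiffAt ℝ n f p) (hw : ∀ i, ContDiffAt ℝ n (w i) p) :
    ContDiffAt ℝ n (fun q => f q (fun i => w i q)) p := by
  let b := Module.finBasis ℝ V
  have e : (fun q => f q (fun i => w i q)) = fun q => ∑ s : Fin k → Fin (Module.finrank ℝ V),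
      (∏ i, b.repr (w i q) (s i)) * f q (fun i => b (s i)) := by
    funext q
    have h1 : (fun i => w i q) = fun i => ∑ j, b.repr (w i q) j • b j := by
      funext i; exact (b.sum_repr _).symm
    rw [h1]
    have h2 := (f q).toMultilinearMap.map_sum (fun i j => b.repr (w i q) j • b j)
    refine h2.trans (Finset.sum_congr rfl fun s _ => ?_)
    have h3 := (f q).toMultilinearMap.map_smul_univ (fun i => b.repr (w i q) (s i))
      (fun i => b (s i))
    exact h3
  rw [e]
  refine ContDiffAt.sum fun s _ => ContDiffAt.mul ?_ (contDiffAt_alternating_iff.1 hf _)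
  refine contDiffAt_prod fun i hi => ?_
  exact (LinearMap.toContinuousLinearMap (b.coord (s i))).contDiff.contDiffAt.comp p (hw i)

theorem ContDiffAt.alternating_comp {f : P → V [⋀^Fin k]→L[ℝ] ℝ} {A : P → V' →L[ℝ] V}
    (hf : ContDiffAt ℝ n f p) (hA : ContDiffAt ℝ n A p) :
    ContDiffAt ℝ n (fun q => (f q).compContinuousLinearMap (A q)) p :=
  contDiffAt_alternating_iff.2 fun v =>
    hf.alternating_apply (w := fun i q => A q (v i)) fun _ => hA.clm_apply contDiffAt_const

theorem ContDiffAt.altWedge {f : P → V [⋀^Fin k]→L[ℝ] ℝ} {g : P → V [⋀^Fin l]→L[ℝ] ℝ}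
    (hf : ContDiffAt ℝ n f p) (hg : ContDiffAt ℝ n g p) :
    ContDiffAt ℝ n (fun q => altWedge (f q) (g q)) p := by
  refine contDiffAt_alternating_iff.2 fun v => ?_
  simp only [altWedge_apply, signedSum, juxt]
  refine contDiffAt_const.mul (ContDiffAt.sum fun σ _ => contDiffAt_const.mul ?_)
  exact (contDiffAt_alternating_iff.1 hf _).mul (contDiffAt_alternating_iff.1 hg _)

theorem ContDiffAt.extDeriv {f : V → V [⋀^Fin k]→L[ℝ] ℝ} {p : V} (hf : ContDiffAt ℝ ∞ f p) :
    ContDiffAt ℝ ∞ (_root_.extDeriv f) p := by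
  have h := (ContinuousAlternatingMap.alternatizeUncurryFinCLM ℝ V ℝ
    (n := k)).contDiff.contDiffAt.comp p (hf.fderiv_right (m := ∞) (by simp))
  exact h

theorem hasFDerivAt_altWedge {f : P → V [⋀^Fin k]→L[ℝ] ℝ} {g : P → V [⋀^Fin l]→L[ℝ] ℝ}
    (hf : DifferentiableAt ℝ f p) (hg : DifferentiableAt ℝ g p)
    (hw : DifferentiableAt ℝ (fun q => _root_.altWedge (f q) (g q)) p) (v : P) :
    fderiv ℝ (fun q => _root_.altWedge (f q) (g q)) p v =
      _root_.altWedge (fderiv ℝ f p v) (g p) + _root_.altWedge (f p) (fderiv ℝ g p v) := by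
  ext w
  have h1 := congrArg (fun L => L v) (fderiv_continuousAlternatingMap_apply_const hw w)
  have hf' : ∀ u : Fin k → V, HasFDerivAt (fun q => f q u)
      ((ContinuousAlternatingMap.apply ℝ V ℝ u).comp (fderiv ℝ f p)) p := fun u =>
    (ContinuousAlternatingMap.apply ℝ V ℝ u).hasFDerivAt.comp p hf.hasFDerivAt
  have hg' : ∀ u : Fin l → V, HasFDerivAt (fun q => g q u)
      ((ContinuousAlternatingMap.apply ℝ V ℝ u).comp (fderiv ℝ g p)) p := fun u =>
    (ContinuousAlternatingMap.apply ℝ V ℝ u).hasFDerivAt.comp p hg.hasFDerivAt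
  have h2 : HasFDerivAt (fun q => _root_.altWedge (f q) (g q) w)
      (((k.factorial : ℝ) * l.factorial)⁻¹ • ∑ σ : Equiv.Perm (Fin (k + l)),
        ((Equiv.Perm.sign σ : ℤ) : ℝ) •
        (f p (fun i => w (σ (Fin.castAdd l i))) •
          (ContinuousAlternatingMap.apply ℝ V ℝ (fun j => w (σ (Fin.natAdd k j)))).comp
            (fderiv ℝ g p) +
        g p (fun j => w (σ (Fin.natAdd k j))) •
          (ContinuousAlternatingMap.apply ℝ V ℝ (fun i => w (σ (Fin.castAdd l i)))).comp
            (fderiv ℝ f p))) p := by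
    simp only [altWedge_apply, signedSum, juxt]
    refine HasFDerivAt.const_mul (HasFDerivAt.fun_sum fun σ _ => HasFDerivAt.const_mul ?_ _) _
    exact (hf' _).mul (hg' _)
  rw [h2.fderiv] at h1
  have h3 : (fderiv ℝ (fun q => _root_.altWedge (f q) (g q)) p v) w = _ := h1.symm
  rw [h3]
  simp only [ContinuousAlternatingMap.add_apply, altWedge_apply, signedSum, juxt, ← mul_add,
    ← Finset.sum_add_distrib]
  simp only [_root_.smul_apply, _root_.sum_apply, _root_.add_apply, smul_eq_mul,
    ContinuousLinearMap.comp_apply, ContinuousAlternatingMap.apply_apply]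
  congr 1
  refine Finset.sum_congr rfl fun σ _ => ?_
  ring

/-- By the product rule the derivative is a sum of two linear maps, and alternatization is additive.
The cast is present because `k + 1 + l` and `k + l + 1` are not definitionally equal. -/
theorem extDeriv_altWedge {f : V → V [⋀^Fin k]→L[ℝ] ℝ} {g : V → V [⋀^Fin l]→L[ℝ] ℝ} {p : V}
    (hf : ContDiffAt ℝ ∞ f p) (hg : ContDiffAt ℝ ∞ g p) :
    extDeriv (fun q => altWedge (f q) (g q)) p =
      degCast (by omega : k + 1 + l = k + l + 1) (altWedge (extDeriv f p) (g p)) +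
      (-1 : ℝ) ^ k • altWedge (f p) (extDeriv g p) := by
  have hf1 := hf.differentiableAt (by simp)
  have hg1 := hg.differentiableAt (by simp)
  have hw := (hf.altWedge hg).differentiableAt (by simp)
  have hd := hasFDerivAt_altWedge hf1 hg1 hw
  unfold extDeriv
  -- the two partial derivatives, as linear maps
  let C₁ : V →ₗ[ℝ] V [⋀^Fin (k + l)]→L[ℝ] ℝ :=
    { toFun := fun v => altWedge (fderiv ℝ f p v) (g p)
      map_add' := fun v w => by rw [map_add, altWedge_add_left]
      map_smul' := fun c v => by rw [map_smul, altWedge_smul_left]; rfl }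
  let C₂ : V →ₗ[ℝ] V [⋀^Fin (k + l)]→L[ℝ] ℝ :=
    { toFun := fun v => altWedge (f p) (fderiv ℝ g p v)
      map_add' := fun v w => by rw [map_add, altWedge_add_right]
      map_smul' := fun c v => by rw [map_smul, altWedge_smul_right]; rfl }
  have hC : fderiv ℝ (fun q => altWedge (f q) (g q)) p =
      LinearMap.toContinuousLinearMap C₁ + LinearMap.toContinuousLinearMap C₂ := by
    ext1 v
    exact hd v
  rw [hC, ContinuousAlternatingMap.alternatizeUncurryFin_add,
    alternatizeUncurryFin_altWedge_left (fderiv ℝ f p) (g p) _ fun v => rfl,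
    alternatizeUncurryFin_altWedge_right (f p) (fderiv ℝ g p) _ fun v => rfl]

theorem extDeriv_fun_mul {f : V → ℝ} {g : V → V [⋀^Fin k]→L[ℝ] ℝ} {p : V}
    (hf : DifferentiableAt ℝ f p) (hg : DifferentiableAt ℝ g p) :
    extDeriv (fun q => f q • g q) p = consWedge (fderiv ℝ f p) (g p) + f p • extDeriv g p := by
  unfold extDeriv consWedge
  rw [fderiv_fun_smul hf hg, ContinuousAlternatingMap.alternatizeUncurryFin_add]
  refine (add_comm _ _).trans (congrArg _ ?_)
  rw [← ContinuousAlternatingMap.alternatizeUncurryFinCLM_apply, map_smul]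
  rfl

end VectorCalculus
end

noncomputable section

set_option linter.unusedSectionVars false

/-! ### Smooth differential forms on manifolds -/

section ManifoldForms

variable {E : Type*} [NormedAddCommGroup E] [NormedSpace ℝ E]
  {F : Type*} [NormedAddCommGroup F] [NormedSpace ℝ F]
  {F' : Type*} [NormedAddCommGroup F'] [NormedSpace ℝ F']
  {M : Type*} [TopologicalSpace M] [ChartedSpace E M]
  {N : Type*} [TopologicalSpace N] [ChartedSpace F N]
  {N' : Type*} [TopologicalSpace N'] [ChartedSpace F' N']
  {k l : ℕ}

theorem formPullback_congr {f g : M → N} {x : M} (h : f =ᶠ[𝓝 x] g) (β : DForm F N k) :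
    (formPullback f β : DForm E M k) x = formPullback g β x := by
  have h1 : f x = g x := h.eq_of_nhds
  have h2 : (mfderiv 𝓘(ℝ, E) 𝓘(ℝ, F) f x : E →L[ℝ] F) = mfderiv 𝓘(ℝ, E) 𝓘(ℝ, F) g x :=
    h.mfderiv_eq
  let B : N → F [⋀^Fin k]→L[ℝ] ℝ := β
  change (B (f x)).compContinuousLinearMap (mfderiv 𝓘(ℝ, E) 𝓘(ℝ, F) f x : E →L[ℝ] F) =
    (B (g x)).compContinuousLinearMap (mfderiv 𝓘(ℝ, E) 𝓘(ℝ, F) g x : E →L[ℝ] F)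
  rw [h1, h2]

theorem formPullback_comp {f : M → N} {g : N → N'} {x : M}
    (hf : MDifferentiableAt 𝓘(ℝ, E) 𝓘(ℝ, F) f x)
    (hg : MDifferentiableAt 𝓘(ℝ, F) 𝓘(ℝ, F') g (f x)) (β : DForm F' N' k) :
    (formPullback (fun x => g (f x)) β : DForm E M k) x =
      formPullback f (formPullback g β : DForm F N k) x := by
  have h := mfderiv_comp x hg hf
  change ContinuousAlternatingMap.compContinuousLinearMap _
    (mfderiv 𝓘(ℝ, E) 𝓘(ℝ, F') (g ∘ f) x) = _
  rw [h]
  rfl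

theorem formPullback_id (β : DForm E M k) : (formPullback (fun x : M => x) β : DForm E M k) = β := by
  funext x
  change (β x).compContinuousLinearMap (mfderiv 𝓘(ℝ, E) 𝓘(ℝ, E) id x) = β x
  rw [mfderiv_id]
  rfl

/-- Smoothness of a form at a point, in the preferred chart at that point. -/
def SmoothFormAt (β : DForm E M k) (x₀ : M) : Prop :=
  ContDiffAt ℝ ∞ (localRep x₀ β) (extChartAt 𝓘(ℝ, E) x₀ x₀)

theorem localRep_congr {β η : DForm E M k} {x₀ x : M} (hx : x ∈ (extChartAt 𝓘(ℝ, E) x₀).source)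
    (h : ∀ᶠ x' in 𝓝 x, β x' = η x') :
    localRep x₀ β =ᶠ[𝓝 (extChartAt 𝓘(ℝ, E) x₀ x)] localRep x₀ η := by
  have hc : Filter.Tendsto (extChartAt 𝓘(ℝ, E) x₀).symm (𝓝 (extChartAt 𝓘(ℝ, E) x₀ x)) (𝓝 x) := by
    have := continuousAt_extChartAt_symm' (I := 𝓘(ℝ, E)) hx
    unfold ContinuousAt at this
    rwa [(extChartAt 𝓘(ℝ, E) x₀).left_inv hx] at this
  filter_upwards [hc.eventually h] with y hy
  unfold localRep formPullback
  rw [hy]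

theorem SmoothFormAt.congr {β η : DForm E M k} {x₀ : M} (hβ : SmoothFormAt β x₀)
    (h : ∀ᶠ x in 𝓝 x₀, β x = η x) : SmoothFormAt η x₀ :=
  ContDiffAt.congr_of_eventuallyEq hβ
    (localRep_congr (mem_extChartAt_source (I := 𝓘(ℝ, E)) x₀) (h.mono fun _ hx => hx.symm))

theorem smoothFormAt_zero (x₀ : M) : SmoothFormAt (0 : DForm E M k) x₀ := by
  have : localRep x₀ (0 : DForm E M k) = fun _ => 0 := by
    funext y; rfl
  unfold SmoothFormAt
  rw [this]
  exact contDiffAt_const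

theorem localRep_add (x₀ : M) (β η : DForm E M k) :
    localRep x₀ (β + η) = localRep x₀ β + localRep x₀ η := rfl

theorem SmoothFormAt.add {β η : DForm E M k} {x₀ : M} (hβ : SmoothFormAt β x₀)
    (hη : SmoothFormAt η x₀) : SmoothFormAt (β + η) x₀ :=
  ContDiffAt.add (f := localRep x₀ β) (g := localRep x₀ η) hβ hη

theorem formPullback_wedge (f : M → N) (β : DForm F N k) (η : DForm F N l) :
    (formPullback f (formWedge β η) : DForm E M (k + l)) =
      formWedge (formPullback f β) (formPullback f η) := by
  funext x
  exact altWedge_comp (V := F) (V' := E) (β (f x)) (η (f x)) (mfderiv 𝓘(ℝ, E) 𝓘(ℝ, F) f x)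

/-- Multiplication of a form by a function. -/
def formSmul (f : M → ℝ) (β : DForm E M k) : DForm E M k := fun x => f x • β x

section FiniteDimensional

variable [FiniteDimensional ℝ E] [FiniteDimensional ℝ F] [FiniteDimensional ℝ F']

theorem SmoothFormAt.wedge {β : DForm E M k} {η : DForm E M l} {x₀ : M} (hβ : SmoothFormAt β x₀)
    (hη : SmoothFormAt η x₀) : SmoothFormAt (formWedge β η) x₀ := by
  have h : localRep x₀ (formWedge β η) = fun y => altWedge (V := E) (localRep x₀ β y)
      (localRep x₀ η y) := by
    unfold localRep
    rw [formPullback_wedge]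
    rfl
  unfold SmoothFormAt
  rw [h]
  exact ContDiffAt.altWedge hβ hη

theorem SmoothFormAt.smul {β : DForm E M k} {u : M → ℝ} {x₀ : M} 
    (hu : ContMDiffAt 𝓘(ℝ, E) 𝓘(ℝ, ℝ) ∞ u x₀)
    (hβ : SmoothFormAt β x₀) : SmoothFormAt (formSmul u β) x₀ := by
  have h : localRep x₀ (formSmul u β) = fun y => u ((extChartAt 𝓘(ℝ, E) x₀).symm y) •
      localRep x₀ β y := rfl
  have h2 := (contMDiffAt_iff.1 hu).2
  simp only [mfld_simps, contDiffWithinAt_univ] at h2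
  have h3 : ContDiffAt ℝ ∞ (fun y => u ((extChartAt 𝓘(ℝ, E) x₀).symm y))
    (extChartAt 𝓘(ℝ, E) x₀ x₀) := h2
  unfold SmoothFormAt
  rw [h]
  exact ContDiffAt.smul (E := E) (F := E [⋀^Fin k]→L[ℝ] ℝ) h3 hβ

variable [IsManifold 𝓘(ℝ, E) ∞ M] [IsManifold 𝓘(ℝ, F) ∞ N] [IsManifold 𝓘(ℝ, F') ∞ N']

theorem eventually_contMDiffAt_extChartAt (x₀ : M) :
    ∀ᶠ x in 𝓝 x₀, ContMDiffAt 𝓘(ℝ, E) 𝓘(ℝ, E) ∞ (extChartAt 𝓘(ℝ, E) x₀) x := by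
  filter_upwards [extChartAt_source_mem_nhds (I := 𝓘(ℝ, E)) x₀] with x hx
  exact contMDiffAt_extChartAt' (by simpa using hx)

theorem contMDiffAt_extChartAt_symm {x₀ : M} {y : E} (hy : y ∈ (extChartAt 𝓘(ℝ, E) x₀).target) :
    ContMDiffAt 𝓘(ℝ, E) 𝓘(ℝ, E) ∞ (extChartAt 𝓘(ℝ, E) x₀).symm y :=
  (contMDiffOn_extChartAt_symm x₀).contMDiffAt ((isOpen_extChartAt_target x₀).mem_nhds hy)

/-- The local representative of a pullback. -/
theorem localRep_formPullback {f : M → N} {x₀ : M} (β : DForm F N k)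
    (hf : ∀ᶠ x in 𝓝 x₀, ContMDiffAt 𝓘(ℝ, E) 𝓘(ℝ, F) ∞ f x) :
    localRep x₀ (formPullback f β : DForm E M k) =ᶠ[𝓝 (extChartAt 𝓘(ℝ, E) x₀ x₀)]
      fun y => (localRep (f x₀) β (writtenInExtChartAt 𝓘(ℝ, E) 𝓘(ℝ, F) x₀ f y)
        ).compContinuousLinearMap
        (fderiv ℝ (writtenInExtChartAt 𝓘(ℝ, E) 𝓘(ℝ, F) x₀ f) y) := by
  set e := extChartAt 𝓘(ℝ, E) x₀ with he
  set e' := extChartAt 𝓘(ℝ, F) (f x₀) with he'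
  have hf0 : ContinuousAt f x₀ := hf.self_of_nhds.continuousAt
  have hc : Filter.Tendsto e.symm (𝓝 (e x₀)) (𝓝 x₀) := by
    have := continuousAt_extChartAt_symm (I := 𝓘(ℝ, E)) x₀
    unfold ContinuousAt at this
    rwa [(extChartAt 𝓘(ℝ, E) x₀).left_inv (mem_extChartAt_source x₀)] at this
  have h1 : ∀ᶠ x in 𝓝 x₀, f x ∈ e'.source :=
    hf0.eventually (extChartAt_source_mem_nhds (I := 𝓘(ℝ, F)) (f x₀))
  have h2 := hc.eventually (hf.and h1)
  have h3 : ∀ᶠ y in 𝓝 (e x₀), y ∈ e.target := extChartAt_target_mem_nhds (I := 𝓘(ℝ, E)) x₀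
  filter_upwards [(h2.and h3).eventually_nhds] with y hy
  have hy0 := hy.self_of_nhds
  have hsm := (contMDiffAt_extChartAt_symm (x₀ := x₀) hy0.2).mdifferentiableAt (by simp)
  have hfs := hy0.1.1.mdifferentiableAt (by simp)
  have key : (fun y => f (e.symm y)) =ᶠ[𝓝 y]
      fun y => e'.symm (writtenInExtChartAt 𝓘(ℝ, E) 𝓘(ℝ, F) x₀ f y) := by
    filter_upwards [hy] with z hz
    exact (e'.left_inv hz.1.2).symm
  have hw : ContMDiffAt 𝓘(ℝ, E) 𝓘(ℝ, F) ∞ (writtenInExtChartAt 𝓘(ℝ, E) 𝓘(ℝ, F) x₀ f) y :=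
    by
    have h4 : f (e.symm y) ∈ (chartAt F (f x₀)).source := by
      simpa [he'] using hy0.1.2
    exact (contMDiffAt_extChartAt' h4).comp y
      (hy0.1.1.comp y (contMDiffAt_extChartAt_symm hy0.2))
  have ht : writtenInExtChartAt 𝓘(ℝ, E) 𝓘(ℝ, F) x₀ f y ∈ e'.target := e'.map_source hy0.1.2
  have h5 : localRep x₀ (formPullback f β : DForm E M k) y =
      (formPullback (fun y => f (e.symm y)) β : DForm E E k) y :=
    (formPullback_comp hsm hfs β).symm
  have h6 : (formPullback (fun y => f (e.symm y)) β : DForm E E k) y =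
      (formPullback (fun y => e'.symm (writtenInExtChartAt 𝓘(ℝ, E) 𝓘(ℝ, F) x₀ f y)) β :
          DForm E E k) y := formPullback_congr key β
  refine h5.trans (h6.trans ?_)
  rw [formPullback_comp (hw.mdifferentiableAt (by simp))
    ((contMDiffAt_extChartAt_symm ht).mdifferentiableAt (by simp)) β]
  unfold formPullback
  rw [mfderiv_eq_fderiv]
  rfl

theorem contDiffAt_writtenInExtChartAt {f : M → N} {x₀ : M}
    (hf : ContMDiffAt 𝓘(ℝ, E) 𝓘(ℝ, F) ∞ f x₀) :
    ContDiffAt ℝ ∞ (writtenInExtChartAt 𝓘(ℝ, E) 𝓘(ℝ, F) x₀ f) (extChartAt 𝓘(ℝ, E) x₀ x₀) := by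
  have h2 := (contMDiffAt_iff.1 hf).2
  simp only [mfld_simps, contDiffWithinAt_univ] at h2
  exact h2

theorem SmoothFormAt.pullback {f : M → N} {x₀ : M} {β : DForm F N k}
    (hf : ∀ᶠ x in 𝓝 x₀, ContMDiffAt 𝓘(ℝ, E) 𝓘(ℝ, F) ∞ f x) (hβ : SmoothFormAt β (f x₀)) :
    SmoothFormAt (formPullback f β : DForm E M k) x₀ := by
  refine ContDiffAt.congr_of_eventuallyEq ?_ (localRep_formPullback β hf)
  have h := contDiffAt_writtenInExtChartAt hf.self_of_nhds
  refine ContDiffAt.alternating_comp ?_ (h.fderiv_right (m := ∞) (by simp))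
  refine ContDiffAt.comp _ ?_ h
  have hw : writtenInExtChartAt 𝓘(ℝ, E) 𝓘(ℝ, F) x₀ f (extChartAt 𝓘(ℝ, E) x₀ x₀) =
      extChartAt 𝓘(ℝ, F) (f x₀) (f x₀) := by simp [writtenInExtChartAt]
  rw [hw]
  exact hβ

/-- A form on a vector space, as a function with values in a fixed space. -/
def modelForm (β : DForm E E k) : E → E [⋀^Fin k]→L[ℝ] ℝ := β

theorem localRep_self (β : DForm E E k) (y : E) : localRep y β = modelForm β := by
  unfold localRep
  rw [extChartAt_model_space_eq_id]
  exact formPullback_id β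

theorem smoothFormAt_self {β : DForm E E k} {y : E} :
    SmoothFormAt β y ↔ ContDiffAt ℝ ∞ (modelForm β) y := by
  unfold SmoothFormAt
  rw [localRep_self, extChartAt_model_space_eq_id]
  rfl

theorem contDiffAt_localRep {β : DForm E M k} {x₀ : M} {y : E}
    (hy : y ∈ (extChartAt 𝓘(ℝ, E) x₀).target)
    (h : SmoothFormAt β ((extChartAt 𝓘(ℝ, E) x₀).symm y)) : ContDiffAt ℝ ∞ (localRep x₀ β) y := by
  refine smoothFormAt_self (β := (localRep x₀ β : DForm E E k)).1 ?_
  refine SmoothFormAt.pullback ?_ h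
  filter_upwards [(isOpen_extChartAt_target x₀).mem_nhds hy] with z hz
  exact contMDiffAt_extChartAt_symm hz

/-- The representative in any preferred chart is the pullback of the form by the inverse chart, and
pullback by a smooth map preserves smoothness at a point. So it suffices to look at each point in
its own chart. -/
theorem isSmoothForm_iff {β : DForm E M k} : IsSmoothForm β ↔ ∀ x, SmoothFormAt β x := by
  constructor
  · intro h x
    exact (h x).contDiffAt (extChartAt_target_mem_nhds x)
  · intro h x₀ y hy
    exact (contDiffAt_localRep hy (h _)).contDiffWithinAt

/-- The exterior derivative commutes with pullbacks. -/
theorem extD_formPullback {f : M → N} {x₀ : M} {β : DForm F N k}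
    (hf : ∀ᶠ x in 𝓝 x₀, ContMDiffAt 𝓘(ℝ, E) 𝓘(ℝ, F) ∞ f x) (hβ : SmoothFormAt β (f x₀)) :
    extD (formPullback f β : DForm E M k) x₀ = formPullback f (extD β) x₀ := by
  have h := contDiffAt_writtenInExtChartAt hf.self_of_nhds
  have hw : writtenInExtChartAt 𝓘(ℝ, E) 𝓘(ℝ, F) x₀ f (extChartAt 𝓘(ℝ, E) x₀ x₀) =
      extChartAt 𝓘(ℝ, F) (f x₀) (f x₀) := by simp [writtenInExtChartAt]
  have hβ' : DifferentiableAt ℝ (localRep (f x₀) β)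
      (writtenInExtChartAt 𝓘(ℝ, E) 𝓘(ℝ, F) x₀ f (extChartAt 𝓘(ℝ, E) x₀ x₀)) := by
    rw [hw]; exact ContDiffAt.differentiableAt hβ (by simp)
  have hd := (localRep_formPullback β hf).extDeriv_eq.trans
    (extDeriv_pullback (F := F) (f := writtenInExtChartAt 𝓘(ℝ, E) 𝓘(ℝ, F) x₀ f) hβ' h (by
      rw [minSmoothness_of_isRCLikeNormedField]; exact WithTop.coe_le_coe.2 le_top))
  have he := (contMDiffAt_extChartAt (I := 𝓘(ℝ, E)) (n := ∞) (x := x₀)).mdifferentiableAt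
    (by simp)
  have he' := (contMDiffAt_extChartAt (I := 𝓘(ℝ, F)) (n := ∞) (x := f x₀)).mdifferentiableAt
    (by simp)
  have hfx := hf.self_of_nhds.mdifferentiableAt (by simp)
  have hchain : (fderiv ℝ (writtenInExtChartAt 𝓘(ℝ, E) 𝓘(ℝ, F) x₀ f)
      (extChartAt 𝓘(ℝ, E) x₀ x₀)).comp
        (mfderiv 𝓘(ℝ, E) 𝓘(ℝ, E) (extChartAt 𝓘(ℝ, E) x₀) x₀ : E →L[ℝ] E) =
      (mfderiv 𝓘(ℝ, F) 𝓘(ℝ, F) (extChartAt 𝓘(ℝ, F) (f x₀)) (f x₀) : F →L[ℝ] F).comp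
        (mfderiv 𝓘(ℝ, E) 𝓘(ℝ, F) f x₀ : E →L[ℝ] F) := by
    have h1 := mfderiv_comp x₀ he' hfx
    have hwm : MDifferentiableAt 𝓘(ℝ, E) 𝓘(ℝ, F) (writtenInExtChartAt 𝓘(ℝ, E) 𝓘(ℝ, F) x₀ f)
        (extChartAt 𝓘(ℝ, E) x₀ x₀) := (h.differentiableAt (by simp)).mdifferentiableAt
    have h2 := mfderiv_comp x₀ hwm he
    rw [mfderiv_eq_fderiv] at h2
    have h3 : (writtenInExtChartAt 𝓘(ℝ, E) 𝓘(ℝ, F) x₀ f ∘ extChartAt 𝓘(ℝ, E) x₀) =ᶠ[𝓝 x₀]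
        (extChartAt 𝓘(ℝ, F) (f x₀) ∘ f) := by
      filter_upwards [extChartAt_source_mem_nhds (I := 𝓘(ℝ, E)) x₀] with x hx
      simp only [writtenInExtChartAt, Function.comp_apply, (extChartAt 𝓘(ℝ, E) x₀).left_inv hx]
    have h4 : (mfderiv 𝓘(ℝ, E) 𝓘(ℝ, F) (writtenInExtChartAt 𝓘(ℝ, E) 𝓘(ℝ, F) x₀ f ∘
        extChartAt 𝓘(ℝ, E) x₀) x₀ : E →L[ℝ] F) =
        mfderiv 𝓘(ℝ, E) 𝓘(ℝ, F) (extChartAt 𝓘(ℝ, F) (f x₀) ∘ f) x₀ := h3.mfderiv_eq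
    exact h2.symm.trans (h4.trans h1)
  unfold extD
  rw [hd]
  change ContinuousAlternatingMap.compContinuousLinearMap
      (ContinuousAlternatingMap.compContinuousLinearMap _ _) _ =
    ContinuousAlternatingMap.compContinuousLinearMap
      (ContinuousAlternatingMap.compContinuousLinearMap _ _) _
  rw [hw]
  ext v
  have h5 : ∀ w : E, (fderiv ℝ (writtenInExtChartAt 𝓘(ℝ, E) 𝓘(ℝ, F) x₀ f)
      (extChartAt 𝓘(ℝ, E) x₀ x₀)) ((mfderiv 𝓘(ℝ, E) 𝓘(ℝ, E) (extChartAt 𝓘(ℝ, E) x₀) x₀ :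
        E →L[ℝ] E) w) = (mfderiv 𝓘(ℝ, F) 𝓘(ℝ, F) (extChartAt 𝓘(ℝ, F) (f x₀)) (f x₀) : F →L[ℝ] F)
        ((mfderiv 𝓘(ℝ, E) 𝓘(ℝ, F) f x₀ : E →L[ℝ] F) w) := fun w =>
    congrArg (fun L : E →L[ℝ] F => L w) hchain
  exact congrArg (extDeriv (localRep (f x₀) β) (extChartAt 𝓘(ℝ, F) (f x₀) (f x₀)))
    (funext fun i => h5 (v i))

theorem extD_self (β : DForm E E k) (y : E) :
    extD β y = extDeriv (modelForm β) y := by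
  unfold extD
  rw [localRep_self, extChartAt_model_space_eq_id]
  change ContinuousAlternatingMap.compContinuousLinearMap _ (mfderiv 𝓘(ℝ, E) 𝓘(ℝ, E) id y) = _
  rw [mfderiv_id]
  rfl

/-- The definition of `extD` uses a different chart at each point. Naturality under the inverse of
one chart shows that this chart computes `extD` on its whole domain, as smoothness of `extD β` and
`d² = 0` require. -/
theorem localRep_extD {β : DForm E M k} {x₀ : M} {y : E}
    (hy : y ∈ (extChartAt 𝓘(ℝ, E) x₀).target)
    (h : SmoothFormAt β ((extChartAt 𝓘(ℝ, E) x₀).symm y)) :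
    localRep x₀ (extD β) y = extDeriv (localRep x₀ β) y := by
  have h1 := extD_formPullback (E := E) (F := E) (f := (extChartAt 𝓘(ℝ, E) x₀).symm) (x₀ := y)
    (β := β) ?_ h
  · rw [extD_self] at h1
    exact h1.symm
  · filter_upwards [(isOpen_extChartAt_target x₀).mem_nhds hy] with z hz
    exact contMDiffAt_extChartAt_symm hz

theorem extD_congr {β η : DForm E M k} {x₀ : M} (h : ∀ᶠ x in 𝓝 x₀, β x = η x) :
    extD β x₀ = extD η x₀ := by
  unfold extD
  rw [(localRep_congr (mem_extChartAt_source (I := 𝓘(ℝ, E)) x₀) h).extDeriv_eq]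

theorem SmoothFormAt.extD {β : DForm E M k} {x₀ : M} (h : ∀ᶠ x in 𝓝 x₀, SmoothFormAt β x) :
    SmoothFormAt (extD β) x₀ := by
  have hc : Filter.Tendsto (extChartAt 𝓘(ℝ, E) x₀).symm (𝓝 (extChartAt 𝓘(ℝ, E) x₀ x₀))
      (𝓝 x₀) := by
    have := continuousAt_extChartAt_symm (I := 𝓘(ℝ, E)) x₀
    unfold ContinuousAt at this
    rwa [(extChartAt 𝓘(ℝ, E) x₀).left_inv (mem_extChartAt_source x₀)] at this
  have h1 : localRep x₀ (_root_.extD β) =ᶠ[𝓝 (extChartAt 𝓘(ℝ, E) x₀ x₀)]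
      extDeriv (localRep x₀ β) := by
    filter_upwards [hc.eventually h, extChartAt_target_mem_nhds (I := 𝓘(ℝ, E)) x₀] with y hy hy'
    exact localRep_extD hy' hy
  exact ContDiffAt.congr_of_eventuallyEq (ContDiffAt.extDeriv h.self_of_nhds) h1

theorem extD_add {β η : DForm E M k} {x₀ : M} (hβ : SmoothFormAt β x₀) (hη : SmoothFormAt η x₀) :
    extD (β + η) x₀ = extD β x₀ + extD η x₀ := by
  unfold extD
  rw [localRep_add, extDeriv_add (ContDiffAt.differentiableAt hβ (by simp))
    (ContDiffAt.differentiableAt hη (by simp))]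
  rfl

/-- Transport of a form along an equality of degrees. -/
def formCast (h : k = l) (β : DForm E M k) : DForm E M l := fun x => degCast (V := E) h (β x)

/-- A form is recovered from its local representatives. -/
theorem formPullback_localRep {x₀ x : M} (hx : x ∈ (extChartAt 𝓘(ℝ, E) x₀).source)
    (β : DForm E M k) :
    (formPullback (extChartAt 𝓘(ℝ, E) x₀) (localRep x₀ β : DForm E E k) : DForm E M k) x = β x := by
  have hx' : x ∈ (chartAt E x₀).source := by simpa using hx
  have h1 := formPullback_comp (f := extChartAt 𝓘(ℝ, E) x₀) (g := (extChartAt 𝓘(ℝ, E) x₀).symm)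
    (x := x) ((contMDiffAt_extChartAt' (n := ∞) hx').mdifferentiableAt (by simp))
    ((contMDiffAt_extChartAt_symm ((extChartAt 𝓘(ℝ, E) x₀).map_source hx)).mdifferentiableAt
      (by simp)) β
  refine h1.symm.trans ?_
  have h2 : (fun x => (extChartAt 𝓘(ℝ, E) x₀).symm (extChartAt 𝓘(ℝ, E) x₀ x)) =ᶠ[𝓝 x]
      fun x => x := by
    filter_upwards [(isOpen_extChartAt_source x₀).mem_nhds hx] with z hz
    exact (extChartAt 𝓘(ℝ, E) x₀).left_inv hz
  rw [formPullback_congr h2, formPullback_id]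

theorem extD_wedge {β : DForm E M k} {η : DForm E M l} {x₀ : M} (hβ : SmoothFormAt β x₀)
    (hη : SmoothFormAt η x₀) :
    extD (formWedge β η) x₀ =
      formCast (by omega : k + 1 + l = k + l + 1) (formWedge (extD β) η) x₀ +
      (-1 : ℝ) ^ k • formWedge β (extD η) x₀ := by
  have h : localRep x₀ (formWedge β η) = fun y => altWedge (V := E) (localRep x₀ β y)
      (localRep x₀ η y) := by
    unfold localRep
    rw [formPullback_wedge]
    rfl
  have hL : ∀ {i j : ℕ} (hij : i = j) (a : E [⋀^Fin i]→L[ℝ] ℝ) (A : E →L[ℝ] E),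
      (degCast hij a).compContinuousLinearMap A = degCast hij (a.compContinuousLinearMap A) := by
    intro i j hij a A; subst hij; rfl
  have hβ0 := formPullback_localRep (mem_extChartAt_source (I := 𝓘(ℝ, E)) x₀) β
  have hη0 := formPullback_localRep (mem_extChartAt_source (I := 𝓘(ℝ, E)) x₀) η
  have h3 := congrArg (fun a : E [⋀^Fin (k + l + 1)]→L[ℝ] ℝ => a.compContinuousLinearMap
    (mfderiv 𝓘(ℝ, E) 𝓘(ℝ, E) (extChartAt 𝓘(ℝ, E) x₀) x₀ : E →L[ℝ] E)) (extDeriv_altWedge hβ hη)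
  rw [← h] at h3
  refine h3.trans ?_
  have hgen : ∀ (a : E [⋀^Fin (k + 1)]→L[ℝ] ℝ) (b : E [⋀^Fin l]→L[ℝ] ℝ)
      (a' : E [⋀^Fin k]→L[ℝ] ℝ) (b' : E [⋀^Fin (l + 1)]→L[ℝ] ℝ) (A : E →L[ℝ] E)
      (h : k + 1 + l = k + l + 1),
      (degCast h (altWedge a b) + (-1 : ℝ) ^ k • (altWedge (k := k) (l := l + 1) a' b' : E [⋀^Fin (k + l + 1)]→L[ℝ] ℝ)
        ).compContinuousLinearMap A =
      degCast h (altWedge (a.compContinuousLinearMap A) (b.compContinuousLinearMap A)) +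
        (-1 : ℝ) ^ k • (altWedge (k := k) (l := l + 1) (a'.compContinuousLinearMap A) (b'.compContinuousLinearMap A) :
          E [⋀^Fin (k + l + 1)]→L[ℝ] ℝ) := by
    intro a b a' b' A h
    rw [← altWedge_comp, ← altWedge_comp, ← hL]
    rfl
  refine (hgen _ _ _ _ _ _).trans ?_
  unfold formCast formWedge
  rw [← hβ0, ← hη0]
  rfl

/-- The differential of a function. -/
def dFun (u : M → ℝ) (x : M) : E →L[ℝ] ℝ := mfderiv 𝓘(ℝ, E) 𝓘(ℝ, ℝ) u x

/-- The exterior product of the differential of a function with a form. -/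
def dWedge (u : M → ℝ) (β : DForm E M k) : DForm E M (k + 1) :=
  fun x => consWedge (V := E) (dFun u x) (β x)

theorem extD_smul {u : M → ℝ} {β : DForm E M k} {x₀ : M}
    (hu : ContMDiffAt 𝓘(ℝ, E) 𝓘(ℝ, ℝ) ∞ u x₀) (hβ : SmoothFormAt β x₀) :
    extD (formSmul u β) x₀ = (dWedge u β + formSmul u (extD β)) x₀ := by
  have h : localRep x₀ (formSmul u β) = fun y => u ((extChartAt 𝓘(ℝ, E) x₀).symm y) •
      localRep x₀ β y := rfl
  have h2 := (contMDiffAt_iff.1 hu).2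
  simp only [mfld_simps, contDiffWithinAt_univ] at h2
  have h4 : ContDiffAt ℝ ∞ (fun y => u ((extChartAt 𝓘(ℝ, E) x₀).symm y))
    (extChartAt 𝓘(ℝ, E) x₀ x₀) := h2
  have hβ0 := formPullback_localRep (mem_extChartAt_source (I := 𝓘(ℝ, E)) x₀) β
  have h3 := congrArg (fun a : E [⋀^Fin (k + 1)]→L[ℝ] ℝ => a.compContinuousLinearMap
    (mfderiv 𝓘(ℝ, E) 𝓘(ℝ, E) (extChartAt 𝓘(ℝ, E) x₀) x₀ : E →L[ℝ] E))
    (extDeriv_fun_mul (h4.differentiableAt (by simp)) (ContDiffAt.differentiableAt hβ (by simp)))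
  rw [← h] at h3
  refine h3.trans ?_
  have hd : (dFun u x₀ : E →L[ℝ] ℝ) = (fderiv ℝ (fun y => u ((extChartAt 𝓘(ℝ, E) x₀).symm y))
      (extChartAt 𝓘(ℝ, E) x₀ x₀)).comp
      (mfderiv 𝓘(ℝ, E) 𝓘(ℝ, E) (extChartAt 𝓘(ℝ, E) x₀) x₀ : E →L[ℝ] E) := by
    have he := (contMDiffAt_extChartAt (I := 𝓘(ℝ, E)) (n := ∞) (x := x₀)).mdifferentiableAt
      (by simp)
    have hg : MDifferentiableAt 𝓘(ℝ, E) 𝓘(ℝ, ℝ) (fun y => u ((extChartAt 𝓘(ℝ, E) x₀).symm y))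
      (extChartAt 𝓘(ℝ, E) x₀ x₀) := (h4.differentiableAt (by simp)).mdifferentiableAt
    have h5 := mfderiv_comp x₀ hg he
    rw [mfderiv_eq_fderiv] at h5
    refine Eq.trans ?_ h5
    have h6 : u =ᶠ[𝓝 x₀] (fun y => u ((extChartAt 𝓘(ℝ, E) x₀).symm y)) ∘
        extChartAt 𝓘(ℝ, E) x₀ := by
      filter_upwards [extChartAt_source_mem_nhds (I := 𝓘(ℝ, E)) x₀] with x hx
      simp only [Function.comp_apply, (extChartAt 𝓘(ℝ, E) x₀).left_inv hx]
    have h7 : (mfderiv 𝓘(ℝ, E) 𝓘(ℝ, ℝ) u x₀ : E →L[ℝ] ℝ) = _ := h6.mfderiv_eq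
    exact h7
  let B : E [⋀^Fin k]→L[ℝ] ℝ := β x₀
  let D : E [⋀^Fin (k + 1)]→L[ℝ] ℝ := extD β x₀
  change _ = consWedge (V := E) (dFun u x₀) B + u x₀ • D
  have hB : B = β x₀ := rfl
  rw [hB, ← hβ0, hd]
  have hu0 : u ((extChartAt 𝓘(ℝ, E) x₀).symm (extChartAt 𝓘(ℝ, E) x₀ x₀)) = u x₀ := by
    rw [(extChartAt 𝓘(ℝ, E) x₀).left_inv (mem_extChartAt_source (I := 𝓘(ℝ, E)) x₀)]
  rw [hu0]
  have hgen : ∀ (c : E →L[ℝ] ℝ) (a : E [⋀^Fin k]→L[ℝ] ℝ) (d : E [⋀^Fin (k + 1)]→L[ℝ] ℝ) (w : ℝ)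
      (A : E →L[ℝ] E), (consWedge c a + w • d).compContinuousLinearMap A =
        consWedge (c.comp A) (a.compContinuousLinearMap A) + w • d.compContinuousLinearMap A := by
    intro c a d w A
    ext v
    simp [consWedge_apply]
    rfl
  exact hgen _ _ _ _ _

theorem extD_zero_form {β : DForm E M k} {x₀ : M} (h : ∀ᶠ x in 𝓝 x₀, β x = 0) :
    extD β x₀ = 0 := by
  rw [extD_congr (η := 0) h]
  have h1 : localRep x₀ (0 : DForm E M k) = fun _ => 0 := by
    funext y; rfl
  unfold extD
  rw [h1]
  unfold extDeriv
  ext v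
  have h2 : fderiv ℝ (fun _ : E => (0 : E [⋀^Fin k]→L[ℝ] ℝ)) (extChartAt 𝓘(ℝ, E) x₀ x₀) = 0 := by
    simp
  change ContinuousAlternatingMap.alternatizeUncurryFin (fderiv ℝ (fun _ : E =>
    (0 : E [⋀^Fin k]→L[ℝ] ℝ)) (extChartAt 𝓘(ℝ, E) x₀ x₀)) _ = 0
  rw [h2]
  change ContinuousAlternatingMap.alternatizeUncurryFin (0 : E →L[ℝ] E [⋀^Fin k]→L[ℝ] ℝ) _ = 0
  simp [ContinuousAlternatingMap.alternatizeUncurryFin_apply]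

end FiniteDimensional

end ManifoldForms
end

noncomputable section

set_option linter.unusedSectionVars false

/-! ### Smooth fields of linear maps between tangent spaces -/

section BundleMaps

variable {E : Type*} [NormedAddCommGroup E] [NormedSpace ℝ E]
  {F : Type*} [NormedAddCommGroup F] [NormedSpace ℝ F]
  {F' : Type*} [NormedAddCommGroup F'] [NormedSpace ℝ F']
  {M : Type*} [TopologicalSpace M] [ChartedSpace E M]
  {N : Type*} [TopologicalSpace N] [ChartedSpace F N]
  {N' : Type*} [TopologicalSpace N'] [ChartedSpace F' N']
  {k l : ℕ}

/-- The pullback of forms by a field `A` of linear maps `T_x M → T_{φ x} N`. -/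
def bundlePullback (φ : M → N) (A : M → E →L[ℝ] F) (β : DForm F N k) : DForm E M k :=
  fun x => show E [⋀^Fin k]→L[ℝ] ℝ from
    (show F [⋀^Fin k]→L[ℝ] ℝ from β (φ x)).compContinuousLinearMap (A x)

/-- The differential of a map as a field of linear maps. -/
def tangentField (f : M → N) (x : M) : E →L[ℝ] F := mfderiv 𝓘(ℝ, E) 𝓘(ℝ, F) f x

theorem bundlePullback_wedge (φ : M → N) (A : M → E →L[ℝ] F) (β : DForm F N k) (η : DForm F N l) :
    bundlePullback φ A (formWedge β η) =
      formWedge (bundlePullback φ A β) (bundlePullback φ A η) := by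
  funext x
  exact altWedge_comp (V := F) (V' := E) (β (φ x)) (η (φ x)) (A x)

/-- The differential of the preferred chart. -/
def chartD (x₀ x : M) : E →L[ℝ] E := mfderiv 𝓘(ℝ, E) 𝓘(ℝ, E) (extChartAt 𝓘(ℝ, E) x₀) x

/-- The differential of the inverse of the preferred chart. -/
def chartDSymm (x₀ : M) (y : E) : E →L[ℝ] E :=
  mfderiv 𝓘(ℝ, E) 𝓘(ℝ, E) (extChartAt 𝓘(ℝ, E) x₀).symm y

/-- The expression of a field of linear maps in the preferred charts. -/
def coordMap (x₀ : M) (φ : M → N) (A : M → E →L[ℝ] F) (y : E) : E →L[ℝ] F :=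
  (chartD (φ x₀) (φ ((extChartAt 𝓘(ℝ, E) x₀).symm y))).comp
    ((A ((extChartAt 𝓘(ℝ, E) x₀).symm y)).comp (chartDSymm x₀ y))

/-- Smoothness at `x₀` of a field of linear maps `T_x M → T_{φ x} N`. -/
structure SmoothFieldAt (φ : M → N) (A : M → E →L[ℝ] F) (x₀ : M) : Prop where
  base : ∀ᶠ x in 𝓝 x₀, ContMDiffAt 𝓘(ℝ, E) 𝓘(ℝ, F) ∞ φ x
  field : ContDiffAt ℝ ∞ (coordMap x₀ φ A) (extChartAt 𝓘(ℝ, E) x₀ x₀)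

theorem tendsto_extChartAt_symm (x₀ : M) : Filter.Tendsto (extChartAt 𝓘(ℝ, E) x₀).symm
    (𝓝 (extChartAt 𝓘(ℝ, E) x₀ x₀)) (𝓝 x₀) := by
  have := continuousAt_extChartAt_symm (I := 𝓘(ℝ, E)) x₀
  unfold ContinuousAt at this
  rwa [(extChartAt 𝓘(ℝ, E) x₀).left_inv (mem_extChartAt_source x₀)] at this

theorem eventually_chart_iff {x₀ : M} {p : M → Prop} (h : ∀ᶠ x in 𝓝 x₀, p x) :
    ∀ᶠ y in 𝓝 (extChartAt 𝓘(ℝ, E) x₀ x₀), y ∈ (extChartAt 𝓘(ℝ, E) x₀).target ∧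
      p ((extChartAt 𝓘(ℝ, E) x₀).symm y) :=
  Filter.Eventually.and (extChartAt_target_mem_nhds (I := 𝓘(ℝ, E)) x₀)
    ((tendsto_extChartAt_symm x₀).eventually h)

theorem SmoothFieldAt.congr {φ φ' : M → N} {A A' : M → E →L[ℝ] F} {x₀ : M}
    (h : SmoothFieldAt φ A x₀) (hφ : ∀ᶠ x in 𝓝 x₀, φ x = φ' x) (hA : ∀ᶠ x in 𝓝 x₀, A x = A' x) :
    SmoothFieldAt φ' A' x₀ := by
  constructor
  · filter_upwards [h.base, hφ.eventually_nhds] with x hx hx'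
    exact hx.congr_of_eventuallyEq (hx'.mono fun _ h => h.symm)
  · refine h.field.congr_of_eventuallyEq ?_
    filter_upwards [eventually_chart_iff hφ, eventually_chart_iff hA] with y hy hy'
    simp only [coordMap, hy.2, hy'.2, hφ.self_of_nhds]

variable [FiniteDimensional ℝ E] [FiniteDimensional ℝ F] [FiniteDimensional ℝ F']
  [IsManifold 𝓘(ℝ, E) ∞ M] [IsManifold 𝓘(ℝ, F) ∞ N] [IsManifold 𝓘(ℝ, F') ∞ N']

theorem chartDSymm_comp_chartD {x₀ x : M} (hx : x ∈ (extChartAt 𝓘(ℝ, E) x₀).source) :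
    (chartDSymm x₀ (extChartAt 𝓘(ℝ, E) x₀ x)).comp (chartD x₀ x) = ContinuousLinearMap.id ℝ E := by
  have hx' : x ∈ (chartAt E x₀).source := by simpa using hx
  have h1 := mfderiv_comp x
    ((contMDiffAt_extChartAt_symm ((extChartAt 𝓘(ℝ, E) x₀).map_source hx)).mdifferentiableAt
      (by simp)) ((contMDiffAt_extChartAt' (n := ∞) hx').mdifferentiableAt (by simp))
  refine h1.symm.trans ?_
  have h2 : ((extChartAt 𝓘(ℝ, E) x₀).symm ∘ extChartAt 𝓘(ℝ, E) x₀) =ᶠ[𝓝 x] id := by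
    filter_upwards [(isOpen_extChartAt_source x₀).mem_nhds hx] with z hz
    exact (extChartAt 𝓘(ℝ, E) x₀).left_inv hz
  have h3 : (mfderiv 𝓘(ℝ, E) 𝓘(ℝ, E) ((extChartAt 𝓘(ℝ, E) x₀).symm ∘ extChartAt 𝓘(ℝ, E) x₀) x :
    E →L[ℝ] E) = mfderiv 𝓘(ℝ, E) 𝓘(ℝ, E) (id : M → M) x := h2.mfderiv_eq
  exact h3.trans mfderiv_id

theorem chartD_comp_chartDSymm {x₀ : M} {y : E} (hy : y ∈ (extChartAt 𝓘(ℝ, E) x₀).target) :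
    (chartD x₀ ((extChartAt 𝓘(ℝ, E) x₀).symm y)).comp (chartDSymm x₀ y) =
      ContinuousLinearMap.id ℝ E := by
  have hs := (extChartAt 𝓘(ℝ, E) x₀).map_target hy
  have hx' : (extChartAt 𝓘(ℝ, E) x₀).symm y ∈ (chartAt E x₀).source := by simpa using hs
  have h1 := mfderiv_comp y ((contMDiffAt_extChartAt' (n := ∞) hx').mdifferentiableAt (by simp))
    ((contMDiffAt_extChartAt_symm hy).mdifferentiableAt (by simp))
  refine h1.symm.trans ?_
  have h2 : (extChartAt 𝓘(ℝ, E) x₀ ∘ (extChartAt 𝓘(ℝ, E) x₀).symm) =ᶠ[𝓝 y] id := by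
    filter_upwards [(isOpen_extChartAt_target x₀).mem_nhds hy] with z hz
    exact (extChartAt 𝓘(ℝ, E) x₀).right_inv hz
  have h3 : (mfderiv 𝓘(ℝ, E) 𝓘(ℝ, E) (extChartAt 𝓘(ℝ, E) x₀ ∘ (extChartAt 𝓘(ℝ, E) x₀).symm) y :
    E →L[ℝ] E) = mfderiv 𝓘(ℝ, E) 𝓘(ℝ, E) (id : E → E) y := h2.mfderiv_eq
  exact h3.trans mfderiv_id

/-- A form in terms of its local representative. -/
theorem eq_localRep {x₀ x : M} (hx : x ∈ (extChartAt 𝓘(ℝ, E) x₀).source) (β : DForm E M k) :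
    β x = (localRep x₀ β (extChartAt 𝓘(ℝ, E) x₀ x)).compContinuousLinearMap (chartD x₀ x) :=
  (formPullback_localRep hx β).symm

theorem eventually_source {φ : M → N} {x₀ : M} (h : ContinuousAt φ x₀) :
    ∀ᶠ x in 𝓝 x₀, φ x ∈ (extChartAt 𝓘(ℝ, F) (φ x₀)).source :=
  h.eventually (extChartAt_source_mem_nhds (I := 𝓘(ℝ, F)) (φ x₀))

theorem localRep_bundlePullback {φ : M → N} (A : M → E →L[ℝ] F) {x₀ : M} (hφ : ContinuousAt φ x₀)
    (β : DForm F N k) :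
    localRep x₀ (bundlePullback φ A β) =ᶠ[𝓝 (extChartAt 𝓘(ℝ, E) x₀ x₀)] fun y =>
      (localRep (φ x₀) β (writtenInExtChartAt 𝓘(ℝ, E) 𝓘(ℝ, F) x₀ φ y)).compContinuousLinearMap
        (coordMap x₀ φ A y) := by
  filter_upwards [eventually_chart_iff (eventually_source (F := F) hφ)] with y hy
  have h := eq_localRep (E := F) hy.2 β
  ext v
  change β _ _ = _
  rw [h]
  rfl

theorem SmoothFieldAt.bundlePullback {φ : M → N} {A : M → E →L[ℝ] F} {x₀ : M}
    (h : SmoothFieldAt φ A x₀) {β : DForm F N k} (hβ : SmoothFormAt β (φ x₀)) :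
    SmoothFormAt (bundlePullback φ A β) x₀ := by
  refine ContDiffAt.congr_of_eventuallyEq ?_
    (localRep_bundlePullback A h.base.self_of_nhds.continuousAt β)
  have h1 := contDiffAt_writtenInExtChartAt h.base.self_of_nhds
  refine ContDiffAt.alternating_comp (ContDiffAt.comp _ ?_ h1) h.field
  have hw : writtenInExtChartAt 𝓘(ℝ, E) 𝓘(ℝ, F) x₀ φ (extChartAt 𝓘(ℝ, E) x₀ x₀) =
      extChartAt 𝓘(ℝ, F) (φ x₀) (φ x₀) := by simp [writtenInExtChartAt]
  rw [hw]
  exact hβ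

theorem SmoothFieldAt.comp {φ : M → N} {A : M → E →L[ℝ] F} {x₀ : M} {ψ : N → N'}
    {B : N → F →L[ℝ] F'} (hB : SmoothFieldAt ψ B (φ x₀)) (hA : SmoothFieldAt φ A x₀) :
    SmoothFieldAt (fun x => ψ (φ x)) (fun x => (B (φ x)).comp (A x)) x₀ := by
  have hφ := hA.base.self_of_nhds.continuousAt
  constructor
  · filter_upwards [hA.base, hφ.eventually hB.base] with x h1 h2
    exact ContMDiffAt.comp (I' := 𝓘(ℝ, F)) x h2 h1
  · have h1 := contDiffAt_writtenInExtChartAt hA.base.self_of_nhds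
    have hw : writtenInExtChartAt 𝓘(ℝ, E) 𝓘(ℝ, F) x₀ φ (extChartAt 𝓘(ℝ, E) x₀ x₀) =
        extChartAt 𝓘(ℝ, F) (φ x₀) (φ x₀) := by simp [writtenInExtChartAt]
    have h2 : ContDiffAt ℝ ∞ (fun y => coordMap (E := F) (F := F') (φ x₀) ψ B
        (writtenInExtChartAt 𝓘(ℝ, E) 𝓘(ℝ, F) x₀ φ y)) (extChartAt 𝓘(ℝ, E) x₀ x₀) := by
      refine ContDiffAt.comp (g := coordMap (E := F) (F := F') (φ x₀) ψ B) _ ?_ h1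
      rw [hw]; exact hB.field
    refine (h2.clm_comp hA.field).congr_of_eventuallyEq ?_
    filter_upwards [eventually_chart_iff (eventually_source (F := F) hφ)] with y hy
    have h3 := chartDSymm_comp_chartD (E := F) hy.2
    have h4 : ∀ v : F, chartDSymm (φ x₀) (extChartAt 𝓘(ℝ, F) (φ x₀)
        (φ ((extChartAt 𝓘(ℝ, E) x₀).symm y))) (chartD (φ x₀)
        (φ ((extChartAt 𝓘(ℝ, E) x₀).symm y)) v) = v := fun v =>
      congrArg (fun L : F →L[ℝ] F => L v) h3
    ext v
    simp only [coordMap, writtenInExtChartAt, ContinuousLinearMap.comp_apply, Function.comp_apply,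
      h4, (extChartAt 𝓘(ℝ, F) (φ x₀)).left_inv hy.2]

theorem coordMap_tangentField {f : M → N} {x₀ : M}
    (hf : ∀ᶠ x in 𝓝 x₀, ContMDiffAt 𝓘(ℝ, E) 𝓘(ℝ, F) ∞ f x) :
    coordMap x₀ f (tangentField (E := E) (F := F) f) =ᶠ[𝓝 (extChartAt 𝓘(ℝ, E) x₀ x₀)]
      fderiv ℝ (writtenInExtChartAt 𝓘(ℝ, E) 𝓘(ℝ, F) x₀ f) := by
  filter_upwards [eventually_chart_iff (hf.and (eventually_source (F := F) hf.self_of_nhds.continuousAt))]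
    with y hy
  have h1 := (contMDiffAt_extChartAt_symm hy.1).mdifferentiableAt (by simp)
  have h2 := hy.2.1.mdifferentiableAt (by simp)
  have h3 : f ((extChartAt 𝓘(ℝ, E) x₀).symm y) ∈ (chartAt F (f x₀)).source := by
    simpa using hy.2.2
  have h4 := (contMDiffAt_extChartAt' (I := 𝓘(ℝ, F)) (n := ∞) h3).mdifferentiableAt (by simp)
  have h5 := mfderiv_comp y (h4.comp _ h2) h1
  have h6 := mfderiv_comp _ h4 h2
  rw [← mfderiv_eq_fderiv]
  refine Eq.trans ?_ h5.symm
  refine (?_ : _ = _).trans (congrArg (fun L : E →L[ℝ] F => L.comp (chartDSymm x₀ y)) h6.symm)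
  rfl

theorem smoothFieldAt_tangentField {f : M → N} {x₀ : M}
    (hf : ∀ᶠ x in 𝓝 x₀, ContMDiffAt 𝓘(ℝ, E) 𝓘(ℝ, F) ∞ f x) :
    SmoothFieldAt f (tangentField (E := E) (F := F) f) x₀ :=
  ⟨hf, ((contDiffAt_writtenInExtChartAt hf.self_of_nhds).fderiv_right (m := ∞)
    (by simp)).congr_of_eventuallyEq (coordMap_tangentField hf)⟩

theorem contDiffAt_coord {u : M → F'} {x₀ : M} (hu : ContMDiffAt 𝓘(ℝ, E) 𝓘(ℝ, F') ∞ u x₀) :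
    ContDiffAt ℝ ∞ (fun y => u ((extChartAt 𝓘(ℝ, E) x₀).symm y)) (extChartAt 𝓘(ℝ, E) x₀ x₀) := by
  have h2 := (contMDiffAt_iff.1 hu).2
  simp only [mfld_simps, contDiffWithinAt_univ] at h2
  exact h2

theorem SmoothFieldAt.add {φ : M → N} {A B : M → E →L[ℝ] F} {x₀ : M}
    (hA : SmoothFieldAt φ A x₀) (hB : SmoothFieldAt φ B x₀) :
    SmoothFieldAt φ (fun x => A x + B x) x₀ := by
  refine ⟨hA.base, (hA.field.add hB.field).congr_of_eventuallyEq (Filter.Eventually.of_forall ?_)⟩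
  intro y
  ext v
  simp [coordMap]

theorem SmoothFieldAt.smul {φ : M → N} {A : M → E →L[ℝ] F} {x₀ : M} {u : M → ℝ}
    (hu : ContMDiffAt 𝓘(ℝ, E) 𝓘(ℝ, ℝ) ∞ u x₀) (hA : SmoothFieldAt φ A x₀) :
    SmoothFieldAt φ (fun x => u x • A x) x₀ := by
  refine ⟨hA.base, ((contDiffAt_coord hu).smul hA.field).congr_of_eventuallyEq
    (Filter.Eventually.of_forall ?_)⟩
  intro y
  ext v
  simp [coordMap]

theorem SmoothFieldAt.neg {φ : M → N} {A : M → E →L[ℝ] F} {x₀ : M}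
    (hA : SmoothFieldAt φ A x₀) : SmoothFieldAt φ (fun x => -A x) x₀ := by
  refine ⟨hA.base, hA.field.neg.congr_of_eventuallyEq (Filter.Eventually.of_forall ?_)⟩
  intro y
  ext v
  simp [coordMap]

theorem SmoothFieldAt.sub {φ : M → N} {A B : M → E →L[ℝ] F} {x₀ : M}
    (hA : SmoothFieldAt φ A x₀) (hB : SmoothFieldAt φ B x₀) :
    SmoothFieldAt φ (fun x => A x - B x) x₀ := by
  simpa only [sub_eq_add_neg] using hA.add hB.neg

theorem smoothFieldAt_zero {φ : M → N} {x₀ : M}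
    (hφ : ∀ᶠ x in 𝓝 x₀, ContMDiffAt 𝓘(ℝ, E) 𝓘(ℝ, F) ∞ φ x) :
    SmoothFieldAt φ (fun _ => (0 : E →L[ℝ] F)) x₀ := by
  refine ⟨hφ, (contDiffAt_const (c := 0)).congr_of_eventuallyEq (Filter.Eventually.of_forall ?_)⟩
  intro y
  ext v
  simp [coordMap]

theorem smoothFieldAt_id (x₀ : M) :
    SmoothFieldAt (fun x : M => x) (fun _ => ContinuousLinearMap.id ℝ E) x₀ := by
  refine ⟨Filter.Eventually.of_forall fun x => contMDiffAt_id,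
    (contDiffAt_const (c := ContinuousLinearMap.id ℝ E)).congr_of_eventuallyEq ?_⟩
  filter_upwards [extChartAt_target_mem_nhds (I := 𝓘(ℝ, E)) x₀] with y hy
  exact chartD_comp_chartDSymm hy

/-- A family of maps, written in the preferred charts at `(x₀, y₀)`. -/
def familyCoord (f : M → N → N') (x₀ : M) (y₀ : N) (y : E) (z : F) : F' :=
  extChartAt 𝓘(ℝ, F') (f x₀ y₀)
    (f ((extChartAt 𝓘(ℝ, E) x₀).symm y) ((extChartAt 𝓘(ℝ, F) y₀).symm z))

theorem contDiffAt_familyCoord {f : M → N → N'} {x₀ : M} {y₀ : N}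
    (hf : ContMDiffAt (𝓘(ℝ, E).prod 𝓘(ℝ, F)) 𝓘(ℝ, F') ∞ (fun p : M × N => f p.1 p.2) (x₀, y₀)) :
    ContDiffAt ℝ ∞ (Function.uncurry (familyCoord (E := E) (F := F) (F' := F') f x₀ y₀))
      (extChartAt 𝓘(ℝ, E) x₀ x₀, extChartAt 𝓘(ℝ, F) y₀ y₀) := by
  have hs : (extChartAt 𝓘(ℝ, E) x₀).symm (extChartAt 𝓘(ℝ, E) x₀ x₀) = x₀ :=
    (extChartAt 𝓘(ℝ, E) x₀).left_inv (mem_extChartAt_source x₀)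
  have hs' : (extChartAt 𝓘(ℝ, F) y₀).symm (extChartAt 𝓘(ℝ, F) y₀ y₀) = y₀ :=
    (extChartAt 𝓘(ℝ, F) y₀).left_inv (mem_extChartAt_source _)
  have h1 : ContMDiffAt (𝓘(ℝ, E).prod 𝓘(ℝ, F)) 𝓘(ℝ, F') ∞
      (Function.uncurry (familyCoord (E := E) (F := F) (F' := F') f x₀ y₀))
      (extChartAt 𝓘(ℝ, E) x₀ x₀, extChartAt 𝓘(ℝ, F) y₀ y₀) := by
    have h2 : ContMDiffAt 𝓘(ℝ, F') 𝓘(ℝ, F') ∞ (extChartAt 𝓘(ℝ, F') (f x₀ y₀))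
        (f x₀ y₀) := contMDiffAt_extChartAt
    have h4 : ContMDiffAt 𝓘(ℝ, E) 𝓘(ℝ, E) ∞ (extChartAt 𝓘(ℝ, E) x₀).symm
        (extChartAt 𝓘(ℝ, E) x₀ x₀) :=
      contMDiffAt_extChartAt_symm ((extChartAt 𝓘(ℝ, E) x₀).map_source (mem_extChartAt_source x₀))
    have h5 : ContMDiffAt 𝓘(ℝ, F) 𝓘(ℝ, F) ∞ (extChartAt 𝓘(ℝ, F) y₀).symm
        (extChartAt 𝓘(ℝ, F) y₀ y₀) :=
      contMDiffAt_extChartAt_symm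
        ((extChartAt 𝓘(ℝ, F) y₀).map_source (mem_extChartAt_source y₀))
    have h6 : ContMDiffAt (𝓘(ℝ, E).prod 𝓘(ℝ, F)) (𝓘(ℝ, E).prod 𝓘(ℝ, F)) ∞
        (fun q : E × F => ((extChartAt 𝓘(ℝ, E) x₀).symm q.1,
          (extChartAt 𝓘(ℝ, F) y₀).symm q.2))
        (extChartAt 𝓘(ℝ, E) x₀ x₀, extChartAt 𝓘(ℝ, F) y₀ y₀) :=
      ContMDiffAt.prodMk (ContMDiffAt.comp _ h4 contMDiffAt_fst)
        (ContMDiffAt.comp _ h5 contMDiffAt_snd)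
    refine ContMDiffAt.comp (I' := 𝓘(ℝ, F')) _ (g := extChartAt 𝓘(ℝ, F') (f x₀ y₀))
      (f := fun q : E × F => f ((extChartAt 𝓘(ℝ, E) x₀).symm q.1)
        ((extChartAt 𝓘(ℝ, F) y₀).symm q.2)) ?_ ?_
    · simp only [hs, hs']; exact h2
    · refine ContMDiffAt.comp (I' := 𝓘(ℝ, E).prod 𝓘(ℝ, F)) _
        (g := fun p : M × N => f p.1 p.2) ?_ h6
      simp only [hs, hs']; exact hf
  rw [← modelWithCornersSelf_prod, chartedSpaceSelf_prod] at h1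
  exact h1.contDiffAt

theorem contMDiffAt_of_family {f : M → N → N'} {x : M} {y : N}
    (hf : ContMDiffAt (𝓘(ℝ, E).prod 𝓘(ℝ, F)) 𝓘(ℝ, F') ∞ (fun p : M × N => f p.1 p.2) (x, y)) :
    ContMDiffAt 𝓘(ℝ, F) 𝓘(ℝ, F') ∞ (f x) y :=
  ContMDiffAt.comp (I' := 𝓘(ℝ, E).prod 𝓘(ℝ, F)) y (g := fun p : M × N => f p.1 p.2)
    (f := fun z => (x, z)) hf (contMDiffAt_const.prodMk contMDiffAt_id)

theorem fderiv_familyCoord {f : M → N → N'} {x₀ x : M} {y₀ y : N}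
    (hx : x ∈ (extChartAt 𝓘(ℝ, E) x₀).source) (hy : y ∈ (extChartAt 𝓘(ℝ, F) y₀).source)
    (hxy : f x y ∈ (extChartAt 𝓘(ℝ, F') (f x₀ y₀)).source)
    (hf : ContMDiffAt 𝓘(ℝ, F) 𝓘(ℝ, F') ∞ (f x) y) :
    fderiv ℝ (familyCoord (E := E) (F := F) (F' := F') f x₀ y₀ (extChartAt 𝓘(ℝ, E) x₀ x))
      (extChartAt 𝓘(ℝ, F) y₀ y) =
      (chartD (E := F') (f x₀ y₀) (f x y)).comp
        ((tangentField (E := F) (F := F') (f x) y).comp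
          (chartDSymm y₀ (extChartAt 𝓘(ℝ, F) y₀ y))) := by
  have hzx := (extChartAt 𝓘(ℝ, F) y₀).left_inv hy
  have hxx := (extChartAt 𝓘(ℝ, E) x₀).left_inv hx
  have k1 : MDifferentiableAt 𝓘(ℝ, F) 𝓘(ℝ, F) (extChartAt 𝓘(ℝ, F) y₀).symm
    (extChartAt 𝓘(ℝ, F) y₀ y) := (contMDiffAt_extChartAt_symm
      ((extChartAt 𝓘(ℝ, F) y₀).map_source hy)).mdifferentiableAt (by simp)
  have k2 : MDifferentiableAt 𝓘(ℝ, F) 𝓘(ℝ, F') (f x)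
      ((extChartAt 𝓘(ℝ, F) y₀).symm (extChartAt 𝓘(ℝ, F) y₀ y)) := by
    rw [hzx]; exact hf.mdifferentiableAt (by simp)
  have k3 : MDifferentiableAt 𝓘(ℝ, F') 𝓘(ℝ, F') (extChartAt 𝓘(ℝ, F') (f x₀ y₀))
      (f x ((extChartAt 𝓘(ℝ, F) y₀).symm (extChartAt 𝓘(ℝ, F) y₀ y))) := by
    rw [hzx]
    have : f x y ∈ (chartAt F' (f x₀ y₀)).source := by simpa using hxy
    exact (contMDiffAt_extChartAt' (n := ∞) this).mdifferentiableAt (by simp)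
  have k4 := mfderiv_comp _ (k3.comp _ k2) k1
  have k5 := mfderiv_comp _ k3 k2
  rw [← mfderiv_eq_fderiv]
  refine Eq.trans (b := mfderiv 𝓘(ℝ, F) 𝓘(ℝ, F') ((extChartAt 𝓘(ℝ, F') (f x₀ y₀) ∘ f x) ∘
    (extChartAt 𝓘(ℝ, F) y₀).symm) (extChartAt 𝓘(ℝ, F) y₀ y)) ?_ ?_
  · unfold familyCoord
    rw [hxx]; rfl
  refine k4.trans ?_
  refine (congrArg (fun L : F →L[ℝ] F' =>
    L.comp (chartDSymm y₀ (extChartAt 𝓘(ℝ, F) y₀ y))) k5).trans ?_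
  unfold chartD tangentField
  rw [hzx]
  rfl

/-- The differentials of a smooth family of maps form a smooth field of linear maps. -/
theorem SmoothFieldAt.tangentField_family {φ : M → N} {A : M → E →L[ℝ] F} {x₀ : M}
    (hA : SmoothFieldAt φ A x₀) {f : M → N → N'}
    (hf : ∀ᶠ p in 𝓝 (x₀, φ x₀), ContMDiffAt (𝓘(ℝ, E).prod 𝓘(ℝ, F)) 𝓘(ℝ, F') ∞
      (fun p : M × N => f p.1 p.2) p) :
    SmoothFieldAt (fun x => f x (φ x))
      (fun x => (tangentField (E := F) (F := F') (f x) (φ x)).comp (A x)) x₀ := by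
  have hφ := hA.base.self_of_nhds.continuousAt
  have hpair : Filter.Tendsto (fun x => (x, φ x)) (𝓝 x₀) (𝓝 (x₀, φ x₀)) :=
    continuousAt_id.prodMk hφ
  have hbase : ∀ᶠ x in 𝓝 x₀, ContMDiffAt 𝓘(ℝ, E) 𝓘(ℝ, F') ∞ (fun x => f x (φ x)) x := by
    filter_upwards [hA.base, hpair.eventually hf] with x h1 h2
    exact ContMDiffAt.comp x (g := fun p : M × N => f p.1 p.2) h2 (contMDiffAt_id.prodMk h1)
  refine ⟨hbase, ?_⟩
  have hw : writtenInExtChartAt 𝓘(ℝ, E) 𝓘(ℝ, F) x₀ φ (extChartAt 𝓘(ℝ, E) x₀ x₀) =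
      extChartAt 𝓘(ℝ, F) (φ x₀) (φ x₀) := by simp [writtenInExtChartAt]
  have hΦ := contDiffAt_familyCoord hf.self_of_nhds
  rw [← hw] at hΦ
  -- The partial differential in the second variable is smooth in both variables; it is evaluated
  -- along the graph of `φ`.
  have hD := ContDiffAt.fderiv (m := ∞) hΦ (contDiffAt_writtenInExtChartAt hA.base.self_of_nhds)
    (by simp)
  refine (hD.clm_comp hA.field).congr_of_eventuallyEq ?_
  have hsrc : ∀ᶠ x in 𝓝 x₀, f x (φ x) ∈ (extChartAt 𝓘(ℝ, F') (f x₀ (φ x₀))).source :=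
    eventually_source (F := F') (φ := fun x => f x (φ x)) hbase.self_of_nhds.continuousAt
  filter_upwards [eventually_chart_iff ((eventually_source (F := F) hφ).and
    (hsrc.and (hpair.eventually hf)))] with y hy
  obtain ⟨hy1, hy2, hy3, hy4⟩ := hy
  have h3 := chartDSymm_comp_chartD (E := F) hy2
  have h4 : ∀ v : F, chartDSymm (φ x₀) (extChartAt 𝓘(ℝ, F) (φ x₀)
      (φ ((extChartAt 𝓘(ℝ, E) x₀).symm y)))
      (chartD (φ x₀) (φ ((extChartAt 𝓘(ℝ, E) x₀).symm y)) v) = v :=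
    fun v => congrArg (fun L : F →L[ℝ] F => L v) h3
  have k6 := fderiv_familyCoord ((extChartAt 𝓘(ℝ, E) x₀).map_target hy1) hy2 hy3
    (contMDiffAt_of_family hy4)
  rw [(extChartAt 𝓘(ℝ, E) x₀).right_inv hy1] at k6
  have k7 : writtenInExtChartAt 𝓘(ℝ, E) 𝓘(ℝ, F) x₀ φ y =
    extChartAt 𝓘(ℝ, F) (φ x₀) (φ ((extChartAt 𝓘(ℝ, E) x₀).symm y)) := rfl
  rw [k7, k6]
  ext v
  simp only [coordMap, ContinuousLinearMap.comp_apply, h4]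

end BundleMaps

/-! ### Smooth coefficients -/

section Coefficients

variable {X : Type*} [NormedAddCommGroup X] [NormedSpace ℝ X]
  {W : Type*} [NormedAddCommGroup W] [NormedSpace ℝ W] [FiniteDimensional ℝ W]

/-- A smooth vector in the span of smooth independent vectors has smooth coefficients. -/
theorem exists_contDiffAt_coeff {ι : Type*} [Fintype ι] {t : ι → X → W} {w : X → W} {x₀ : X}
    (ht : ∀ᶠ x in 𝓝 x₀, ∀ i, ContDiffAt ℝ ∞ (t i) x) (hw : ∀ᶠ x in 𝓝 x₀, ContDiffAt ℝ ∞ w x)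
    (hli : LinearIndependent ℝ fun i => t i x₀)
    (hspan : ∀ᶠ x in 𝓝 x₀, w x ∈ Submodule.span ℝ (Set.range fun i => t i x)) :
    ∃ c : ι → X → ℝ, ∀ᶠ x in 𝓝 x₀, (∀ i, ContDiffAt ℝ ∞ (c i) x) ∧ w x = ∑ i, c i x • t i x := by
  let L : X → (ι → ℝ) →L[ℝ] W := fun x => ∑ i, (ContinuousLinearMap.proj i).smulRight (t i x)
  have hLa : ∀ x a, L x a = ∑ i, a i • t i x := by
    intro x a
    simp [L]
  have hL : ∀ x, (∀ i, ContDiffAt ℝ ∞ (t i) x) → ContDiffAt ℝ ∞ L x := fun x hx => by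
    refine ContDiffAt.sum fun i _ => ?_
    exact (ContinuousLinearMap.smulRightL ℝ (ι → ℝ) W (ContinuousLinearMap.proj i)
      ).contDiff.contDiffAt.comp x (hx i)
  have hinj : LinearMap.ker (L x₀ : (ι → ℝ) →ₗ[ℝ] W) = ⊥ := by
    rw [LinearMap.ker_eq_bot']
    intro a ha
    have ha' : ∑ i, a i • t i x₀ = 0 := by rw [← hLa]; exact ha
    funext i
    exact Fintype.linearIndependent_iff.1 hli a ha' i
  -- With `R` a left inverse of `L x₀`, the endomorphism `B x = R ∘ L x` is the identity at `x₀`,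
  -- hence invertible nearby. Applying `R` to `w = L a` recovers the coefficients as `B⁻¹ (R w)`.
  obtain ⟨R0, hR0⟩ := LinearMap.exists_leftInverse_of_injective _ hinj
  let R : W →L[ℝ] (ι → ℝ) := LinearMap.toContinuousLinearMap R0
  let B : X → (ι → ℝ) →L[ℝ] (ι → ℝ) := fun x => R.comp (L x)
  have hB : ∀ x, (∀ i, ContDiffAt ℝ ∞ (t i) x) → ContDiffAt ℝ ∞ B x := fun x hx =>
    contDiffAt_const.clm_comp (hL x hx)
  have hB0 : B x₀ = (ContinuousLinearEquiv.refl ℝ (ι → ℝ) : (ι → ℝ) →L[ℝ] (ι → ℝ)) := by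
    ext1 a
    exact congrArg (fun l : (ι → ℝ) →ₗ[ℝ] (ι → ℝ) => l a) hR0
  have hev : ∀ᶠ x in 𝓝 x₀, (B x).IsInvertible := by
    have : IsOpen {T : (ι → ℝ) →L[ℝ] (ι → ℝ) | T.IsInvertible} :=
      ContinuousLinearEquiv.isOpen (𝕜 := ℝ) (E := ι → ℝ) (F := ι → ℝ)
    refine (hB x₀ ht.self_of_nhds).continuousAt.eventually (this.mem_nhds ?_)
    rw [hB0]; exact ContinuousLinearMap.isInvertible_equiv
  refine ⟨fun i x => (B x).inverse (R (w x)) i, ?_⟩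
  filter_upwards [hev, hspan, ht, hw] with x hx hwx htx hw'
  constructor
  · have hinvB : ContDiffAt ℝ ∞ (fun x => (B x).inverse) x := by
      refine ContDiffAt.comp (g := ContinuousLinearMap.inverse) x ?_ (hB x htx)
      obtain ⟨T, hT⟩ := hx
      rw [← hT]; exact contDiffAt_map_inverse _
    have hc : ContDiffAt ℝ ∞ (fun x => (B x).inverse (R (w x))) x :=
      hinvB.clm_apply (R.contDiff.contDiffAt.comp x hw')
    exact fun i => contDiffAt_pi.1 hc i
  · obtain ⟨a, ha⟩ := (Submodule.mem_span_range_iff_exists_fun ℝ).1 hwx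
    have h1 : R (w x) = B x a := by
      rw [← ha, ← hLa]; rfl
    rw [h1, hx.inverse_apply_self, ha]

/-- A smooth vector in the span of smooth vectors of constant rank has smooth coefficients. -/
theorem exists_contDiffAt_coeff_of_finrank {ι : Type*} [Fintype ι] {t : ι → X → W} {w : X → W}
    {x₀ : X} (ht : ∀ᶠ x in 𝓝 x₀, ∀ i, ContDiffAt ℝ ∞ (t i) x)
    (hw : ∀ᶠ x in 𝓝 x₀, ContDiffAt ℝ ∞ w x) {r : ℕ}
    (hr : ∀ᶠ x in 𝓝 x₀, Module.finrank ℝ (Submodule.span ℝ (Set.range fun i => t i x)) = r)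
    (hspan : ∀ᶠ x in 𝓝 x₀, w x ∈ Submodule.span ℝ (Set.range fun i => t i x)) :
    ∃ c : ι → X → ℝ, ∀ᶠ x in 𝓝 x₀, (∀ i, ContDiffAt ℝ ∞ (c i) x) ∧ w x = ∑ i, c i x • t i x := by
  classical
  -- A subfamily that is a basis of the span at `x₀` stays independent nearby, and constancy of the
  -- rank makes it span there too. The remaining coefficients are set to zero.
  obtain ⟨κ, a, ha, hs, hli⟩ := exists_linearIndependent' ℝ (fun i => t i x₀)
  have : Finite κ := Finite.of_injective a ha
  have : Fintype κ := Fintype.ofFinite κ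
  have hcard : Fintype.card κ = r := by
    rw [← hr.self_of_nhds, ← hs, finrank_span_eq_card hli]
  have hcont : ContinuousAt (fun x j => t (a j) x : X → κ → W) x₀ :=
    continuousAt_pi.2 fun j => (ht.self_of_nhds (a j)).continuousAt
  have hli' : ∀ᶠ x in 𝓝 x₀, LinearIndependent ℝ fun j => t (a j) x :=
    hcont.eventually ((isOpen_setOfPred_linearIndependent (𝕜 := ℝ) (E := W) (ι := κ)).mem_nhds hli)
  have hspan' : ∀ᶠ x in 𝓝 x₀, w x ∈ Submodule.span ℝ (Set.range fun j => t (a j) x) := by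
    filter_upwards [hli', hr, hspan] with x h1 h2 h3
    have h4 : Submodule.span ℝ (Set.range fun j => t (a j) x) =
        Submodule.span ℝ (Set.range fun i => t i x) := by
      refine Submodule.eq_of_le_of_finrank_eq (Submodule.span_mono ?_) ?_
      · rintro _ ⟨j, rfl⟩; exact ⟨a j, rfl⟩
      · rw [h2, finrank_span_eq_card h1, hcard]
    rw [h4]; exact h3
  obtain ⟨c, hc⟩ := exists_contDiffAt_coeff (t := fun j => t (a j))
    (ht.mono fun x hx j => hx (a j)) hw hli hspan'
  refine ⟨fun i x => ∑ j, if a j = i then c j x else 0, ?_⟩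
  filter_upwards [hc] with x hx
  constructor
  · intro i
    refine ContDiffAt.sum fun j _ => ?_
    split_ifs
    · exact hx.1 j
    · exact contDiffAt_const
  · rw [hx.2]
    simp only [Finset.sum_smul, ite_smul, zero_smul]
    rw [Finset.sum_comm]
    simp

end Coefficients
end

noncomputable section

set_option linter.unusedSectionVars false

/-! ### Finitely coloured partitions of unity -/

section Coloured

variable {E : Type*} [NormedAddCommGroup E] [NormedSpace ℝ E] [FiniteDimensional ℝ E]
  {X : Type*} [TopologicalSpace X] [ChartedSpace E X]

/-- Every open cover can be shrunk, only on `K`, so as to have order at most `D` on `K`. -/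
def Shrinkable (D : ℕ) (ι : Type*) (K : Set X) : Prop :=
  ∀ U : ι → Set X, (∀ i, IsOpen (U i)) → (∀ x, ∃ i, x ∈ U i) →
    ∃ V : ι → Set X, (∀ i, IsOpen (V i)) ∧ (∀ x, ∃ i, x ∈ V i) ∧ (∀ i, V i ⊆ U i) ∧
      (∀ i x, x ∉ K → x ∈ U i → x ∈ V i) ∧
      ∀ x ∈ K, ∀ F : Finset ι, (∀ i ∈ F, x ∈ V i) → F.card ≤ D

theorem shrinkable_empty (D : ℕ) (ι : Type*) : Shrinkable D ι (∅ : Set X) :=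
  fun U ho hc => ⟨U, ho, hc, fun _ => le_rfl, fun _ _ _ h => h, fun _ h => h.elim⟩

/-- In the chart, balls of one radius around the points of `K`, small enough to lie in members of
the cover by the Lebesgue number lemma, contain boundedly many disjoint families covering `K` by the
Besicovitch theorem. Balls are grouped by the index chosen for their centre: a point of `K` meets at
most one ball per family, hence at most that many of the new sets. Off `K` the cover is left
unchanged. -/
theorem shrinkable_of_subset_chart [T2Space X] (ι : Type*) {K : Set X} (hK : IsCompact K) {x₀ : X}
    (hKs : K ⊆ (extChartAt 𝓘(ℝ, E) x₀).source) : Shrinkable (Besicovitch.multiplicity E) ι K := by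
  intro U ho hc
  set e := extChartAt 𝓘(ℝ, E) x₀ with he
  have heo : ∀ O : Set E, IsOpen O → IsOpen (e.source ∩ e ⁻¹' O) := fun O hO =>
    (continuousOn_extChartAt x₀).isOpen_inter_preimage (isOpen_extChartAt_source x₀) hO
  have heo' : ∀ O : Set X, IsOpen O → IsOpen (e.target ∩ e.symm ⁻¹' O) := fun O hO =>
    (continuousOn_extChartAt_symm x₀).isOpen_inter_preimage (isOpen_extChartAt_target x₀) hO
  have hK' : IsCompact (e '' K) := hK.image_of_continuousOn ((continuousOn_extChartAt x₀).mono hKs)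
  obtain ⟨δ, hδ, hL⟩ := lebesgue_number_lemma_of_metric (c := fun i => e.target ∩ e.symm ⁻¹' (U i))
    hK' (fun i => heo' _ (ho i)) (by
      rintro _ ⟨x, hx, rfl⟩
      obtain ⟨i, hi⟩ := hc x
      refine Set.mem_iUnion.2 ⟨i, e.map_source (hKs hx), ?_⟩
      change e.symm (e x) ∈ U i
      rwa [e.left_inv (hKs hx)])
  choose idx hidx using fun y : e '' K => hL y y.2
  let q : Besicovitch.BallPackage (e '' K) E :=
    { c := fun y => y, r := fun _ => δ / 2, rpos := fun _ => by positivity, r_bound := δ / 2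
      r_le := fun _ => le_rfl }
  obtain ⟨s, hs, hcov⟩ := Besicovitch.exist_disjoint_covering_families
    (Besicovitch.one_lt_goodτ E) (Besicovitch.isEmpty_satelliteConfig_multiplicity E) q
  refine ⟨fun i => (U i \ K) ∪ (U i ∩ (e.source ∩ e ⁻¹' (⋃ c, ⋃ j ∈ {j ∈ s c | idx j = i},
    Metric.ball (j : E) (δ / 2)))), fun i => ?_, fun x => ?_, fun i => ?_, fun i x hx hi => ?_, ?_⟩
  · refine ((ho i).sdiff hK.isClosed).union ((ho i).inter (heo _ ?_))
    exact isOpen_iUnion fun c => isOpen_biUnion fun j _ => Metric.isOpen_ball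
  · by_cases hx : x ∈ K
    · have h1 : e x ∈ Set.range q.c := ⟨⟨e x, x, hx, rfl⟩, rfl⟩
      obtain ⟨c, hc1⟩ := Set.mem_iUnion.1 (hcov h1)
      obtain ⟨j, hj, hj2⟩ := Set.mem_iUnion₂.1 hc1
      have hj3 : e x ∈ Metric.ball (j : E) (δ / 2) := hj2
      have h2 := hidx j (Metric.ball_subset_ball (by linarith) hj3)
      refine ⟨idx j, Or.inr ⟨?_, hKs hx, ?_⟩⟩
      · have h3 : e.symm (e x) ∈ U (idx j) := h2.2
        rwa [e.left_inv (hKs hx)] at h3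
      · exact Set.mem_iUnion.2 ⟨c, Set.mem_iUnion₂.2 ⟨j, ⟨hj, rfl⟩, hj3⟩⟩
    · obtain ⟨i, hi⟩ := hc x
      exact ⟨i, Or.inl ⟨hi, hx⟩⟩
  · rintro x (hx | hx)
    · exact hx.1
    · exact hx.1
  · exact Or.inl ⟨hi, hx⟩
  · intro x hx F hF
    have h1 : ∀ i ∈ F, ∃ c, ∃ j ∈ s c, idx j = i ∧ e x ∈ Metric.ball (j : E) (δ / 2) := by
      intro i hi
      rcases hF i hi with h | h
      · exact absurd hx h.2
      · obtain ⟨c, hc1⟩ := Set.mem_iUnion.1 h.2.2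
        obtain ⟨j, hj, hj2⟩ := Set.mem_iUnion₂.1 hc1
        exact ⟨c, j, hj.1, hj.2, hj2⟩
    choose c j hj hj2 hj3 using h1
    have hinj : Function.Injective fun i : F => c i i.2 := by
      intro i i' hii
      have h2 : j i i.2 = j i' i'.2 := by
        by_contra hne
        have hii' : c i i.2 = c i' i'.2 := hii
        have hd := hs (c i i.2) (hj i i.2) (by rw [hii']; exact hj i' i'.2) hne
        exact Set.disjoint_left.1 hd (Metric.ball_subset_closedBall (hj3 i i.2))
          (Metric.ball_subset_closedBall (hj3 i' i'.2))
      exact Subtype.ext (by rw [← hj2 i i.2, ← hj2 i' i'.2, h2])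
    simpa using Fintype.card_le_of_injective _ hinj

/-- An open cover of a space which is a countable locally finite union of shrinkable sets can be
shrunk to a cover of bounded order. -/
theorem exists_shrinking {D : ℕ} {ι : Type*} {K : ℕ → Set X} (hK : ∀ n, Shrinkable D ι (K n))
    (hlf : LocallyFinite K) (hcov : ∀ x, ∃ n, x ∈ K n) {U : ι → Set X} (ho : ∀ i, IsOpen (U i))
    (hc : ∀ x, ∃ i, x ∈ U i) :
    ∃ V : ι → Set X, (∀ i, IsOpen (V i)) ∧ (∀ x, ∃ i, x ∈ V i) ∧ (∀ i, V i ⊆ U i) ∧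
      ∀ x, ∀ F : Finset ι, (∀ i ∈ F, x ∈ V i) → F.card ≤ D := by
  let C := {W : ι → Set X // (∀ i, IsOpen (W i)) ∧ ∀ x, ∃ i, x ∈ W i}
  have hstep : ∀ (n : ℕ) (W : C), ∃ W' : C, (∀ i, W'.1 i ⊆ W.1 i) ∧
      (∀ i x, x ∉ K n → x ∈ W.1 i → x ∈ W'.1 i) ∧
      ∀ x ∈ K n, ∀ F : Finset ι, (∀ i ∈ F, x ∈ W'.1 i) → F.card ≤ D := by
    intro n W
    obtain ⟨V, h1, h2, h3⟩ := hK n W.1 W.2.1 W.2.2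
    exact ⟨⟨V, h1, h2⟩, h3⟩
  choose step hs1 hs2 hs3 using hstep
  let W : ℕ → C := fun n => Nat.rec ⟨U, ho, hc⟩ (fun n W => step n W) n
  have hW : ∀ n, W (n + 1) = step n (W n) := fun n => rfl
  have hanti : ∀ i, Antitone fun n => (W n).1 i := fun i =>
    antitone_nat_of_succ_le fun n => by rw [hW]; exact hs1 n (W n) i
  -- Only finitely many `K n` meet a small neighbourhood, and step `n` removes nothing off `K n`, so
  -- the decreasing covers are locally stationary. Their intersection is therefore open and still a
  -- cover.
  have hstab : ∀ x, ∃ O ∈ 𝓝 x, ∃ n₀, ∀ z ∈ O, ∀ i, z ∈ (W n₀).1 i → ∀ n, z ∈ (W n).1 i := by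
    intro x
    obtain ⟨O, hO, hfin⟩ := hlf x
    obtain ⟨n₀, hn₀⟩ := hfin.bddAbove
    refine ⟨O, hO, n₀ + 1, fun z hz i hi n => ?_⟩
    have h1 : ∀ m, z ∈ (W (n₀ + 1 + m)).1 i := by
      intro m
      induction m with
      | zero => exact hi
      | succ m ih =>
        rw [← add_assoc, hW]
        refine hs2 _ _ _ _ (fun hzK => ?_) ih
        have := hn₀ (show (n₀ + 1 + m) ∈ {n | (K n ∩ O).Nonempty} from ⟨z, hzK, hz⟩)
        omega
    exact hanti i (by omega : n ≤ n₀ + 1 + n) (h1 n)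
  refine ⟨fun i => ⋂ n, (W n).1 i, fun i => ?_, fun x => ?_, fun i => ?_, fun x F hF => ?_⟩
  · rw [isOpen_iff_mem_nhds]
    intro x hx
    obtain ⟨O, hO, n₀, h⟩ := hstab x
    filter_upwards [hO, ((W n₀).2.1 i).mem_nhds (Set.mem_iInter.1 hx n₀)] with z hz hz'
    exact Set.mem_iInter.2 (h z hz i hz')
  · obtain ⟨O, hO, n₀, h⟩ := hstab x
    obtain ⟨i, hi⟩ := (W n₀).2.2 x
    exact ⟨i, Set.mem_iInter.2 (h x (mem_of_mem_nhds hO) i hi)⟩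
  · exact Set.iInter_subset (fun n => (W n).1 i) 0
  · obtain ⟨n, hn⟩ := hcov x
    refine hs3 n (W n) x hn F fun i hi => ?_
    rw [← hW]
    exact Set.mem_iInter.1 (hF i hi) (n + 1)

theorem exists_locallyFinite_shrinkable [T2Space X] [SigmaCompactSpace X] (ι : Type*) :
    ∃ K : ℕ → Set X, (∀ n, Shrinkable (Besicovitch.multiplicity E) ι (K n)) ∧ LocallyFinite K ∧
      ∀ x, ∃ n, x ∈ K n := by
  have : LocallyCompactSpace X := Manifold.locallyCompact_of_finiteDimensional 𝓘(ℝ, E)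
  obtain ⟨α, c, r, hr, hcov, hlf⟩ := refinement_of_locallyCompact_sigmaCompact_of_nhds_basis
    (fun x : X => (compact_basis_nhds x).restrict_subset
      (extChartAt_source_mem_nhds (I := 𝓘(ℝ, E)) x))
  have hct : Countable α := by
    rw [← Set.countable_univ_iff]
    exact hlf.countable_univ fun a => ⟨c a, mem_of_mem_nhds (hr a).1.1⟩
  obtain ⟨f, hf⟩ := hct.exists_injective_nat
  classical
  let K : ℕ → Set X := fun n => if h : ∃ a, f a = n then r h.choose else ∅
  have hKf : ∀ a, K (f a) = r a := by
    intro a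
    have h : ∃ a', f a' = f a := ⟨a, rfl⟩
    have h2 : h.choose = a := hf h.choose_spec
    simp only [K, dif_pos h, h2]
  refine ⟨K, fun n => ?_, fun x => ?_, fun x => ?_⟩
  · by_cases h : ∃ a, f a = n
    · obtain ⟨a, rfl⟩ := h
      rw [hKf]
      exact shrinkable_of_subset_chart ι (hr a).1.2 (hr a).2
    · simp only [K, dif_neg h]
      exact shrinkable_empty _ _
  · obtain ⟨O, hO, hfin⟩ := hlf x
    refine ⟨O, hO, (hfin.image f).subset ?_⟩
    rintro n ⟨z, hz, hzO⟩
    by_cases h : ∃ a, f a = n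
    · obtain ⟨a, rfl⟩ := h
      rw [hKf] at hz
      exact ⟨a, ⟨z, hz, hzO⟩, rfl⟩
    · simp only [K, dif_neg h] at hz
      exact hz.elim
  · have hx : x ∈ ⋃ a, r a := by rw [hcov]; trivial
    obtain ⟨a, ha⟩ := Set.mem_iUnion.1 hx
    exact ⟨f a, by rw [hKf]; exact ha⟩

/-- A finite smooth partition of unity `b c`, together with a locally constant choice, on the
support of each `b c`, of a point `p c x` such that `x ∈ U (p c x)`. -/
structure Colouring (U : X → Set X) where
  /-- the number of colours -/
  num : ℕ
  /-- the functions of the partition of unity -/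
  b : Fin num → X → ℝ
  /-- the locally constant choice of points -/
  p : Fin num → X → X
  smooth : ∀ c, ContMDiff 𝓘(ℝ, E) 𝓘(ℝ, ℝ) ∞ (b c)
  nonneg : ∀ c x, 0 ≤ b c x
  sum_eq_one : ∀ x, ∑ c, b c x = 1
  loc : ∀ c x₀, (∀ᶠ x in 𝓝 x₀, b c x = 0) ∨ (∀ᶠ x in 𝓝 x₀, p c x = p c x₀ ∧ x ∈ U (p c x₀))

variable [IsManifold 𝓘(ℝ, E) ∞ X]

/-- This is barycentric subdivision of a cover of order at most `D`. With `ρ` a subordinate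
partition of unity, `W F` is the set where the functions indexed by `F` are positive and exceed all
others. Sets `W F` with different `F` of equal cardinality are disjoint, so cardinality serves as
the colour, and an element of `F` is a choice of point that is constant on `W F`. Since `W F` lies
in `V i` for each `i ∈ F`, the chosen point is suitable. -/
theorem exists_colouring [T2Space X] [SigmaCompactSpace X] (U : X → Set X) (ho : ∀ x, IsOpen (U x))
    (hU : ∀ x, x ∈ U x) : Nonempty (Colouring (E := E) U) := by
  have : LocallyCompactSpace X := Manifold.locallyCompact_of_finiteDimensional 𝓘(ℝ, E)
  obtain ⟨K, hK, hlf, hcov⟩ := exists_locallyFinite_shrinkable (E := E) (X := X) X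
  obtain ⟨V, hVo, hVc, hVU, hVord⟩ := exists_shrinking hK hlf hcov ho fun x => ⟨x, hU x⟩
  obtain ⟨ρ, hρ⟩ := PartitionOfUnity.exists_isSubordinate isClosed_univ V hVo
    (fun x _ => Set.mem_iUnion.2 (hVc x))
  set D := Besicovitch.multiplicity E with hD
  let W : Finset X → Set X := fun F => {x | F.Nonempty ∧ ∀ i ∈ F, 0 < ρ i x ∧ ∀ j ∉ F, ρ j x < ρ i x}
  have hWV : ∀ F i x, i ∈ F → x ∈ W F → x ∈ V i := by
    intro F i x hi hx
    exact hρ i (subset_closure (by simpa using (hx.2 i hi).1.ne'))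
  have hWo : ∀ F, IsOpen (W F) := by
    intro F
    rw [isOpen_iff_mem_nhds]
    intro x hx
    obtain ⟨O, hO, hfin⟩ := ρ.locallyFinite x
    have h1 : ∀ᶠ z in 𝓝 x, ∀ i ∈ F, 0 < ρ i z := (Finset.eventually_all F).2 fun i hi =>
      (ρ i).continuous.continuousAt.eventually (lt_mem_nhds (hx.2 i hi).1)
    have h2 : ∀ᶠ z in 𝓝 x, ∀ i ∈ F, ∀ j ∈ hfin.toFinset, j ∉ F → ρ j z < ρ i z := by
      refine (Finset.eventually_all F).2 fun i hi => (Finset.eventually_all _).2 fun j _ => ?_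
      by_cases hj : j ∈ F
      · exact Filter.Eventually.of_forall fun _ h => absurd hj h
      · filter_upwards [(ρ j).continuous.continuousAt.eventually_lt (ρ i).continuous.continuousAt
          ((hx.2 i hi).2 j hj)] with z hz _ using hz
    filter_upwards [h1, h2, hO] with z hz1 hz2 hzO
    refine ⟨hx.1, fun i hi => ⟨hz1 i hi, fun j hj => ?_⟩⟩
    by_cases hj2 : ρ j z = 0
    · rw [hj2]; exact hz1 i hi
    · exact hz2 i hi j (hfin.mem_toFinset.2 ⟨z, by simpa using hj2, hzO⟩) hj
  -- Different sets of equal size each contain an index missing from the other, and the two values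
  -- of `ρ` would each exceed the other.
  have hWdisj : ∀ F F' : Finset X, F.card = F'.card → ∀ x, x ∈ W F → x ∈ W F' → F = F' := by
    intro F F' hc x hx hx'
    by_contra hne
    have h1 : ¬ F ⊆ F' := fun h => hne (Finset.eq_of_subset_of_card_le h hc.ge)
    have h2 : ¬ F' ⊆ F := fun h => hne (Finset.eq_of_subset_of_card_le h hc.le).symm
    obtain ⟨i, hi, hi'⟩ := Finset.not_subset.1 h1
    obtain ⟨j, hj, hj'⟩ := Finset.not_subset.1 h2
    exact lt_asymm ((hx.2 i hi).2 j hj') ((hx'.2 j hj).2 i hi')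
  let O : Fin (D + 1) → Set X := fun c => ⋃ F ∈ {F : Finset X | F.card = c}, W F
  have hOo : ∀ c, IsOpen (O c) := fun c => isOpen_biUnion fun F _ => hWo F
  -- The set of all indices with `ρ i x ≠ 0` qualifies, and the bound on the order keeps its
  -- cardinality among the colours `0, …, D`.
  have hOc : ∀ x, ∃ c, x ∈ O c := by
    intro x
    have hfin := ρ.finite_tsupport x
    have hfin2 : {i | ρ i x ≠ 0}.Finite := hfin.subset fun i hi =>
      subset_closure (by simpa using hi)
    let F := hfin2.toFinset
    have hF : ∀ i ∈ F, x ∈ V i := fun i hi =>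
      hρ i (subset_closure (by simpa [F] using hi))
    have hFc := hVord x F hF
    refine ⟨⟨F.card, by omega⟩, Set.mem_iUnion₂.2 ⟨F, rfl, ?_, fun i hi => ?_⟩⟩
    · by_contra hne
      have h0 : ∀ i, ρ i x = 0 := fun i => by
        by_contra h
        exact hne ⟨i, by simpa [F] using h⟩
      have := ρ.sum_eq_one (Set.mem_univ x)
      simp [h0] at this
    · have hpos : 0 < ρ i x := lt_of_le_of_ne (ρ.nonneg i x) (Ne.symm (by simpa [F] using hi))
      refine ⟨hpos, fun j hj => ?_⟩
      have : ρ j x = 0 := by simpa [F] using hj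
      rw [this]; exact hpos
  obtain ⟨f, hf⟩ := SmoothPartitionOfUnity.exists_isSubordinate 𝓘(ℝ, E) isClosed_univ O hOo
    (fun x _ => Set.mem_iUnion.2 (hOc x))
  classical
  have hpt : ∀ (c : Fin (D + 1)) (x : X), ∃ z : X, ∀ F : Finset X, F.card = c → x ∈ W F →
      ∃ h : F.Nonempty, z = h.choose := by
    intro c x
    by_cases h : ∃ F : Finset X, F.card = c ∧ x ∈ W F
    · obtain ⟨F, hFc, hFx⟩ := h
      refine ⟨hFx.1.choose, fun F' hF'c hF'x => ?_⟩
      have := hWdisj F F' (hFc.trans hF'c.symm) x hFx hF'x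
      subst this
      exact ⟨hFx.1, rfl⟩
    · exact ⟨x, fun F h1 h2 => absurd ⟨F, h1, h2⟩ h⟩
  choose p hp using hpt
  refine ⟨⟨D + 1, fun c => f c, p, fun c => (f c).contMDiff, fun c x => f.nonneg c x, fun x => ?_,
    fun c x₀ => ?_⟩⟩
  · rw [← finsum_eq_sum_of_fintype]
    exact f.sum_eq_one (Set.mem_univ x)
  · by_cases hx : x₀ ∈ tsupport (f c)
    · right
      obtain ⟨F, hF, hx₀⟩ := Set.mem_iUnion₂.1 (hf c hx)
      filter_upwards [(hWo F).mem_nhds hx₀] with x hxF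
      obtain ⟨h1, h2⟩ := hp c x F hF hxF
      obtain ⟨h3, h4⟩ := hp c x₀ F hF hx₀
      have h5 : p c x = p c x₀ := by rw [h2, h4]
      refine ⟨h5, ?_⟩
      rw [h4]
      exact hVU _ (hWV F _ x h3.choose_spec hxF)
    · left
      filter_upwards [(isClosed_tsupport (f c)).isOpen_compl.mem_nhds hx] with x hx
      exact image_eq_zero_of_notMem_tsupport hx

end Coloured
end

noncomputable section

set_option linter.unusedSectionVars false

/-! ### Algebraic ideals of forms -/

section Ideals

variable {E : Type*} [NormedAddCommGroup E] [NormedSpace ℝ E]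
  {M : Type*} [TopologicalSpace M] [ChartedSpace E M] {k l : ℕ}

/-- Homogeneous ideals of the algebra of smooth forms. -/
structure IsIdealSet (B : FormSet E M) : Prop where
  zero_mem : ∀ k : ℕ, (0 : DForm E M k) ∈ B k
  add_mem : ∀ {k : ℕ} {β η : DForm E M k}, β ∈ B k → η ∈ B k → β + η ∈ B k
  wedge_right : ∀ {k l : ℕ} {β : DForm E M k} {α : DForm E M l},
    β ∈ B k → IsSmoothForm α → formWedge β α ∈ B (k + l)
  wedge_left : ∀ {k l : ℕ} {β : DForm E M k} {α : DForm E M l},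
    β ∈ B k → IsSmoothForm α → formWedge α β ∈ B (l + k)

theorem isIdealSet_algIdeal (A : FormSet E M) : IsIdealSet (algIdeal A) :=
  ⟨AlgGen.zero, AlgGen.add, AlgGen.wedge_right, AlgGen.wedge_left⟩

theorem isIdealSet_diffIdeal (A : FormSet E M) : IsIdealSet (diffIdeal A) :=
  ⟨DiffGen.zero, DiffGen.add, DiffGen.wedge_right, DiffGen.wedge_left⟩

theorem IsEDS.isIdealSet {S : FormSet E M} (h : IsEDS S) : IsIdealSet S :=
  ⟨h.zero_mem, h.add_mem, h.wedge_right, h.wedge_left⟩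

theorem algIdeal_subset {A B : FormSet E M} (hB : IsIdealSet B) (h : ∀ k, A k ⊆ B k) (k : ℕ) :
    algIdeal A k ⊆ B k := by
  intro β hβ
  induction hβ with
  | of h' => exact h _ h'
  | zero k => exact hB.zero_mem k
  | add _ _ h1 h2 => exact hB.add_mem h1 h2
  | wedge_right _ hα h1 => exact hB.wedge_right h1 hα
  | wedge_left _ hα h1 => exact hB.wedge_left h1 hα

theorem diffIdeal_subset {A B : FormSet E M} (hB : IsIdealSet B) (h : ∀ k, A k ⊆ B k)
    (hd : ∀ k β, β ∈ B k → extD β ∈ B (k + 1)) (k : ℕ) : diffIdeal A k ⊆ B k := by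
  intro β hβ
  induction hβ with
  | of h' => exact h _ h'
  | zero k => exact hB.zero_mem k
  | add _ _ h1 h2 => exact hB.add_mem h1 h2
  | wedge_right _ hα h1 => exact hB.wedge_right h1 hα
  | wedge_left _ hα h1 => exact hB.wedge_left h1 hα
  | d _ h1 => exact hd _ _ h1

theorem IsIdealSet.cast_mem {B : FormSet E M} (h : k = l) {β : DForm E M k}
    (hβ : β ∈ B k) : formCast h β ∈ B l := by
  subst h; exact hβ

/-- A function as a form of degree zero. -/
def zeroForm (u : M → ℝ) : DForm E M 0 :=
  fun x => show E [⋀^Fin 0]→L[ℝ] ℝ from ContinuousAlternatingMap.constOfIsEmpty ℝ E (Fin 0) (u x)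

theorem formWedge_zeroForm (u : M → ℝ) (β : DForm E M k) :
    formWedge β (zeroForm u) = formSmul u β := by
  funext x
  exact altWedge_const_right (V := E) (β x) (ContinuousAlternatingMap.constOfIsEmpty ℝ E (Fin 0) (u x))

/-- A field of covectors as a form of degree one. -/
def oneForm (c : M → E →L[ℝ] ℝ) : DForm E M 1 :=
  fun x => show E [⋀^Fin 1]→L[ℝ] ℝ from ContinuousAlternatingMap.ofSubsingleton ℝ E ℝ (0 : Fin 1) (c x)

/-- The exterior product of a field of covectors with a form. -/
def consForm (c : M → E →L[ℝ] ℝ) (β : DForm E M k) : DForm E M (k + 1) :=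
  fun x => consWedge (V := E) (c x) (β x)

theorem consForm_eq (c : M → E →L[ℝ] ℝ) (β : DForm E M k) :
    consForm c β = formCast (add_comm 1 k) (formWedge (oneForm c) β) := by
  funext x
  exact altWedge_ofSubsingleton (V := E) (c x) (β x)

/-- The covector given by a form of degree one. -/
def covector (β : DForm E M 1) (x : M) : E →L[ℝ] ℝ :=
  (ContinuousAlternatingMap.ofSubsingleton ℝ E ℝ (0 : Fin 1)).symm (β x)

theorem oneForm_covector (β : DForm E M 1) : oneForm (covector β) = β := by
  funext x
  exact (ContinuousAlternatingMap.ofSubsingleton ℝ E ℝ (0 : Fin 1)).apply_symm_apply _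

theorem oneForm_apply (c : M → E →L[ℝ] ℝ) (x : M) (v : Fin 1 → E) : oneForm c x v = c x (v 0) := rfl

theorem form_one_ext {β η : DForm E M 1} {x : M}
    (h : ∀ v : E, β x (fun _ => v) = η x (fun _ => v)) : β x = η x := by
  ext v
  have : v = fun _ => v 0 := by funext i; rw [Subsingleton.elim i 0]
  rw [this]
  exact h _

section Smooth

variable [FiniteDimensional ℝ E]

theorem smoothFormAt_zeroForm {u : M → ℝ} {x₀ : M} (hu : ContMDiffAt 𝓘(ℝ, E) 𝓘(ℝ, ℝ) ∞ u x₀) :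
    SmoothFormAt (zeroForm (E := E) u) x₀ := by
  have h2 := (contMDiffAt_iff.1 hu).2
  simp only [mfld_simps, contDiffWithinAt_univ] at h2
  have h4 : ContDiffAt ℝ ∞ (fun y => u ((extChartAt 𝓘(ℝ, E) x₀).symm y))
    (extChartAt 𝓘(ℝ, E) x₀ x₀) := h2
  refine contDiffAt_alternating_iff.2 fun v => h4.congr_of_eventuallyEq ?_
  exact Filter.Eventually.of_forall fun y => rfl

variable [IsManifold 𝓘(ℝ, E) ∞ M]

theorem isSmoothForm_zeroForm {u : M → ℝ} (hu : ContMDiff 𝓘(ℝ, E) 𝓘(ℝ, ℝ) ∞ u) :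
    IsSmoothForm (zeroForm (E := E) u) :=
  isSmoothForm_iff.2 fun _ => smoothFormAt_zeroForm hu.contMDiffAt

theorem IsSmoothForm.add {β η : DForm E M k} (hβ : IsSmoothForm β) (hη : IsSmoothForm η) :
    IsSmoothForm (β + η) :=
  isSmoothForm_iff.2 fun x => (isSmoothForm_iff.1 hβ x).add (isSmoothForm_iff.1 hη x)

theorem IsSmoothForm.wedge {β : DForm E M k} {η : DForm E M l} (hβ : IsSmoothForm β)
    (hη : IsSmoothForm η) : IsSmoothForm (formWedge β η) :=
  isSmoothForm_iff.2 fun x => (isSmoothForm_iff.1 hβ x).wedge (isSmoothForm_iff.1 hη x)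

theorem IsSmoothForm.smul {β : DForm E M k} {u : M → ℝ} (hu : ContMDiff 𝓘(ℝ, E) 𝓘(ℝ, ℝ) ∞ u)
    (hβ : IsSmoothForm β) : IsSmoothForm (formSmul u β) :=
  isSmoothForm_iff.2 fun x => (isSmoothForm_iff.1 hβ x).smul hu.contMDiffAt

theorem IsSmoothForm.extD {β : DForm E M k} (hβ : IsSmoothForm β) : IsSmoothForm (extD β) :=
  isSmoothForm_iff.2 fun _ => SmoothFormAt.extD (Filter.Eventually.of_forall (isSmoothForm_iff.1 hβ))

theorem isSmoothForm_zero : IsSmoothForm (0 : DForm E M k) :=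
  isSmoothForm_iff.2 smoothFormAt_zero

namespace IsIdealSet

variable {B : FormSet E M}


theorem smul_mem (hB : IsIdealSet B) {u : M → ℝ} (hu : ContMDiff 𝓘(ℝ, E) 𝓘(ℝ, ℝ) ∞ u) {β : DForm E M k}
    (hβ : β ∈ B k) : formSmul u β ∈ B k := by
  rw [← formWedge_zeroForm]
  exact hB.wedge_right hβ (isSmoothForm_zeroForm hu)

theorem neg_mem (hB : IsIdealSet B) {β : DForm E M k} (hβ : β ∈ B k) : -β ∈ B k := by
  have h : -β = formSmul (fun _ => -1) β := by
    funext x; exact (neg_one_smul ℝ (β x)).symm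
  rw [h]; exact hB.smul_mem contMDiff_const hβ

theorem sub_mem (hB : IsIdealSet B) {β η : DForm E M k} (hβ : β ∈ B k) (hη : η ∈ B k) : β - η ∈ B k := by
  rw [sub_eq_add_neg]; exact hB.add_mem hβ (hB.neg_mem hη)

theorem sum_mem (hB : IsIdealSet B) {ι : Type*} (s : Finset ι) {β : ι → DForm E M k}
    (h : ∀ i ∈ s, β i ∈ B k) : ∑ i ∈ s, β i ∈ B k := by
  classical
  induction s using Finset.induction_on with
  | empty => simpa using hB.zero_mem k
  | insert a s ha ih =>
    rw [Finset.sum_insert ha]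
    exact hB.add_mem (h a (Finset.mem_insert_self a s))
      (ih fun i hi => h i (Finset.mem_insert_of_mem hi))

theorem consForm_mem_left (hB : IsIdealSet B) {c : M → E →L[ℝ] ℝ} {β : DForm E M k} (hc : oneForm c ∈ B 1)
    (hβ : IsSmoothForm β) : consForm c β ∈ B (k + 1) := by
  rw [consForm_eq]
  exact cast_mem _ (hB.wedge_right hc hβ)

theorem consForm_mem_right (hB : IsIdealSet B) {c : M → E →L[ℝ] ℝ} {β : DForm E M k} (hc : IsSmoothForm (oneForm c))
    (hβ : β ∈ B k) : consForm c β ∈ B (k + 1) := by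
  rw [consForm_eq]
  exact cast_mem _ (hB.wedge_left hβ hc)

/-- Membership can be checked after multiplication by functions without common zeros. -/
theorem mem_of_weights (hB : IsIdealSet B) {ι : Type*} [Fintype ι] {u : ι → M → ℝ}
    (hu : ∀ i, ContMDiff 𝓘(ℝ, E) 𝓘(ℝ, ℝ) ∞ (u i)) (h0 : ∀ x, ∑ i, u i x ≠ 0) {β : DForm E M k}
    (h : ∀ i, formSmul (u i) β ∈ B k) : β ∈ B k := by
  have hs : ContMDiff 𝓘(ℝ, E) 𝓘(ℝ, ℝ) ∞ (fun x => (∑ i, u i x)⁻¹) := by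
    refine ContMDiff.inv₀ ?_ h0
    exact contMDiff_finsetSum fun i _ => hu i
  have h1 : β = formSmul (fun x => (∑ i, u i x)⁻¹) (∑ i, formSmul (u i) β) := by
    funext x
    have h2 : (∑ i, formSmul (u i) β) x = (∑ i, u i x) • β x := by
      rw [Finset.sum_apply, Finset.sum_smul]; rfl
    change β x = (∑ i, u i x)⁻¹ • ((∑ i, formSmul (u i) β) x)
    rw [h2, smul_smul, inv_mul_cancel₀ (h0 x), one_smul]
  rw [h1]
  exact hB.smul_mem hs (hB.sum_mem _ fun i _ => h i)

/-- The functions `C.b c` are nonnegative with sum one, so their `n`-th powers have no common zero.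
Powers are admitted because a product of glued forms picks up one cutoff for each factor. -/
theorem mem_of_colouring (hB : IsIdealSet B) {U : M → Set M} (C : Colouring (E := E) U) {n : ℕ} {β : DForm E M k}
    (h : ∀ c, formSmul (fun x => C.b c x ^ n) β ∈ B k) : β ∈ B k := by
  refine hB.mem_of_weights (u := fun c x => C.b c x ^ n) (fun c => (C.smooth c).pow n)
    (fun x => ?_) h
  have h1 : ∃ c ∈ Finset.univ, 0 < C.b c x := by
    by_contra hne
    push Not at hne
    have := Finset.sum_nonpos hne
    rw [C.sum_eq_one] at this
    linarith
  obtain ⟨c, hc, hc2⟩ := h1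
  exact (Finset.sum_pos' (fun i _ => pow_nonneg (C.nonneg i x) n) ⟨c, hc, pow_pos hc2 n⟩).ne'

end IsIdealSet

theorem formSmul_formSmul (u v : M → ℝ) (β : DForm E M k) :
    formSmul u (formSmul v β) = formSmul (fun x => u x * v x) β := by
  funext x; exact smul_smul (u x) (v x) (β x)

theorem formSmul_add (u : M → ℝ) (β η : DForm E M k) :
    formSmul u (β + η) = formSmul u β + formSmul u η := by
  funext x; exact smul_add (u x) (β x) (η x)

/-- The exterior derivative preserves an algebraic ideal if it does so on generators. -/
theorem extD_mem_algIdeal {A : FormSet E M} (hA : ∀ k β, β ∈ A k → IsSmoothForm β)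
    (hd : ∀ k β, β ∈ A k → extD β ∈ algIdeal A (k + 1)) {β : DForm E M k} (hβ : β ∈ algIdeal A k) :
    IsSmoothForm β ∧ extD β ∈ algIdeal A (k + 1) := by
  have hI := isIdealSet_algIdeal A
  induction hβ with
  | of h => exact ⟨hA _ _ h, hd _ _ h⟩
  | zero k =>
    refine ⟨isSmoothForm_zero, ?_⟩
    have : extD (0 : DForm E M k) = 0 := by
      funext x; exact extD_zero_form (Filter.Eventually.of_forall fun _ => rfl)
    rw [this]; exact hI.zero_mem _
  | @add k β η _ _ h1 h2 =>
    refine ⟨h1.1.add h2.1, ?_⟩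
    have : extD (β + η) = extD β + extD η := by
      funext x; exact extD_add (isSmoothForm_iff.1 h1.1 x) (isSmoothForm_iff.1 h2.1 x)
    rw [this]; exact hI.add_mem h1.2 h2.2
  | @wedge_right k l β α hβ hα h1 =>
    refine ⟨h1.1.wedge hα, ?_⟩
    have : extD (formWedge β α) = formCast (by omega : k + 1 + l = k + l + 1)
        (formWedge (extD β) α) + formSmul (fun _ => (-1 : ℝ) ^ k) (formWedge β (extD α)) := by
      funext x; exact extD_wedge (isSmoothForm_iff.1 h1.1 x) (isSmoothForm_iff.1 hα x)
    rw [this]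
    exact hI.add_mem (IsIdealSet.cast_mem _ (hI.wedge_right h1.2 hα))
      (hI.smul_mem contMDiff_const (hI.wedge_right (l := l + 1) hβ hα.extD))
  | @wedge_left k l β α hβ hα h1 =>
    refine ⟨hα.wedge h1.1, ?_⟩
    have : extD (formWedge α β) = formCast (by omega : l + 1 + k = l + k + 1)
        (formWedge (extD α) β) + formSmul (fun _ => (-1 : ℝ) ^ l) (formWedge α (extD β)) := by
      funext x; exact extD_wedge (isSmoothForm_iff.1 hα x) (isSmoothForm_iff.1 h1.1 x)
    rw [this]
    exact hI.add_mem (IsIdealSet.cast_mem _ (hI.wedge_left hβ hα.extD))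
      (hI.smul_mem contMDiff_const (hI.wedge_left (k := k + 1) h1.2 hα))

end Smooth

end Ideals
end

noncomputable section

set_option linter.unusedSectionVars false

/-! ### Spans of alternating forms under linear substitutions -/

section Pointwise

variable {V : Type*} [NormedAddCommGroup V] [NormedSpace ℝ V] {V' : Type*} [NormedAddCommGroup V']
  [NormedSpace ℝ V'] {k : ℕ}

theorem finiteDimensional_alternating [FiniteDimensional ℝ V] :
    FiniteDimensional ℝ (V [⋀^Fin k]→L[ℝ] ℝ) := by
  have h : Function.Injective ((AlternatingMap.toMultilinearMapLM (S := ℝ)).comp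
      (ContinuousAlternatingMap.toAlternatingMapLinear (R := ℝ) (A := ℝ) (M := V) (N := ℝ)
        (ι := Fin k))) :=
    AlternatingMap.coe_multilinearMap_injective.comp
      ContinuousAlternatingMap.toAlternatingMap_injective
  exact FiniteDimensional.of_injective _ h

theorem span_compContinuousLinearMap {ι : Type*} (s : ι → V [⋀^Fin k]→L[ℝ] ℝ) (B : V' →L[ℝ] V) :
    Submodule.span ℝ (Set.range fun i => (s i).compContinuousLinearMap B) =
      (Submodule.span ℝ (Set.range s)).map
        (ContinuousAlternatingMap.compContinuousLinearMapCLM (𝕜 := ℝ) (F := ℝ) (ι := Fin k) B :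
          (V [⋀^Fin k]→L[ℝ] ℝ) →ₗ[ℝ] (V' [⋀^Fin k]→L[ℝ] ℝ)) := by
  rw [Submodule.map_span, ← Set.range_comp]
  rfl

theorem finrank_span_compContinuousLinearMap {ι : Type*} (s : ι → V [⋀^Fin k]→L[ℝ] ℝ)
    {B : V' →L[ℝ] V} (hB : Function.Surjective B) :
    Module.finrank ℝ (Submodule.span ℝ (Set.range fun i => (s i).compContinuousLinearMap B)) =
      Module.finrank ℝ (Submodule.span ℝ (Set.range s)) := by
  rw [span_compContinuousLinearMap]
  refine (LinearEquiv.finrank_eq (Submodule.equivMapOfInjective _ ?_ _)).symm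
  intro a b hab
  ext v
  choose w hw using fun i => hB (v i)
  have h3 := congrArg (fun c : V' [⋀^Fin k]→L[ℝ] ℝ => c w) hab
  have h4 : a (fun i => B (w i)) = b (fun i => B (w i)) := h3
  simpa only [hw] using h4

theorem mem_span_compContinuousLinearMap {ι : Type*} {s : ι → V [⋀^Fin k]→L[ℝ] ℝ}
    {b : V [⋀^Fin k]→L[ℝ] ℝ} (h : b ∈ Submodule.span ℝ (Set.range s)) (B : V' →L[ℝ] V) :
    b.compContinuousLinearMap B ∈
      Submodule.span ℝ (Set.range fun i => (s i).compContinuousLinearMap B) := by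
  rw [span_compContinuousLinearMap]
  exact Submodule.mem_map_of_mem h

theorem sum_compContinuousLinearMap {ι : Type*} (t : Finset ι) (c : ι → ℝ)
    (s : ι → V [⋀^Fin k]→L[ℝ] ℝ) (B : V' →L[ℝ] V) :
    (∑ i ∈ t, c i • s i).compContinuousLinearMap B =
      ∑ i ∈ t, c i • (s i).compContinuousLinearMap B := by
  ext v
  simp only [ContinuousAlternatingMap.compContinuousLinearMap_apply]
  rw [ContinuousAlternatingMap.sum_apply, ContinuousAlternatingMap.sum_apply]
  rfl

end Pointwise

/-! ### Gluing by coloured partitions of unity -/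

section Gluing

variable {E : Type*} [NormedAddCommGroup E] [NormedSpace ℝ E] [FiniteDimensional ℝ E]
  {M : Type*} [TopologicalSpace M] [ChartedSpace E M] [IsManifold 𝓘(ℝ, E) ∞ M]
  {W : Type*} [NormedAddCommGroup W] [NormedSpace ℝ W]
  {U : M → Set M} {k : ℕ}

namespace Colouring

theorem zero_or_mem (C : Colouring (E := E) U) (c : Fin C.num) (x₀ : M) :
    (∀ᶠ x in 𝓝 x₀, C.b c x = 0) ∨ (x₀ ∈ U (C.p c x₀) ∧ ∀ᶠ x in 𝓝 x₀, C.p c x = C.p c x₀) :=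
  (C.loc c x₀).imp id fun h => ⟨h.self_of_nhds.2, h.mono fun _ hx => hx.1⟩

theorem zero_or_mem' (C : Colouring (E := E) U) (c : Fin C.num) (x : M) :
    C.b c x = 0 ∨ x ∈ U (C.p c x) :=
  (C.zero_or_mem c x).imp (fun h => h.self_of_nhds) fun h => h.1

/-- The form equal to `b_c β_z` where `p_c = z`. -/
def glueForm (C : Colouring (E := E) U) (c : Fin C.num) (β : M → DForm E M k) : DForm E M k :=
  fun x => C.b c x • β (C.p c x) x

theorem isSmoothForm_glueForm (C : Colouring (E := E) U) (c : Fin C.num) {β : M → DForm E M k}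
    (h : ∀ z, ∀ x ∈ U z, SmoothFormAt (β z) x) : IsSmoothForm (C.glueForm c β) := by
  refine isSmoothForm_iff.2 fun x₀ => ?_
  rcases C.zero_or_mem c x₀ with h0 | ⟨h1, h2⟩
  · refine (smoothFormAt_zero x₀).congr ?_
    filter_upwards [h0] with x hx
    simp only [glueForm, hx, zero_smul]
    rfl
  · refine ((h _ _ h1).smul ((C.smooth c) x₀)).congr ?_
    filter_upwards [h2] with x hx
    simp only [glueForm, hx]
    rfl

/-- The function equal to `b_c u_z` where `p_c = z`. -/
def glueFun (C : Colouring (E := E) U) (c : Fin C.num) (u : M → M → W) : M → W :=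
  fun x => C.b c x • u (C.p c x) x

theorem contMDiff_glueFun (C : Colouring (E := E) U) (c : Fin C.num) {u : M → M → W}
    (h : ∀ z, ∀ x ∈ U z, ContMDiffAt 𝓘(ℝ, E) 𝓘(ℝ, W) ∞ (u z) x) :
    ContMDiff 𝓘(ℝ, E) 𝓘(ℝ, W) ∞ (C.glueFun c u) := by
  intro x₀
  rcases C.zero_or_mem c x₀ with h0 | ⟨h1, h2⟩
  · refine (contMDiffAt_const (c := 0)).congr_of_eventuallyEq ?_
    filter_upwards [h0] with x hx
    simp only [glueFun, hx, zero_smul]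
  · refine (((C.smooth c) x₀).smul (h _ _ h1)).congr_of_eventuallyEq ?_
    filter_upwards [h2] with x hx
    simp only [glueFun, hx]
    rfl

/-- The field of endomorphisms equal to `b_c A_z` where `p_c = z`. -/
def glueField (C : Colouring (E := E) U) (c : Fin C.num) (A : M → M → E →L[ℝ] E) :
    M → E →L[ℝ] E := fun x => C.b c x • A (C.p c x) x

theorem smoothFieldAt_glueField (C : Colouring (E := E) U) (c : Fin C.num)
    {A : M → M → E →L[ℝ] E} (h : ∀ z, ∀ x ∈ U z, SmoothFieldAt (fun x => x) (A z) x) (x₀ : M) :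
    SmoothFieldAt (fun x => x) (C.glueField c A) x₀ := by
  rcases C.zero_or_mem c x₀ with h0 | ⟨h1, h2⟩
  · refine (smoothFieldAt_zero (φ := fun x : M => x)
      (Filter.Eventually.of_forall fun x => contMDiffAt_id)).congr
      (Filter.Eventually.of_forall fun _ => rfl) ?_
    filter_upwards [h0] with x hx
    simp only [glueField, hx, zero_smul]
  · refine ((h _ _ h1).smul ((C.smooth c) x₀)).congr (Filter.Eventually.of_forall fun _ => rfl) ?_
    filter_upwards [h2] with x hx
    simp only [glueField, hx]

end Colouring

theorem SmoothFieldAt.sum {ι : Type*} (s : Finset ι) {A : ι → M → E →L[ℝ] E} {x₀ : M}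
    (h : ∀ i ∈ s, SmoothFieldAt (fun x => x) (A i) x₀) :
    SmoothFieldAt (fun x => x) (fun x => ∑ i ∈ s, A i x) x₀ := by
  classical
  induction s using Finset.induction_on with
  | empty =>
    simpa using smoothFieldAt_zero (φ := fun x : M => x)
      (Filter.Eventually.of_forall fun x => contMDiffAt_id)
  | insert a s ha ih =>
    simp only [Finset.sum_insert ha]
    exact (h a (Finset.mem_insert_self a s)).add (ih fun i hi => h i (Finset.mem_insert_of_mem hi))

variable [T2Space M]

theorem exists_isSmoothForm_eventuallyEq {β : DForm E M k} {x₀ : M}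
    (h : ∀ᶠ x in 𝓝 x₀, SmoothFormAt β x) : ∃ u : M → ℝ, ContMDiff 𝓘(ℝ, E) 𝓘(ℝ, ℝ) ∞ u ∧
      (∀ᶠ x in 𝓝 x₀, u x = 1) ∧ IsSmoothForm (formSmul u β) := by
  obtain ⟨f, hf⟩ := ((SmoothBumpFunction.nhds_basis_tsupport (I := 𝓘(ℝ, E)) x₀).mem_iff.1 h)
  refine ⟨f, f.contMDiff, f.eventuallyEq_one, isSmoothForm_iff.2 fun x => ?_⟩
  by_cases hx : x ∈ tsupport f
  · exact (hf.2 hx).smul f.contMDiff.contMDiffAt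
  · refine (smoothFormAt_zero x).congr ?_
    filter_upwards [(isClosed_tsupport f).isOpen_compl.mem_nhds hx] with z hz
    simp only [formSmul, image_eq_zero_of_notMem_tsupport hz, zero_smul]
    rfl

/-- Every covector extends to a smooth form. -/
theorem exists_isSmoothForm_apply_eq (x₀ : M) (a : E →L[ℝ] ℝ) :
    ∃ β : DForm E M 1, IsSmoothForm β ∧ ∀ v : E, β x₀ (fun _ => v) = a v := by
  let c : E →L[ℝ] ℝ := a.comp (chartDSymm x₀ (extChartAt 𝓘(ℝ, E) x₀ x₀))
  let γ : DForm E E 1 := fun _ => ContinuousAlternatingMap.ofSubsingleton ℝ E ℝ (0 : Fin 1) c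
  have h : ∀ᶠ x in 𝓝 x₀, SmoothFormAt (formPullback (extChartAt 𝓘(ℝ, E) x₀) γ : DForm E M 1) x := by
    filter_upwards [(eventually_contMDiffAt_extChartAt (E := E) x₀).eventually_nhds] with x hx
    exact SmoothFormAt.pullback hx (smoothFormAt_self.2 contDiffAt_const)
  obtain ⟨u, hu, hu1, hs⟩ := exists_isSmoothForm_eventuallyEq h
  refine ⟨_, hs, fun v => ?_⟩
  have h1 := chartDSymm_comp_chartD (mem_extChartAt_source (I := 𝓘(ℝ, E)) x₀)
  have h2 : chartDSymm x₀ (extChartAt 𝓘(ℝ, E) x₀ x₀) (chartD x₀ x₀ v) = v :=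
    congrArg (fun L : E →L[ℝ] E => L v) h1
  change u x₀ • a (chartDSymm x₀ (extChartAt 𝓘(ℝ, E) x₀ x₀) (chartD x₀ x₀ v)) = a v
  rw [hu1.self_of_nhds, h2, one_smul]

variable [SigmaCompactSpace M]

/-- A colouring refining a property which holds near each point. -/
theorem exists_colouring_of_eventually {p : M → M → Prop} (h : ∀ z, ∀ᶠ x in 𝓝 z, p z x) :
    ∃ (U : M → Set M) (_ : Colouring (E := E) U), ∀ z, ∀ x ∈ U z, p z x := by
  have h1 : ∀ z, ∃ O : Set M, IsOpen O ∧ z ∈ O ∧ ∀ x ∈ O, p z x := fun z => by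
    obtain ⟨O, h1, h2, h3⟩ := mem_nhds_iff.1 (h z)
    exact ⟨O, h2, h3, fun x hx => h1 hx⟩
  choose U hUo hU hp using h1
  obtain ⟨C⟩ := exists_colouring (E := E) U hUo hU
  exact ⟨U, C, hp⟩

/-- A form with locally smooth coefficients in terms of a finite family has smooth coefficients. -/
theorem exists_coeff_of_local {ι : Type*} {σ : ι → DForm E M k} {β : DForm E M k} [Fintype ι]
    (h : ∀ z, ∃ u : ι → M → ℝ, ∀ᶠ x in 𝓝 z, (∀ i, ContMDiffAt 𝓘(ℝ, E) 𝓘(ℝ, ℝ) ∞ (u i) x) ∧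
      β x = ∑ i, u i x • σ i x) :
    ∃ u : ι → M → ℝ, (∀ i, ContMDiff 𝓘(ℝ, E) 𝓘(ℝ, ℝ) ∞ (u i)) ∧
      β = ∑ i, formSmul (u i) (σ i) := by
  choose u hu using h
  obtain ⟨U, C, hU⟩ := exists_colouring_of_eventually (E := E) hu
  refine ⟨fun i x => ∑ c, C.glueFun c (fun z => u z i) x, fun i => ?_, ?_⟩
  · exact contMDiff_finsetSum fun c _ => C.contMDiff_glueFun c fun z x hx => (hU z x hx).1 i
  · funext x
    have h1 : ∀ c, C.b c x • β x = ∑ i, (C.glueFun c (fun z => u z i) x) • σ i x := by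
      intro c
      rcases C.zero_or_mem' c x with h0 | h0
      · simp [Colouring.glueFun, h0]
      · rw [(hU _ _ h0).2, Finset.smul_sum]
        refine Finset.sum_congr rfl fun i _ => ?_
        rw [smul_smul]; rfl
    calc β x = ∑ c, C.b c x • β x := by rw [← Finset.sum_smul, C.sum_eq_one, one_smul]
      _ = ∑ c, ∑ i, (C.glueFun c (fun z => u z i) x) • σ i x := Finset.sum_congr rfl fun c _ => h1 c
      _ = ∑ i, ∑ c, (C.glueFun c (fun z => u z i) x) • σ i x := Finset.sum_comm
      _ = (∑ i, formSmul (fun x => ∑ c, C.glueFun c (fun z => u z i) x) (σ i)) x := by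
        rw [Finset.sum_apply]
        refine Finset.sum_congr rfl fun i _ => ?_
        rw [← Finset.sum_smul]; rfl

/-- The local version of `exists_coeff_of_finrank`. -/
theorem exists_local_coeff_of_finrank {ι : Type*} [Fintype ι] {σ : ι → DForm E M k}
    {β : DForm E M k} {z : M} (hσ : ∀ᶠ x in 𝓝 z, ∀ i, SmoothFormAt (σ i) x)
    (hβ : ∀ᶠ x in 𝓝 z, SmoothFormAt β x) {r : ℕ}
    (hr : ∀ᶠ x in 𝓝 z, Module.finrank ℝ (Submodule.span ℝ (Set.range fun i => σ i x)) = r)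
    (hspan : ∀ᶠ x in 𝓝 z, β x ∈ Submodule.span ℝ (Set.range fun i => σ i x)) :
    ∃ u : ι → M → ℝ, ∀ᶠ x in 𝓝 z, (∀ i, ContMDiffAt 𝓘(ℝ, E) 𝓘(ℝ, ℝ) ∞ (u i) x) ∧
      β x = ∑ i, u i x • σ i x := by
  set e := extChartAt 𝓘(ℝ, E) z with he
  have hsurj : ∀ y ∈ e.target, Function.Surjective (chartDSymm z y) := by
    intro y hy v
    have h1 := chartDSymm_comp_chartD (e.map_target hy)
    rw [e.right_inv hy] at h1
    exact ⟨chartD z (e.symm y) v, congrArg (fun L : E →L[ℝ] E => L v) h1⟩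
  have := finiteDimensional_alternating (V := E) (k := k)
  obtain ⟨c, hc⟩ := exists_contDiffAt_coeff_of_finrank (t := fun i => localRep z (σ i))
    (w := localRep z β) (x₀ := e z) (r := r)
    ((eventually_chart_iff hσ).mono fun y hy i => contDiffAt_localRep hy.1 (hy.2 i))
    ((eventually_chart_iff hβ).mono fun y hy => contDiffAt_localRep hy.1 hy.2)
    ((eventually_chart_iff hr).mono fun y hy =>
      (finrank_span_compContinuousLinearMap (V := E) (V' := E) (fun i => σ i (e.symm y))
        (hsurj y hy.1)).trans hy.2)
    ((eventually_chart_iff hspan).mono fun y hy =>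
      mem_span_compContinuousLinearMap (V := E) (V' := E) (s := fun i => σ i (e.symm y)) hy.2 _)
  refine ⟨fun i x => c i (e x), ?_⟩
  have hcont : Filter.Tendsto e (𝓝 z) (𝓝 (e z)) := continuousAt_extChartAt z
  filter_upwards [hcont.eventually hc, extChartAt_source_mem_nhds (I := 𝓘(ℝ, E)) z] with x hx hxs
  have hxs' : x ∈ (chartAt E z).source := by simpa using hxs
  refine ⟨fun i => ContMDiffAt.comp x (hx.1 i).contMDiffAt (contMDiffAt_extChartAt' hxs'), ?_⟩
  have h1 := eq_localRep hxs β
  rw [hx.2] at h1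
  refine h1.trans ((sum_compContinuousLinearMap _ _ _ _).trans ?_)
  refine Finset.sum_congr rfl fun i _ => ?_
  rw [eq_localRep hxs (σ i)]
  rfl

/-- A smooth form in the span of a finite family of smooth forms of constant rank is a combination
of these forms with smooth coefficients. -/
theorem exists_coeff_of_finrank {ι : Type*} [Fintype ι] {σ : ι → DForm E M k}
    {β : DForm E M k} (hσ : ∀ i, IsSmoothForm (σ i)) (hβ : IsSmoothForm β) {r : ℕ}
    (hr : ∀ x, Module.finrank ℝ (Submodule.span ℝ (Set.range fun i => σ i x)) = r)
    (hspan : ∀ x, β x ∈ Submodule.span ℝ (Set.range fun i => σ i x)) :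
    ∃ u : ι → M → ℝ, (∀ i, ContMDiff 𝓘(ℝ, E) 𝓘(ℝ, ℝ) ∞ (u i)) ∧
      β = ∑ i, formSmul (u i) (σ i) :=
  exists_coeff_of_local fun _ => exists_local_coeff_of_finrank
    (Filter.Eventually.of_forall fun x i => isSmoothForm_iff.1 (hσ i) x)
    (Filter.Eventually.of_forall fun x => isSmoothForm_iff.1 hβ x)
    (Filter.Eventually.of_forall hr) (Filter.Eventually.of_forall hspan)

/-! ### Contractions and global frames -/

/-- The contraction of a form with a vector field. -/
def contract (Y : M → E) (β : DForm E M (k + 1)) : DForm E M k :=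
  fun x => show E [⋀^Fin k]→L[ℝ] ℝ from (show E [⋀^Fin (k + 1)]→L[ℝ] ℝ from β x).curryLeft (Y x)

/-- Smoothness of a vector field at a point. -/
def SmoothVecAt (Y : M → E) (x₀ : M) : Prop :=
  ContDiffAt ℝ ∞ (fun y => chartD x₀ ((extChartAt 𝓘(ℝ, E) x₀).symm y)
    (Y ((extChartAt 𝓘(ℝ, E) x₀).symm y))) (extChartAt 𝓘(ℝ, E) x₀ x₀)

theorem SmoothFormAt.contract {Y : M → E} {β : DForm E M (k + 1)} {x₀ : M}
    (hβ : SmoothFormAt β x₀) (hY : SmoothVecAt Y x₀) : SmoothFormAt (contract Y β) x₀ := by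
  refine contDiffAt_alternating_iff.2 fun v => ?_
  have h1 : ContDiffAt ℝ ∞ (fun y => localRep x₀ β y
      (fun i => Fin.cons (α := fun _ => E → E) (fun y => chartD x₀ ((extChartAt 𝓘(ℝ, E) x₀).symm y)
        (Y ((extChartAt 𝓘(ℝ, E) x₀).symm y))) (fun j _ => v j) i y)) (extChartAt 𝓘(ℝ, E) x₀ x₀) := by
    refine ContDiffAt.alternating_apply hβ fun i => ?_
    refine Fin.cases ?_ (fun j => ?_) i
    · exact hY
    · exact contDiffAt_const
  refine h1.congr_of_eventuallyEq ?_
  filter_upwards [extChartAt_target_mem_nhds (I := 𝓘(ℝ, E)) x₀] with y hy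
  set x := (extChartAt 𝓘(ℝ, E) x₀).symm y with hx
  have h2 := chartDSymm_comp_chartD ((extChartAt 𝓘(ℝ, E) x₀).map_target hy)
  rw [(extChartAt 𝓘(ℝ, E) x₀).right_inv hy] at h2
  have h3 : ∀ w, chartDSymm x₀ y (chartD x₀ x w) = w := fun w =>
    congrArg (fun L : E →L[ℝ] E => L w) h2
  let b : E [⋀^Fin (k + 1)]→L[ℝ] ℝ := β x
  change b (Matrix.vecCons (Y x) (fun j => chartDSymm x₀ y (v j))) =
    b (fun i => chartDSymm x₀ y (Fin.cons (α := fun _ => E → E) (fun y => chartD x₀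
      ((extChartAt 𝓘(ℝ, E) x₀).symm y) (Y ((extChartAt 𝓘(ℝ, E) x₀).symm y))) (fun j _ => v j) i y))
  congr 1
  funext i
  refine Fin.cases ?_ (fun j => ?_) i
  · exact (h3 (Y x)).symm
  · simp

theorem SmoothVecAt.congr {Y Y' : M → E} {x₀ : M} (hY : SmoothVecAt Y x₀)
    (h : ∀ᶠ x in 𝓝 x₀, Y x = Y' x) : SmoothVecAt Y' x₀ := by
  refine ContDiffAt.congr_of_eventuallyEq hY ?_
  filter_upwards [eventually_chart_iff h] with y hy
  rw [hy.2]

theorem SmoothVecAt.smul {Y : M → E} {u : M → ℝ} {x₀ : M} (hY : SmoothVecAt Y x₀)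
    (hu : ContMDiffAt 𝓘(ℝ, E) 𝓘(ℝ, ℝ) ∞ u x₀) : SmoothVecAt (fun x => u x • Y x) x₀ := by
  refine ((contDiffAt_coord hu).smul hY).congr_of_eventuallyEq
    (Filter.Eventually.of_forall fun y => ?_)
  exact map_smul _ _ _

theorem smoothVecAt_zero (x₀ : M) : SmoothVecAt (fun _ : M => (0 : E)) x₀ := by
  unfold SmoothVecAt
  simpa using contDiffAt_const

theorem smoothVecAt_coord {z x₀ : M} (hx : x₀ ∈ (extChartAt 𝓘(ℝ, E) z).source) (w : E) :
    SmoothVecAt (fun x => chartDSymm z (extChartAt 𝓘(ℝ, E) z x) w) x₀ := by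
  have hev : ∀ᶠ y in 𝓝 (extChartAt 𝓘(ℝ, E) z x₀),
      ContMDiffAt 𝓘(ℝ, E) 𝓘(ℝ, E) ∞ (extChartAt 𝓘(ℝ, E) z).symm y := by
    filter_upwards [(isOpen_extChartAt_target z).mem_nhds ((extChartAt 𝓘(ℝ, E) z).map_source hx)]
      with y hy using contMDiffAt_extChartAt_symm hy
  have h1 := (smoothFieldAt_tangentField (E := E) (F := E) hev).field
  have hx' : x₀ ∈ (chartAt E z).source := by simpa using hx
  have h2 : ContDiffAt ℝ ∞ (fun y => extChartAt 𝓘(ℝ, E) z ((extChartAt 𝓘(ℝ, E) x₀).symm y))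
      (extChartAt 𝓘(ℝ, E) x₀ x₀) := contDiffAt_coord (contMDiffAt_extChartAt' hx')
  rw [extChartAt_model_space_eq_id] at h1
  have hs : (extChartAt 𝓘(ℝ, E) x₀).symm (extChartAt 𝓘(ℝ, E) x₀ x₀) = x₀ :=
    (extChartAt 𝓘(ℝ, E) x₀).left_inv (mem_extChartAt_source x₀)
  have h3 := (ContDiffAt.comp (g := coordMap (E := E) (F := E) (extChartAt 𝓘(ℝ, E) z x₀)
    (extChartAt 𝓘(ℝ, E) z).symm (tangentField (E := E) (F := E) (extChartAt 𝓘(ℝ, E) z).symm))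
    (extChartAt 𝓘(ℝ, E) x₀ x₀) (by simp only [hs]; exact h1) h2).clm_apply
    (contDiffAt_const (c := w))
  refine h3.congr_of_eventuallyEq ?_
  filter_upwards [eventually_chart_iff ((isOpen_extChartAt_source (I := 𝓘(ℝ, E)) z).mem_nhds hx)]
    with y hy
  have h4 : chartDSymm (M := E) (E := E) (extChartAt 𝓘(ℝ, E) z x₀)
      (extChartAt 𝓘(ℝ, E) z ((extChartAt 𝓘(ℝ, E) x₀).symm y)) = ContinuousLinearMap.id ℝ E := by
    unfold chartDSymm
    rw [extChartAt_model_space_eq_id]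
    exact mfderiv_id
  simp only [Function.comp_apply, coordMap, ContinuousLinearMap.comp_apply, h4,
    extChartAt_model_space_eq_id, PartialEquiv.refl_symm, PartialEquiv.refl_coe, id,
    ContinuousLinearMap.id_apply]
  rw [(extChartAt 𝓘(ℝ, E) z).left_inv hy.2, (extChartAt 𝓘(ℝ, E) z).left_inv hx]
  rfl

theorem smoothFormAt_coord {z x₀ : M} (hx : x₀ ∈ (extChartAt 𝓘(ℝ, E) z).source) (a : E →L[ℝ] ℝ) :
    SmoothFormAt (oneForm fun x : M => a.comp (chartD z x)) x₀ := by
  let γ : DForm E E 1 := oneForm fun _ => a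
  have h : SmoothFormAt (formPullback (extChartAt 𝓘(ℝ, E) z) γ : DForm E M 1) x₀ := by
    refine SmoothFormAt.pullback ?_ (smoothFormAt_self.2 contDiffAt_const)
    filter_upwards [(isOpen_extChartAt_source z).mem_nhds hx] with x hx
    exact contMDiffAt_extChartAt' (by simpa using hx)
  exact h

theorem formSmul_oneForm (u : M → ℝ) (c : M → E →L[ℝ] ℝ) :
    formSmul u (oneForm c) = oneForm fun x => u x • c x := rfl

/-- Coordinate covectors and coordinate vector fields of the charts, each multiplied by the cutoff
of its colour, satisfy the duality relation up to the nowhere vanishing factor `∑ C.b c ^ 2`, which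
is divided out. The family is redundant in general, so no parallelizability is needed. -/
theorem exists_global_frame : ∃ (ι : Type) (_ : Fintype ι) (c : ι → M → E →L[ℝ] ℝ)
    (Y : ι → M → E), (∀ i, IsSmoothForm (oneForm (c i))) ∧ (∀ i x, SmoothVecAt (Y i) x) ∧
      ∀ x v, ∑ i, c i x v • Y i x = v := by
  obtain ⟨U, C, hU⟩ := exists_colouring_of_eventually (E := E)
    (p := fun z x : M => x ∈ (extChartAt 𝓘(ℝ, E) z).source)
    fun z => extChartAt_source_mem_nhds (I := 𝓘(ℝ, E)) z
  let B := Module.finBasis ℝ E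
  let s : M → ℝ := fun x => (∑ c, C.b c x ^ 2)
  have hs0 : ∀ x, s x ≠ 0 := by
    intro x
    have h1 : ∃ c ∈ Finset.univ, 0 < C.b c x := by
      by_contra hne
      push Not at hne
      have := Finset.sum_nonpos hne
      rw [C.sum_eq_one] at this
      linarith
    obtain ⟨c, hc, hc2⟩ := h1
    exact (Finset.sum_pos' (fun i _ => pow_nonneg (C.nonneg i x) 2) ⟨c, hc, pow_pos hc2 2⟩).ne'
  have hs : ContMDiff 𝓘(ℝ, E) 𝓘(ℝ, ℝ) ∞ (fun x => (s x)⁻¹) :=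
    ContMDiff.inv₀ (contMDiff_finsetSum fun i _ => (C.smooth i).pow 2) hs0
  refine ⟨Fin C.num × Fin (Module.finrank ℝ E), inferInstance,
    fun i x => (s x)⁻¹ • (C.b i.1 x • (B.coord i.2).toContinuousLinearMap.comp (chartD (C.p i.1 x) x)),
    fun i x => C.b i.1 x • chartDSymm (C.p i.1 x) (extChartAt 𝓘(ℝ, E) (C.p i.1 x) x) (B i.2),
    fun i => ?_, fun i x₀ => ?_, fun x v => ?_⟩
  · rw [← formSmul_oneForm]
    refine IsSmoothForm.smul hs ?_
    exact C.isSmoothForm_glueForm i.1 (β := fun z => oneForm fun x =>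
      (B.coord i.2).toContinuousLinearMap.comp (chartD z x)) fun z x hx =>
        smoothFormAt_coord (hU z x hx) _
  · rcases C.zero_or_mem i.1 x₀ with h0 | ⟨h1, h2⟩
    · refine (smoothVecAt_zero x₀).congr ?_
      filter_upwards [h0] with x hx
      simp [hx]
    · refine ((smoothVecAt_coord (hU _ _ h1) (B i.2)).smul ((C.smooth i.1) x₀)).congr ?_
      filter_upwards [h2] with x hx
      rw [hx]
  · have h1 : ∀ c, ∑ j, (C.b c x • (B.coord j) (chartD (C.p c x) x v)) • C.b c x •
        chartDSymm (C.p c x) (extChartAt 𝓘(ℝ, E) (C.p c x) x) (B j) = C.b c x ^ 2 • v := by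
      intro c
      rcases C.zero_or_mem' c x with h0 | h0
      · simp [h0]
      · have h2 := chartDSymm_comp_chartD (hU _ _ h0)
        have h3 : chartDSymm (C.p c x) (extChartAt 𝓘(ℝ, E) (C.p c x) x)
          (chartD (C.p c x) x v) = v := congrArg (fun L : E →L[ℝ] E => L v) h2
        conv_rhs => rw [← h3, ← B.sum_repr (chartD (C.p c x) x v), map_sum, Finset.smul_sum]
        refine Finset.sum_congr rfl fun j _ => ?_
        rw [map_smul, smul_smul, smul_smul, smul_eq_mul, Module.Basis.coord_apply]
        congr 1
        ring
    rw [Fintype.sum_prod_type]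
    have h2 : ∀ c j, (((s x)⁻¹ • (C.b c x • (B.coord j).toContinuousLinearMap.comp
        (chartD (C.p c x) x))) v) • C.b c x •
        chartDSymm (C.p c x) (extChartAt 𝓘(ℝ, E) (C.p c x) x) (B j) =
        (s x)⁻¹ • ((C.b c x • (B.coord j) (chartD (C.p c x) x v)) • C.b c x •
        chartDSymm (C.p c x) (extChartAt 𝓘(ℝ, E) (C.p c x) x) (B j)) := by
      intro c j
      exact smul_assoc (s x)⁻¹ (C.b c x • (B.coord j) (chartD (C.p c x) x v))
        (C.b c x • chartDSymm (C.p c x) (extChartAt 𝓘(ℝ, E) (C.p c x) x) (B j))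
    simp only [h2, ← Finset.smul_sum, h1]
    rw [← Finset.sum_smul, smul_smul, inv_mul_cancel₀ (hs0 x), one_smul]

/-! ### Reduction of forms modulo a splitting -/

theorem bundlePullback_consForm (A : M → E →L[ℝ] E) (c : M → E →L[ℝ] ℝ) (β : DForm E M k) :
    bundlePullback (fun x => x) A (consForm c β) =
      consForm (fun x => (c x).comp (A x)) (bundlePullback (fun x => x) A β) := by
  funext x
  let b : E [⋀^Fin k]→L[ℝ] ℝ := β x
  have : ∀ (a : E →L[ℝ] ℝ) (b : E [⋀^Fin k]→L[ℝ] ℝ) (L : E →L[ℝ] E),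
      (consWedge a b).compContinuousLinearMap L =
        consWedge (a.comp L) (b.compContinuousLinearMap L) := by
    intro a b L
    ext v
    simp [consWedge_apply]
    rfl
  exact this _ b _

/-- If all `b • (θ ∘ Q)` belong to an ideal, then a form differs, after multiplication by a power of
`b`, from its pullback by `1 - Q` by an element of the ideal. -/
theorem sub_bundlePullback_mem {B : FormSet E M} (hB : IsIdealSet B) {b : M → ℝ}
    (hb : ContMDiff 𝓘(ℝ, E) 𝓘(ℝ, ℝ) ∞ b) {Q : M → E →L[ℝ] E}
    (hQ : ∀ x₀, (∀ᶠ x in 𝓝 x₀, b x = 0) ∨ SmoothFieldAt (fun x => x) Q x₀)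
    (hQB : ∀ c : M → E →L[ℝ] ℝ, IsSmoothForm (oneForm c) →
      oneForm (fun x => b x • (c x).comp (Q x)) ∈ B 1) :
    ∀ (k : ℕ) (β : DForm E M k), IsSmoothForm β → formSmul (fun x => b x ^ k)
      (β - bundlePullback (fun x => x) (fun x => ContinuousLinearMap.id ℝ E - Q x) β) ∈ B k := by
  obtain ⟨ι, _, c, Y, hc, hY, hcY⟩ := exists_global_frame (E := E) (M := M)
  intro k
  induction k with
  | zero =>
    intro β _
    have h : (formSmul (fun x => b x ^ 0) (β - bundlePullback (fun x => x)
        (fun x => ContinuousLinearMap.id ℝ E - Q x) β) : DForm E M 0) = 0 := by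
      funext x
      have : β x = bundlePullback (fun x => x) (fun x => ContinuousLinearMap.id ℝ E - Q x) β x := by
        ext v
        exact congrArg (fun w : Fin 0 → E => β x w) (Subsingleton.elim _ _)
      change b x ^ 0 • (β x - _) = 0
      rw [← this, sub_self, smul_zero]
    rw [h]
    exact hB.zero_mem 0
  | succ k ih =>
    intro β hβ
    -- Euler's identity writes `(k + 1) β` as the sum of the products of `c i` with the contraction
    -- of `β` by `Y i`. With `P = 1 - Q` and `a` such a contraction, `c ∧ a - (c ∘ P) ∧ P^* a = (c ∘
    -- Q) ∧ a + (c ∘ P) ∧ (a - P^* a)`. The first term is covered by the hypothesis on `Q`, the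
    -- second by induction, and each uses up one factor `b`.
    have hι : ∀ i, IsSmoothForm (contract (Y i) β) := fun i => isSmoothForm_iff.2 fun x =>
      (isSmoothForm_iff.1 hβ x).contract (hY i x)
    let P : M → E →L[ℝ] E := fun x => ContinuousLinearMap.id ℝ E - Q x
    have h1 : ∀ i, consForm (fun x => b x • (c i x).comp (Q x))
        (formSmul (fun x => b x ^ k) (contract (Y i) β)) ∈ B (k + 1) := fun i =>
      hB.consForm_mem_left (hQB _ (hc i)) (IsSmoothForm.smul (hb.pow k) (hι i))
    have hP : ∀ i, IsSmoothForm (oneForm fun x => b x • (c i x).comp (P x)) := by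
      intro i
      refine isSmoothForm_iff.2 fun x₀ => ?_
      rcases hQ x₀ with h0 | h0
      · refine (smoothFormAt_zero x₀).congr ?_
        filter_upwards [h0] with x hx
        refine form_one_ext fun v => ?_
        rw [oneForm_apply, hx, zero_smul]
        rfl
      · have h2 : SmoothFieldAt (fun x => x) P x₀ := (smoothFieldAt_id x₀).sub h0
        exact (h2.bundlePullback (isSmoothForm_iff.1 (hc i) x₀)).smul (hb x₀)
    have h2 : ∀ i, consForm (fun x => b x • (c i x).comp (P x))
        (formSmul (fun x => b x ^ k) (contract (Y i) β -
          bundlePullback (fun x => x) P (contract (Y i) β))) ∈ B (k + 1) := fun i =>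
      hB.consForm_mem_right (hP i) (ih _ (hι i))
    have h3 := hB.smul_mem (u := fun _ => ((k : ℝ) + 1)⁻¹) contMDiff_const
      (hB.sum_mem Finset.univ fun i _ => hB.add_mem (h1 i) (h2 i))
    convert h3 using 1
    funext x
    have hE1 : ((k : ℝ) + 1) • β x = ∑ i, consForm (c i) (contract (Y i) β) x :=
      (sum_consWedge_curryLeft (V := E) (β x) Finset.univ (fun i => c i x) (fun i => Y i x)
        (hcY x)).symm
    have hE2 : ((k : ℝ) + 1) • bundlePullback (fun x => x) P β x =
        ∑ i, bundlePullback (fun x => x) P (consForm (c i) (contract (Y i) β)) x := by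
      let b' : E [⋀^Fin (k + 1)]→L[ℝ] ℝ := β x
      have h4 := congrArg (fun a : E [⋀^Fin (k + 1)]→L[ℝ] ℝ => a.compContinuousLinearMap (P x)) hE1
      refine Eq.trans (b := (((k : ℝ) + 1) • b').compContinuousLinearMap (P x)) rfl (h4.trans ?_)
      have hgen : ∀ s : ι → E [⋀^Fin (k + 1)]→L[ℝ] ℝ, (∑ i, s i).compContinuousLinearMap (P x) =
          ∑ i, (s i).compContinuousLinearMap (P x) := fun s => by
        simpa using sum_compContinuousLinearMap Finset.univ (fun _ => (1 : ℝ)) s (P x)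
      exact hgen fun i => consForm (c i) (contract (Y i) β) x
    simp only [bundlePullback_consForm] at hE2
    have hk : ((k : ℝ) + 1) ≠ 0 := by positivity
    have halg : ∀ (b : ℝ) (c : E →L[ℝ] ℝ) (Q : E →L[ℝ] E) (a : E [⋀^Fin k]→L[ℝ] ℝ),
        b ^ (k + 1) • (consWedge c a - consWedge (c.comp (ContinuousLinearMap.id ℝ E - Q))
          (a.compContinuousLinearMap (ContinuousLinearMap.id ℝ E - Q))) =
        consWedge (b • c.comp Q) (b ^ k • a) +
          consWedge (b • c.comp (ContinuousLinearMap.id ℝ E - Q))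
          (b ^ k • (a - a.compContinuousLinearMap (ContinuousLinearMap.id ℝ E - Q))) := by
      intro b c Q a
      ext v
      simp only [ContinuousAlternatingMap.smul_apply, ContinuousAlternatingMap.add_apply,
        ContinuousAlternatingMap.sub_apply, consWedge_apply, smul_eq_mul, smul_apply,
        ContinuousLinearMap.comp_apply, sub_apply, map_sub, ContinuousLinearMap.id_apply]
      rw [← Finset.sum_sub_distrib, ← Finset.sum_add_distrib, Finset.mul_sum]
      refine Finset.sum_congr rfl fun i _ => ?_
      ring
    change b x ^ (k + 1) • (β x - bundlePullback (fun x => x) P β x) = ((k : ℝ) + 1)⁻¹ • _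
    rw [eq_inv_smul_iff₀ hk, smul_comm, smul_sub, hE1, hE2, ← Finset.sum_sub_distrib,
      Finset.smul_sum, Finset.sum_apply]
    refine Finset.sum_congr rfl fun i _ => ?_
    exact halg (b x) (c i x) (Q x) (contract (Y i) β x)

end Gluing
end

noncomputable section

set_option linter.unusedSectionVars false

/-! ### Inverse functions, local sections and constant rank in vector spaces -/

section Submersions

variable {V : Type*} [NormedAddCommGroup V] [NormedSpace ℝ V] [FiniteDimensional ℝ V]
  {W : Type*} [NormedAddCommGroup W] [NormedSpace ℝ W] [FiniteDimensional ℝ W]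

/-- The inverse function theorem, with smoothness on a neighbourhood. -/
theorem exists_local_inverse {f : V → W} {a : V} (hf : ∀ᶠ x in 𝓝 a, ContDiffAt ℝ ∞ f x)
    (hb : Function.Bijective (fderiv ℝ f a)) : ∃ g : W → V,
      (∀ᶠ y in 𝓝 (f a), ContDiffAt ℝ ∞ g y ∧ f (g y) = y) ∧ ∀ᶠ x in 𝓝 a, g (f x) = x := by
  let e : V ≃L[ℝ] W := (LinearEquiv.ofBijective (fderiv ℝ f a : V →ₗ[ℝ] W) hb).toContinuousLinearEquiv
  have he : (e : V →L[ℝ] W) = fderiv ℝ f a := by ext; rfl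
  have hd : ∀ᶠ x in 𝓝 a, HasFDerivAt f (fderiv ℝ f x) x :=
    hf.mono fun x hx => (hx.differentiableAt (by simp)).hasFDerivAt
  have hfa : HasFDerivAt f (e : V →L[ℝ] W) a := he ▸ hd.self_of_nhds
  let φ := hf.self_of_nhds.toOpenPartialHomeomorph f hfa (by simp)
  have hφ : (φ : V → W) = f := hf.self_of_nhds.toOpenPartialHomeomorph_coe hfa (by simp)
  have ha : a ∈ φ.source := hf.self_of_nhds.mem_toOpenPartialHomeomorph_source hfa (by simp)
  have hfa' : f a ∈ φ.target := hf.self_of_nhds.image_mem_toOpenPartialHomeomorph_target hfa (by simp)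
  have hinv : φ.symm (f a) = a := by
    have := φ.left_inv ha
    rwa [hφ] at this
  have hcont : Filter.Tendsto φ.symm (𝓝 (f a)) (𝓝 a) := by
    have := φ.continuousAt_symm hfa'
    unfold ContinuousAt at this
    rwa [hinv] at this
  have hc' : ContinuousAt (fderiv ℝ f) a :=
    (hf.self_of_nhds.fderiv_right (m := ∞) (by simp)).continuousAt
  have hinvert : ∀ᶠ x in 𝓝 a, (fderiv ℝ f x) ∈ Set.range ((↑) : (V ≃L[ℝ] W) → V →L[ℝ] W) :=
    hc'.eventually (he ▸ ContinuousLinearEquiv.nhds e)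
  refine ⟨φ.symm, ?_, ?_⟩
  · filter_upwards [hcont.eventually hinvert, hcont.eventually hf, hcont.eventually hd,
      φ.open_target.mem_nhds hfa'] with y h1 h2 h3 h4
    obtain ⟨e', he'⟩ := h1
    refine ⟨φ.contDiffAt_symm (f₀' := e') h4 ?_ ?_, ?_⟩
    · rw [hφ, he']; exact h3
    · rw [hφ]; exact h2
    · have := φ.right_inv h4
      rwa [hφ] at this
  · filter_upwards [φ.open_source.mem_nhds ha] with x hx
    have := φ.left_inv hx
    rwa [hφ] at this

/-- A submersion between vector spaces has smooth local sections. -/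
theorem exists_local_section {f : V → W} {a : V} (hf : ∀ᶠ x in 𝓝 a, ContDiffAt ℝ ∞ f x)
    (hs : Function.Surjective (fderiv ℝ f a)) : ∃ g : W → V,
      g (f a) = a ∧ ∀ᶠ y in 𝓝 (f a), ContDiffAt ℝ ∞ g y ∧ f (g y) = y := by
  obtain ⟨R, hR⟩ := (fderiv ℝ f a).exists_rightInverse_of_surjective (LinearMap.range_eq_top.2 hs)
  -- Restricted to the affine slice through `a` in the directions of a right inverse `R` of the
  -- differential, `f` has the identity as differential, so the inverse function theorem applies.
  let j : W → V := fun y => a + R (y - f a)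
  have hj : ContDiff ℝ ∞ j := contDiff_const.add (R.contDiff.comp (contDiff_id.sub contDiff_const))
  have hja : j (f a) = a := by simp [j]
  have hjt : Filter.Tendsto j (𝓝 (f a)) (𝓝 a) := by
    have := hj.continuous.tendsto (f a)
    rwa [hja] at this
  have hfj : ∀ᶠ y in 𝓝 (f a), ContDiffAt ℝ ∞ (fun y => f (j y)) y := by
    filter_upwards [hjt.eventually hf] with y hy using hy.comp y hj.contDiffAt
  have hdj : HasFDerivAt j R (f a) := by
    have h := (R.hasFDerivAt.comp (f a) ((hasFDerivAt_id (f a)).sub_const (f a))).const_add a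
    exact h.congr_fderiv (by ext; rfl)
  have hd : fderiv ℝ (fun y => f (j y)) (f a) = ContinuousLinearMap.id ℝ W := by
    have h1 : HasFDerivAt f (fderiv ℝ f a) (j (f a)) := by
      rw [hja]; exact (hf.self_of_nhds.differentiableAt (by simp)).hasFDerivAt
    exact ((h1.comp (f a) hdj).fderiv).trans hR
  obtain ⟨g, hg1, hg2⟩ := exists_local_inverse hfj (by rw [hd]; exact Function.bijective_id)
  simp only [hja] at hg1
  refine ⟨fun y => j (g y), ?_, ?_⟩
  · have := hg2.self_of_nhds
    simp only [hja] at this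
    simp only [this, hja]
  · filter_upwards [hg1] with y hy using ⟨hj.contDiffAt.comp y hy.1, hy.2⟩

/-- The image of a map of constant rank has locally dimension at most the rank. -/
theorem exists_dimH_image_le {f : V → W} {a : V} (hf : ∀ᶠ x in 𝓝 a, ContDiffAt ℝ ∞ f x) {e : ℕ}
    (hr : ∀ᶠ x in 𝓝 a, Module.finrank ℝ (LinearMap.range (fderiv ℝ f x : V →ₗ[ℝ] W)) = e) :
    ∃ O ∈ 𝓝 a, dimH (f '' O) ≤ e := by
  let A := fderiv ℝ f a
  let R := LinearMap.range (A : V →ₗ[ℝ] W)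
  let K := LinearMap.ker (A : V →ₗ[ℝ] W)
  obtain ⟨pr, hpr⟩ := Submodule.ClosedComplemented.of_finiteDimensional R
  obtain ⟨κ, hκ⟩ := Submodule.ClosedComplemented.of_finiteDimensional K
  -- Coordinates adapted to `f`: the component of its value along the range of the differential at
  -- `a`, and the component of the point along the kernel.
  let φ : V → R × K := fun x => (pr (f x), κ x)
  have hφ : ∀ᶠ x in 𝓝 a, ContDiffAt ℝ ∞ φ x := by
    filter_upwards [hf] with x hx
    exact (pr.contDiff.contDiffAt.comp x hx).prodMk κ.contDiff.contDiffAt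
  have hfa := hf.self_of_nhds.differentiableAt (by simp)
  have hφd : fderiv ℝ φ a = (pr.comp A).prod κ :=
    ((pr.hasFDerivAt.comp a hfa.hasFDerivAt).prodMk κ.hasFDerivAt).fderiv
  have hAr : ∀ u, (pr (A u) : W) = A u := fun u => congrArg Subtype.val (hpr ⟨A u, u, rfl⟩)
  have hb : Function.Bijective (fderiv ℝ φ a) := by
    rw [hφd]
    constructor
    · refine (injective_iff_map_eq_zero _).2 fun x hx => ?_
      have h1 : pr (A x) = 0 := congrArg Prod.fst hx
      have h2 : κ x = 0 := congrArg Prod.snd hx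
      have h3 : A x = 0 := by rw [← hAr, h1]; rfl
      have h4 := hκ ⟨x, h3⟩
      rw [h2] at h4
      exact (congrArg Subtype.val h4).symm
    · rintro ⟨⟨_, u, rfl⟩, k⟩
      refine ⟨u - κ u + k, ?_⟩
      have h1 : A (u - κ u + k) = A u := by
        have h2 : A (κ u) = 0 := (κ u).2
        have h3 : A (k : V) = 0 := k.2
        rw [map_add, map_sub, h2, h3]; simp
      refine Prod.ext ?_ ?_
      · refine Subtype.ext ?_
        change ((pr (A (u - κ u + k)) : R) : W) = _
        rw [hAr, h1]; rfl
      · change κ (u - κ u + k) = k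
        rw [map_add, map_sub, hκ, hκ]; simp
  obtain ⟨g, hg1, hg2⟩ := exists_local_inverse hφ hb
  have hgt : Filter.Tendsto g (𝓝 (φ a)) (𝓝 a) := by
    have := hg1.self_of_nhds.1.continuousAt
    unfold ContinuousAt at this
    rwa [hg2.self_of_nhds] at this
  have hRe : Module.finrank ℝ R = e := hr.self_of_nhds
  let h : R × K → W := fun y => f (g y)
  have hev : ∀ᶠ y in 𝓝 (φ a), ContDiffAt ℝ ∞ h y ∧ ∀ k : K, fderiv ℝ h y (0, k) = 0 := by
    filter_upwards [hg1.eventually_nhds, hgt.eventually hf, hgt.eventually hr] with y h1 h2 h3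
    have hgd := h1.self_of_nhds.1.differentiableAt (by simp)
    have hfd := h2.differentiableAt (by simp)
    refine ⟨h2.comp y h1.self_of_nhds.1, fun k => ?_⟩
    have hh : HasFDerivAt h ((fderiv ℝ f (g y)).comp (fderiv ℝ g y)) y :=
      hfd.hasFDerivAt.comp y hgd.hasFDerivAt
    have hpd : (pr.comp ((fderiv ℝ f (g y)).comp (fderiv ℝ g y))) = ContinuousLinearMap.fst ℝ R K := by
      have e1 : (fun y => pr (h y)) =ᶠ[𝓝 y] Prod.fst := by
        filter_upwards [h1] with z hz
        exact congrArg Prod.fst hz.2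
      exact ((pr.hasFDerivAt.comp y hh).congr_of_eventuallyEq e1.symm).unique
        (hasFDerivAt_fst (p := y))
    rw [hh.fderiv]
    -- The constant rank enters here: `pr` maps the range of the nearby differential onto `R`, and
    -- equal dimensions make it injective there. The derivative of `h` along `K` has zero image
    -- under `pr`, hence is zero.
    let T := LinearMap.range (fderiv ℝ f (g y) : V →ₗ[ℝ] W)
    let prT : T →ₗ[ℝ] R := (pr : W →ₗ[ℝ] R).comp T.subtype
    have hsurj : Function.Surjective prT := fun r =>
      ⟨⟨fderiv ℝ f (g y) (fderiv ℝ g y (r, 0)), _, rfl⟩,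
        congrArg (fun L : R × K →L[ℝ] R => L (r, 0)) hpd⟩
    have hinj : Function.Injective prT :=
      (LinearMap.injective_iff_surjective_of_finrank_eq_finrank (h3.trans hRe.symm)).2 hsurj
    have h5 : (⟨fderiv ℝ f (g y) (fderiv ℝ g y (0, k)), _, rfl⟩ : T) = 0 := by
      refine hinj ?_
      rw [map_zero]
      exact congrArg (fun L : R × K →L[ℝ] R => L (0, k)) hpd
    exact congrArg Subtype.val h5
  obtain ⟨ε, hε, hball⟩ := Metric.eventually_nhds_iff_ball.1 hev
  refine ⟨{x | g (φ x) = x ∧ φ x ∈ Metric.ball (φ a) ε}, ?_, ?_⟩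
  · exact Filter.Eventually.and hg2
      (hφ.self_of_nhds.continuousAt.eventually (Metric.ball_mem_nhds _ hε))
  · have hmem : ∀ r ∈ Metric.ball (φ a).1 ε, ∀ k ∈ Metric.ball (φ a).2 ε,
        (r, k) ∈ Metric.ball (φ a) ε := fun r hr k hk => by
      rw [← Prod.mk.eta (p := φ a), ← ball_prod_same]; exact ⟨hr, hk⟩
    -- In the new coordinates `f` does not depend on the kernel variable, so its image is that of a
    -- ball in `R`, a space of dimension `e`.
    have hconst : ∀ r ∈ Metric.ball (φ a).1 ε, ∀ k ∈ Metric.ball (φ a).2 ε,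
        h (r, k) = h (r, (φ a).2) := by
      intro r hr k hk
      have hd : ∀ k ∈ Metric.ball (φ a).2 ε, HasFDerivAt (fun k => h (r, k)) (0 : K →L[ℝ] W) k := by
        intro k hk
        have h1 := hball _ (hmem r hr k hk)
        have h2 := (h1.1.differentiableAt (by simp)).hasFDerivAt.comp k
          (hasFDerivAt_prodMk_right r k)
        refine h2.congr_fderiv ?_
        ext u
        exact h1.2 u
      refine (convex_ball (φ a).2 ε).is_const_of_fderivWithin_eq_zero (𝕜 := ℝ)
        (f := fun k => h (r, k)) (fun k hk => (hd k hk).differentiableAt.differentiableWithinAt)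
        (fun k hk => ?_) hk (Metric.mem_ball_self hε)
      exact ((hd k hk).hasFDerivWithinAt).fderivWithin (Metric.isOpen_ball.uniqueDiffWithinAt hk)
    have hsub : f '' {x | g (φ x) = x ∧ φ x ∈ Metric.ball (φ a) ε} ⊆
        (fun r => h (r, (φ a).2)) '' Metric.ball (φ a).1 ε := by
      rintro _ ⟨x, ⟨h1, h2⟩, rfl⟩
      rw [← Prod.mk.eta (p := φ a), ← ball_prod_same] at h2
      refine ⟨(φ x).1, h2.1, ?_⟩
      change h _ = _
      rw [← hconst _ h2.1 _ h2.2]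
      change f (g (φ x)) = _
      rw [h1]
    refine (dimH_mono hsub).trans ?_
    have hcd : ContDiffOn ℝ 1 (fun r => h (r, (φ a).2)) (Metric.ball (φ a).1 ε) := fun r hr =>
      (((hball _ (hmem r hr _ (Metric.mem_ball_self hε))).1.of_le (by simp)).comp r
        (contDiff_prodMk_left (φ a).2).contDiffAt).contDiffWithinAt
    refine (hcd.dimH_image_le (convex_ball _ _) subset_rfl).trans ?_
    refine (dimH_mono (Set.subset_univ _)).trans ?_
    rw [Real.dimH_univ_eq_finrank, hRe]

end Submersions
end

noncomputable section

set_option linter.unusedSectionVars false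

/-! ### Differentials in charts and local sections of submersions between manifolds -/

section ManifoldSubmersions

variable {E : Type*} [NormedAddCommGroup E] [NormedSpace ℝ E] [FiniteDimensional ℝ E]
  {F : Type*} [NormedAddCommGroup F] [NormedSpace ℝ F] [FiniteDimensional ℝ F]
  {F' : Type*} [NormedAddCommGroup F'] [NormedSpace ℝ F'] [FiniteDimensional ℝ F']
  {M : Type*} [TopologicalSpace M] [ChartedSpace E M] [IsManifold 𝓘(ℝ, E) ∞ M]
  {N : Type*} [TopologicalSpace N] [ChartedSpace F N] [IsManifold 𝓘(ℝ, F) ∞ N]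
  {N' : Type*} [TopologicalSpace N'] [ChartedSpace F' N'] [IsManifold 𝓘(ℝ, F') ∞ N']

theorem tangentField_comp {f : M → N} {g : N → N'} {x : M}
    (hg : ContMDiffAt 𝓘(ℝ, F) 𝓘(ℝ, F') ∞ g (f x)) (hf : ContMDiffAt 𝓘(ℝ, E) 𝓘(ℝ, F) ∞ f x) :
    tangentField (E := E) (F := F') (fun x => g (f x)) x =
      (tangentField (E := F) (F := F') g (f x)).comp (tangentField f x) :=
  mfderiv_comp x (hg.mdifferentiableAt (by simp)) (hf.mdifferentiableAt (by simp))

theorem tangentField_congr {f g : M → N} {x : M} (h : ∀ᶠ z in 𝓝 x, f z = g z) :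
    tangentField (E := E) (F := F) f x = tangentField g x :=
  Filter.EventuallyEq.mfderiv_eq h

theorem tangentField_id (x : M) :
    tangentField (E := E) (F := E) (fun x : M => x) x = ContinuousLinearMap.id ℝ E :=
  mfderiv_id

theorem tangentField_const (x : M) (y : N) :
    tangentField (E := E) (F := F) (fun _ : M => y) x = 0 :=
  mfderiv_const

theorem chartD_injective {z x : M} (hx : x ∈ (extChartAt 𝓘(ℝ, E) z).source) :
    Function.Injective (chartD (E := E) z x) := fun v w h => by
  have h1 := chartDSymm_comp_chartD hx
  have h2 : ∀ v, chartDSymm z (extChartAt 𝓘(ℝ, E) z x) (chartD z x v) = v := fun v =>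
    congrArg (fun L : E →L[ℝ] E => L v) h1
  rw [← h2 v, h, h2]

theorem chartD_bijective {z x : M} (hx : x ∈ (extChartAt 𝓘(ℝ, E) z).source) :
    Function.Bijective (chartD (E := E) z x) :=
  ⟨chartD_injective hx, LinearMap.injective_iff_surjective (f := (chartD (E := E) z x : E →ₗ[ℝ] E)).1
    (chartD_injective hx)⟩

theorem chartDSymm_bijective {z x : M} (hx : x ∈ (extChartAt 𝓘(ℝ, E) z).source) :
    Function.Bijective (chartDSymm z (extChartAt 𝓘(ℝ, E) z x)) := by
  have h : Function.Surjective (chartDSymm z (extChartAt 𝓘(ℝ, E) z x)) := fun v =>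
    ⟨chartD z x v, congrArg (fun L : E →L[ℝ] E => L v) (chartDSymm_comp_chartD hx)⟩
  exact ⟨LinearMap.injective_iff_surjective
    (f := (chartDSymm z (extChartAt 𝓘(ℝ, E) z x) : E →ₗ[ℝ] E)).2 h, h⟩

/-- The expression of a map in the preferred charts at `z` and `w`. -/
def localExpr (z : M) (w : N) (f : M → N) (y : E) : F :=
  extChartAt 𝓘(ℝ, F) w (f ((extChartAt 𝓘(ℝ, E) z).symm y))

theorem contMDiffAt_symm {z x : M} (hx : x ∈ (extChartAt 𝓘(ℝ, E) z).source) :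
    ContMDiffAt 𝓘(ℝ, E) 𝓘(ℝ, E) ∞ (extChartAt 𝓘(ℝ, E) z).symm (extChartAt 𝓘(ℝ, E) z x) :=
  contMDiffAt_extChartAt_symm ((extChartAt 𝓘(ℝ, E) z).map_source hx)

theorem contMDiffAt_chart {z x : M} (hx : x ∈ (extChartAt 𝓘(ℝ, E) z).source) :
    ContMDiffAt 𝓘(ℝ, E) 𝓘(ℝ, E) ∞ (extChartAt 𝓘(ℝ, E) z) x :=
  contMDiffAt_extChartAt' (by simpa using hx)

theorem contDiffAt_localExpr {f : M → N} {z x : M} {w : N}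
    (hx : x ∈ (extChartAt 𝓘(ℝ, E) z).source) (hw : f x ∈ (extChartAt 𝓘(ℝ, F) w).source)
    (hf : ContMDiffAt 𝓘(ℝ, E) 𝓘(ℝ, F) ∞ f x) :
    ContDiffAt ℝ ∞ (localExpr (E := E) (F := F) z w f) (extChartAt 𝓘(ℝ, E) z x) := by
  have hz := (extChartAt 𝓘(ℝ, E) z).left_inv hx
  have h : ContMDiffAt 𝓘(ℝ, E) 𝓘(ℝ, F) ∞ (fun y => extChartAt 𝓘(ℝ, F) w
      (f ((extChartAt 𝓘(ℝ, E) z).symm y))) (extChartAt 𝓘(ℝ, E) z x) := by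
    refine ContMDiffAt.comp (I' := 𝓘(ℝ, F)) _ (g := extChartAt 𝓘(ℝ, F) w)
      (f := fun y => f ((extChartAt 𝓘(ℝ, E) z).symm y)) ?_ ?_
    · rw [hz]; exact contMDiffAt_chart hw
    · refine ContMDiffAt.comp (I' := 𝓘(ℝ, E)) _ (g := f) ?_ (contMDiffAt_symm hx)
      rw [hz]; exact hf
  exact h.contDiffAt

theorem fderiv_localExpr {f : M → N} {z x : M} {w : N}
    (hx : x ∈ (extChartAt 𝓘(ℝ, E) z).source) (hw : f x ∈ (extChartAt 𝓘(ℝ, F) w).source)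
    (hf : ContMDiffAt 𝓘(ℝ, E) 𝓘(ℝ, F) ∞ f x) :
    fderiv ℝ (localExpr (E := E) (F := F) z w f) (extChartAt 𝓘(ℝ, E) z x) =
      (chartD w (f x)).comp ((tangentField (E := E) (F := F) f x).comp
        (chartDSymm z (extChartAt 𝓘(ℝ, E) z x))) := by
  have hz := (extChartAt 𝓘(ℝ, E) z).left_inv hx
  have k1 := (contMDiffAt_symm hx).mdifferentiableAt (n := ∞) (by simp)
  have k2 : MDifferentiableAt 𝓘(ℝ, E) 𝓘(ℝ, F) f
      ((extChartAt 𝓘(ℝ, E) z).symm (extChartAt 𝓘(ℝ, E) z x)) := by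
    rw [hz]; exact hf.mdifferentiableAt (by simp)
  have k3 : MDifferentiableAt 𝓘(ℝ, F) 𝓘(ℝ, F) (extChartAt 𝓘(ℝ, F) w)
      (f ((extChartAt 𝓘(ℝ, E) z).symm (extChartAt 𝓘(ℝ, E) z x))) := by
    rw [hz]; exact (contMDiffAt_chart hw).mdifferentiableAt (by simp)
  have k4 := mfderiv_comp _ (k3.comp _ k2) k1
  have k5 := mfderiv_comp _ k3 k2
  rw [← mfderiv_eq_fderiv]
  refine k4.trans ?_
  refine (congrArg (fun L : E →L[ℝ] F =>
    L.comp (chartDSymm z (extChartAt 𝓘(ℝ, E) z x))) k5).trans ?_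
  unfold chartD tangentField
  rw [hz]
  rfl

theorem eventually_contDiffAt_localExpr {f : M → N} {z x : M} {w : N}
    (hx : x ∈ (extChartAt 𝓘(ℝ, E) z).source) (hw : f x ∈ (extChartAt 𝓘(ℝ, F) w).source)
    (hf : ∀ᶠ x in 𝓝 x, ContMDiffAt 𝓘(ℝ, E) 𝓘(ℝ, F) ∞ f x) :
    ∀ᶠ y in 𝓝 (extChartAt 𝓘(ℝ, E) z x),
      ContDiffAt ℝ ∞ (localExpr (E := E) (F := F) z w f) y ∧
      fderiv ℝ (localExpr (E := E) (F := F) z w f) y =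
        (chartD w (f ((extChartAt 𝓘(ℝ, E) z).symm y))).comp
          ((tangentField (E := E) (F := F) f ((extChartAt 𝓘(ℝ, E) z).symm y)).comp
            (chartDSymm z y)) ∧
      y ∈ (extChartAt 𝓘(ℝ, E) z).target ∧
      f ((extChartAt 𝓘(ℝ, E) z).symm y) ∈ (extChartAt 𝓘(ℝ, F) w).source := by
  have ht : Filter.Tendsto (extChartAt 𝓘(ℝ, E) z).symm (𝓝 (extChartAt 𝓘(ℝ, E) z x)) (𝓝 x) := by
    have := (contMDiffAt_symm hx).continuousAt
    unfold ContinuousAt at this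
    rwa [(extChartAt 𝓘(ℝ, E) z).left_inv hx] at this
  filter_upwards [ht.eventually hf, ht.eventually (hf.self_of_nhds.continuousAt.eventually
    ((isOpen_extChartAt_source w).mem_nhds hw)), (isOpen_extChartAt_target z).mem_nhds
    ((extChartAt 𝓘(ℝ, E) z).map_source hx)] with y h1 h2 h3
  have h4 := (extChartAt 𝓘(ℝ, E) z).map_target h3
  have h5 := contDiffAt_localExpr h4 h2 h1
  have h6 := fderiv_localExpr h4 h2 h1
  rw [(extChartAt 𝓘(ℝ, E) z).right_inv h3] at h5 h6
  exact ⟨h5, h6, h3, h2⟩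

/-- A map which is a smooth submersion near a point has a smooth local section through it. -/
theorem exists_smooth_section {p : M → N} {x₀ : M}
    (hp : ∀ᶠ x in 𝓝 x₀, ContMDiffAt 𝓘(ℝ, E) 𝓘(ℝ, F) ∞ p x)
    (hs : Function.Surjective (tangentField (E := E) (F := F) p x₀)) :
    ∃ s : N → M, s (p x₀) = x₀ ∧
      ∀ᶠ y in 𝓝 (p x₀), ContMDiffAt 𝓘(ℝ, F) 𝓘(ℝ, E) ∞ s y ∧ p (s y) = y := by
  have hx := mem_extChartAt_source (I := 𝓘(ℝ, E)) x₀
  have hw := mem_extChartAt_source (I := 𝓘(ℝ, F)) (p x₀)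
  have hev := eventually_contDiffAt_localExpr hx hw hp
  have hsurj : Function.Surjective (fderiv ℝ (localExpr (E := E) (F := F) x₀ (p x₀) p)
      (extChartAt 𝓘(ℝ, E) x₀ x₀)) := by
    rw [fderiv_localExpr hx hw hp.self_of_nhds]
    exact (chartD_bijective hw).2.comp (hs.comp (chartDSymm_bijective hx).2)
  obtain ⟨g, hg1, hg2⟩ := exists_local_section (hev.mono fun y hy => hy.1) hsurj
  have hval : localExpr (E := E) (F := F) x₀ (p x₀) p (extChartAt 𝓘(ℝ, E) x₀ x₀) =
      extChartAt 𝓘(ℝ, F) (p x₀) (p x₀) := by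
    unfold localExpr
    rw [(extChartAt 𝓘(ℝ, E) x₀).left_inv hx]
  rw [hval] at hg1 hg2
  have hgt : Filter.Tendsto g (𝓝 (extChartAt 𝓘(ℝ, F) (p x₀) (p x₀)))
      (𝓝 (extChartAt 𝓘(ℝ, E) x₀ x₀)) := by
    have := hg2.self_of_nhds.1.continuousAt
    unfold ContinuousAt at this
    rwa [hg1] at this
  refine ⟨fun y => (extChartAt 𝓘(ℝ, E) x₀).symm (g (extChartAt 𝓘(ℝ, F) (p x₀) y)), ?_, ?_⟩
  · simp only [hg1]
    exact (extChartAt 𝓘(ℝ, E) x₀).left_inv hx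
  · have hc : Filter.Tendsto (extChartAt 𝓘(ℝ, F) (p x₀)) (𝓝 (p x₀))
        (𝓝 (extChartAt 𝓘(ℝ, F) (p x₀) (p x₀))) := (continuousAt_extChartAt (p x₀))
    filter_upwards [hc.eventually hg2, (hc.eventually (hgt.eventually hev)),
      (isOpen_extChartAt_source (p x₀)).mem_nhds hw] with y h1 h2 h3
    refine ⟨?_, ?_⟩
    · refine ContMDiffAt.comp (I' := 𝓘(ℝ, E)) y (g := (extChartAt 𝓘(ℝ, E) x₀).symm)
        (f := fun y => g (extChartAt 𝓘(ℝ, F) (p x₀) y)) ?_ ?_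
      · exact contMDiffAt_extChartAt_symm h2.2.2.1
      · exact ContMDiffAt.comp (I' := 𝓘(ℝ, F)) y (g := g) h1.1.contMDiffAt (contMDiffAt_chart h3)
    · have h4 : extChartAt 𝓘(ℝ, F) (p x₀) (p ((extChartAt 𝓘(ℝ, E) x₀).symm
          (g (extChartAt 𝓘(ℝ, F) (p x₀) y)))) = extChartAt 𝓘(ℝ, F) (p x₀) y := h1.2
      exact (extChartAt 𝓘(ℝ, F) (p x₀)).injOn h2.2.2.2 h3 h4

end ManifoldSubmersions

/-! ### Orbits -/

section Orbits

variable {E : Type*} [NormedAddCommGroup E] [NormedSpace ℝ E] [FiniteDimensional ℝ E]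
  {F : Type*} [NormedAddCommGroup F] [NormedSpace ℝ F] [FiniteDimensional ℝ F]
  {M : Type*} [TopologicalSpace M] [ChartedSpace E M] [IsManifold 𝓘(ℝ, E) ∞ M]
  {N : Type*} [TopologicalSpace N] [ChartedSpace F N] [IsManifold 𝓘(ℝ, F) ∞ N]
  {V : Type*} [NormedAddCommGroup V] [NormedSpace ℝ V] [FiniteDimensional ℝ V]
  {G : Type*} [TopologicalSpace G] [ChartedSpace V G] [Group G] [LieGroup 𝓘(ℝ, V) ∞ G]
  [MulAction G M] [ContMDiffSMul 𝓘(ℝ, V) 𝓘(ℝ, E) ∞ G M]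

/-- The orbit map of a point. -/
def orbitMap (G : Type*) [Group G] [MulAction G M] (x : M) (g : G) : M := g • x

theorem contMDiff_translation (V : Type*) [NormedAddCommGroup V] [NormedSpace ℝ V] {G : Type*}
    [TopologicalSpace G] [ChartedSpace V G] [Group G] [MulAction G M]
    [ContMDiffSMul 𝓘(ℝ, V) 𝓘(ℝ, E) ∞ G M] (g : G) :
    ContMDiff 𝓘(ℝ, E) 𝓘(ℝ, E) ∞ (fun x : M => g • x) :=
  ContMDiffSMul.contMDiff_const_smul (I := 𝓘(ℝ, V)) (I' := 𝓘(ℝ, E)) (M := M) g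

theorem contMDiff_orbitMap (x : M) : ContMDiff 𝓘(ℝ, V) 𝓘(ℝ, E) ∞ (orbitMap G x) :=
  ContMDiff.smul (I := 𝓘(ℝ, V)) (I' := 𝓘(ℝ, E)) contMDiff_id contMDiff_const

theorem bijective_tangentField_translation {G : Type*} [Group G] [MulAction G M]
    (ht : ∀ g : G, ContMDiff 𝓘(ℝ, E) 𝓘(ℝ, E) ∞ (fun x : M => g • x)) (g : G) (x : M) :
    Function.Bijective (tangentField (E := E) (F := E) (fun x : M => g • x) x) := by
  have h : ∀ (g : G) (x : M), (tangentField (E := E) (F := E) (fun x : M => g⁻¹ • x) (g • x)).comp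
      (tangentField (E := E) (F := E) (fun x : M => g • x) x) = ContinuousLinearMap.id ℝ E := by
    intro g x
    rw [← tangentField_comp (ht g⁻¹ _) (ht g x), ← tangentField_id x]
    exact tangentField_congr (Filter.Eventually.of_forall fun z => inv_smul_smul g z)
  have h1 : Function.Injective (tangentField (E := E) (F := E) (fun x : M => g • x) x) :=
    Function.LeftInverse.injective (g := tangentField (E := E) (F := E)
      (fun x : M => g⁻¹ • x) (g • x)) fun v => congrArg (fun L : E →L[ℝ] E => L v) (h g x)
  exact ⟨h1, LinearMap.injective_iff_surjective
    (f := (tangentField (E := E) (F := E) (fun x : M => g • x) x : E →ₗ[ℝ] E)).1 h1⟩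

theorem surjective_tangentField_mul_left (g : G) :
    Function.Surjective (tangentField (E := V) (F := V) (fun h : G => g * h) 1) := by
  have h1 := tangentField_comp (E := V) (F := V) (F' := V) (f := fun h : G => g⁻¹ * h)
    (g := fun h : G => g * h) (x := g * 1)
    ((contMDiff_mul_left (I := 𝓘(ℝ, V)) (n := ∞)) _) ((contMDiff_mul_left (I := 𝓘(ℝ, V)) (n := ∞)) _)
  simp only [mul_inv_cancel_left, tangentField_id] at h1
  intro v
  refine ⟨tangentField (E := V) (F := V) (fun h : G => g⁻¹ * h) (g * 1) v, ?_⟩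
  have h2 := congrArg (fun L : V →L[ℝ] V => L v) h1
  simp only [mul_one, inv_mul_cancel] at h2 ⊢
  exact h2.symm

/-- The orbit map intertwines left translation by `g` with the action of `g`. The first has
surjective differential at `1` and the second injective differential, so the rank at `g` is the rank
at `1`. -/
theorem finrank_range_orbitMap (x : M) (g : G) :
    Module.finrank ℝ (LinearMap.range (tangentField (E := V) (F := E) (orbitMap G x) g : V →ₗ[ℝ] E)) =
    Module.finrank ℝ
      (LinearMap.range (tangentField (E := V) (F := E) (orbitMap G x) 1 : V →ₗ[ℝ] E)) := by
  have h1 := tangentField_comp (E := V) (F := V) (F' := E) (f := fun h : G => g * h)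
    (g := orbitMap G x) (x := 1) (contMDiff_orbitMap x _)
    ((contMDiff_mul_left (I := 𝓘(ℝ, V)) (n := ∞)) _)
  have h2 := tangentField_comp (E := V) (F := E) (F' := E) (f := orbitMap G x)
    (g := fun z : M => g • z) (x := 1) (contMDiff_translation V g _)
    (contMDiff_orbitMap x _)
  have h3 : (fun h : G => orbitMap G x (g * h)) = fun h => g • orbitMap G x h := by
    funext h; exact mul_smul g h x
  rw [h3, h2] at h1
  simp only [mul_one] at h1
  have h4 : LinearMap.range (tangentField (E := V) (F := E) (orbitMap G x) g : V →ₗ[ℝ] E) =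
      (LinearMap.range (tangentField (E := V) (F := E) (orbitMap G x) 1 : V →ₗ[ℝ] E)).map
        (tangentField (E := E) (F := E) (fun z : M => g • z) (orbitMap G x 1) : E →ₗ[ℝ] E) := by
    rw [← LinearMap.range_comp]
    have h5 := congrArg (fun L : V →L[ℝ] E => LinearMap.range (L : V →ₗ[ℝ] E)) h1
    refine Eq.trans ?_ h5.symm
    exact (LinearMap.range_comp_of_range_eq_top _
      (LinearMap.range_eq_top.2 (surjective_tangentField_mul_left (V := V) g))).symm
  rw [h4]
  exact (LinearEquiv.finrank_eq (Submodule.equivMapOfInjective _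
    (bijective_tangentField_translation (contMDiff_translation V) g _).1 _)).symm

/-- For a quotient submersion, the vertical tangent vectors are the values of the infinitesimal
generators. -/
theorem exists_tangentField_orbitMap_eq [SecondCountableTopology G] {q : M → N}
    (hq : IsSmoothSubmersion (E := E) (F := F) q) (hinv : ∀ (g : G) (x : M), q (g • x) = q x)
    (hfib : ∀ x y, q x = q y → ∃ g : G, g • x = y) (x₀ : M) (v : E)
    (hv : tangentField (E := E) (F := F) q x₀ v = 0) :
    ∃ ξ : V, v = tangentField (E := V) (F := E) (orbitMap G x₀) 1 ξ := by
  let R := LinearMap.range (tangentField (E := V) (F := E) (orbitMap G x₀) 1 : V →ₗ[ℝ] E)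
  let e := Module.finrank ℝ R
  let c := extChartAt 𝓘(ℝ, E) x₀
  have hx := mem_extChartAt_source (I := 𝓘(ℝ, E)) x₀
  have hw := mem_extChartAt_source (I := 𝓘(ℝ, F)) (q x₀)
  have horb : ∀ g, ContMDiffAt 𝓘(ℝ, V) 𝓘(ℝ, E) ∞ (orbitMap G x₀) g := contMDiff_orbitMap x₀
  let S : Set G := {g | orbitMap G x₀ g ∈ c.source}
  have hS : IsOpen S := (isOpen_extChartAt_source x₀).preimage (contMDiff_orbitMap (E := E) (V := V) x₀).continuous
  -- The orbit map has constant rank `e`, so small pieces of the orbit have Hausdorff dimension at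
  -- most `e`. Second countability of `G` reduces the orbit inside the chart to countably many such
  -- pieces.
  have hloc : ∀ g ∈ S, ∃ O ∈ 𝓝 g, dimH ((fun h => c (orbitMap G x₀ h)) '' O) ≤ e := by
    intro g hg
    have hgs := mem_extChartAt_source (I := 𝓘(ℝ, V)) g
    have hev := eventually_contDiffAt_localExpr (E := V) (F := E) hgs hg
      (Filter.Eventually.of_forall horb)
    obtain ⟨O, hO, hd⟩ := exists_dimH_image_le (hev.mono fun y hy => hy.1) (e := e) (by
      filter_upwards [hev] with y hy
      have h1 := (extChartAt 𝓘(ℝ, V) g).map_target hy.2.2.1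
      have h2 := chartDSymm_bijective h1
      rw [(extChartAt 𝓘(ℝ, V) g).right_inv hy.2.2.1] at h2
      let A : V →L[ℝ] E := tangentField (E := V) (F := E) (orbitMap G x₀)
        ((extChartAt 𝓘(ℝ, V) g).symm y)
      have h3 : LinearMap.range (fderiv ℝ (localExpr (E := V) (F := E) g x₀ (orbitMap G x₀)) y :
          V →ₗ[ℝ] E) = (LinearMap.range (A : V →ₗ[ℝ] E)).map
            (chartD (E := E) x₀ (orbitMap G x₀ ((extChartAt 𝓘(ℝ, V) g).symm y)) : E →ₗ[ℝ] E) := by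
        rw [hy.2.1, ← LinearMap.range_comp]
        exact LinearMap.range_comp_of_range_eq_top
          ((chartD (E := E) x₀ (orbitMap G x₀ ((extChartAt 𝓘(ℝ, V) g).symm y)) :
            E →ₗ[ℝ] E).comp (A : V →ₗ[ℝ] E)) (LinearMap.range_eq_top.2 h2.2)
      rw [h3]
      refine (LinearEquiv.finrank_eq (Submodule.equivMapOfInjective _
        (chartD_bijective hy.2.2.2).1 _)).symm.trans ?_
      exact finrank_range_orbitMap x₀ _)
    refine ⟨(extChartAt 𝓘(ℝ, V) g).source ∩ extChartAt 𝓘(ℝ, V) g ⁻¹' O,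
      Filter.inter_mem (extChartAt_source_mem_nhds g)
        ((continuousAt_extChartAt g).preimage_mem_nhds hO), (dimH_mono ?_).trans hd⟩
    rintro _ ⟨h, ⟨h1, h2⟩, rfl⟩
    refine ⟨_, h2, ?_⟩
    unfold localExpr
    rw [(extChartAt 𝓘(ℝ, V) g).left_inv h1]
  choose! O hO hd using hloc
  obtain ⟨T, hTS, hT, hcov⟩ := TopologicalSpace.countable_cover_nhdsWithin
    fun g hg => mem_nhdsWithin_of_mem_nhds (hO g hg)
  have hdim : dimH ((fun h => c (orbitMap G x₀ h)) '' S) ≤ e := by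
    refine (dimH_mono (Set.image_mono hcov)).trans ?_
    rw [Set.image_iUnion₂, dimH_bUnion hT]
    exact iSup₂_le fun g hg => hd g (hTS hg)
  let f := localExpr (E := E) (F := F) x₀ (q x₀) q
  have hf := eventually_contDiffAt_localExpr (E := E) (F := F) hx hw
    (Filter.Eventually.of_forall fun x => hq.1 x)
  let L := fderiv ℝ f (c x₀)
  have hL : L = (chartD (q x₀) (q x₀)).comp ((tangentField (E := E) (F := F) q x₀).comp
      (chartDSymm x₀ (c x₀))) := fderiv_localExpr hx hw (hq.1 x₀)
  let W := LinearMap.ker (L : E →ₗ[ℝ] F)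
  obtain ⟨pr, hpr⟩ := Submodule.ClosedComplemented.of_finiteDimensional W
  have hLs : Function.Surjective L := by
    rw [hL]
    exact (chartD_bijective hw).2.comp ((hq.2 x₀).comp (chartDSymm_bijective hx).2)
  let Φ : E → F × W := fun y => (f y, pr y)
  have hΦ : ∀ᶠ y in 𝓝 (c x₀), ContDiffAt ℝ ∞ Φ y :=
    hf.mono fun y hy => hy.1.prodMk pr.contDiff.contDiffAt
  have hΦd : fderiv ℝ Φ (c x₀) = L.prod pr :=
    ((hf.self_of_nhds.1.differentiableAt (by simp)).hasFDerivAt.prodMk pr.hasFDerivAt).fderiv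
  have hΦs : Function.Surjective (fderiv ℝ Φ (c x₀)) := by
    rw [hΦd]
    rintro ⟨y, w⟩
    obtain ⟨u, hu⟩ := hLs y
    refine ⟨u - pr u + w, Prod.ext ?_ ?_⟩
    · have h2 : L (pr u) = 0 := (pr u).2
      have h3 : L (w : E) = 0 := w.2
      change L _ = _
      rw [map_add, map_sub, h2, h3, hu]; simp
    · change pr _ = _
      rw [map_add, map_sub, hpr, hpr]; simp
  obtain ⟨s, hs1, hs2⟩ := exists_local_section hΦ hΦs
  have hst : Filter.Tendsto s (𝓝 (Φ (c x₀))) (𝓝 (c x₀)) := by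
    have := hs2.self_of_nhds.1.continuousAt
    unfold ContinuousAt at this
    rwa [hs1] at this
  have hι : Filter.Tendsto (fun w : W => (f (c x₀), w)) (𝓝 (pr (c x₀))) (𝓝 (Φ (c x₀))) :=
    (continuous_const.prodMk continuous_id).tendsto _
  -- Since `(f, pr)` is a submersion, every `w` near `pr (c x₀)` is the `pr`-component of a point of
  -- the fibre of `q`, and the fibre is the orbit. The projected orbit thus contains an open subset
  -- of the vertical space `W`, which bounds the dimension of `W` by `e`.
  have hnhds : pr '' ((fun h => c (orbitMap G x₀ h)) '' S) ∈ 𝓝 (pr (c x₀)) := by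
    filter_upwards [hι.eventually hs2, hι.eventually (hst.eventually hf)] with w h1 h2
    have h3 : f (s (f (c x₀), w)) = f (c x₀) := congrArg Prod.fst h1.2
    have h4 : pr (s (f (c x₀), w)) = w := congrArg Prod.snd h1.2
    have h5 : f (c x₀) = extChartAt 𝓘(ℝ, F) (q x₀) (q x₀) := by
      change extChartAt 𝓘(ℝ, F) (q x₀) (q (c.symm (c x₀))) = _
      rw [c.left_inv hx]
    have h6 := (extChartAt 𝓘(ℝ, F) (q x₀)).injOn h2.2.2.2 hw (h3.trans h5)
    obtain ⟨g, hg⟩ := hfib x₀ (c.symm (s (f (c x₀), w))) h6.symm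
    refine ⟨s (f (c x₀), w), ⟨g, ?_, ?_⟩, h4⟩
    · change g • x₀ ∈ c.source
      rw [hg]; exact c.map_target h2.2.2.1
    · change c (g • x₀) = _
      rw [hg]; exact c.right_inv h2.2.2.1
  have hWe : Module.finrank ℝ W ≤ e := by
    have h1 := Real.dimH_of_mem_nhds hnhds
    have h2 := (pr.lipschitz.dimH_image_le ((fun h => c (orbitMap G x₀ h)) '' S)).trans hdim
    rw [h1] at h2
    exact_mod_cast h2
  -- Conversely the orbit directions are vertical, because `q` is constant on orbits; the dimension
  -- bound turns this inclusion into an equality.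
  have hRW : R.map (chartD (E := E) x₀ x₀ : E →ₗ[ℝ] E) ≤ W := by
    rintro _ ⟨_, ⟨ξ, rfl⟩, rfl⟩
    change L (chartD x₀ x₀ (tangentField (E := V) (F := E) (orbitMap G x₀) 1 ξ)) = 0
    rw [hL]
    have h1 : ∀ v, chartDSymm x₀ (c x₀) (chartD x₀ x₀ v) = v := fun v =>
      congrArg (fun L : E →L[ℝ] E => L v) (chartDSymm_comp_chartD hx)
    have h2 := tangentField_comp (E := V) (F := E) (F' := F) (f := orbitMap G x₀) (g := q) (x := 1)
      (hq.1 _) (horb 1)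
    have h3 : (fun g : G => q (orbitMap G x₀ g)) = fun _ => q x₀ := by
      funext g; exact hinv g x₀
    rw [h3, tangentField_const] at h2
    have h4 : orbitMap G x₀ 1 = x₀ := one_smul G x₀
    rw [h4] at h2
    have h5 : tangentField (E := E) (F := F) q x₀ (tangentField (E := V) (F := E)
      (orbitMap G x₀) 1 ξ) = 0 := congrArg (fun L : V →L[ℝ] F => L ξ) h2.symm
    simp only [ContinuousLinearMap.comp_apply, h1, h5, map_zero]
  have hfr : Module.finrank ℝ (R.map (chartD (E := E) x₀ x₀ : E →ₗ[ℝ] E)) = e :=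
    (LinearEquiv.finrank_eq (Submodule.equivMapOfInjective _ (chartD_bijective hx).1 _)).symm
  have heq := Submodule.eq_of_le_of_finrank_le hRW (hWe.trans_eq hfr.symm)
  have hvW : chartD x₀ x₀ v ∈ W := by
    change L (chartD x₀ x₀ v) = 0
    rw [hL]
    have h1 : ∀ v, chartDSymm x₀ (c x₀) (chartD x₀ x₀ v) = v := fun v =>
      congrArg (fun L : E →L[ℝ] E => L v) (chartDSymm_comp_chartD hx)
    simp only [ContinuousLinearMap.comp_apply, h1, hv, map_zero]
  rw [← heq] at hvW
  obtain ⟨_, ⟨ξ, rfl⟩, h⟩ := hvW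
  exact ⟨ξ, ((chartD_bijective hx).1 h).symm⟩

/-- Along a fibre of a quotient submersion, the action moves a local section smoothly onto a
neighbourhood. -/
theorem exists_slice {q : M → N}
    (hq : IsSmoothSubmersion (E := E) (F := F) q) (hinv : ∀ (g : G) (x : M), q (g • x) = q x)
    (hfib : ∀ x y, q x = q y → ∃ g : G, g • x = y)
    (hspan : ∀ (x : M) (v : E), tangentField (E := E) (F := F) q x v = 0 →
      ∃ ξ : V, v = tangentField (E := V) (F := E) (orbitMap G x) 1 ξ)
    {y₀ : N} {s : N → M}
    (hs : ∀ᶠ y in 𝓝 y₀, ContMDiffAt 𝓘(ℝ, F) 𝓘(ℝ, E) ∞ s y ∧ q (s y) = y) (x₁ : M)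
    (hx₁ : q x₁ = y₀) :
    ∃ γ : M → G, ∀ᶠ x in 𝓝 x₁, ContMDiffAt 𝓘(ℝ, E) 𝓘(ℝ, V) ∞ γ x ∧ γ x • s (q x) = x := by
  have key : ∃ γ : M → G, ∀ᶠ x in 𝓝 (s y₀),
      ContMDiffAt 𝓘(ℝ, E) 𝓘(ℝ, V) ∞ γ x ∧ γ x • s (q x) = x := by
    set x₀ := s y₀ with hx₀
    let c := extChartAt 𝓘(ℝ, E) x₀
    let cG := extChartAt 𝓘(ℝ, V) (1 : G)
    let cN := extChartAt 𝓘(ℝ, F) y₀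
    have hc := mem_extChartAt_source (I := 𝓘(ℝ, E)) x₀
    have hcG := mem_extChartAt_source (I := 𝓘(ℝ, V)) (1 : G)
    have hcN := mem_extChartAt_source (I := 𝓘(ℝ, F)) y₀
    -- The map `(g, y) ↦ g • s y` has surjective differential at `(1, y₀)`: the orbit directions
    -- fill the vertical space and the image of the differential of `s` complements it. The group
    -- component of a local right inverse is the desired `γ`.
    let ψ : V × F → M := fun p => cG.symm p.1 • s (cN.symm p.2)
    let Ψ : V × F → E := fun p => c (ψ p)
    let a : V × F := (cG 1, cN y₀)
    have hfst : Filter.Tendsto (Prod.fst : V × F → V) (𝓝 a) (𝓝 (cG 1)) := continuous_fst.tendsto a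
    have hsnd : Filter.Tendsto (Prod.snd : V × F → F) (𝓝 a) (𝓝 (cN y₀)) := continuous_snd.tendsto a
    have hψa : ψ a = x₀ := by
      change cG.symm (cG 1) • s (cN.symm (cN y₀)) = x₀
      rw [cG.left_inv hcG, cN.left_inv hcN, one_smul]
    have hcNt : Filter.Tendsto cN.symm (𝓝 (cN y₀)) (𝓝 y₀) := tendsto_extChartAt_symm y₀
    have hψ : ∀ᶠ p in 𝓝 a, ContMDiffAt 𝓘(ℝ, V × F) 𝓘(ℝ, E) ∞ ψ p := by
      filter_upwards [hfst.eventually (extChartAt_target_mem_nhds (I := 𝓘(ℝ, V)) (1 : G)),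
        hsnd.eventually (extChartAt_target_mem_nhds (I := 𝓘(ℝ, F)) y₀),
        hsnd.eventually (hcNt.eventually hs)] with p h1 h2 h3
      refine ContMDiffAt.smul (I := 𝓘(ℝ, V)) (I' := 𝓘(ℝ, E)) ?_ ?_
      · exact ContMDiffAt.comp (I' := 𝓘(ℝ, V)) p (g := cG.symm) (f := Prod.fst)
          (contMDiffAt_extChartAt_symm h1) contDiffAt_fst.contMDiffAt
      · refine ContMDiffAt.comp (I' := 𝓘(ℝ, F)) p (g := s) (f := fun p : V × F => cN.symm p.2) h3.1 ?_
        exact ContMDiffAt.comp (I' := 𝓘(ℝ, F)) p (g := cN.symm) (f := Prod.snd)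
          (contMDiffAt_extChartAt_symm h2) contDiffAt_snd.contMDiffAt
    have hψs : ∀ᶠ p in 𝓝 a, ψ p ∈ c.source :=
      hψ.self_of_nhds.continuousAt.eventually ((isOpen_extChartAt_source x₀).mem_nhds (hψa ▸ hc))
    have hΨ : ∀ᶠ p in 𝓝 a, ContDiffAt ℝ ∞ Ψ p := by
      filter_upwards [hψ, hψs] with p h1 h2
      exact (ContMDiffAt.comp (I' := 𝓘(ℝ, E)) p (g := c) (contMDiffAt_chart h2) h1).contDiffAt
    have hΨd := (hΨ.self_of_nhds.differentiableAt (by simp)).hasFDerivAt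
    have hd1 : ∀ ξ : V, fderiv ℝ Ψ a (chartD (1 : G) 1 ξ, 0) =
        chartD x₀ x₀ (tangentField (E := V) (F := E) (orbitMap G x₀) 1 ξ) := by
      intro ξ
      have horb : orbitMap G x₀ 1 = x₀ := one_smul G x₀
      have e1 : (fun v => Ψ (v, cN y₀)) = localExpr (E := V) (F := E) 1 x₀ (orbitMap G x₀) := by
        funext v
        change c (cG.symm v • s (cN.symm (cN y₀))) = _
        rw [cN.left_inv hcN]
        rfl
      have h1 : HasFDerivAt (fun v => Ψ (v, cN y₀))
          ((fderiv ℝ Ψ a).comp (ContinuousLinearMap.inl ℝ V F)) (cG 1) :=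
        HasFDerivAt.comp (f := fun v => (v, cN y₀)) (cG 1) hΨd (hasFDerivAt_prodMk_left (cG 1) (cN y₀))
      rw [e1] at h1
      have h2 := fderiv_localExpr (E := V) (F := E) (f := orbitMap G x₀) hcG
        (by rw [horb]; exact hc) (contMDiff_orbitMap x₀ 1)
      have h3 := congrArg (fun L : V →L[ℝ] E => L (chartD (1 : G) 1 ξ)) (h1.fderiv.symm.trans h2)
      have h4 : chartDSymm (1 : G) (cG 1) (chartD (1 : G) 1 ξ) = ξ :=
        congrArg (fun L : V →L[ℝ] V => L ξ) (chartDSymm_comp_chartD hcG)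
      simp only [ContinuousLinearMap.comp_apply, horb] at h3
      rw [h4] at h3
      exact h3
    have hd2 : ∀ η : F, fderiv ℝ Ψ a (0, chartD y₀ y₀ η) =
        chartD x₀ x₀ (tangentField (E := F) (F := E) s y₀ η) := by
      intro η
      have e1 : (fun y => Ψ (cG 1, y)) = localExpr (E := F) (F := E) y₀ x₀ s := by
        funext y
        change c (cG.symm (cG 1) • s (cN.symm y)) = _
        rw [cG.left_inv hcG, one_smul]
        rfl
      have h1 : HasFDerivAt (fun y => Ψ (cG 1, y))
          ((fderiv ℝ Ψ a).comp (ContinuousLinearMap.inr ℝ V F)) (cN y₀) :=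
        hΨd.comp (cN y₀) (hasFDerivAt_prodMk_right (cG 1) (cN y₀))
      rw [e1] at h1
      have h2 := fderiv_localExpr (E := F) (F := E) (f := s) hcN hc hs.self_of_nhds.1
      have h3 := congrArg (fun L : F →L[ℝ] E => L (chartD y₀ y₀ η)) (h1.fderiv.symm.trans h2)
      have h4 : chartDSymm y₀ (cN y₀) (chartD y₀ y₀ η) = η :=
        congrArg (fun L : F →L[ℝ] F => L η) (chartDSymm_comp_chartD hcN)
      simp only [ContinuousLinearMap.comp_apply] at h3
      rw [h4] at h3
      exact h3
    have hqs : ∀ η, tangentField (E := E) (F := F) q x₀ (tangentField (E := F) (F := E) s y₀ η) = η := by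
      intro η
      have h1 := tangentField_comp (E := F) (F := E) (F' := F) (f := s) (g := q) (x := y₀) (hq.1 _)
        hs.self_of_nhds.1
      rw [tangentField_congr (hs.mono fun y hy => hy.2), tangentField_id] at h1
      exact (congrArg (fun L : F →L[ℝ] F => L η) h1).symm
    have hsurj : Function.Surjective (fderiv ℝ Ψ a) := by
      intro u'
      obtain ⟨u, rfl⟩ := (chartD_bijective hc).2 u'
      obtain ⟨ξ, hξ⟩ := hspan x₀ (u - tangentField (E := F) (F := E) s y₀
        (tangentField (E := E) (F := F) q x₀ u)) (by rw [map_sub, hqs, sub_self])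
      refine ⟨(chartD (1 : G) 1 ξ, 0) + (0, chartD y₀ y₀ (tangentField (E := E) (F := F) q x₀ u)), ?_⟩
      rw [map_add, hd1, hd2, ← hξ, ← map_add, sub_add_cancel]
    obtain ⟨t, ht1, ht2⟩ := exists_local_section hΨ hsurj
    have hΨa : Ψ a = c x₀ := congrArg c hψa
    rw [hΨa] at ht1 ht2
    have htt : Filter.Tendsto t (𝓝 (c x₀)) (𝓝 a) := by
      have := ht2.self_of_nhds.1.continuousAt
      unfold ContinuousAt at this
      rwa [ht1] at this
    have hct : Filter.Tendsto c (𝓝 x₀) (𝓝 (c x₀)) := continuousAt_extChartAt x₀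
    refine ⟨fun x => cG.symm (t (c x)).1, ?_⟩
    filter_upwards [(isOpen_extChartAt_source x₀).mem_nhds hc, hct.eventually ht2,
      hct.eventually (htt.eventually hψs),
      hct.eventually (htt.eventually (hfst.eventually
        (extChartAt_target_mem_nhds (I := 𝓘(ℝ, V)) (1 : G)))),
      hct.eventually (htt.eventually (hsnd.eventually (hcNt.eventually hs)))] with x h1 h2 h3 h4 h5
    have h6 : ψ (t (c x)) = x := c.injOn h3 h1 h2.2
    refine ⟨?_, ?_⟩
    · refine ContMDiffAt.comp (I' := 𝓘(ℝ, V)) x (g := cG.symm) (f := fun x => (t (c x)).1)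
        (contMDiffAt_extChartAt_symm h4) ?_
      exact ContMDiffAt.comp (I' := 𝓘(ℝ, E)) x (g := fun y => (t y).1) (f := c)
        (contDiffAt_fst.comp _ h2.1).contMDiffAt (contMDiffAt_chart h1)
    -- Invariance of `q` forces the base component of the right inverse to be `q x`.
    · have h7 : q x = cN.symm (t (c x)).2 := by
        conv_lhs => rw [← h6]
        change q (cG.symm (t (c x)).1 • s (cN.symm (t (c x)).2)) = _
        rw [hinv, h5.2]
      rw [h7]
      exact h6
  obtain ⟨γ, hγ⟩ := key
  obtain ⟨g, rfl⟩ := hfib (s y₀) x₁ (by rw [hx₁, hs.self_of_nhds.2])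
  -- Conjugation by translations: a point near `g • s y₀` is moved by `g⁻¹` to the neighbourhood of
  -- `s y₀` already treated.
  refine ⟨fun x => g * γ (g⁻¹ • x), ?_⟩
  have hg := contMDiff_translation (E := E) (M := M) V g⁻¹
  have hgt : Filter.Tendsto (fun x : M => g⁻¹ • x) (𝓝 (g • s y₀)) (𝓝 (s y₀)) := by
    have := hg.continuous.tendsto (g • s y₀)
    rwa [inv_smul_smul] at this
  filter_upwards [hgt.eventually hγ] with x hx
  refine ⟨?_, ?_⟩
  · refine ContMDiffAt.comp (I' := 𝓘(ℝ, V)) x (g := fun h : G => g * h)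
      (f := fun x : M => γ (g⁻¹ • x)) (contMDiff_mul_left (I := 𝓘(ℝ, V)) (n := ∞) _) ?_
    exact ContMDiffAt.comp (I' := 𝓘(ℝ, E)) x (g := γ) (f := fun x : M => g⁻¹ • x) hx.1 (hg x)
  · have h1 := hx.2
    rw [hinv] at h1
    rw [mul_smul, h1, smul_inv_smul]

end Orbits
end

noncomputable section

set_option linter.unusedSectionVars false

theorem altWedge_const_left {V : Type*} [NormedAddCommGroup V] [NormedSpace ℝ V] {k : ℕ}
    (b : V [⋀^Fin 0]→L[ℝ] ℝ) (a : V [⋀^Fin k]→L[ℝ] ℝ) :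
    altWedge b a = degCast (zero_add k).symm (b 0 • a) := by
  ext v
  rw [altWedge_apply]
  have h1 : juxt (⇑b) (⇑a) = fun w => b 0 * (degCast (zero_add k).symm a) w := by
    funext w
    rw [degCast_apply]
    simp only [juxt]
    congr 1
    · congr 1
      exact Subsingleton.elim _ _
    · congr 1
      funext j
      congr 1
      ext
      simp
  rw [h1]
  refine (congrArg _ ((signedSum_smul (b 0) (⇑(degCast (zero_add k).symm a)) v).trans
    (by rw [signedSum_alternating]))).trans ?_
  simp only [degCast_apply, ContinuousAlternatingMap.smul_apply, smul_eq_mul]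
  have := Nat.factorial_pos k
  simp
  field_simp

/-! ### Global finite generators of a Pfaffian system -/

section Pfaffian

variable {E : Type*} [NormedAddCommGroup E] [NormedSpace ℝ E] [FiniteDimensional ℝ E]
  {M : Type*} [TopologicalSpace M] [ChartedSpace E M] [IsManifold 𝓘(ℝ, E) ∞ M] {k l : ℕ}

theorem extD_extD {β : DForm E M k} (hβ : IsSmoothForm β) : extD (extD β) = 0 := by
  funext x
  have h : localRep x (extD β) =ᶠ[𝓝 (extChartAt 𝓘(ℝ, E) x x)] extDeriv (localRep x β) := by
    filter_upwards [extChartAt_target_mem_nhds (I := 𝓘(ℝ, E)) x] with y hy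
    exact localRep_extD hy (isSmoothForm_iff.1 hβ _)
  have h2 : extDeriv (localRep x (extD β)) (extChartAt 𝓘(ℝ, E) x x) = 0 := by
    rw [h.extDeriv_eq]
    exact extDeriv_extDeriv_apply (isSmoothForm_iff.1 hβ x) (by simp; exact WithTop.coe_le_coe.2 le_top)
  unfold extD at h2 ⊢
  rw [h2]
  rfl

theorem form_zero_eq (β : DForm E M 0) : β = zeroForm fun x => β x 0 := by
  funext x
  ext v
  rw [Subsingleton.elim v 0]
  rfl

/-- A family of one-forms and their exterior derivatives. -/
inductive FrameGen {ι : Type*} (θ : ι → DForm E M 1) : (k : ℕ) → DForm E M k → Prop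
  | form (i : ι) : FrameGen θ 1 (θ i)
  | diff (i : ι) : FrameGen θ 2 (extD (θ i))

/-- The one-forms of a family and their exterior derivatives, as a set of forms. -/
def frameSet {ι : Type*} (θ : ι → DForm E M 1) : FormSet E M := fun k => {β | FrameGen θ k β}

/-- A finite family of one-forms generating a Pfaffian system. -/
structure IsPfaffianFrame {ι : Type*} (S : FormSet E M) (θ : ι → DForm E M 1) (r : ℕ) : Prop where
  smooth : ∀ i, IsSmoothForm (θ i)
  finrank : ∀ x, Module.finrank ℝ (Submodule.span ℝ (Set.range fun i => θ i x)) = r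
  mem_span : ∀ β ∈ S 1, ∀ x, β x ∈ Submodule.span ℝ (Set.range fun i => θ i x)
  eq_algIdeal : S = algIdeal (frameSet θ)

/-- The forms of degree at least two, those of degree one with values in `J`, and zero. -/
def degreeOneIdeal (J : (x : M) → Submodule ℝ ((TangentSpace 𝓘(ℝ, E) x) [⋀^Fin 1]→L[ℝ] ℝ)) :
    FormSet E M := fun k => {β | (k = 0 → β = 0) ∧ ∀ h : k = 1, ∀ x, formCast h β x ∈ J x}

variable {J : (x : M) → Submodule ℝ ((TangentSpace 𝓘(ℝ, E) x) [⋀^Fin 1]→L[ℝ] ℝ)}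

theorem formWedge_zero_left (α : DForm E M l) : formWedge (0 : DForm E M k) α = 0 := by
  funext x; exact altWedge_zero_left (V := E) (α x)

theorem formWedge_zero_right (α : DForm E M l) : formWedge α (0 : DForm E M k) = 0 := by
  funext x; exact altWedge_zero_right (V := E) (α x)

theorem degreeOneIdeal_zero (k : ℕ) : (0 : DForm E M k) ∈ degreeOneIdeal J k := by
  refine ⟨fun _ => rfl, ?_⟩
  rintro rfl x
  exact (J x).zero_mem

theorem smul_mem_degreeOneIdeal (u : M → ℝ) {β : DForm E M k} (hβ : β ∈ degreeOneIdeal J k) :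
    formSmul u β ∈ degreeOneIdeal J k := by
  refine ⟨fun h => ?_, ?_⟩
  · rw [hβ.1 h]; funext x; exact smul_zero _
  · rintro rfl x
    exact (J x).smul_mem _ (hβ.2 rfl x)

theorem formWedge_zeroForm_left (u : M → ℝ) (β : DForm E M k) :
    formWedge (zeroForm u) β = formCast (zero_add k).symm (formSmul u β) := by
  funext x
  exact altWedge_const_left (V := E) (ContinuousAlternatingMap.constOfIsEmpty ℝ E (Fin 0) (u x)) (β x) 

theorem isIdealSet_degreeOneIdeal : IsIdealSet (degreeOneIdeal J) := by
  refine ⟨degreeOneIdeal_zero, ?_, ?_, ?_⟩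
  · intro k β η hβ hη
    refine ⟨fun h => by rw [hβ.1 h, hη.1 h, add_zero], ?_⟩
    rintro rfl x
    exact (J x).add_mem (hβ.2 rfl x) (hη.2 rfl x)
  · intro k l β α hβ _
    rcases k with _ | k
    · rw [hβ.1 rfl, formWedge_zero_left]; exact degreeOneIdeal_zero _
    rcases l with _ | l
    · rw [form_zero_eq α, formWedge_zeroForm]; exact smul_mem_degreeOneIdeal _ hβ
    exact ⟨fun h => by omega, fun h => by omega⟩
  · intro k l β α hβ _
    rcases k with _ | k
    · rw [hβ.1 rfl, formWedge_zero_right]; exact degreeOneIdeal_zero _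
    rcases l with _ | l
    · rw [form_zero_eq α, formWedge_zeroForm_left]
      have h : ∀ {m n : ℕ} (h : m = n) {γ : DForm E M m}, γ ∈ degreeOneIdeal J m →
          formCast h γ ∈ degreeOneIdeal J n := by
        rintro m _ rfl γ hγ; exact hγ
      exact h _ (smul_mem_degreeOneIdeal _ hβ)
    exact ⟨fun h => by omega, fun h => by omega⟩

/-- The ideal has no nonzero functions, and exterior derivatives of its 1-forms land in degree two.
Hence differentiation adds nothing in degree one, and the 1-forms of the system take values in `J`.
-/
theorem diffIdeal_sectionsOf_subset (k : ℕ) :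
    diffIdeal (sectionsOf J) k ⊆ degreeOneIdeal J k := by
  refine diffIdeal_subset isIdealSet_degreeOneIdeal ?_ ?_ k
  · rintro k β ⟨hβ, h⟩
    exact ⟨fun h => by omega, fun _ x => h x⟩
  · intro k β hβ
    refine ⟨fun h => by omega, fun h x => ?_⟩
    obtain rfl : k = 0 := by omega
    rw [hβ.1 rfl]
    have : extD (0 : DForm E M 0) x = 0 := extD_zero_form (Filter.Eventually.of_forall fun _ => rfl)
    change extD (0 : DForm E M 0) x ∈ J x
    rw [this]
    exact (J x).zero_mem

variable [T2Space M] [SigmaCompactSpace M]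

/-- Local frames of the bundle, cut off by the functions of a colouring, form a finite global family
that spans it at every point, though redundantly. Constant rank makes the coefficients of sections
smooth. As `d² = 0`, the algebraic ideal of the family and its differentials is already closed under
`d`, so it is the whole differential ideal. -/
theorem exists_isPfaffianFrame {S : FormSet E M} (hS : IsPfaffianSystem S) :
    ∃ (ι : Type) (_ : Fintype ι) (θ : ι → DForm E M 1) (r : ℕ), IsPfaffianFrame S θ r := by
  obtain ⟨r, J, hJ, rfl⟩ := hS
  choose σ hσ hσJ using hJ
  obtain ⟨U, C, hU⟩ := exists_colouring_of_eventually (E := E) hσJ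
  let θ : Fin C.num × Fin r → DForm E M 1 := fun i => C.glueForm i.1 fun z => σ z i.2
  have hθ : ∀ i, IsSmoothForm (θ i) := fun i =>
    C.isSmoothForm_glueForm _ fun z x _ => isSmoothForm_iff.1 (hσ z i.2) x
  have hspan : ∀ x, Submodule.span ℝ (Set.range fun i => θ i x) = J x := by
    intro x
    refine le_antisymm (Submodule.span_le.2 ?_) ?_
    · rintro _ ⟨i, rfl⟩
      rcases C.zero_or_mem' i.1 x with h | h
      · change C.b i.1 x • σ (C.p i.1 x) i.2 x ∈ J x
        rw [h, zero_smul]; exact (J x).zero_mem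
      · refine (J x).smul_mem _ ?_
        rw [← (hU _ _ h).2]
        exact Submodule.subset_span ⟨i.2, rfl⟩
    · obtain ⟨c, hc⟩ : ∃ c, C.b c x ≠ 0 := by
        by_contra! hne
        have := C.sum_eq_one x
        simp [hne] at this
      have h := (C.zero_or_mem' c x).resolve_left hc
      rw [← (hU _ _ h).2]
      refine Submodule.span_le.2 ?_
      rintro _ ⟨i, rfl⟩
      have h1 : θ (c, i) x ∈ Submodule.span ℝ (Set.range fun i => θ i x) :=
        Submodule.subset_span ⟨_, rfl⟩
      have h2 := Submodule.smul_mem _ (C.b c x)⁻¹ h1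
      change (C.b c x)⁻¹ • C.b c x • σ (C.p c x) i x ∈ _ at h2
      rwa [inv_smul_smul₀ hc] at h2
  have hrank : ∀ x, Module.finrank ℝ (Submodule.span ℝ (Set.range fun i => θ i x)) = r := by
    intro x
    rw [hspan, ← (hσJ x).self_of_nhds.2, finrank_span_eq_card (hσJ x).self_of_nhds.1]
    simp
  refine ⟨_, inferInstance, θ, r, hθ, hrank, ?_, ?_⟩
  · intro β hβ x
    rw [hspan]
    exact (diffIdeal_sectionsOf_subset 1 hβ).2 rfl x
  · have hθJ : ∀ i, θ i ∈ diffIdeal (sectionsOf J) 1 := fun i =>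
      DiffGen.of (SectionOf.mk (hθ i) fun x => by
        rw [← hspan]; exact Submodule.subset_span ⟨i, rfl⟩)
    have hI := isIdealSet_algIdeal (frameSet θ)
    funext k
    refine subset_antisymm (diffIdeal_subset hI ?_ ?_ k)
      (algIdeal_subset (isIdealSet_diffIdeal _) ?_ k)
    · rintro k β ⟨hβ, h⟩
      obtain ⟨u, hu, rfl⟩ := exists_coeff_of_finrank hθ hβ hrank (fun x => by rw [hspan]; exact h x)
      exact hI.sum_mem _ fun i _ => hI.smul_mem (hu i) (AlgGen.of (FrameGen.form i))
    · intro k β hβ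
      refine (extD_mem_algIdeal ?_ ?_ hβ).2
      · rintro k β (i | i)
        · exact hθ i
        · exact (hθ i).extD
      · rintro k β (i | i)
        · exact AlgGen.of (FrameGen.diff i)
        · rw [extD_extD (hθ i)]; exact AlgGen.zero _
    · rintro k β (i | i)
      · exact hθJ i
      · exact DiffGen.d (hθJ i)

variable {ι : Type*} {S : FormSet E M} {θ : ι → DForm E M 1} {r : ℕ}

namespace IsPfaffianFrame

theorem isIdealSet (h : IsPfaffianFrame S θ r) : IsIdealSet S := by
  rw [h.eq_algIdeal]; exact isIdealSet_algIdeal _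

theorem form_mem (h : IsPfaffianFrame S θ r) (i : ι) : θ i ∈ S 1 := by
  rw [h.eq_algIdeal]; exact AlgGen.of (FrameGen.form i)

theorem smooth_extD_mem (h : IsPfaffianFrame S θ r) {β : DForm E M k} (hβ : β ∈ S k) :
    IsSmoothForm β ∧ extD β ∈ S (k + 1) := by
  rw [h.eq_algIdeal] at hβ ⊢
  refine extD_mem_algIdeal ?_ ?_ hβ
  · rintro k β (i | i)
    · exact h.smooth i
    · exact (h.smooth i).extD
  · rintro k β (i | i)
    · exact AlgGen.of (FrameGen.diff i)
    · rw [extD_extD (h.smooth i)]; exact AlgGen.zero _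

theorem isEDS (h : IsPfaffianFrame S θ r) : IsEDS S :=
  ⟨fun hβ => (h.smooth_extD_mem hβ).1, h.isIdealSet.zero_mem, h.isIdealSet.add_mem,
    h.isIdealSet.wedge_right, h.isIdealSet.wedge_left, fun hβ => (h.smooth_extD_mem hβ).2⟩

theorem mem_of_span [Fintype ι] (h : IsPfaffianFrame S θ r) {β : DForm E M 1} (hβ : IsSmoothForm β)
    (hs : ∀ x, β x ∈ Submodule.span ℝ (Set.range fun i => θ i x)) : β ∈ S 1 := by
  obtain ⟨u, hu, rfl⟩ := exists_coeff_of_finrank h.smooth hβ h.finrank hs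
  exact h.isIdealSet.sum_mem _ fun i _ => h.isIdealSet.smul_mem (hu i) (h.form_mem i)

end IsPfaffianFrame

end Pfaffian
end

noncomputable section

set_option linter.unusedSectionVars false

/-! ### Projections onto vertical spaces and the bundles of 1-forms they define -/

section Splittings

variable {E : Type*} [NormedAddCommGroup E] [NormedSpace ℝ E] [FiniteDimensional ℝ E]
  {F : Type*} [NormedAddCommGroup F] [NormedSpace ℝ F] [FiniteDimensional ℝ F]
  {M : Type*} [TopologicalSpace M] [ChartedSpace E M] [IsManifold 𝓘(ℝ, E) ∞ M]
  {N : Type*} [TopologicalSpace N] [ChartedSpace F N] [IsManifold 𝓘(ℝ, F) ∞ N] {k : ℕ}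

theorem contDiffAt_clm_of_apply {f : E → E →L[ℝ] F} {y : E}
    (h : ∀ v, ContDiffAt ℝ ∞ (fun z => f z v) y) : ContDiffAt ℝ ∞ f y := by
  let d := Module.finrank ℝ E
  have hd : d = Module.finrank ℝ (Fin d → ℝ) := (Module.finrank_fin_fun ℝ).symm
  let e₁ := ContinuousLinearEquiv.ofFinrankEq hd
  let e₂ := (e₁.arrowCongr (1 : F ≃L[ℝ] F)).trans (ContinuousLinearEquiv.piRing (Fin d))
  rw [← Function.id_comp f, ← e₂.symm_comp_self]
  exact e₂.symm.contDiff.contDiffAt.comp y (contDiffAt_pi.2 fun i => h _)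

theorem smoothFieldAt_model {A : E → E →L[ℝ] E} {y : E} (hA : ContDiffAt ℝ ∞ A y) :
    SmoothFieldAt (E := E) (F := E) (M := E) (N := E) (fun y => y) A y := by
  have h1 : ∀ z w : E, chartD (E := E) (M := E) z w = ContinuousLinearMap.id ℝ E := by
    intro z w
    unfold chartD
    rw [extChartAt_model_space_eq_id]
    exact mfderiv_id
  have h2 : ∀ z w : E, chartDSymm (E := E) (M := E) z w = ContinuousLinearMap.id ℝ E := by
    intro z w
    unfold chartDSymm
    rw [extChartAt_model_space_eq_id]
    exact mfderiv_id
  refine ⟨Filter.Eventually.of_forall fun z => contMDiffAt_id, ?_⟩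
  have h3 : coordMap (E := E) (F := E) (M := E) (N := E) y (fun y => y) A = A := by
    funext z
    unfold coordMap
    rw [h1, h2, extChartAt_model_space_eq_id]
    rfl
  rw [h3, extChartAt_model_space_eq_id]
  exact hA

/-- The field of endomorphisms with given expression in a chart. -/
def chartField (z : M) (A : E → E →L[ℝ] E) (x : M) : E →L[ℝ] E :=
  (chartDSymm z (extChartAt 𝓘(ℝ, E) z x)).comp ((A (extChartAt 𝓘(ℝ, E) z x)).comp (chartD z x))

theorem smoothFieldAt_chartField {z x : M} (hx : x ∈ (extChartAt 𝓘(ℝ, E) z).source)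
    {A : E → E →L[ℝ] E} (hA : ContDiffAt ℝ ∞ A (extChartAt 𝓘(ℝ, E) z x)) :
    SmoothFieldAt (fun x => x) (chartField z A) x := by
  have h1 : SmoothFieldAt (extChartAt 𝓘(ℝ, E) z) (chartD (E := E) z) x := by
    refine smoothFieldAt_tangentField ?_
    filter_upwards [(isOpen_extChartAt_source z).mem_nhds hx] with x hx
    exact contMDiffAt_chart hx
  have h2 : SmoothFieldAt (E := E) (F := E) (M := E) (N := M) (extChartAt 𝓘(ℝ, E) z).symm
      (chartDSymm (E := E) z) (extChartAt 𝓘(ℝ, E) z x) := by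
    refine smoothFieldAt_tangentField ?_
    filter_upwards [(isOpen_extChartAt_target z).mem_nhds ((extChartAt 𝓘(ℝ, E) z).map_source hx)]
      with y hy
    exact contMDiffAt_extChartAt_symm hy
  have h3 := SmoothFieldAt.comp (E := E) (F := E) (F' := E) h2
    (SmoothFieldAt.comp (E := E) (F := E) (F' := E) (φ := extChartAt 𝓘(ℝ, E) z)
      (ψ := fun y : E => y) (smoothFieldAt_model hA) h1)
  refine h3.congr ?_ (Filter.Eventually.of_forall fun x => rfl)
  filter_upwards [(isOpen_extChartAt_source z).mem_nhds hx] with x hx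
  exact (extChartAt 𝓘(ℝ, E) z).left_inv hx

/-- In a chart, let `W` be the vertical space at `x₀`, `Θ` the covectors `θ` taken together, and `A`
a left inverse of the injective restriction of `Θ` to `W`. Then `B = (dq, A Θ)` is invertible at
`x₀`, hence nearby, and `Q = B⁻¹ (0, A Θ)` is the projection onto the kernel of `dq` along the
kernel of `A Θ`. The latter contains the common kernel of `θ`. -/
theorem exists_local_splitting {q : M → N} (hq : IsSmoothSubmersion (E := E) (F := F) q)
    {ι : Type*} [Fintype ι] {θ : ι → DForm E M 1} (hθ : ∀ i, IsSmoothForm (θ i)) (x₀ : M)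
    (hinj : ∀ v : E, (∀ i, θ i x₀ (fun _ => v) = 0) → tangentField (E := E) (F := F) q x₀ v = 0 →
      v = 0) :
    ∃ Q : M → E →L[ℝ] E, ∀ᶠ x in 𝓝 x₀, SmoothFieldAt (fun x => x) Q x ∧
      (∀ v, tangentField (E := E) (F := F) q x (Q x v) = 0) ∧
      (∀ v, tangentField (E := E) (F := F) q x v = 0 → Q x v = v) ∧
      ∀ v : E, (∀ i, θ i x (fun _ => v) = 0) → Q x v = 0 := by
  let c := extChartAt 𝓘(ℝ, E) x₀
  have hx := mem_extChartAt_source (I := 𝓘(ℝ, E)) x₀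
  have hw := mem_extChartAt_source (I := 𝓘(ℝ, F)) (q x₀)
  let f := localExpr (E := E) (F := F) x₀ (q x₀) q
  have hf := eventually_contDiffAt_localExpr (E := E) (F := F) hx hw
    (Filter.Eventually.of_forall fun x => hq.1 x)
  let Θ : E → E →L[ℝ] (ι → ℝ) := fun y => ContinuousLinearMap.pi fun i =>
    (ContinuousAlternatingMap.ofSubsingleton ℝ E ℝ (0 : Fin 1)).symm (localRep x₀ (θ i) y)
  have hΘv : ∀ y v i, Θ y v i = localRep x₀ (θ i) y (fun _ => v) := fun _ _ _ => rfl
  have hΘ : ∀ y ∈ c.target, ContDiffAt ℝ ∞ Θ y := by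
    intro y hy
    refine contDiffAt_clm_of_apply fun v => contDiffAt_pi.2 fun i => ?_
    exact contDiffAt_alternating_iff.1 (contDiffAt_localRep hy (isSmoothForm_iff.1 (hθ i) _)) _
  have hΘx : ∀ x ∈ c.source, ∀ v i, Θ (c x) (chartD x₀ x v) i = θ i x (fun _ => v) := by
    intro x hx v i
    rw [eq_localRep hx (θ i), hΘv]
    rfl
  have hinv : ∀ x ∈ c.source, ∀ v, chartDSymm x₀ (c x) (chartD x₀ x v) = v := fun x hx v =>
    congrArg (fun L : E →L[ℝ] E => L v) (chartDSymm_comp_chartD hx)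
  have hinv' : ∀ y ∈ c.target, ∀ v, chartD x₀ (c.symm y) (chartDSymm x₀ y v) = v := fun y hy v =>
    congrArg (fun L : E →L[ℝ] E => L v) (chartD_comp_chartDSymm hy)
  let L := fderiv ℝ f (c x₀)
  have hL : ∀ v, L (chartD x₀ x₀ v) =
      chartD (q x₀) (q x₀) (tangentField (E := E) (F := F) q x₀ v) := by
    intro v
    have := congrArg (fun L : E →L[ℝ] F => L (chartD x₀ x₀ v)) (fderiv_localExpr hx hw (hq.1 x₀))
    simp only [ContinuousLinearMap.comp_apply] at this
    rw [show L = fderiv ℝ (localExpr (E := E) (F := F) x₀ (q x₀) q) (c x₀) from rfl, this, hinv x₀ hx]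
  have hLs : Function.Surjective L := by
    intro w
    obtain ⟨w', rfl⟩ := (chartD_bijective hw).2 w
    obtain ⟨v, rfl⟩ := hq.2 x₀ w'
    exact ⟨_, hL v⟩
  let W := LinearMap.ker (L : E →ₗ[ℝ] F)
  let ΘW : W →ₗ[ℝ] (ι → ℝ) := (Θ (c x₀) : E →ₗ[ℝ] (ι → ℝ)).comp W.subtype
  have hΘW : LinearMap.ker ΘW = ⊥ := by
    refine LinearMap.ker_eq_bot'.2 fun w hw0 => ?_
    obtain ⟨v, hv⟩ := (chartD_bijective hx).2 (w : E)
    have h1 : L w = 0 := w.2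
    rw [← hv, hL] at h1
    have h2 := (chartD_bijective hw).1 (h1.trans (map_zero _).symm)
    have h3 := hinj v (fun i => by
      rw [← hΘx x₀ hx v i, hv]
      exact congrFun hw0 i) h2
    ext
    rw [← hv, h3, map_zero]; rfl
  obtain ⟨A', hA'⟩ := ΘW.exists_leftInverse_of_injective hΘW
  let A : (ι → ℝ) →L[ℝ] W := A'.toContinuousLinearMap
  have hA : ∀ w : W, A (Θ (c x₀) w) = w := fun w => congrArg (fun L : W →ₗ[ℝ] W => L w) hA'
  let B : E → E →L[ℝ] F × W := fun y => (fderiv ℝ f y).prod (A.comp (Θ y))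
  have hBinj : Function.Injective (B (c x₀)) := by
    refine (injective_iff_map_eq_zero _).2 fun u hu => ?_
    have h1 : L u = 0 := congrArg Prod.fst hu
    have h2 : A (Θ (c x₀) u) = 0 := congrArg Prod.snd hu
    have h3 := hA ⟨u, h1⟩
    rw [h2] at h3
    exact (congrArg Subtype.val h3).symm
  have hdim : Module.finrank ℝ E = Module.finrank ℝ (F × W) := by
    have h := (L : E →ₗ[ℝ] F).finrank_range_add_finrank_ker
    rw [LinearMap.range_eq_top.2 hLs, finrank_top] at h
    rw [Module.finrank_prod, h]
  let e : E ≃L[ℝ] F × W := (LinearEquiv.ofBijective (B (c x₀) : E →ₗ[ℝ] F × W)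
    ⟨hBinj, (LinearMap.injective_iff_surjective_of_finrank_eq_finrank hdim).1 hBinj⟩
    ).toContinuousLinearEquiv
  have he : (e : E →L[ℝ] F × W) = B (c x₀) := by ext <;> rfl
  have hB : ∀ᶠ y in 𝓝 (c x₀), ContDiffAt ℝ ∞ B y := by
    filter_upwards [hf] with y hy
    refine contDiffAt_clm_of_apply fun v => ContDiffAt.prodMk
      ((hy.1.fderiv_right (m := ∞) (by simp)).clm_apply contDiffAt_const) ?_
    exact A.contDiff.contDiffAt.comp y ((hΘ y hy.2.2.1).clm_apply contDiffAt_const)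
  have hBe : ∀ᶠ y in 𝓝 (c x₀), B y ∈ Set.range ((↑) : (E ≃L[ℝ] F × W) → E →L[ℝ] F × W) :=
    hB.self_of_nhds.continuousAt.eventually (he ▸ ContinuousLinearEquiv.nhds e)
  let Q' : E → E →L[ℝ] E := fun y =>
    (B y).inverse.comp ((ContinuousLinearMap.inr ℝ F W).comp (A.comp (Θ y)))
  have hct : Filter.Tendsto c (𝓝 x₀) (𝓝 (c x₀)) := continuousAt_extChartAt x₀
  refine ⟨chartField x₀ Q', ?_⟩
  filter_upwards [(isOpen_extChartAt_source x₀).mem_nhds hx, hct.eventually hf, hct.eventually hB,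
    hct.eventually hBe] with x h1 h2 h3 h4
  obtain ⟨e', he'⟩ := h4
  have hQ : ContDiffAt ℝ ∞ Q' (c x) := by
    have h5 : ContDiffAt ℝ ∞ (fun y => (B y).inverse) (c x) := by
      refine ContDiffAt.comp (c x) (g := ContinuousLinearMap.inverse) ?_ h3
      rw [← he']; exact contDiffAt_map_inverse e'
    exact h5.clm_comp (contDiffAt_const.clm_comp (contDiffAt_const.clm_comp (hΘ _ h2.2.2.1)))
  have hxx : c.symm (c x) = x := c.left_inv h1
  have hBQ : ∀ u, B (c x) (Q' (c x) u) = (0, A (Θ (c x) u)) := by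
    intro u
    change B (c x) ((B (c x)).inverse _) = _
    rw [← he', ContinuousLinearMap.inverse_equiv]
    exact e'.apply_symm_apply _
  have hBu : ∀ v, fderiv ℝ f (c x) v = chartD (q x₀) (q x)
      (tangentField (E := E) (F := F) q x (chartDSymm x₀ (c x) v)) := by
    intro v
    have := congrArg (fun L : E →L[ℝ] F => L v) h2.2.1
    simp only [ContinuousLinearMap.comp_apply] at this
    refine this.trans ?_
    change chartD (q x₀) (q (c.symm (c x))) (tangentField (E := E) (F := F) q (c.symm (c x)) _) = _
    rw [hxx]
  have hqx : q x ∈ (extChartAt 𝓘(ℝ, F) (q x₀)).source := by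
    have := h2.2.2.2
    change q (c.symm (c x)) ∈ _ at this
    rwa [hxx] at this
  have hQx : ∀ v, chartField x₀ Q' x v = chartDSymm x₀ (c x) (Q' (c x) (chartD x₀ x v)) :=
    fun v => rfl
  refine ⟨smoothFieldAt_chartField h1 hQ, fun v => ?_, fun v hv => ?_, fun v hv => ?_⟩
  · have h5 : fderiv ℝ f (c x) (Q' (c x) (chartD x₀ x v)) = 0 := congrArg Prod.fst (hBQ _)
    rw [hBu] at h5
    exact (chartD_bijective hqx).1 (h5.trans (map_zero _).symm)
  · have h5 : B (c x) (chartD x₀ x v) = (0, A (Θ (c x) (chartD x₀ x v))) := by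
      refine Prod.ext ?_ rfl
      change fderiv ℝ f (c x) (chartD x₀ x v) = 0
      rw [hBu, hinv x h1, hv, map_zero]
    have h6 : Function.Injective (B (c x)) := by rw [← he']; exact e'.injective
    rw [hQx, h6 ((hBQ _).trans h5.symm), hinv x h1]
  · have h5 : Θ (c x) (chartD x₀ x v) = 0 := by
      funext i; rw [hΘx x h1]; exact hv i
    rw [hQx]
    change chartDSymm x₀ (c x) ((B (c x)).inverse (ContinuousLinearMap.inr ℝ F W
      (A (Θ (c x) (chartD x₀ x v))))) = 0
    rw [h5]; simp only [map_zero]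

/-- A smooth family of projections onto the vertical spaces of a map. -/
structure IsSplitting (q : M → N) (Q : M → E →L[ℝ] E) : Prop where
  smooth : ∀ x, SmoothFieldAt (fun x => x) Q x
  vert : ∀ x v, tangentField (E := E) (F := F) q x (Q x v) = 0
  fix : ∀ x v, tangentField (E := E) (F := F) q x v = 0 → Q x v = v

variable [T2Space M] [SigmaCompactSpace M]

/-- Local splittings can be glued. -/
theorem exists_splitting_of_local {q : M → N} {P : M → (E →L[ℝ] E) → Prop}
    (hP : ∀ x (n : ℕ) (b : Fin n → ℝ) (A : Fin n → E →L[ℝ] E), (∀ c, b c = 0 ∨ P x (A c)) →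
      P x (∑ c, b c • A c))
    (h : ∀ x₀, ∃ Q : M → E →L[ℝ] E, ∀ᶠ x in 𝓝 x₀, SmoothFieldAt (fun x => x) Q x ∧
      (∀ v, tangentField (E := E) (F := F) q x (Q x v) = 0) ∧
      (∀ v, tangentField (E := E) (F := F) q x v = 0 → Q x v = v) ∧ P x (Q x)) :
    ∃ Q : M → E →L[ℝ] E, IsSplitting (F := F) q Q ∧ ∀ x, P x (Q x) := by
  choose Q' hQ' using h
  obtain ⟨U, C, hU⟩ := exists_colouring_of_eventually (E := E) hQ'
  refine ⟨fun x => ∑ c, C.glueField c Q' x, ⟨fun x => ?_, fun x v => ?_, fun x v hv => ?_⟩, fun x => ?_⟩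
  · exact SmoothFieldAt.sum _ fun c _ => C.smoothFieldAt_glueField c (fun z x hx => (hU z x hx).1) x
  · rw [sum_apply, map_sum]
    refine Finset.sum_eq_zero fun c _ => ?_
    change tangentField (E := E) (F := F) q x (C.b c x • Q' (C.p c x) x v) = 0
    rw [map_smul]
    rcases C.zero_or_mem' c x with h | h
    · rw [h, zero_smul]
    · rw [(hU _ _ h).2.1, smul_zero]
  · rw [sum_apply]
    -- The condition of fixing vertical vectors is affine in the field of endomorphisms, so it
    -- survives averaging with weights of sum one.
    have h1 : ∀ c, C.glueField c Q' x v = C.b c x • v := by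
      intro c
      change C.b c x • Q' (C.p c x) x v = _
      rcases C.zero_or_mem' c x with h | h
      · rw [h, zero_smul, zero_smul]
      · rw [(hU _ _ h).2.2.1 v hv]
    simp only [h1]
    rw [← Finset.sum_smul, C.sum_eq_one, one_smul]
  · exact hP x _ (fun c => C.b c x) (fun c => Q' (C.p c x) x) fun c =>
      (C.zero_or_mem' c x).imp id fun h => (hU _ _ h).2.2.2

theorem exists_splitting {q : M → N} (hq : IsSmoothSubmersion (E := E) (F := F) q)
    {ι : Type*} [Fintype ι] {θ : ι → DForm E M 1} (hθ : ∀ i, IsSmoothForm (θ i))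
    (hinj : ∀ (x₀ : M) (v : E), (∀ i, θ i x₀ (fun _ => v) = 0) →
      tangentField (E := E) (F := F) q x₀ v = 0 → v = 0) :
    ∃ Q : M → E →L[ℝ] E, IsSplitting (F := F) q Q ∧
      ∀ x (v : E), (∀ i, θ i x (fun _ => v) = 0) → Q x v = 0 := by
  refine exists_splitting_of_local (F := F) (P := fun x L => ∀ v : E, (∀ i, θ i x (fun _ => v) = 0) → L v = 0)
    ?_ fun x₀ => exists_local_splitting hq hθ x₀ (hinj x₀)
  intro x n b A h v hv
  rw [sum_apply]
  refine Finset.sum_eq_zero fun c _ => ?_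
  rcases h c with h | h
  · simp [h]
  · rw [smul_apply, h v hv, smul_zero]

/-- Finite-dimensional duality. It turns the span conditions below into statements about common
kernels, that is, about integral vectors. -/
theorem mem_span_forms_of_ker {ι : Type*} [Fintype ι] {s : ι → E [⋀^Fin 1]→L[ℝ] ℝ}
    {b : E [⋀^Fin 1]→L[ℝ] ℝ}
    (h : ∀ v, (∀ i, s i (fun _ => v) = 0) → b (fun _ => v) = 0) :
    b ∈ Submodule.span ℝ (Set.range s) := by
  let e := (ContinuousAlternatingMap.ofSubsingleton ℝ E ℝ (0 : Fin 1)).symm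
  have h1 : (e b : E →ₗ[ℝ] ℝ) ∈
      Submodule.span ℝ (Set.range fun i => ((e (s i) : E →L[ℝ] ℝ) : E →ₗ[ℝ] ℝ)) := by
    refine mem_span_of_iInf_ker_le_ker fun v hv => h v fun i => ?_
    exact (Submodule.mem_iInf _).1 hv i
  obtain ⟨a, ha⟩ := (Submodule.mem_span_range_iff_exists_fun ℝ).1 h1
  refine (Submodule.mem_span_range_iff_exists_fun ℝ).2 ⟨a, ?_⟩
  ext v
  have hv : v = fun _ => v 0 := by funext i; rw [Subsingleton.elim i 0]
  rw [hv, ContinuousAlternatingMap.sum_apply]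
  have h2 := congrArg (fun L : E →ₗ[ℝ] ℝ => L (v 0)) ha
  simp only [LinearMap.sum_apply] at h2
  exact h2

theorem apply_eq_zero_of_mem_span {ι : Type*} {s : ι → E [⋀^Fin 1]→L[ℝ] ℝ}
    {b : E [⋀^Fin 1]→L[ℝ] ℝ} (hb : b ∈ Submodule.span ℝ (Set.range s)) {v : Fin 1 → E}
    (h : ∀ i, s i v = 0) : b v = 0 := by
  induction hb using Submodule.span_induction with
  | mem b hb => obtain ⟨i, rfl⟩ := hb; exact h i
  | zero => rfl
  | add a b _ _ ha hb => rw [ContinuousAlternatingMap.add_apply, ha, hb, add_zero]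
  | smul c a _ ha => rw [ContinuousAlternatingMap.smul_apply, ha, smul_zero]

/-- The one-forms which factor through an endomorphism. -/
def splitSpace (L : E →L[ℝ] E) : Submodule ℝ (E [⋀^Fin 1]→L[ℝ] ℝ) :=
  LinearMap.range (ContinuousAlternatingMap.compContinuousLinearMapCLM (𝕜 := ℝ) (F := ℝ)
    (ι := Fin 1) L : (E [⋀^Fin 1]→L[ℝ] ℝ) →ₗ[ℝ] (E [⋀^Fin 1]→L[ℝ] ℝ))

/-- The one-forms which factor through a family of endomorphisms of the tangent spaces. -/
def splitBundle (Q : M → E →L[ℝ] E) (x : M) :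
    Submodule ℝ ((TangentSpace 𝓘(ℝ, E) x) [⋀^Fin 1]→L[ℝ] ℝ) :=
  show Submodule ℝ (E [⋀^Fin 1]→L[ℝ] ℝ) from splitSpace (Q x)

theorem mem_splitBundle_iff {Q : M → E →L[ℝ] E} {x : M} {b : E [⋀^Fin 1]→L[ℝ] ℝ} :
    b ∈ splitBundle Q x ↔ ∃ a : E [⋀^Fin 1]→L[ℝ] ℝ, a.compContinuousLinearMap (Q x) = b :=
  Iff.rfl

theorem bundlePullback_mem_splitBundle (Q : M → E →L[ℝ] E) (β : DForm E M 1) (x : M) :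
    bundlePullback (fun x => x) Q β x ∈ splitBundle Q x :=
  mem_splitBundle_iff.2 ⟨β x, rfl⟩

theorem apply_eq_zero_of_mem_splitBundle {Q : M → E →L[ℝ] E} {x : M} {v : E} (hv : Q x v = 0)
    {b : E [⋀^Fin 1]→L[ℝ] ℝ} (hb : b ∈ splitBundle Q x) : b (fun _ => v) = 0 := by
  obtain ⟨a, rfl⟩ := mem_splitBundle_iff.1 hb
  change a (fun _ => Q x v) = 0
  rw [hv]
  exact a.map_zero

/-- A vertical `v` equals `Q x v`. If it were nonzero, some covector `c` would detect it, and `c ∘ Q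
x` is a form of the bundle with the same value on `v`. This is the admissibility condition `ann(J) ∩
ker q_* = 0`. -/
theorem IsSplitting.eq_zero {q : M → N} {Q : M → E →L[ℝ] E} (hQ : IsSplitting (F := F) q Q) {x : M}
    {v : E} (h : ∀ b ∈ splitBundle Q x, b (fun _ => v) = 0)
    (hv : tangentField (E := E) (F := F) q x v = 0) : v = 0 := by
  rw [← hQ.fix x v hv]
  by_contra hne
  obtain ⟨c, hc⟩ := SeparatingDual.exists_ne_zero (R := ℝ) hne
  exact hc (h _ (mem_splitBundle_iff.2
    ⟨ContinuousAlternatingMap.ofSubsingleton ℝ E ℝ (0 : Fin 1) c, rfl⟩))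

/-- Forms of the bundle factor through the vertical space, so its fibre dimension is at most `d`.
Covectors dual to a basis of the vertical space at `x₀`, extended to smooth forms and composed with
`Q`, are `d` sections independent at `x₀`, hence nearby, where by the bound they form a frame. -/
theorem IsSplitting.isSubbundle {q : M → N} {Q : M → E →L[ℝ] E} (hQ : IsSplitting (F := F) q Q)
    (hq : ∀ x, Function.Surjective (tangentField (E := E) (F := F) q x)) :
    IsSubbundle (splitBundle Q) (Module.finrank ℝ E - Module.finrank ℝ F) := by
  let d := Module.finrank ℝ E - Module.finrank ℝ F
  let V : M → Submodule ℝ E := fun x =>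
    LinearMap.ker (tangentField (E := E) (F := F) q x : E →ₗ[ℝ] F)
  have hV : ∀ x, Module.finrank ℝ (V x) = d := by
    intro x
    have h := (tangentField (E := E) (F := F) q x : E →ₗ[ℝ] F).finrank_range_add_finrank_ker
    rw [LinearMap.range_eq_top.2 (hq x), finrank_top] at h
    change Module.finrank ℝ (LinearMap.ker _) = _
    omega
  have hfin : FiniteDimensional ℝ (E [⋀^Fin 1]→L[ℝ] ℝ) := finiteDimensional_alternating
  have hle : ∀ x, Module.finrank ℝ (splitSpace (Q x)) ≤ d := by
    intro x
    let Q' : E →L[ℝ] V x := (Q x).codRestrict (V x) fun v => hQ.vert x v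
    let T : (V x →L[ℝ] ℝ) →ₗ[ℝ] (E [⋀^Fin 1]→L[ℝ] ℝ) :=
      { toFun := fun c => ContinuousAlternatingMap.ofSubsingleton ℝ E ℝ (0 : Fin 1) (c.comp Q')
        map_add' := fun c c' => by ext; rfl
        map_smul' := fun a c => by ext; rfl }
    have h1 : splitSpace (Q x) ≤ LinearMap.range T := by
      rintro _ ⟨a, rfl⟩
      refine ⟨((ContinuousAlternatingMap.ofSubsingleton ℝ E ℝ (0 : Fin 1)).symm a).comp
        (V x).subtypeL, ?_⟩
      ext v
      change a (fun _ => Q x (v 0)) = a (fun i => Q x (v i))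
      congr 1
      funext i
      rw [Subsingleton.elim i 0]
    refine (Submodule.finrank_mono h1).trans ((LinearMap.finrank_range_le T).trans ?_)
    rw [(LinearMap.toContinuousLinearMap (𝕜 := ℝ) (E := V x) (F' := ℝ)).symm.finrank_eq,
      ← hV x]
    exact (Subspace.dual_finrank_eq (K := ℝ) (V := V x)).le
  intro x₀
  let B : Module.Basis (Fin d) ℝ (V x₀) := Module.finBasisOfFinrankEq ℝ (V x₀) (hV x₀)
  obtain ⟨pr, hpr⟩ := Submodule.ClosedComplemented.of_finiteDimensional (V x₀)
  choose β hβ hβx using fun j => exists_isSmoothForm_apply_eq x₀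
    ((B.coord j).toContinuousLinearMap.comp pr)
  let σ : Fin d → DForm E M 1 := fun j => bundlePullback (fun x => x) Q (β j)
  have hσ : ∀ j, IsSmoothForm (σ j) := fun j => isSmoothForm_iff.2 fun x =>
    (hQ.smooth x).bundlePullback (isSmoothForm_iff.1 (hβ j) x)
  have hli : LinearIndependent ℝ fun j => (show E [⋀^Fin 1]→L[ℝ] ℝ from σ j x₀) := by
    refine Fintype.linearIndependent_iff.2 fun a ha i => ?_
    let s : Fin d → E [⋀^Fin 1]→L[ℝ] ℝ := fun j => σ j x₀
    have h1 : ∑ j, a j * s j (fun _ => (B i : E)) = 0 := by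
      have h1 := congrArg (fun b : E [⋀^Fin 1]→L[ℝ] ℝ => b (fun _ => (B i : E)))
        (show ∑ j, a j • s j = 0 from ha)
      simpa [ContinuousAlternatingMap.sum_apply] using h1
    have h2 : ∀ j, s j (fun _ => (B i : E)) = if i = j then 1 else 0 := by
      intro j
      change β j x₀ (fun _ => Q x₀ (B i : E)) = _
      rw [hQ.fix x₀ _ (B i).2, hβx]
      change B.coord j (pr (B i : E)) = _
      rw [hpr, Module.Basis.coord_apply, Module.Basis.repr_self, Finsupp.single_apply]
    simp only [h2] at h1
    simpa using h1
  have hev : ∀ᶠ x in 𝓝 x₀, LinearIndependent ℝ fun j => (show E [⋀^Fin 1]→L[ℝ] ℝ from σ j x) := by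
    let c := extChartAt 𝓘(ℝ, E) x₀
    have hx := mem_extChartAt_source (I := 𝓘(ℝ, E)) x₀
    have hrel : ∀ x ∈ c.source, LinearIndependent ℝ (fun j => localRep x₀ (σ j) (c x)) ↔
        LinearIndependent ℝ fun j => (show E [⋀^Fin 1]→L[ℝ] ℝ from σ j x) := by
      intro x hx
      have h1 : (fun j => (show E [⋀^Fin 1]→L[ℝ] ℝ from σ j x)) = fun j =>
          (localRep x₀ (σ j) (c x)).compContinuousLinearMap (chartD x₀ x) := by
        funext j; exact eq_localRep hx (σ j)
      rw [h1, linearIndependent_iff_card_eq_finrank_span, linearIndependent_iff_card_eq_finrank_span]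
      have := finrank_span_compContinuousLinearMap (fun j => localRep x₀ (σ j) (c x))
        (chartD_bijective hx).2
      unfold Set.finrank
      rw [this]
    have h1 : ContinuousAt (fun y => fun j => localRep x₀ (σ j) y) (c x₀) :=
      continuousAt_pi.2 fun j => ContDiffAt.continuousAt (isSmoothForm_iff.1 (hσ j) x₀)
    have h2 : ∀ᶠ x in 𝓝 x₀, LinearIndependent ℝ fun j => localRep x₀ (σ j) (c x) :=
      (continuousAt_extChartAt (I := 𝓘(ℝ, E)) x₀).eventually
        (h1.eventually ((hrel x₀ hx).2 hli).eventually)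
    filter_upwards [h2, extChartAt_source_mem_nhds (I := 𝓘(ℝ, E)) x₀] with x h3 h4
    exact (hrel x h4).1 h3
  refine ⟨σ, hσ, ?_⟩
  filter_upwards [hev] with x hx
  refine ⟨hx, ?_⟩
  let s : Fin d → E [⋀^Fin 1]→L[ℝ] ℝ := fun j => σ j x
  have h1 : Submodule.span ℝ (Set.range s) ≤ splitSpace (Q x) := by
    refine Submodule.span_le.2 ?_
    rintro _ ⟨j, rfl⟩
    exact ⟨β j x, rfl⟩
  have h2 : Submodule.span ℝ (Set.range s) = splitSpace (Q x) := by
    refine Submodule.eq_of_le_of_finrank_le h1 ((hle x).trans ?_)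
    rw [finrank_span_eq_card hx, Fintype.card_fin]
  exact h2

end Splittings
end

noncomputable section

set_option linter.unusedSectionVars false

/-! ### Invariance of 1-forms under smooth families of maps -/

section Families

variable {E : Type*} [NormedAddCommGroup E] [NormedSpace ℝ E] [FiniteDimensional ℝ E]
  {F : Type*} [NormedAddCommGroup F] [NormedSpace ℝ F] [FiniteDimensional ℝ F]
  {M : Type*} [TopologicalSpace M] [ChartedSpace E M] [IsManifold 𝓘(ℝ, E) ∞ M] {k : ℕ}

theorem chartD_model (z w : F) : chartD (E := F) (M := F) z w = ContinuousLinearMap.id ℝ F := by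
  unfold chartD
  rw [extChartAt_model_space_eq_id]
  exact mfderiv_id

theorem smoothFormAt_oneForm_comp {φ : M → F} {B : M → E →L[ℝ] F} {x₀ : M}
    (hB : SmoothFieldAt φ B x₀) {L : M → F →L[ℝ] ℝ}
    (hL : ContMDiffAt 𝓘(ℝ, E) 𝓘(ℝ, F →L[ℝ] ℝ) ∞ L x₀) :
    SmoothFormAt (oneForm fun x => (L x).comp (B x)) x₀ := by
  have h1 := (contDiffAt_coord hL).clm_comp hB.field
  refine contDiffAt_alternating_iff.2 fun v => ?_
  refine (h1.clm_apply (contDiffAt_const (c := v 0))).congr_of_eventuallyEq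
    (Filter.Eventually.of_forall fun y => ?_)
  simp only [coordMap, chartD_model]
  rfl

theorem eventually_contDiffAt_familyCoord {f : M → M → M} {x₀ z₀ : M}
    (hf : ∀ᶠ p in 𝓝 (x₀, z₀), ContMDiffAt (𝓘(ℝ, E).prod 𝓘(ℝ, E)) 𝓘(ℝ, E) ∞
      (fun p : M × M => f p.1 p.2) p) :
    ∀ᶠ p in 𝓝 (x₀, z₀), ContDiffAt ℝ ∞ (Function.uncurry (familyCoord (E := E) (F := E) (F' := E) f x₀ z₀))
      (extChartAt 𝓘(ℝ, E) x₀ p.1, extChartAt 𝓘(ℝ, E) z₀ p.2) ∧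
      p.1 ∈ (extChartAt 𝓘(ℝ, E) x₀).source ∧ p.2 ∈ (extChartAt 𝓘(ℝ, E) z₀).source ∧
      f p.1 p.2 ∈ (extChartAt 𝓘(ℝ, E) (f x₀ z₀)).source := by
  have hs1 : ∀ᶠ p in 𝓝 (x₀, z₀), p.1 ∈ (extChartAt 𝓘(ℝ, E) x₀).source :=
    continuous_fst.continuousAt.eventually (extChartAt_source_mem_nhds (I := 𝓘(ℝ, E)) x₀)
  have hs2 : ∀ᶠ p in 𝓝 (x₀, z₀), p.2 ∈ (extChartAt 𝓘(ℝ, E) z₀).source :=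
    continuous_snd.continuousAt.eventually (extChartAt_source_mem_nhds (I := 𝓘(ℝ, E)) z₀)
  have hs3 : ∀ᶠ p in 𝓝 (x₀, z₀), f p.1 p.2 ∈ (extChartAt 𝓘(ℝ, E) (f x₀ z₀)).source :=
    hf.self_of_nhds.continuousAt.eventually
      (extChartAt_source_mem_nhds (I := 𝓘(ℝ, E)) (f x₀ z₀))
  filter_upwards [hf, hs1, hs2, hs3] with p h1 h2 h3 h4
  refine ⟨?_, h2, h3, h4⟩
  have e1 := (extChartAt 𝓘(ℝ, E) x₀).left_inv h2
  have e2 := (extChartAt 𝓘(ℝ, E) z₀).left_inv h3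
  have h5 : ContMDiffAt (𝓘(ℝ, E).prod 𝓘(ℝ, E)) (𝓘(ℝ, E).prod 𝓘(ℝ, E)) ∞
      (fun q : E × E => ((extChartAt 𝓘(ℝ, E) x₀).symm q.1, (extChartAt 𝓘(ℝ, E) z₀).symm q.2))
      (extChartAt 𝓘(ℝ, E) x₀ p.1, extChartAt 𝓘(ℝ, E) z₀ p.2) :=
    ContMDiffAt.prodMk (ContMDiffAt.comp _ (contMDiffAt_symm h2) contMDiffAt_fst)
      (ContMDiffAt.comp _ (contMDiffAt_symm h3) contMDiffAt_snd)
  have h6 : ContMDiffAt (𝓘(ℝ, E).prod 𝓘(ℝ, E)) 𝓘(ℝ, E) ∞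
      (Function.uncurry (familyCoord (E := E) (F := E) (F' := E) f x₀ z₀))
      (extChartAt 𝓘(ℝ, E) x₀ p.1, extChartAt 𝓘(ℝ, E) z₀ p.2) := by
    refine ContMDiffAt.comp (I' := 𝓘(ℝ, E)) _ (g := extChartAt 𝓘(ℝ, E) (f x₀ z₀))
      (f := fun q : E × E => f ((extChartAt 𝓘(ℝ, E) x₀).symm q.1)
        ((extChartAt 𝓘(ℝ, E) z₀).symm q.2)) ?_ ?_
    · simp only [e1, e2]; exact contMDiffAt_chart h4
    · refine ContMDiffAt.comp (I' := 𝓘(ℝ, E).prod 𝓘(ℝ, E)) _ (g := fun p : M × M => f p.1 p.2) ?_ h5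
      simp only [e1, e2]; exact h1
  rw [← modelWithCornersSelf_prod, chartedSpaceSelf_prod] at h6
  exact h6.contDiffAt

variable {ι : Type*} [Fintype ι] {σ : ι → DForm E M k} {β : DForm E M k} {r : ℕ}

/-- Smooth coefficients, with smooth dependence on a parameter. -/
theorem exists_family_coeff (hσ : ∀ i, IsSmoothForm (σ i)) (hβ : IsSmoothForm β)
    (hr : ∀ x, Module.finrank ℝ (Submodule.span ℝ (Set.range fun i => σ i x)) = r)
    {f : M → M → M} {x₀ z₀ : M}
    (hf : ∀ᶠ p in 𝓝 (x₀, z₀), ContMDiffAt (𝓘(ℝ, E).prod 𝓘(ℝ, E)) 𝓘(ℝ, E) ∞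
      (fun p : M × M => f p.1 p.2) p)
    (hspan : ∀ x y, (formPullback (f x) β : DForm E M k) y ∈
      Submodule.span ℝ (Set.range fun i => σ i y)) :
    ∃ c : ι → E × E → ℝ, ∀ᶠ p in 𝓝 (x₀, z₀),
      (∀ i, ContDiffAt ℝ ∞ (c i) (extChartAt 𝓘(ℝ, E) x₀ p.1, extChartAt 𝓘(ℝ, E) z₀ p.2)) ∧
      (formPullback (f p.1) β : DForm E M k) p.2 =
        ∑ i, c i (extChartAt 𝓘(ℝ, E) x₀ p.1, extChartAt 𝓘(ℝ, E) z₀ p.2) • σ i p.2 := by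
  have hfin : FiniteDimensional ℝ (E [⋀^Fin k]→L[ℝ] ℝ) := finiteDimensional_alternating
  let cx := extChartAt 𝓘(ℝ, E) x₀
  let cz := extChartAt 𝓘(ℝ, E) z₀
  have hcx := mem_extChartAt_source (I := 𝓘(ℝ, E)) x₀
  have hcz := mem_extChartAt_source (I := 𝓘(ℝ, E)) z₀
  let fc := familyCoord (E := E) (F := E) (F' := E) f x₀ z₀
  -- The pulled-back form in charts, as a function of parameter and point jointly. The constant-rank
  -- lemma is applied on `E × E`, with spanning vectors `t` that depend on the point alone.
  let w : E × E → E [⋀^Fin k]→L[ℝ] ℝ := fun p =>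
    (localRep (f x₀ z₀) β (fc p.1 p.2)).compContinuousLinearMap (fderiv ℝ (fc p.1) p.2)
  let t : ι → E × E → E [⋀^Fin k]→L[ℝ] ℝ := fun i p => localRep z₀ (σ i) p.2
  have hsymm : Filter.Tendsto (fun p : E × E => (cx.symm p.1, cz.symm p.2))
      (𝓝 (cx x₀, cz z₀)) (𝓝 (x₀, z₀)) :=
    (((tendsto_extChartAt_symm x₀).comp (continuous_fst.tendsto _))).prodMk_nhds
      ((tendsto_extChartAt_symm z₀).comp (continuous_snd.tendsto _))
  have htx : ∀ᶠ p in 𝓝 (cx x₀, cz z₀), p.1 ∈ cx.target :=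
    continuous_fst.continuousAt.eventually (extChartAt_target_mem_nhds (I := 𝓘(ℝ, E)) x₀)
  have htz : ∀ᶠ p in 𝓝 (cx x₀, cz z₀), p.2 ∈ cz.target :=
    continuous_snd.continuousAt.eventually (extChartAt_target_mem_nhds (I := 𝓘(ℝ, E)) z₀)
  have hev : ∀ᶠ p in 𝓝 (cx x₀, cz z₀), p.1 ∈ cx.target ∧ p.2 ∈ cz.target ∧
      ContDiffAt ℝ ∞ (Function.uncurry fc) p ∧
      f (cx.symm p.1) (cz.symm p.2) ∈ (extChartAt 𝓘(ℝ, E) (f x₀ z₀)).source ∧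
      ContMDiffAt (𝓘(ℝ, E).prod 𝓘(ℝ, E)) 𝓘(ℝ, E) ∞ (fun p : M × M => f p.1 p.2)
        (cx.symm p.1, cz.symm p.2) := by
    filter_upwards [htx, htz, hsymm.eventually (eventually_contDiffAt_familyCoord hf),
      hsymm.eventually hf] with p h1 h2 h3 h4
    refine ⟨h1, h2, ?_, h3.2.2.2, h4⟩
    have := h3.1
    rwa [cx.right_inv h1, cz.right_inv h2] at this
  have hsurj : ∀ y ∈ cz.target, Function.Surjective (chartDSymm z₀ y) := by
    intro y hy
    have := (chartDSymm_bijective (cz.map_target hy)).2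
    rwa [cz.right_inv hy] at this
  have hw : ∀ᶠ p in 𝓝 (cx x₀, cz z₀), ContDiffAt ℝ ∞ w p := by
    filter_upwards [hev] with p h
    refine ContDiffAt.alternating_comp ?_ ?_
    · refine ContDiffAt.comp p (g := localRep (f x₀ z₀) β) ?_ h.2.2.1
      refine contDiffAt_localRep ((extChartAt 𝓘(ℝ, E) (f x₀ z₀)).map_source h.2.2.2.1) ?_
      exact isSmoothForm_iff.1 hβ _
    · exact ContDiffAt.fderiv (m := ∞) (f := fun p : E × E => fc p.1) (g := Prod.snd)
        (ContDiffAt.comp (p, p.2) (g := Function.uncurry fc)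
          (f := fun q : (E × E) × E => (q.1.1, q.2)) h.2.2.1
          ((contDiffAt_fst.comp _ contDiffAt_fst).prodMk contDiffAt_snd)) contDiffAt_snd (by simp)
  let b : M → M → E [⋀^Fin k]→L[ℝ] ℝ := fun x => (formPullback (f x) β : DForm E M k)
  have hwx : ∀ᶠ p in 𝓝 (cx x₀, cz z₀), w p =
      (b (cx.symm p.1) (cz.symm p.2)).compContinuousLinearMap (chartDSymm z₀ p.2) := by
    filter_upwards [hev] with p h
    have h1 := fderiv_familyCoord (f := f) (cx.map_target h.1) (cz.map_target h.2.1) h.2.2.2.1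
      (contMDiffAt_of_family h.2.2.2.2)
    rw [cx.right_inv h.1, cz.right_inv h.2.1] at h1
    have h2 := eq_localRep h.2.2.2.1 β
    ext v
    change localRep (f x₀ z₀) β (fc p.1 p.2) (fun i => fderiv ℝ (fc p.1) p.2 (v i)) =
      β (f (cx.symm p.1) (cz.symm p.2)) (fun i => tangentField (E := E) (F := E)
        (f (cx.symm p.1)) (cz.symm p.2) (chartDSymm z₀ p.2 (v i)))
    rw [h2, h1]
    rfl
  obtain ⟨c, hc⟩ := exists_contDiffAt_coeff_of_finrank (t := t) (w := w) (x₀ := (cx x₀, cz z₀))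
    (r := r) (by
      filter_upwards [hev] with p h i
      exact (contDiffAt_localRep h.2.1 (isSmoothForm_iff.1 (hσ i) _)).comp p contDiffAt_snd) hw
    (by
      filter_upwards [hev] with p h
      rw [← hr (cz.symm p.2)]
      exact finrank_span_compContinuousLinearMap (V := E) (V' := E)
        (fun i => σ i (cz.symm p.2)) (hsurj p.2 h.2.1))
    (by
      filter_upwards [hwx] with p h
      rw [h]
      exact mem_span_compContinuousLinearMap (V := E) (V' := E) (hspan (cx.symm p.1) (cz.symm p.2))
        (chartDSymm z₀ p.2))
  refine ⟨c, ?_⟩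
  have hchart : Filter.Tendsto (fun p : M × M => (cx p.1, cz p.2)) (𝓝 (x₀, z₀))
      (𝓝 (cx x₀, cz z₀)) :=
    Filter.Tendsto.prodMk_nhds
      (Filter.Tendsto.comp (continuousAt_extChartAt (I := 𝓘(ℝ, E)) x₀) (continuous_fst.tendsto _))
      (Filter.Tendsto.comp (continuousAt_extChartAt (I := 𝓘(ℝ, E)) z₀) (continuous_snd.tendsto _))
  filter_upwards [hchart.eventually hc, hchart.eventually hwx,
    eventually_contDiffAt_familyCoord hf] with p h1 h2 h3
  refine ⟨h1.1, ?_⟩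
  have e1 : cx.symm (cx p.1) = p.1 := cx.left_inv h3.2.1
  have e2 : cz.symm (cz p.2) = p.2 := cz.left_inv h3.2.2.1
  let a := b p.1 p.2
  have h4 : w (cx p.1, cz p.2) = a.compContinuousLinearMap (chartDSymm z₀ (cz p.2)) := by
    rw [h2, e1, e2]
  have h5 : a = (w (cx p.1, cz p.2)).compContinuousLinearMap (chartD z₀ p.2) := by
    rw [h4]
    ext v
    have : ∀ v, chartDSymm z₀ (cz p.2) (chartD z₀ p.2 v) = v := fun v =>
      congrArg (fun L : E →L[ℝ] E => L v) (chartDSymm_comp_chartD h3.2.2.1)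
    change a v = a fun i => chartDSymm z₀ (cz p.2) (chartD z₀ p.2 (v i))
    simp only [this]
  refine Eq.trans h5 ?_
  rw [h1.2]
  refine (sum_compContinuousLinearMap (V := E) (V' := E) _ _ _ _).trans ?_
  refine Finset.sum_congr rfl fun i _ => ?_
  rw [eq_localRep h3.2.2.1 (σ i)]
  rfl

theorem extD_sum {β : ι → DForm E M k} {x₀ : M} (h : ∀ i, SmoothFormAt (β i) x₀) :
    extD (∑ i, β i) x₀ = ∑ i, extD (β i) x₀ := by
  classical
  have key : ∀ s : Finset ι, SmoothFormAt (∑ i ∈ s, β i) x₀ ∧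
      extD (∑ i ∈ s, β i) x₀ = ∑ i ∈ s, extD (β i) x₀ := by
    intro s
    induction s using Finset.induction_on with
    | empty =>
      simp only [Finset.sum_empty]
      exact ⟨smoothFormAt_zero x₀, extD_zero_form (Filter.Eventually.of_forall fun _ => rfl)⟩
    | insert a s ha ih =>
      simp only [Finset.sum_insert ha]
      exact ⟨(h a).add ih.1, by rw [extD_add (h a) ih.1, ih.2]⟩
  exact (key Finset.univ).2

/-- Invariance of a family of one-forms under a smooth family of maps, and its consequence for
the exterior derivatives. -/
theorem exists_twist {θ : ι → DForm E M 1} (hθ : ∀ i, IsSmoothForm (θ i))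
    (hr : ∀ x, Module.finrank ℝ (Submodule.span ℝ (Set.range fun i => θ i x)) = r)
    {f : M → M → M} {φ : M → M} {A : M → E →L[ℝ] E} {x₀ : M}
    (hf : ∀ᶠ p in 𝓝 (x₀, φ x₀), ContMDiffAt (𝓘(ℝ, E).prod 𝓘(ℝ, E)) 𝓘(ℝ, E) ∞
      (fun p : M × M => f p.1 p.2) p)
    (hA : ∀ᶠ x in 𝓝 x₀, SmoothFieldAt φ A x) (j : ι)
    (hspan : ∀ x y, (formPullback (f x) (θ j) : DForm E M 1) y ∈
      Submodule.span ℝ (Set.range fun i => θ i y)) :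
    ∃ (C : ι → M → ℝ) (D : ι → M → E →L[ℝ] ℝ), ∀ᶠ x in 𝓝 x₀,
      (∀ i, ContMDiffAt 𝓘(ℝ, E) 𝓘(ℝ, ℝ) ∞ (C i) x) ∧ (∀ i, SmoothFormAt (oneForm (D i)) x) ∧
      bundlePullback (fun x => f x (φ x))
        (fun x => (tangentField (E := E) (F := E) (f x) (φ x)).comp (A x)) (θ j) x =
        ∑ i, C i x • bundlePullback φ A (θ i) x ∧
      bundlePullback (fun x => f x (φ x))
        (fun x => (tangentField (E := E) (F := E) (f x) (φ x)).comp (A x)) (extD (θ j)) x =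
        ∑ i, (consForm (D i) (bundlePullback φ A (θ i)) x +
          C i x • bundlePullback φ A (extD (θ i)) x) := by
  obtain ⟨c, hc⟩ := exists_family_coeff hθ (hθ j) hr hf hspan
  let cx := extChartAt 𝓘(ℝ, E) x₀
  let cz := extChartAt 𝓘(ℝ, E) (φ x₀)
  have hφ := hA.self_of_nhds.base.self_of_nhds.continuousAt
  have hpair : Filter.Tendsto (fun x => (x, φ x)) (𝓝 x₀) (𝓝 (x₀, φ x₀)) :=
    continuousAt_id.prodMk hφ
  -- The covector `D i` is the differential of the coefficient in its second variable only, composed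
  -- with `A`: the parameter `x` stays frozen while `d` is taken.
  refine ⟨fun i x => c i (cx x, cz (φ x)),
    fun i x => (fderiv ℝ (fun z => c i (cx x, z)) (cz (φ x))).comp
      ((chartD (φ x₀) (φ x)).comp (A x)), ?_⟩
  filter_upwards [hA, hpair.eventually hc.eventually_nhds, hpair.eventually hf.eventually_nhds,
    eventually_source (F := E) hφ, extChartAt_source_mem_nhds (I := 𝓘(ℝ, E)) x₀] with x h1 h2 h3 h4 h5
  have hpx : ContMDiffAt 𝓘(ℝ, E) 𝓘(ℝ, E × E) ∞ (fun x => (cx x, cz (φ x))) x :=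
    ContMDiffAt.prodMk_space (contMDiffAt_chart h5)
      (ContMDiffAt.comp (I' := 𝓘(ℝ, E)) x (g := cz) (f := φ) (contMDiffAt_chart h4)
        h1.base.self_of_nhds)
  have hfx : ∀ᶠ y in 𝓝 (φ x), ContMDiffAt 𝓘(ℝ, E) 𝓘(ℝ, E) ∞ (f x) y := by
    have : Filter.Tendsto (fun y => (x, y)) (𝓝 (φ x)) (𝓝 (x, φ x)) :=
      tendsto_const_nhds.prodMk_nhds Filter.tendsto_id
    exact (this.eventually h3).mono fun y hy => contMDiffAt_of_family hy
  have hcx : ∀ᶠ y in 𝓝 (φ x), (∀ i, ContDiffAt ℝ ∞ (c i) (cx x, cz y)) ∧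
      (formPullback (f x) (θ j) : DForm E M 1) y = ∑ i, c i (cx x, cz y) • θ i y := by
    have : Filter.Tendsto (fun y => (x, y)) (𝓝 (φ x)) (𝓝 (x, φ x)) :=
      tendsto_const_nhds.prodMk_nhds Filter.tendsto_id
    exact this.eventually h2
  have hci := hcx.self_of_nhds.1
  refine ⟨fun i => ?_, fun i => ?_, ?_, ?_⟩
  · exact ContMDiffAt.comp (I' := 𝓘(ℝ, E × E)) x (g := c i) (f := fun x => (cx x, cz (φ x)))
      (hci i).contMDiffAt hpx
  · refine smoothFormAt_oneForm_comp (φ := fun x => cz (φ x)) ?_ ?_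
    · refine SmoothFieldAt.comp (ψ := cz) (B := chartD (φ x₀)) (φ := φ) ?_ h1
      refine smoothFieldAt_tangentField ?_
      filter_upwards [(isOpen_extChartAt_source (φ x₀)).mem_nhds h4] with y hy
      exact contMDiffAt_chart hy
    · have h6 : ContDiffAt ℝ ∞ (fun p : E × E => fderiv ℝ (fun z => c i (p.1, z)) p.2)
          (cx x, cz (φ x)) :=
        ContDiffAt.fderiv (m := ∞) (f := fun (p : E × E) z => c i (p.1, z)) (g := Prod.snd)
          (ContDiffAt.comp ((cx x, cz (φ x)), cz (φ x)) (g := c i)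
            (f := fun q : (E × E) × E => (q.1.1, q.2)) (hci i)
            ((contDiffAt_fst.comp _ contDiffAt_fst).prodMk contDiffAt_snd)) contDiffAt_snd (by simp)
      exact ContMDiffAt.comp (I' := 𝓘(ℝ, E × E)) x
        (g := fun p : E × E => fderiv ℝ (fun z => c i (p.1, z)) p.2)
        (f := fun x => (cx x, cz (φ x))) h6.contMDiffAt hpx
  · let b : E [⋀^Fin 1]→L[ℝ] ℝ := (formPullback (f x) (θ j) : DForm E M 1) (φ x)
    refine Eq.trans (b := b.compContinuousLinearMap (A x)) rfl ?_
    have h6 : b = _ := hcx.self_of_nhds.2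
    rw [h6]
    exact sum_compContinuousLinearMap (V := E) (V' := E) _ _ _ _
  -- For the fixed map `f x`, naturality of `d` and the Leibniz rule applied to `(f x)^* θ j = ∑ u i
  -- θ i` near `φ x` give the relation for `extD (θ j)` at `φ x`; afterwards it is composed with `A
  -- x`.
  · let u : ι → M → ℝ := fun i y => c i (cx x, cz y)
    have hu : ∀ i, ContMDiffAt 𝓘(ℝ, E) 𝓘(ℝ, ℝ) ∞ (u i) (φ x) := fun i =>
      ContMDiffAt.comp (I' := 𝓘(ℝ, E)) (φ x) (g := fun z => c i (cx x, z)) (f := cz)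
        ((hci i).comp (cz (φ x)) (contDiff_prodMk_right (cx x)).contDiffAt).contMDiffAt
        (contMDiffAt_chart h4)
    have hdu : ∀ i, dFun (u i) (φ x) =
        (fderiv ℝ (fun z => c i (cx x, z)) (cz (φ x))).comp (chartD (φ x₀) (φ x)) := by
      intro i
      have h6 := mfderiv_comp (I' := 𝓘(ℝ, E)) (I'' := 𝓘(ℝ, ℝ)) (φ x) (g := fun z => c i (cx x, z))
        (f := cz) ((((hci i).comp (cz (φ x)) (contDiff_prodMk_right (cx x)).contDiffAt).contMDiffAt
          ).mdifferentiableAt (by simp)) ((contMDiffAt_chart h4).mdifferentiableAt (n := ∞) (by simp))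
      rw [mfderiv_eq_fderiv] at h6
      exact h6
    let b : E [⋀^Fin 2]→L[ℝ] ℝ := extD (formPullback (f x) (θ j) : DForm E M 1) (φ x)
    have h6 : b = (formPullback (f x) (extD (θ j)) : DForm E M 2) (φ x) :=
      extD_formPullback hfx (isSmoothForm_iff.1 (hθ j) _)
    have h7 : b = ∑ i, (consWedge (V := E) (dFun (u i) (φ x)) (θ i (φ x)) +
        u i (φ x) • (show E [⋀^Fin 2]→L[ℝ] ℝ from extD (θ i) (φ x))) := by
      have h8 : b = extD (∑ i, formSmul (u i) (θ i)) (φ x) := by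
        refine extD_congr ?_
        filter_upwards [hcx] with y hy
        rw [hy.2, Finset.sum_apply]
        rfl
      rw [h8]
      have h9 := extD_sum (β := fun i => formSmul (u i) (θ i)) (x₀ := φ x)
        (fun i => (isSmoothForm_iff.1 (hθ i) _).smul (hu i))
      refine h9.trans (Finset.sum_congr rfl fun i _ => ?_)
      exact extD_smul (hu i) (isSmoothForm_iff.1 (hθ i) _)
    refine Eq.trans (b := b.compContinuousLinearMap (A x)) (by rw [h6]; rfl) ?_
    rw [h7]
    have hgen : ∀ (a : ι → E [⋀^Fin 2]→L[ℝ] ℝ), (∑ i, a i).compContinuousLinearMap (A x) =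
        ∑ i, (a i).compContinuousLinearMap (A x) := fun a => by
      simpa using sum_compContinuousLinearMap Finset.univ (fun _ => (1 : ℝ)) a (A x)
    refine (hgen _).trans (Finset.sum_congr rfl fun i _ => ?_)
    have halg : ∀ (l : E →L[ℝ] ℝ) (a : E [⋀^Fin 1]→L[ℝ] ℝ) (e : E [⋀^Fin 2]→L[ℝ] ℝ) (t : ℝ)
        (B : E →L[ℝ] E), (consWedge l a + t • e).compContinuousLinearMap B =
        consWedge (l.comp B) (a.compContinuousLinearMap B) + t • e.compContinuousLinearMap B := by
      intro l a e t B
      ext v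
      simp only [ContinuousAlternatingMap.compContinuousLinearMap_apply,
        ContinuousAlternatingMap.add_apply, ContinuousAlternatingMap.smul_apply, consWedge_apply]
      rfl
    refine (halg _ _ _ _ _).trans ?_
    rw [hdu]
    rfl

end Families
end

noncomputable section

set_option linter.unusedSectionVars false

/-! ### Reduced systems, and 2-forms modulo the ideal of the 1-forms -/

section Reductions

variable {E : Type*} [NormedAddCommGroup E] [NormedSpace ℝ E] [FiniteDimensional ℝ E]
  {F : Type*} [NormedAddCommGroup F] [NormedSpace ℝ F] [FiniteDimensional ℝ F]
  {F' : Type*} [NormedAddCommGroup F'] [NormedSpace ℝ F'] [FiniteDimensional ℝ F']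
  {M : Type*} [TopologicalSpace M] [ChartedSpace E M] [IsManifold 𝓘(ℝ, E) ∞ M]
  {N : Type*} [TopologicalSpace N] [ChartedSpace F N] [IsManifold 𝓘(ℝ, F) ∞ N]
  {N' : Type*} [TopologicalSpace N'] [ChartedSpace F' N'] [IsManifold 𝓘(ℝ, F') ∞ N'] {k : ℕ}

theorem IsSmoothForm.pullback {f : M → N} (hf : ContMDiff 𝓘(ℝ, E) 𝓘(ℝ, F) ∞ f) {β : DForm F N k}
    (hβ : IsSmoothForm β) : IsSmoothForm (formPullback f β : DForm E M k) :=
  isSmoothForm_iff.2 fun x => (isSmoothForm_iff.1 hβ (f x)).pullback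
    (Filter.Eventually.of_forall fun z => hf z)

/-- Only the compatibility of pullback with `∧` and `d` matters; the map need not be a submersion.
-/
theorem IsEDS.reduction {S : FormSet E M} (hS : IsEDS S) {f : M → N}
    (hf : ContMDiff 𝓘(ℝ, E) 𝓘(ℝ, F) ∞ f) : IsEDS (reduction f S : FormSet F N) where
  smooth h := h.1
  zero_mem k := ⟨isSmoothForm_zero, hS.zero_mem k⟩
  add_mem h h' := ⟨h.1.add h'.1, hS.add_mem h.2 h'.2⟩
  wedge_right h hα := ⟨h.1.wedge hα, by
    rw [formPullback_wedge]
    exact hS.wedge_right h.2 (hα.pullback hf)⟩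
  wedge_left h hα := ⟨hα.wedge h.1, by
    rw [formPullback_wedge]
    exact hS.wedge_left h.2 (hα.pullback hf)⟩
  d_mem {k β} h := ⟨h.1.extD, by
    have h1 : (formPullback f (extD β) : DForm E M (k + 1)) = extD (formPullback f β) :=
      funext fun x => (extD_formPullback (Filter.Eventually.of_forall fun z => hf z)
        (isSmoothForm_iff.1 h.1 (f x))).symm
    rw [h1]
    exact hS.d_mem h.2⟩

theorem pullbackSet_reduction_subset (f : M → N) (S : FormSet E M) (k : ℕ) :
    pullbackSet f (reduction f S : FormSet F N) k ⊆ S k := by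
  rintro _ ⟨β, hβ, rfl⟩
  exact hβ.2

theorem formPullback_comp_smooth {f : M → N} {g : N → N'} (hf : ContMDiff 𝓘(ℝ, E) 𝓘(ℝ, F) ∞ f)
    (hg : ContMDiff 𝓘(ℝ, F) 𝓘(ℝ, F') ∞ g) (β : DForm F' N' k) :
    (formPullback (fun x => g (f x)) β : DForm E M k) =
      formPullback f (formPullback g β : DForm F N k) :=
  funext fun x => formPullback_comp ((hf x).mdifferentiableAt (by simp))
    ((hg (f x)).mdifferentiableAt (by simp)) β

theorem reduction_comp {f : M → N} {g : N → N'} (hf : ContMDiff 𝓘(ℝ, E) 𝓘(ℝ, F) ∞ f)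
    (hg : ContMDiff 𝓘(ℝ, F) 𝓘(ℝ, F') ∞ g) (S : FormSet E M) :
    (reduction (fun x => g (f x)) S : FormSet F' N') =
      reduction g (reduction f S : FormSet F N) := by
  funext k
  ext β
  change (_ ∧ _) ↔ (_ ∧ _ ∧ _)
  rw [formPullback_comp_smooth hf hg]
  exact ⟨fun h => ⟨h.1, h.1.pullback hg, h.2⟩, fun h => ⟨h.1, h.2.2⟩⟩

theorem form_mem_span_of_ker {ι : Type*} [Fintype ι] {σ : ι → DForm E M 1} {β : DForm E M 1} {x : M}
    (h : ∀ v : E, (∀ i, σ i x (fun _ => v) = 0) → β x (fun _ => v) = 0) :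
    β x ∈ Submodule.span ℝ (Set.range fun i => σ i x) :=
  mem_span_forms_of_ker (E := E) h

theorem form_apply_eq_zero_of_mem_span {ι : Type*} {σ : ι → DForm E M 1} {β : DForm E M 1} {x : M}
    (hβ : β x ∈ Submodule.span ℝ (Set.range fun i => σ i x)) {v : E}
    (h : ∀ i, σ i x (fun _ => v) = 0) : β x (fun _ => v) = 0 :=
  apply_eq_zero_of_mem_span (E := E) hβ h

section Local

variable [T2Space M] [SigmaCompactSpace M]

theorem consWedge_smul_left {V : Type*} [NormedAddCommGroup V] [NormedSpace ℝ V] (t : ℝ)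
    (c : V →L[ℝ] ℝ) (a : V [⋀^Fin k]→L[ℝ] ℝ) : consWedge (t • c) a = t • consWedge c a := by
  ext v
  rw [ContinuousAlternatingMap.smul_apply, consWedge_apply, consWedge_apply, smul_eq_mul,
    Finset.mul_sum]
  refine Finset.sum_congr rfl fun i _ => ?_
  rw [smul_apply, smul_eq_mul]
  ring

theorem smul_add_consWedge {V : Type*} [NormedAddCommGroup V] [NormedSpace ℝ V] (t u : ℝ)
    (c : V →L[ℝ] ℝ) (a : V [⋀^Fin k]→L[ℝ] ℝ) (b : V [⋀^Fin (k + 1)]→L[ℝ] ℝ) :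
    consWedge (t • c) a + (t • u) • b = t • (consWedge c a + u • b) := by
  rw [consWedge_smul_left, smul_add, smul_assoc]

theorem alternating_sum_apply {V : Type*} [NormedAddCommGroup V] [NormedSpace ℝ V] {ι : Type*}
    (s : Finset ι) (t : ι → V [⋀^Fin k]→L[ℝ] ℝ) (v : Fin k → V) :
    (∑ i ∈ s, t i) v = ∑ i ∈ s, t i v :=
  ContinuousAlternatingMap.sum_apply _ _

/-- A form of degree two belongs to an ideal as soon as it is, locally, a combination of elements
of the ideal. -/
theorem IsIdealSet.mem_two_of_local {B : FormSet E M} (hB : IsIdealSet B) {ι : Type*} [Fintype ι]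
    {σ : ι → DForm E M 1} {τ : ι → DForm E M 2} (hσ : ∀ i, σ i ∈ B 1) (hτ : ∀ i, τ i ∈ B 2)
    {β : DForm E M 2}
    (h : ∀ z, ∃ (D : ι → M → E →L[ℝ] ℝ) (C : ι → M → ℝ), ∀ᶠ x in 𝓝 z,
      (∀ i, SmoothFormAt (oneForm (D i)) x) ∧ (∀ i, ContMDiffAt 𝓘(ℝ, E) 𝓘(ℝ, ℝ) ∞ (C i) x) ∧
      β x = ∑ i, (consForm (D i) (σ i) x + C i x • τ i x)) : β ∈ B 2 := by
  choose D C hDC using h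
  obtain ⟨U, K, hU⟩ := exists_colouring_of_eventually (E := E) hDC
  refine hB.mem_of_colouring K (n := 1) fun c => ?_
  have h1 : formSmul (fun x => K.b c x ^ 1) β = ∑ i,
      (consForm (fun x => K.b c x • D (K.p c x) i x) (σ i) +
        formSmul (K.glueFun c fun z => C z i) (τ i)) := by
    funext x
    rw [Finset.sum_apply]
    have h2 : ∀ (i : ι), (consForm (fun x => K.b c x • D (K.p c x) i x) (σ i) +
        formSmul (K.glueFun c fun z => C z i) (τ i)) x =
        K.b c x • (consForm (D (K.p c x) i) (σ i) x + C (K.p c x) i x • τ i x) := fun i =>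
      smul_add_consWedge (V := E) _ _ _ _ _
    refine Eq.trans ?_ (Finset.sum_congr rfl fun i _ => h2 i).symm
    rw [← Finset.smul_sum]
    change K.b c x ^ 1 • β x = _
    rw [pow_one]
    rcases K.zero_or_mem' c x with h0 | h0
    · rw [h0]
      exact (zero_smul ℝ (β x : E [⋀^Fin 2]→L[ℝ] ℝ)).trans
        (zero_smul ℝ (_ : E [⋀^Fin 2]→L[ℝ] ℝ)).symm
    · rw [(hU _ _ h0).2.2]
  rw [h1]
  refine hB.sum_mem _ fun i _ => hB.add_mem (hB.consForm_mem_right ?_ (hσ i))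
    (hB.smul_mem (K.contMDiff_glueFun c fun z x hx => (hU z x hx).2.1 i) (hτ i))
  exact K.isSmoothForm_glueForm c (β := fun z => oneForm (D z i)) fun z x hx => (hU z x hx).1 i

/-- The left side is `b(Qv₀, v₁) + b(v₀, Qv₁) - b(Qv₀, Qv₁)`. The factor `2⁻¹` shares the last term
between the two antisymmetric halves. Expanding the argument `Q v` in the dual frame shows the
difference as a sum of wedge products with first factor `c a ∘ Q`. -/
theorem two_form_sub_eq {V : Type*} [NormedAddCommGroup V] [NormedSpace ℝ V] {κ : Type*} [Fintype κ]
    {c : κ → V →L[ℝ] ℝ} {y : κ → V} (hcy : ∀ v, ∑ a, c a v • y a = v)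
    (b : V [⋀^Fin 2]→L[ℝ] ℝ) (Q : V →L[ℝ] V) (v : Fin 2 → V) :
    b v - b (fun j => v j - Q (v j)) = ∑ a,
      (c a (Q (v 0)) * (b.curryLeft (y a) (fun _ => v 1) -
        2⁻¹ * b.curryLeft (y a) (fun _ => Q (v 1))) -
      c a (Q (v 1)) * (b.curryLeft (y a) (fun _ => v 0) -
        2⁻¹ * b.curryLeft (y a) (fun _ => Q (v 0)))) := by
  let g : V → V → ℝ := fun u w => b.curryLeft u (fun _ => w)
  have hg : ∀ v : Fin 2 → V, b v = g (v 0) (v 1) := fun v => by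
    change _ = b (Matrix.vecCons _ _)
    congr 1
    ext j
    fin_cases j <;> rfl
  have hl : ∀ u u' w, g (u - u') w = g u w - g u' w := fun u u' w => by
    simp only [g, map_sub, ContinuousAlternatingMap.sub_apply]
  have ha : ∀ u w, g u w = - g w u := fun u w => by
    have h1 := b.toAlternatingMap.map_swap (v := ![u, w]) (i := 0) (j := 1) (by simp)
    have h2 := hg ![u, w]
    have h3 := hg (![u, w] ∘ Equiv.swap (0 : Fin 2) 1)
    simp only [Matrix.cons_val_zero, Matrix.cons_val_one, Function.comp_apply,
      Equiv.swap_apply_left, Equiv.swap_apply_right] at h2 h3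
    rw [← h2]
    have h4 : b (![u, w] ∘ Equiv.swap (0 : Fin 2) 1) = - b ![u, w] := h1
    linarith
  have hs : ∀ u w, ∑ a, c a u * g (y a) w = g u w := fun u w => by
    conv_rhs => rw [← hcy u]
    simp only [g, map_sum, map_smul, ContinuousAlternatingMap.sum_apply,
      ContinuousAlternatingMap.smul_apply, smul_eq_mul]
  have hr : ∀ u w w', g u (w - w') = g u w - g u w' := fun u w w' => by
    rw [ha, hl, ha w, ha w']
    ring
  have h1 : ∀ a, c a (Q (v 0)) * (g (y a) (v 1) - 2⁻¹ * g (y a) (Q (v 1))) -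
      c a (Q (v 1)) * (g (y a) (v 0) - 2⁻¹ * g (y a) (Q (v 0))) =
      c a (Q (v 0)) * g (y a) (v 1) - 2⁻¹ * (c a (Q (v 0)) * g (y a) (Q (v 1))) -
      (c a (Q (v 1)) * g (y a) (v 0) - 2⁻¹ * (c a (Q (v 1)) * g (y a) (Q (v 0)))) := fun a => by
    ring
  refine Eq.trans ?_ (Finset.sum_congr rfl fun a _ => (h1 a).symm)
  simp only [Finset.sum_sub_distrib, ← Finset.mul_sum, hs]
  rw [hg, hg, hl, hr, hr, ha (Q (v 1)) (v 0), ha (Q (v 1)) (Q (v 0))]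
  ring

/-- If the kernel of `Q` contains the common kernel of a family of forms, then a two-form differs
from its pullback by `1 - Q` by an element of the ideal generated by the family. -/
theorem exists_local_sub_bundlePullback_eq {ι : Type*} [Fintype ι] {θ : ι → DForm E M 1}
    (hθ : ∀ i, IsSmoothForm (θ i)) {r : ℕ}
    (hr : ∀ x, Module.finrank ℝ (Submodule.span ℝ (Set.range fun i => θ i x)) = r)
    {Q : M → E →L[ℝ] E} {x₀ : M} (hQ : ∀ᶠ x in 𝓝 x₀, SmoothFieldAt (fun x => x) Q x)
    (hker : ∀ᶠ x in 𝓝 x₀, ∀ v : E, (∀ i, θ i x (fun _ => v) = 0) → Q x v = 0)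
    {β : DForm E M 2} (hβ : IsSmoothForm β) :
    ∃ D : ι → M → E →L[ℝ] ℝ, ∀ᶠ x in 𝓝 x₀, (∀ i, SmoothFormAt (oneForm (D i)) x) ∧
      β x - bundlePullback (fun x => x) (fun x => ContinuousLinearMap.id ℝ E - Q x) β x =
        ∑ i, consForm (D i) (θ i) x := by
  obtain ⟨κ, _, c, Y, hc, hY, hcY⟩ := exists_global_frame (E := E) (M := M)
  have hθ' := fun i x => isSmoothForm_iff.1 (hθ i) x
  -- Each `c a ∘ Q` vanishes on the common kernel of `θ`, hence is a combination of the `θ i` with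
  -- smooth coefficients.
  have he : ∀ a, ∃ u : ι → M → ℝ, ∀ᶠ x in 𝓝 x₀,
      (∀ i, ContMDiffAt 𝓘(ℝ, E) 𝓘(ℝ, ℝ) ∞ (u i) x) ∧
      bundlePullback (fun x => x) Q (oneForm (c a)) x = ∑ i, u i x • θ i x := fun a => by
    refine exists_local_coeff_of_finrank (Filter.Eventually.of_forall fun x i => hθ' i x)
      (hQ.mono fun x hx => hx.bundlePullback (isSmoothForm_iff.1 (hc a) x))
      (Filter.Eventually.of_forall hr) (hker.mono fun x hx => ?_)
    refine form_mem_span_of_ker fun v hv => ?_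
    change c a x (Q x v) = 0
    rw [hx v hv, map_zero]
  choose u hu using he
  let μ : κ → DForm E M 1 := fun a => contract (Y a) β + formSmul (fun _ => -2⁻¹)
    (bundlePullback (fun x => x) Q (contract (Y a) β))
  -- The minus sign exchanges the factors: the expansion has `(c a ∘ Q) ∧ μ a`, whereas the
  -- conclusion has `θ i` in second place.
  refine ⟨fun i x => covector (∑ a, formSmul (fun x => - u a i x) (μ a)) x, ?_⟩
  filter_upwards [hQ, Filter.eventually_all.2 hu] with x hQx hux
  have hη : ∀ a, SmoothFormAt (contract (Y a) β) x := fun a =>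
    (isSmoothForm_iff.1 hβ x).contract (hY a x)
  have hμ : ∀ a, SmoothFormAt (μ a) x := fun a =>
    (hη a).add ((hQx.bundlePullback (hη a)).smul contMDiffAt_const)
  refine ⟨fun i => ?_, ?_⟩
  · change SmoothFormAt (oneForm (covector _)) x
    rw [oneForm_covector]
    have hsum : ∀ s : Finset κ, SmoothFormAt (∑ a ∈ s, formSmul (fun x => - u a i x) (μ a)) x := by
      classical
      intro s
      induction s using Finset.induction_on with
      | empty => exact smoothFormAt_zero x
      | insert a s ha ih =>
        rw [Finset.sum_insert ha]
        exact ((hμ a).smul ((hux a).1 i).neg).add ih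
    exact hsum _
  · let b : E [⋀^Fin 2]→L[ℝ] ℝ := β x
    let t : ι → E [⋀^Fin 1]→L[ℝ] ℝ := fun i => θ i x
    let m : κ → E → ℝ := fun a v => b.curryLeft (Y a x) (fun _ => v) -
      2⁻¹ * b.curryLeft (Y a x) (fun _ => Q x v)
    let d : ι → E →L[ℝ] ℝ := fun i => covector (∑ a, formSmul (fun x => - u a i x) (μ a)) x
    have hd : ∀ i v, d i v = - ∑ a, u a i x * m a v := fun i v => by
      change (∑ a, formSmul (fun x => - u a i x) (μ a)) x (fun _ => v) = _
      rw [Finset.sum_apply]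
      refine (alternating_sum_apply (V := E) _ _ _).trans ?_
      rw [← Finset.sum_neg_distrib]
      refine Finset.sum_congr rfl fun a _ => ?_
      change - u a i x * (b.curryLeft (Y a x) (fun _ => v) +
        -2⁻¹ * b.curryLeft (Y a x) (fun _ => Q x v)) = - (u a i x * (_ - _))
      ring
    have hct : ∀ a v, c a x (Q x v) = ∑ i, u a i x * t i (fun _ => v) := fun a v => by
      have h1 := congrArg (fun q : E [⋀^Fin 1]→L[ℝ] ℝ => q (fun _ => v)) (hux a).2
      exact h1.trans (alternating_sum_apply (V := E) _ _ _)
    have key : b - b.compContinuousLinearMap (ContinuousLinearMap.id ℝ E - Q x) =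
        ∑ i, consWedge (d i) (t i) := by
      ext v
      refine (two_form_sub_eq (hcY x) b (Q x) v).trans ?_
      rw [ContinuousAlternatingMap.sum_apply]
      have h2 : ∀ i, consWedge (d i) (t i) v =
          d i (v 0) * t i (fun _ => v 1) - d i (v 1) * t i (fun _ => v 0) := fun i => by
        rw [consWedge_apply, Fin.sum_univ_two]
        have e0 : (0 : Fin 2).removeNth v = fun _ => v 1 := by
          ext j; fin_cases j; rfl
        have e1 : (1 : Fin 2).removeNth v = fun _ => v 0 := by
          ext j; fin_cases j; rfl
        rw [e0, e1]
        simp only [Fin.val_zero, pow_zero, Fin.val_one, pow_one]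
        ring
      change ∑ a, (c a x (Q x (v 0)) * m a (v 1) - c a x (Q x (v 1)) * m a (v 0)) = _
      have h3 : ∀ w w' : E, ∑ a, c a x (Q x w) * m a w' = - ∑ i, d i w' * t i (fun _ => w) := by
        intro w w'
        simp only [hd, hct, Finset.sum_mul, neg_mul, Finset.sum_neg_distrib, neg_neg]
        rw [Finset.sum_comm]
        exact Finset.sum_congr rfl fun i _ => Finset.sum_congr rfl fun a _ => by ring
      simp only [h2, Finset.sum_sub_distrib, h3]
      ring
    exact key

end Local

end Reductions
end

noncomputable section

set_option linter.unusedSectionVars false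

/-! ### Splittings adapted to an invariant system, and descent by local sections -/

section Adapted

variable {E : Type*} [NormedAddCommGroup E] [NormedSpace ℝ E] [FiniteDimensional ℝ E]
  {F : Type*} [NormedAddCommGroup F] [NormedSpace ℝ F] [FiniteDimensional ℝ F]
  {M : Type*} [TopologicalSpace M] [ChartedSpace E M] [IsManifold 𝓘(ℝ, E) ∞ M]
  {N : Type*} [TopologicalSpace N] [ChartedSpace F N] [IsManifold 𝓘(ℝ, F) ∞ N]
  {K : Type*} [Group K] [MulAction K M] {k : ℕ}

/-- `q` is a surjective smooth submersion whose fibres are the orbits of a group of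
diffeomorphisms. -/
structure IsOrbitSubmersion (K : Type*) [Group K] [MulAction K M] (q : M → N) : Prop where
  contMDiff_smul : ∀ g : K, ContMDiff 𝓘(ℝ, E) 𝓘(ℝ, E) ∞ (fun x : M => g • x)
  submersion : IsSmoothSubmersion (E := E) (F := F) q
  surjective : Function.Surjective q
  apply_smul : ∀ (g : K) (x : M), q (g • x) = q x
  exists_smul : ∀ x y, q x = q y → ∃ g : K, g • x = y

/-- `s` is a smooth section of `q` near `y₀`. -/
def IsLocalSection (q : M → N) (s : N → M) (y₀ : N) : Prop :=
  ∀ᶠ y in 𝓝 y₀, ContMDiffAt 𝓘(ℝ, F) 𝓘(ℝ, E) ∞ s y ∧ q (s y) = y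

/-- The pullback of a form by a section `s`, composed with the projection `1 - Q`. -/
def sectionPull (Q : M → E →L[ℝ] E) (s : N → M) (β : DForm E M k) : DForm F N k :=
  bundlePullback s (fun y => (ContinuousLinearMap.id ℝ E - Q (s y)).comp
    (tangentField (E := F) (F := E) s y)) β

namespace IsLocalSection

variable {q : M → N} {s : N → M} {y : N}

theorem eventually (h : IsLocalSection (E := E) (F := F) q s y) :
    ∀ᶠ y' in 𝓝 y, IsLocalSection (E := E) (F := F) q s y' :=
  eventually_eventually_nhds.2 h

theorem apply_eq (h : IsLocalSection (E := E) (F := F) q s y) : q (s y) = y := h.self_of_nhds.2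

theorem tangentField_apply (h : IsLocalSection (E := E) (F := F) q s y)
    (hq : ContMDiff 𝓘(ℝ, E) 𝓘(ℝ, F) ∞ q) (w : F) :
    tangentField (E := E) (F := F) q (s y) (tangentField (E := F) (F := E) s y w) = w := by
  have h1 := tangentField_comp (E := F) (F := E) (F' := F) (x := y) (hq (s y)) h.self_of_nhds.1
  have h2 : tangentField (E := F) (F := F) (fun x => q (s x)) y = ContinuousLinearMap.id ℝ F :=
    (tangentField_congr (h.mono fun _ hz => hz.2)).trans (tangentField_id y)
  rw [h2] at h1
  exact (DFunLike.congr_fun h1 w).symm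

theorem smoothFieldAt (h : IsLocalSection (E := E) (F := F) q s y) {Q : M → E →L[ℝ] E}
    (hQ : SmoothFieldAt (fun x => x) Q (s y)) :
    SmoothFieldAt s (fun y => (ContinuousLinearMap.id ℝ E - Q (s y)).comp
      (tangentField (E := F) (F := E) s y)) y :=
  ((smoothFieldAt_id (s y)).sub hQ).comp
    (smoothFieldAt_tangentField (h.mono fun _ hz => hz.1))

theorem smoothFormAt (h : IsLocalSection (E := E) (F := F) q s y) {Q : M → E →L[ℝ] E}
    (hQ : SmoothFieldAt (fun x => x) Q (s y)) {β : DForm E M k} (hβ : SmoothFormAt β (s y)) :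
    SmoothFormAt (sectionPull (F := F) Q s β) y :=
  (h.smoothFieldAt hQ).bundlePullback hβ

end IsLocalSection

theorem IsOrbitSubmersion.tangentField_smul {q : M → N}
    (h : IsOrbitSubmersion (E := E) (F := F) K q) (g : K) (x : M) (v : E) :
    tangentField (E := E) (F := F) q (g • x)
      (tangentField (E := E) (F := E) (fun x : M => g • x) x v) =
      tangentField (E := E) (F := F) q x v := by
  have h1 := tangentField_comp (E := E) (F := E) (F' := F) (x := x) (f := fun x : M => g • x)
    (h.submersion.1 (g • x)) (h.contMDiff_smul g x)
  have h2 : (fun x => q (g • x)) = q := funext fun x => h.apply_smul g x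
  rw [h2] at h1
  exact (DFunLike.congr_fun h1 v).symm

/-- A finite family of local sections of a surjective submersion. -/
theorem exists_coloured_sections [T2Space N] [SigmaCompactSpace N] {q : M → N}
    (hq : IsSmoothSubmersion (E := E) (F := F) q) (hs : Function.Surjective q) :
    ∃ (U : N → Set N) (_ : Colouring (E := F) U) (s : N → N → M),
      ∀ z, ∀ y ∈ U z, IsLocalSection (E := E) (F := F) q (s z) y := by
  have h : ∀ z, ∃ s : N → M, IsLocalSection (E := E) (F := F) q s z := fun z => by
    obtain ⟨x, rfl⟩ := hs z
    obtain ⟨s, -, h⟩ := exists_smooth_section (E := E) (F := F) (p := q) (x₀ := x)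
      (Filter.Eventually.of_forall fun x => hq.1 x) (hq.2 x)
    exact ⟨s, h⟩
  choose s hs using h
  obtain ⟨U, C, hU⟩ := exists_colouring_of_eventually (E := F) fun z => (hs z).eventually
  exact ⟨U, C, s, hU⟩

variable {ι : Type*} {S : FormSet E M} {θ : ι → DForm E M 1} {r : ℕ} {q : M → N}
  {Q : M → E →L[ℝ] E}

/-- A splitting of the tangent spaces which is adapted to an invariant Pfaffian system. -/
structure IsAdaptedSplitting (K : Type*) [Group K] [MulAction K M] (q : M → N) (S : FormSet E M)
    (θ : ι → DForm E M 1) (r : ℕ) (Q : M → E →L[ℝ] E) : Prop where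
  orbit : IsOrbitSubmersion (E := E) (F := F) K q
  frame : IsPfaffianFrame S θ r
  invariant : ∀ (g : K) (j : ι) (y : M),
    (formPullback (fun x : M => g • x) (θ j) : DForm E M 1) y ∈
      Submodule.span ℝ (Set.range fun i => θ i y)
  split : IsSplitting (F := F) q Q
  apply_eq_zero : ∀ (x : M) (v : E), (∀ i, θ i x (fun _ => v) = 0) → Q x v = 0

/-- The algebraic ideal generated by the pullback of the reduced system and by the sections of
the bundle determined by `Q`. -/
def extensionIdeal (F : Type*) [NormedAddCommGroup F] [NormedSpace ℝ F] {N : Type*}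
    [TopologicalSpace N] [ChartedSpace F N] (q : M → N) (S : FormSet E M) (Q : M → E →L[ℝ] E) :
    FormSet E M :=
  algIdeal fun k => pullbackSet q (reduction q S : FormSet F N) k ∪ sectionsOf (splitBundle Q) k

namespace IsAdaptedSplitting

/-- Some element of `K` carries `x` to `x'`. By invariance of the span of `θ` its differential
preserves integral vectors, and it does not affect projections because `q` is invariant. -/
theorem exists_transport (h : IsAdaptedSplitting (F := F) K q S θ r Q) {x x' : M} (hx : q x = q x')
    {v : E} (hv : ∀ i, θ i x (fun _ => v) = 0) : ∃ w : E, (∀ i, θ i x' (fun _ => w) = 0) ∧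
      tangentField (E := E) (F := F) q x' w = tangentField (E := E) (F := F) q x v := by
  obtain ⟨g, rfl⟩ := h.orbit.exists_smul x x' hx
  exact ⟨tangentField (E := E) (F := E) (fun x : M => g • x) x v,
    fun i => form_apply_eq_zero_of_mem_span (h.invariant g i x) hv, h.orbit.tangentField_smul g x v⟩

/-- The vector `u - w` is vertical, hence fixed by `Q`, while `Q` kills `w`. So `1 - Q` sends every
lift of a tangent vector to its integral lift, whenever there is one. -/
theorem sub_apply_eq (h : IsAdaptedSplitting (F := F) K q S θ r Q) {x : M} {u w : E}
    (hw : ∀ i, θ i x (fun _ => w) = 0)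
    (huw : tangentField (E := E) (F := F) q x u = tangentField (E := E) (F := F) q x w) :
    u - Q x u = w := by
  have h1 := h.split.fix x (u - w) (by rw [map_sub, huw, sub_self])
  rw [map_sub, h.apply_eq_zero x w hw, sub_zero] at h1
  rw [h1, sub_sub_cancel]

/-- The splitting projects lifts of `v` to the lift which is annihilated by the system. -/
theorem sub_apply_section (h : IsAdaptedSplitting (F := F) K q S θ r Q) {s : N → M} {x : M}
    (hs : IsLocalSection (E := E) (F := F) q s (q x)) {w : E}
    (hw : ∀ i, θ i (s (q x)) (fun _ => w) = 0) {v : E}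
    (hwv : tangentField (E := E) (F := F) q (s (q x)) w = tangentField (E := E) (F := F) q x v) :
    (ContinuousLinearMap.id ℝ E - Q (s (q x))) (tangentField (E := F) (F := E) s (q x)
      (tangentField (E := E) (F := F) q x v)) = w :=
  h.sub_apply_eq hw ((hs.tangentField_apply h.orbit.submersion.1 _).trans hwv.symm)

variable [Fintype ι]

/-- An integral vector at `x` can be transported to `s (q x)`, and `(1 - Q) s_* q_*` sends it
exactly to the transported vector, on which `θ j` vanishes. The individual `θ j` need not be
invariant; only their span is. -/
theorem formPullback_sectionPull_mem_span (h : IsAdaptedSplitting (F := F) K q S θ r Q) {s : N → M}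
    {x : M} (hs : IsLocalSection (E := E) (F := F) q s (q x)) (j : ι) :
    (formPullback q (sectionPull (F := F) Q s (θ j)) : DForm E M 1) x ∈
      Submodule.span ℝ (Set.range fun i => θ i x) := by
  refine form_mem_span_of_ker fun v hv => ?_
  obtain ⟨w, hw, hwv⟩ := h.exists_transport (x := x) (x' := s (q x)) hs.apply_eq.symm hv
  have h1 := h.sub_apply_section hs hw hwv
  refine Eq.trans ?_ (hw j)
  exact congrArg (fun u : E => θ j (s (q x)) (fun _ => u)) h1

/-- The forms obtained from a local section, together with the components along the fibres. -/
def sectionFrame (q : M → N) (Q : M → E →L[ℝ] E) (θ : ι → DForm E M 1) (s : N → M) :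
    ι ⊕ ι → DForm E M 1 :=
  Sum.elim (fun j => formPullback q (sectionPull (F := F) Q s (θ j)))
    (fun j => bundlePullback (fun x => x) Q (θ j))

theorem bundlePullback_mem_span (h : IsAdaptedSplitting (F := F) K q S θ r Q) (β : DForm E M 1)
    (x : M) : bundlePullback (fun x => x) Q β x ∈
      Submodule.span ℝ (Set.range fun i => θ i x) := by
  refine form_mem_span_of_ker fun v hv => ?_
  have h1 := h.apply_eq_zero x v hv
  exact (congrArg (fun u : E => β x (fun _ => u)) h1).trans
    ((show E [⋀^Fin 1]→L[ℝ] ℝ from β x).map_zero)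

/-- Vanishing of the forms `θ j ∘ Q` makes `Q x v` both vertical and integral, hence zero. Vanishing
of the descended forms makes `(1 - Q) s_* q_* v` integral at `s (q x)`. Transported back to `x`, it
is an integral vector with the same projection as `v`, and since `Q x v = 0` it is `v`. -/
theorem apply_eq_zero_of_sectionFrame (h : IsAdaptedSplitting (F := F) K q S θ r Q) {s : N → M}
    {x : M} (hs : IsLocalSection (E := E) (F := F) q s (q x)) {v : E}
    (hv : ∀ a, sectionFrame (F := F) q Q θ s a x (fun _ => v) = 0) (i : ι) :
    θ i x (fun _ => v) = 0 := by
  have h0 : Q x v = 0 := by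
    rw [← h.split.fix x (Q x v) (h.split.vert x v)]
    exact h.apply_eq_zero x _ fun j => hv (Sum.inr j)
  obtain ⟨v', hv', hvv⟩ := h.exists_transport (x := s (q x)) (x' := x) hs.apply_eq
    (v := (ContinuousLinearMap.id ℝ E - Q (s (q x))) (tangentField (E := F) (F := E) s (q x)
      (tangentField (E := E) (F := F) q x v))) fun j => hv (Sum.inl j)
  have h1 : tangentField (E := E) (F := F) q x v = tangentField (E := E) (F := F) q x v' := by
    rw [hvv, sub_apply, map_sub, h.split.vert, sub_zero]
    exact (hs.tangentField_apply h.orbit.submersion.1 _).symm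
  have h2 := h.sub_apply_eq hv' h1
  rw [h0, sub_zero] at h2
  rw [h2]
  exact hv' i

theorem span_sectionFrame (h : IsAdaptedSplitting (F := F) K q S θ r Q) {s : N → M}
    {x : M} (hs : IsLocalSection (E := E) (F := F) q s (q x)) :
    Submodule.span ℝ (Set.range fun a => sectionFrame (F := F) q Q θ s a x) =
      Submodule.span ℝ (Set.range fun i => θ i x) := by
  apply le_antisymm
  · rw [Submodule.span_le]
    rintro _ ⟨a | a, rfl⟩
    · exact h.formPullback_sectionPull_mem_span hs a
    · exact h.bundlePullback_mem_span (θ a) x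
  · rw [Submodule.span_le]
    rintro _ ⟨i, rfl⟩
    exact form_mem_span_of_ker fun v hv => h.apply_eq_zero_of_sectionFrame hs hv i

end IsAdaptedSplitting

end Adapted
end

noncomputable section

set_option linter.unusedSectionVars false

/-! ### The 1-forms of the system lie in the extension ideal -/

section Generation

variable {E : Type*} [NormedAddCommGroup E] [NormedSpace ℝ E] [FiniteDimensional ℝ E]
  {F : Type*} [NormedAddCommGroup F] [NormedSpace ℝ F] [FiniteDimensional ℝ F]
  {M : Type*} [TopologicalSpace M] [ChartedSpace E M] [IsManifold 𝓘(ℝ, E) ∞ M]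
  {N : Type*} [TopologicalSpace N] [ChartedSpace F N] [IsManifold 𝓘(ℝ, F) ∞ N]
  {K : Type*} [Group K] [MulAction K M] {k : ℕ}
  {ι : Type*} [Fintype ι] {S : FormSet E M} {θ : ι → DForm E M 1} {r : ℕ} {q : M → N}
  {Q : M → E →L[ℝ] E}

namespace IsAdaptedSplitting

theorem smoothFormAt_sectionPull (h : IsAdaptedSplitting (F := F) K q S θ r Q) {s : N → M} {y : N}
    (hs : IsLocalSection (E := E) (F := F) q s y) {β : DForm E M k} (hβ : IsSmoothForm β) :
    SmoothFormAt (sectionPull (F := F) Q s β) y :=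
  hs.smoothFormAt (h.split.smooth _) (isSmoothForm_iff.1 hβ _)

theorem smoothFormAt_formPullback_sectionPull (h : IsAdaptedSplitting (F := F) K q S θ r Q)
    {s : N → M} {x : M} (hs : IsLocalSection (E := E) (F := F) q s (q x)) {β : DForm E M k}
    (hβ : IsSmoothForm β) :
    SmoothFormAt (formPullback q (sectionPull (F := F) Q s β) : DForm E M k) x :=
  (h.smoothFormAt_sectionPull hs hβ).pullback (Filter.Eventually.of_forall fun x =>
    h.orbit.submersion.1 x)

theorem eventually_isLocalSection (h : IsAdaptedSplitting (F := F) K q S θ r Q) {s : N → M} {x : M}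
    (hs : IsLocalSection (E := E) (F := F) q s (q x)) :
    ∀ᶠ x' in 𝓝 x, IsLocalSection (E := E) (F := F) q s (q x') :=
  h.orbit.submersion.1.continuous.continuousAt.eventually hs.eventually

section Coloured

variable {U : N → Set N} (C : Colouring (E := F) U) {s : N → N → M}

theorem glueForm_sectionPull_mem (h : IsAdaptedSplitting (F := F) K q S θ r Q) [T2Space M]
    [SigmaCompactSpace M] (hs : ∀ z, ∀ y ∈ U z, IsLocalSection (E := E) (F := F) q (s z) y)
    (c : Fin C.num) (j : ι) :
    C.glueForm c (fun z => sectionPull (F := F) Q (s z) (θ j)) ∈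
      (reduction q S : FormSet F N) 1 := by
  have hsm : IsSmoothForm (C.glueForm c (fun z => sectionPull (F := F) Q (s z) (θ j))) :=
    C.isSmoothForm_glueForm c fun z y hy => h.smoothFormAt_sectionPull (hs z y hy) (h.frame.smooth j)
  refine ⟨hsm, h.frame.mem_of_span (hsm.pullback h.orbit.submersion.1) fun x => ?_⟩
  change C.b c (q x) • (formPullback q (sectionPull (F := F) Q (s (C.p c (q x))) (θ j)) :
    DForm E M 1) x ∈ _
  rcases C.zero_or_mem' c (q x) with h0 | h0
  · rw [h0, zero_smul]
    exact Submodule.zero_mem _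
  · exact Submodule.smul_mem _ _ (h.formPullback_sectionPull_mem_span (hs _ _ h0) j)

end Coloured

theorem isIdealSet_extensionIdeal : IsIdealSet (extensionIdeal F q S Q) := isIdealSet_algIdeal _

theorem formPullback_mem_extensionIdeal {β : DForm F N k}
    (hβ : β ∈ (reduction q S : FormSet F N) k) :
    (formPullback q β : DForm E M k) ∈ extensionIdeal F q S Q k :=
  AlgGen.of (Or.inl ⟨β, hβ, rfl⟩)

variable [T2Space M] [SigmaCompactSpace M]

theorem bundlePullback_mem_extensionIdeal (h : IsAdaptedSplitting (F := F) K q S θ r Q)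
    {β : DForm E M 1} (hβ : IsSmoothForm β) :
    bundlePullback (fun x => x) Q β ∈ extensionIdeal F q S Q 1 :=
  AlgGen.of (Or.inr (SectionOf.mk (isSmoothForm_iff.2 fun x => SmoothFieldAt.bundlePullback (h.split.smooth x)
    (isSmoothForm_iff.1 hβ x)) fun x => bundlePullback_mem_splitBundle Q β x))

variable [T2Space N] [SigmaCompactSpace N]

theorem mem_of_mul_colouring {U : N → Set N} (C : Colouring (E := F) U) {B : FormSet E M}
    (hB : IsIdealSet B) (h : IsAdaptedSplitting (F := F) K q S θ r Q) {β : DForm E M k}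
    (hβ : ∀ c, formSmul (fun x => C.b c (q x)) β ∈ B k) : β ∈ B k :=
  hB.mem_of_weights (fun c => (C.smooth c).comp h.orbit.submersion.1)
    (fun x => by simp [C.sum_eq_one]) hβ

/-- For a local section, `sectionFrame` has the same span as `θ`, hence the same constant rank, so
`θ i` has smooth coefficients in it. One colour is treated at a time, so that finitely many glued
generators suffice. -/
theorem form_mem_extensionIdeal (h : IsAdaptedSplitting (F := F) K q S θ r Q) (i : ι) :
    θ i ∈ extensionIdeal F q S Q 1 := by
  obtain ⟨U, C, s, hs⟩ := exists_coloured_sections h.orbit.submersion h.orbit.surjective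
  have hB := isIdealSet_extensionIdeal (F := F) (q := q) (S := S) (Q := Q)
  refine h.mem_of_mul_colouring C hB fun c => ?_
  let σ : ι ⊕ ι → DForm E M 1 := Sum.elim
    (fun j => formPullback q (C.glueForm c fun z => sectionPull (F := F) Q (s z) (θ j)))
    (fun j => bundlePullback (fun x => x) Q (θ j))
  have hσ : ∀ a, σ a ∈ extensionIdeal F q S Q 1 := by
    rintro (j | j)
    · exact formPullback_mem_extensionIdeal (h.glueForm_sectionPull_mem C hs c j)
    · exact h.bundlePullback_mem_extensionIdeal (h.frame.smooth j)
  obtain ⟨u, hu, hσu⟩ := exists_coeff_of_local (σ := σ)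
    (β := formSmul (fun x => C.b c (q x)) (θ i)) fun x₀ => by
    have hqc := h.orbit.submersion.1.continuous.continuousAt (x := x₀)
    rcases C.zero_or_mem c (q x₀) with h0 | ⟨h0, h1⟩
    · refine ⟨fun _ _ => 0, (hqc.eventually h0).mono fun x hx => ⟨fun _ => contMDiffAt_const, ?_⟩⟩
      change C.b c (q x) • θ i x = _
      rw [hx, zero_smul]
      exact (Finset.sum_eq_zero fun a _ => zero_smul ℝ (σ a x)).symm
    · have hs' := hs _ _ h0
      have hev := h.eventually_isLocalSection hs'
      obtain ⟨u, hu⟩ := exists_local_coeff_of_finrank (β := θ i) (r := r) (z := x₀)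
        (σ := sectionFrame (F := F) q Q θ (s (C.p c (q x₀))))
        (hev.mono fun x hx a => by
          rcases a with j | j
          · exact h.smoothFormAt_formPullback_sectionPull hx (h.frame.smooth j)
          · exact (h.split.smooth x).bundlePullback (isSmoothForm_iff.1 (h.frame.smooth j) x))
        (Filter.Eventually.of_forall fun x => isSmoothForm_iff.1 (h.frame.smooth i) x)
        (hev.mono fun x hx => by rw [h.span_sectionFrame hx, h.frame.finrank])
        (hev.mono fun x hx => by
          rw [h.span_sectionFrame hx]
          exact Submodule.subset_span ⟨i, rfl⟩)
      -- The glued descended forms already contain the cutoff. The forms `θ j ∘ Q` are global and do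
      -- not, so there it goes into the coefficient.
      refine ⟨Sum.elim (fun j => u (Sum.inl j)) (fun j x => C.b c (q x) * u (Sum.inr j) x), ?_⟩
      filter_upwards [hu, hqc.eventually h1] with x hx hpx
      refine ⟨?_, ?_⟩
      · rintro (j | j)
        · exact hx.1 _
        · exact (((C.smooth c).comp h.orbit.submersion.1) x).mul (hx.1 _)
      · change C.b c (q x) • θ i x = _
        rw [hx.2, Finset.smul_sum]
        refine Finset.sum_congr rfl fun a _ => ?_
        rw [smul_smul]
        rcases a with j | j
        · change (_ * _) • (formPullback q (sectionPull (F := F) Q (s (C.p c (q x₀))) (θ j)) :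
            DForm E M 1) x = u (Sum.inl j) x • C.b c (q x) •
              (formPullback q (sectionPull (F := F) Q (s (C.p c (q x))) (θ j)) : DForm E M 1) x
          rw [hpx, smul_smul, mul_comm]
        · rfl
  rw [hσu]
  exact hB.sum_mem _ fun a _ => hB.smul_mem (hu a) (hσ a)

theorem mem_extensionIdeal_of_span (h : IsAdaptedSplitting (F := F) K q S θ r Q) {β : DForm E M 1}
    (hβ : IsSmoothForm β) (hspan : ∀ x, β x ∈ Submodule.span ℝ (Set.range fun i => θ i x)) :
    β ∈ extensionIdeal F q S Q 1 := by
  have hB := isIdealSet_extensionIdeal (F := F) (q := q) (S := S) (Q := Q)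
  obtain ⟨u, hu, rfl⟩ := exists_coeff_of_finrank h.frame.smooth hβ h.frame.finrank hspan
  exact hB.sum_mem _ fun a _ => hB.smul_mem (hu a) (h.form_mem_extensionIdeal a)

/-- Forms factoring through `Q` vanish on integral vectors, so sections of the bundle lie in the
span of `θ`. -/
theorem extensionIdeal_subset (h : IsAdaptedSplitting (F := F) K q S θ r Q) (k : ℕ) :
    extensionIdeal F q S Q k ⊆ S k := by
  refine algIdeal_subset h.frame.isIdealSet (fun k => ?_) k
  rintro β (hβ | hβ)
  · exact pullbackSet_reduction_subset q S k hβ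
  · cases hβ with
    | mk hβ hJ =>
      refine h.frame.mem_of_span hβ fun x => form_mem_span_of_ker fun v hv => ?_
      exact apply_eq_zero_of_mem_splitBundle (h.apply_eq_zero x v hv) (hJ x)

end IsAdaptedSplitting

end Generation
end

noncomputable section

set_option linter.unusedSectionVars false

/-! ### Local generation of 2-forms -/

section TwoForms

variable {E : Type*} [NormedAddCommGroup E] [NormedSpace ℝ E] [FiniteDimensional ℝ E]
  {F : Type*} [NormedAddCommGroup F] [NormedSpace ℝ F] [FiniteDimensional ℝ F]
  {M : Type*} [TopologicalSpace M] [ChartedSpace E M] [IsManifold 𝓘(ℝ, E) ∞ M]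
  {N : Type*} [TopologicalSpace N] [ChartedSpace F N] [IsManifold 𝓘(ℝ, F) ∞ N]
  {K : Type*} [Group K] [MulAction K M] {k : ℕ} {κ : Type*} [Fintype κ]

theorem bundlePullback_congr_at {φ φ' : M → N} {A A' : M → E →L[ℝ] F} {x : M} (h : φ x = φ' x)
    (h' : A x = A' x) (β : DForm F N k) : bundlePullback φ A β x = bundlePullback φ' A' β x := by
  unfold bundlePullback
  rw [h, h']

theorem consWedge_add_left {V : Type*} [NormedAddCommGroup V] [NormedSpace ℝ V]
    (c c' : V →L[ℝ] ℝ) (a : V [⋀^Fin k]→L[ℝ] ℝ) :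
    consWedge (c + c') a = consWedge c a + consWedge c' a := by
  ext v
  simp only [ContinuousAlternatingMap.add_apply, consWedge_apply, add_apply, add_mul, mul_add,
    Finset.sum_add_distrib]

theorem consWedge_sum_right {V : Type*} [NormedAddCommGroup V] [NormedSpace ℝ V]
    (c : V →L[ℝ] ℝ) (u : κ → ℝ) (a : κ → V [⋀^Fin k]→L[ℝ] ℝ) :
    consWedge c (∑ i, u i • a i) = ∑ i, consWedge (u i • c) (a i) := by
  ext v
  simp only [ContinuousAlternatingMap.sum_apply, ContinuousAlternatingMap.smul_apply,
    consWedge_apply, smul_apply, smul_eq_mul, Finset.mul_sum]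
  rw [Finset.sum_comm]
  exact Finset.sum_congr rfl fun i _ => Finset.sum_congr rfl fun j _ => by ring

/-- Near `z`, the two-form `β` is a combination with smooth coefficients of the one-forms `σ` and
the two-forms `τ`. -/
def LocallyGenerated (σ : κ → DForm E M 1) (τ : κ → DForm E M 2) (z : M) (β : DForm E M 2) : Prop :=
  ∃ (D : κ → M → E →L[ℝ] ℝ) (C : κ → M → ℝ), ∀ᶠ x in 𝓝 z,
    (∀ i, SmoothFormAt (oneForm (D i)) x) ∧ (∀ i, ContMDiffAt 𝓘(ℝ, E) 𝓘(ℝ, ℝ) ∞ (C i) x) ∧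
    β x = ∑ i, (consForm (D i) (σ i) x + C i x • τ i x)

namespace LocallyGenerated

variable {σ : κ → DForm E M 1} {τ : κ → DForm E M 2} {z : M} {β η : DForm E M 2}

theorem congr (h : LocallyGenerated σ τ z β) (hβη : ∀ᶠ x in 𝓝 z, β x = η x) :
    LocallyGenerated σ τ z η := by
  obtain ⟨D, C, h⟩ := h
  refine ⟨D, C, ?_⟩
  filter_upwards [h, hβη] with x hx hx'
  exact ⟨hx.1, hx.2.1, hx' ▸ hx.2.2⟩

theorem smoothFormAt_zero_covector (x : M) : SmoothFormAt (oneForm fun _ : M => (0 : E →L[ℝ] ℝ)) x :=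
  (smoothFormAt_zero x).congr (Filter.Eventually.of_forall fun _ =>
    form_one_ext fun _ => rfl)

theorem zero (σ : κ → DForm E M 1) (τ : κ → DForm E M 2) (z : M) : LocallyGenerated σ τ z 0 := by
  refine ⟨fun _ _ => 0, fun _ _ => 0, Filter.Eventually.of_forall fun x =>
    ⟨fun i => smoothFormAt_zero_covector x, fun i => contMDiffAt_const, ?_⟩⟩
  have h : ∀ i, consForm (fun _ : M => (0 : E →L[ℝ] ℝ)) (σ i) x + (0 : ℝ) • τ i x = 0 := fun i => by
    have h1 := consWedge_smul_left (V := E) 0 0 (σ i x)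
    rw [smul_zero, zero_smul] at h1
    rw [zero_smul, add_zero]
    exact h1
  exact (Finset.sum_eq_zero fun i _ => h i).symm

theorem add (h : LocallyGenerated σ τ z β) (h' : LocallyGenerated σ τ z η) :
    LocallyGenerated σ τ z (β + η) := by
  obtain ⟨D, C, h⟩ := h
  obtain ⟨D', C', h'⟩ := h'
  refine ⟨fun i x => D i x + D' i x, fun i x => C i x + C' i x, ?_⟩
  filter_upwards [h, h'] with x hx hx'
  refine ⟨fun i => ((hx.1 i).add (hx'.1 i)).congr (Filter.Eventually.of_forall fun _ =>
    form_one_ext fun _ => rfl), fun i => (hx.2.1 i).add (hx'.2.1 i), ?_⟩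
  change β x + η x = _
  rw [hx.2.2, hx'.2.2, ← Finset.sum_add_distrib]
  refine Finset.sum_congr rfl fun i _ => ?_
  have h1 : consForm (fun x => D i x + D' i x) (σ i) x =
      consForm (D i) (σ i) x + consForm (D' i) (σ i) x := consWedge_add_left (V := E) _ _ _
  rw [h1, add_smul]
  abel

theorem smul (h : LocallyGenerated σ τ z β) {u : M → ℝ}
    (hu : ∀ᶠ x in 𝓝 z, ContMDiffAt 𝓘(ℝ, E) 𝓘(ℝ, ℝ) ∞ u x) :
    LocallyGenerated σ τ z (formSmul u β) := by
  obtain ⟨D, C, h⟩ := h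
  refine ⟨fun i x => u x • D i x, fun i x => u x • C i x, ?_⟩
  filter_upwards [h, hu] with x hx hx'
  refine ⟨fun i => (hx.1 i).smul hx', fun i => hx'.mul (hx.2.1 i), ?_⟩
  change u x • β x = _
  rw [hx.2.2, Finset.smul_sum]
  exact Finset.sum_congr rfl fun i _ => (smul_add_consWedge (V := E) _ _ _ _ _).symm

theorem sub (h : LocallyGenerated σ τ z β) (h' : LocallyGenerated σ τ z η) :
    LocallyGenerated σ τ z (β - η) := by
  refine (h.add (h'.smul (u := fun _ => -1) (Filter.Eventually.of_forall fun x =>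
    contMDiffAt_const))).congr (Filter.Eventually.of_forall fun x => ?_)
  have hgen : ∀ a b : E [⋀^Fin 2]→L[ℝ] ℝ, a + (-1 : ℝ) • b = a - b := fun a b => by
    ext v
    simp only [ContinuousAlternatingMap.add_apply, ContinuousAlternatingMap.smul_apply,
      ContinuousAlternatingMap.sub_apply, smul_eq_mul]
    ring
  exact hgen (β x) (η x)

theorem sum {ν : Type*} [Fintype ν] {β : ν → DForm E M 2}
    (h : ∀ a, LocallyGenerated σ τ z (β a)) : LocallyGenerated σ τ z (∑ a, β a) := by
  classical
  have h' : ∀ s : Finset ν, LocallyGenerated σ τ z (∑ a ∈ s, β a) := fun s => by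
    induction s using Finset.induction_on with
    | empty => exact zero σ τ z
    | insert a s ha ih =>
      rw [Finset.sum_insert ha]
      exact (h a).add ih
  exact h' _

theorem consForm {c : M → E →L[ℝ] ℝ} {α : DForm E M 1}
    (hc : ∀ᶠ x in 𝓝 z, SmoothFormAt (oneForm c) x)
    (hα : ∃ u : κ → M → ℝ, ∀ᶠ x in 𝓝 z, (∀ i, ContMDiffAt 𝓘(ℝ, E) 𝓘(ℝ, ℝ) ∞ (u i) x) ∧
      α x = ∑ i, u i x • σ i x) : LocallyGenerated σ τ z (consForm c α) := by
  obtain ⟨u, hu⟩ := hα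
  refine ⟨fun i x => u i x • c x, fun _ _ => 0, ?_⟩
  filter_upwards [hc, hu] with x hx hux
  refine ⟨fun i => hx.smul (hux.1 i), fun i => contMDiffAt_const, ?_⟩
  have h1 := consWedge_sum_right (V := E) (c x) (fun i => u i x) (fun i => σ i x)
  have h2 : _root_.consForm c α x = consWedge (V := E) (c x) (∑ i, u i x • σ i x) :=
    congrArg (consWedge (V := E) (c x)) hux.2
  refine (h2.trans h1).trans (Finset.sum_congr rfl fun i _ => ?_)
  rw [zero_smul, add_zero]
  rfl

theorem single (τ : κ → DForm E M 2) (z : M) (i : κ) : LocallyGenerated σ τ z (τ i) := by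
  classical
  refine ⟨fun _ _ => 0, fun j _ => if j = i then 1 else 0, Filter.Eventually.of_forall fun x =>
    ⟨fun i => smoothFormAt_zero_covector x, fun i => contMDiffAt_const, ?_⟩⟩
  have h : ∀ j, _root_.consForm (fun _ : M => (0 : E →L[ℝ] ℝ)) (σ j) x = 0 := fun j => by
    have h1 := consWedge_smul_left (V := E) 0 0 (σ j x)
    rw [smul_zero, zero_smul] at h1
    exact h1
  refine Eq.symm ((Finset.sum_eq_single i ?_ ?_).trans ?_)
  · intro j _ hj
    beta_reduce
    rw [h, if_neg hj, zero_smul, add_zero]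
  · intro hi
    exact absurd (Finset.mem_univ i) hi
  · beta_reduce
    rw [h, if_pos rfl, one_smul, zero_add]

theorem exists_coeff_single (σ : κ → DForm E M 1) (z : M) (i : κ) : ∃ u : κ → M → ℝ,
    ∀ᶠ x in 𝓝 z, (∀ j, ContMDiffAt 𝓘(ℝ, E) 𝓘(ℝ, ℝ) ∞ (u j) x) ∧ σ i x = ∑ j, u j x • σ j x := by
  classical
  refine ⟨fun j _ => if j = i then 1 else 0, Filter.Eventually.of_forall fun x =>
    ⟨fun i => contMDiffAt_const, Eq.symm ((Finset.sum_eq_single i ?_ ?_).trans ?_)⟩⟩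
  · intro j _ hj
    beta_reduce
    rw [if_neg hj, zero_smul]
  · intro hi
    exact absurd (Finset.mem_univ i) hi
  · beta_reduce
    rw [if_pos rfl, one_smul]

theorem trans {κ' : Type*} [Fintype κ'] {σ' : κ' → DForm E M 1} {τ' : κ' → DForm E M 2}
    (h : LocallyGenerated σ τ z β)
    (hσ : ∀ i, ∃ u : κ' → M → ℝ, ∀ᶠ x in 𝓝 z, (∀ j, ContMDiffAt 𝓘(ℝ, E) 𝓘(ℝ, ℝ) ∞ (u j) x) ∧
      σ i x = ∑ j, u j x • σ' j x)
    (hτ : ∀ i, LocallyGenerated σ' τ' z (τ i)) : LocallyGenerated σ' τ' z β := by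
  obtain ⟨D, C, h⟩ := h
  refine (sum fun i => (consForm (h.mono fun x hx => hx.1 i) (hσ i)).add
    ((hτ i).smul (h.mono fun x hx => hx.2.1 i))).congr (h.mono fun x hx => ?_)
  rw [hx.2.2, Finset.sum_apply]
  rfl

/-- A cutoff `u` is moved from the form to its generators: near `z`, the forms `u • σ i` and `u • τ
i` agree with globally defined ones, while `σ` and `τ` may exist only locally. -/
theorem smul_gens {σ' : κ → DForm E M 1} {τ' : κ → DForm E M 2} (h : LocallyGenerated σ τ z β)
    {u : M → ℝ} (hσ : ∀ᶠ x in 𝓝 z, ∀ i, σ' i x = u x • σ i x)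
    (hτ : ∀ᶠ x in 𝓝 z, ∀ i, τ' i x = u x • τ i x) : LocallyGenerated σ' τ' z (formSmul u β) := by
  obtain ⟨D, C, h⟩ := h
  refine ⟨D, C, ?_⟩
  filter_upwards [h, hσ, hτ] with x hx hσx hτx
  refine ⟨hx.1, hx.2.1, ?_⟩
  change u x • β x = _
  rw [hx.2.2, Finset.smul_sum]
  refine Finset.sum_congr rfl fun i _ => ?_
  have hgen : ∀ (c : E →L[ℝ] ℝ) (a : E [⋀^Fin 1]→L[ℝ] ℝ) (t w : ℝ) (b : E [⋀^Fin 2]→L[ℝ] ℝ),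
      t • (consWedge c a + w • b) = consWedge c (t • a) + w • (t • b) := fun c a t w b => by
    have h1 := consWedge_sum_right (κ := Unit) c (fun _ => t) (fun _ => a)
    simp only [Finset.univ_unique, Finset.sum_singleton] at h1
    rw [h1, consWedge_smul_left, smul_add, smul_comm]
  rw [hτx]
  refine (hgen _ _ _ _ _).trans (congrArg₂ (· + ·) ?_ rfl)
  exact congrArg (consWedge (V := E) (D i x)) (hσx i).symm

theorem mem [T2Space M] [SigmaCompactSpace M] {B : FormSet E M} (hB : IsIdealSet B)
    (hσ : ∀ i, σ i ∈ B 1) (hτ : ∀ i, τ i ∈ B 2) (h : ∀ z, LocallyGenerated σ τ z β) : β ∈ B 2 :=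
  hB.mem_two_of_local hσ hτ h

end LocallyGenerated

end TwoForms
end

noncomputable section

set_option linter.unusedSectionVars false

/-! ### Smooth slices and the exterior derivatives of the generators -/

section Slices

variable {E : Type*} [NormedAddCommGroup E] [NormedSpace ℝ E] [FiniteDimensional ℝ E]
  {F : Type*} [NormedAddCommGroup F] [NormedSpace ℝ F] [FiniteDimensional ℝ F]
  {M : Type*} [TopologicalSpace M] [ChartedSpace E M] [IsManifold 𝓘(ℝ, E) ∞ M]
  {N : Type*} [TopologicalSpace N] [ChartedSpace F N] [IsManifold 𝓘(ℝ, F) ∞ N]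
  {K : Type*} [Group K] [MulAction K M] {k : ℕ}
  {ι : Type*} [Fintype ι] {S : FormSet E M} {θ : ι → DForm E M 1} {r : ℕ} {q : M → N}
  {Q : M → E →L[ℝ] E}

/-- Near every point, `x` is obtained from the value `s (q x)` of a local section by the action of
a group element depending smoothly on `x`. -/
def HasSmoothSlices (K : Type*) [Group K] [MulAction K M] (q : M → N) : Prop :=
  ∀ (s : N → M) (z : M), IsLocalSection (E := E) (F := F) q s (q z) → ∃ γ : M → K,
    ∀ᶠ x in 𝓝 z, γ x • s (q x) = x ∧ ∀ y : M,
      ContMDiffAt (𝓘(ℝ, E).prod 𝓘(ℝ, E)) 𝓘(ℝ, E) ∞ (fun p : M × M => γ p.1 • p.2) (x, y) ∧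
      ContMDiffAt (𝓘(ℝ, E).prod 𝓘(ℝ, E)) 𝓘(ℝ, E) ∞ (fun p : M × M => (γ p.1)⁻¹ • p.2) (x, y)

/-- The composition of `q`, of a section `s` and of the projection `1 - Q`, on tangent spaces. -/
def sectionField (q : M → N) (Q : M → E →L[ℝ] E) (s : N → M) (x : M) : E →L[ℝ] E :=
  ((ContinuousLinearMap.id ℝ E - Q (s (q x))).comp (tangentField (E := F) (F := E) s (q x))).comp
    (tangentField (E := E) (F := F) q x)

theorem formPullback_sectionPull (q : M → N) (Q : M → E →L[ℝ] E) (s : N → M) (β : DForm E M k) :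
    (formPullback q (sectionPull (F := F) Q s β) : DForm E M k) =
      bundlePullback (fun x => s (q x)) (sectionField (F := F) q Q s) β := rfl

/-- The translate of `sectionField` back to the tangent space at `x`. -/
def sliceField (q : M → N) (Q : M → E →L[ℝ] E) (s : N → M) (γ : M → K) (x : M) : E →L[ℝ] E :=
  (tangentField (E := E) (F := E) (fun y : M => γ x • y) (s (q x))).comp
    (sectionField (F := F) q Q s x)

namespace IsAdaptedSplitting

/-- An integral `v` goes to the integral vector at `s (q x)` with the same projection, and `γ x`
moves that back to an integral vector at `x`, still with this projection. Integral vectors with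
equal projection agree, so it is `v`. -/
theorem sliceField_apply (h : IsAdaptedSplitting (F := F) K q S θ r Q) {s : N → M} {x : M}
    (hs : IsLocalSection (E := E) (F := F) q s (q x)) {γ : M → K} (hγ : γ x • s (q x) = x) {v : E}
    (hv : ∀ i, θ i x (fun _ => v) = 0) : sliceField (F := F) q Q s γ x v = v := by
  obtain ⟨w, hw, hwv⟩ := h.exists_transport (x := x) (x' := s (q x)) hs.apply_eq.symm hv
  have h1 : sectionField (F := F) q Q s x v = w := h.sub_apply_section hs hw hwv
  let w' : E := tangentField (E := E) (F := E) (fun y : M => γ x • y) (s (q x)) w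
  have h2 : sliceField (F := F) q Q s γ x v = w' := congrArg
    (tangentField (E := E) (F := E) (fun y : M => γ x • y) (s (q x))) h1
  have h3 : ∀ i, θ i (γ x • s (q x)) (fun _ => w') = 0 := fun i =>
    form_apply_eq_zero_of_mem_span (h.invariant (γ x) i (s (q x))) hw
  have h4 := h.orbit.tangentField_smul (γ x) (s (q x)) w
  rw [hγ] at h3 h4
  have h5 := h.sub_apply_eq h3 (u := v) (hwv.symm.trans h4.symm)
  rw [h.apply_eq_zero x v hv, sub_zero] at h5
  exact h2.trans h5.symm

theorem inv_comp_sliceField (h : IsAdaptedSplitting (F := F) K q S θ r Q) {s : N → M} {x : M}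
    {γ : M → K} (hγ : γ x • s (q x) = x) :
    (tangentField (E := E) (F := E) (fun y : M => (γ x)⁻¹ • y) x).comp
      (sliceField (F := F) q Q s γ x) = sectionField (F := F) q Q s x := by
  have h1 := tangentField_comp (E := E) (F := E) (F' := E) (x := s (q x))
    (f := fun y : M => γ x • y) (g := fun y : M => (γ x)⁻¹ • y)
    (h.orbit.contMDiff_smul (γ x)⁻¹ _) (h.orbit.contMDiff_smul (γ x) _)
  simp only [inv_smul_smul, hγ] at h1
  rw [tangentField_id] at h1
  rw [sliceField, ← ContinuousLinearMap.comp_assoc, ← h1, ContinuousLinearMap.id_comp]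

variable {s : N → M} {z : M} {γ : M → K}

theorem smoothFieldAt_sectionField (h : IsAdaptedSplitting (F := F) K q S θ r Q) {x : M}
    (hs : IsLocalSection (E := E) (F := F) q s (q x)) :
    SmoothFieldAt (fun x => s (q x)) (sectionField (F := F) q Q s) x :=
  (hs.smoothFieldAt (h.split.smooth _)).comp
    (smoothFieldAt_tangentField (Filter.Eventually.of_forall fun x => h.orbit.submersion.1 x))

theorem smoothFieldAt_sliceField (h : IsAdaptedSplitting (F := F) K q S θ r Q) {x : M}
    (hs : IsLocalSection (E := E) (F := F) q s (q x))
    (hγ : ∀ᶠ x in 𝓝 x, γ x • s (q x) = x ∧ ∀ y : M,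
      ContMDiffAt (𝓘(ℝ, E).prod 𝓘(ℝ, E)) 𝓘(ℝ, E) ∞ (fun p : M × M => γ p.1 • p.2) (x, y)) :
    SmoothFieldAt (fun x => x) (sliceField (F := F) q Q s γ) x := by
  have h1 := (h.smoothFieldAt_sectionField hs).tangentField_family (f := fun x y => γ x • y)
    (by
      rw [nhds_prod_eq]
      exact (hγ.prod_inl _).mono fun p hp => hp.2 p.2)
  exact h1.congr (hγ.mono fun x hx => hx.1) (Filter.Eventually.of_forall fun _ => rfl)

section Local

variable [T2Space M] [SigmaCompactSpace M]

/-- Since `1 - sliceField` kills integral vectors, the difference lies in the ideal of `θ` alone.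
The 2-forms `τ` enter with coefficient zero and are therefore arbitrary. -/
theorem locallyGenerated_sub (h : IsAdaptedSplitting (F := F) K q S θ r Q)
    (hs : IsLocalSection (E := E) (F := F) q s (q z))
    (hγ : ∀ᶠ x in 𝓝 z, γ x • s (q x) = x ∧ ∀ y : M,
      ContMDiffAt (𝓘(ℝ, E).prod 𝓘(ℝ, E)) 𝓘(ℝ, E) ∞ (fun p : M × M => γ p.1 • p.2) (x, y))
    (τ : ι → DForm E M 2) {β : DForm E M 2} (hβ : IsSmoothForm β) :
    LocallyGenerated θ τ z (β - bundlePullback (fun x => x) (sliceField (F := F) q Q s γ) β) := by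
  have hev := h.eventually_isLocalSection hs
  obtain ⟨D, hD⟩ := exists_local_sub_bundlePullback_eq (x₀ := z) h.frame.smooth h.frame.finrank
    (Q := fun x => ContinuousLinearMap.id ℝ E - sliceField (F := F) q Q s γ x)
    (by
      filter_upwards [hev, eventually_eventually_nhds.2 hγ] with x hx hγx
      exact (smoothFieldAt_id x).sub (h.smoothFieldAt_sliceField hx hγx))
    (by
      filter_upwards [hev, hγ] with x hx hγx v hv
      rw [sub_apply, h.sliceField_apply hx hγx.1 hv]
      exact sub_self v) hβ
  refine ⟨D, fun _ _ => 0, hD.mono fun x hx => ⟨hx.1, fun _ => contMDiffAt_const, ?_⟩⟩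
  have h1 := hx.2
  simp only [sub_sub_cancel] at h1
  refine Eq.trans h1 (Finset.sum_congr rfl fun i _ => ?_)
  rw [zero_smul, add_zero]

/-- This shows that the descended 2-form has its `q`-pullback in `S`. The field behind that pullback
is the translate of `sliceField` by `(γ x)⁻¹`, so `exists_twist` for the inverse elements expresses
it through the `sliceField`-pullbacks of `θ i` and `dθ i`. Modulo the ideal of `θ` these are `θ i`
and `dθ i` themselves. -/
theorem locallyGenerated_formPullback (h : IsAdaptedSplitting (F := F) K q S θ r Q)
    (hs : IsLocalSection (E := E) (F := F) q s (q z))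
    (hγ : ∀ᶠ x in 𝓝 z, γ x • s (q x) = x ∧ ∀ y : M,
      ContMDiffAt (𝓘(ℝ, E).prod 𝓘(ℝ, E)) 𝓘(ℝ, E) ∞ (fun p : M × M => γ p.1 • p.2) (x, y) ∧
      ContMDiffAt (𝓘(ℝ, E).prod 𝓘(ℝ, E)) 𝓘(ℝ, E) ∞ (fun p : M × M => (γ p.1)⁻¹ • p.2) (x, y))
    (j : ι) : LocallyGenerated θ (fun i => extD (θ i)) z
      (formPullback q (sectionPull (F := F) Q s (extD (θ j)))) := by
  have hev := h.eventually_isLocalSection hs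
  have hγ' : ∀ᶠ x in 𝓝 z, γ x • s (q x) = x ∧ ∀ y : M,
      ContMDiffAt (𝓘(ℝ, E).prod 𝓘(ℝ, E)) 𝓘(ℝ, E) ∞ (fun p : M × M => γ p.1 • p.2) (x, y) :=
    hγ.mono fun x hx => ⟨hx.1, fun y => (hx.2 y).1⟩
  have hP : ∀ᶠ x in 𝓝 z, SmoothFieldAt (fun x => x) (sliceField (F := F) q Q s γ) x := by
    filter_upwards [hev, eventually_eventually_nhds.2 hγ'] with x hx hγx
    exact h.smoothFieldAt_sliceField hx hγx
  obtain ⟨C, D, hCD⟩ := exists_twist h.frame.smooth h.frame.finrank (f := fun x y => (γ x)⁻¹ • y)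
    (φ := fun x => x) (A := sliceField (F := F) q Q s γ) (x₀ := z)
    (by
      rw [nhds_prod_eq]
      exact (hγ.prod_inl _).mono fun p hp => (hp.2 p.2).2) hP j
    (fun x y => h.invariant (γ x)⁻¹ j y)
  have h1 : LocallyGenerated
      (fun i => bundlePullback (fun x => x) (sliceField (F := F) q Q s γ) (θ i))
      (fun i => bundlePullback (fun x => x) (sliceField (F := F) q Q s γ) (extD (θ i))) z
      (formPullback q (sectionPull (F := F) Q s (extD (θ j)))) := by
    refine ⟨D, C, ?_⟩
    filter_upwards [hCD, hγ] with x hx hγx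
    refine ⟨hx.2.1, hx.1, Eq.trans ?_ hx.2.2.2⟩
    rw [formPullback_sectionPull]
    refine bundlePullback_congr_at ?_ (h.inv_comp_sliceField hγx.1).symm _
    exact (inv_smul_eq_iff.2 hγx.1.symm).symm
  refine h1.trans (fun i => ?_) fun i => ?_
  · refine exists_local_coeff_of_finrank
      (Filter.Eventually.of_forall fun x i => isSmoothForm_iff.1 (h.frame.smooth i) x)
      (hP.mono fun x hx => hx.bundlePullback (isSmoothForm_iff.1 (h.frame.smooth i) x))
      (Filter.Eventually.of_forall h.frame.finrank) ?_
    filter_upwards [hev, hγ] with x hx hγx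
    refine form_mem_span_of_ker fun v hv => ?_
    exact (congrArg (fun u : E => θ i x (fun _ => u)) (h.sliceField_apply hx hγx.1 hv)).trans (hv i)
  · refine ((LocallyGenerated.single (σ := θ) (fun i => extD (θ i)) z i).sub
      (h.locallyGenerated_sub hs hγ' _ (h.frame.smooth i).extD)).congr
      (Filter.Eventually.of_forall fun x => ?_)
    exact sub_sub_cancel (extD (θ i) x) _

/-- The opposite direction: `sliceField` is the translate of `sectionField` by `γ x`, so
`exists_twist` for the elements `γ x` leads back to the descended forms. -/
theorem locallyGenerated_sliceField (h : IsAdaptedSplitting (F := F) K q S θ r Q)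
    (hs : IsLocalSection (E := E) (F := F) q s (q z))
    (hγ : ∀ᶠ x in 𝓝 z, γ x • s (q x) = x ∧ ∀ y : M,
      ContMDiffAt (𝓘(ℝ, E).prod 𝓘(ℝ, E)) 𝓘(ℝ, E) ∞ (fun p : M × M => γ p.1 • p.2) (x, y))
    (j : ι) : LocallyGenerated (fun i => formPullback q (sectionPull (F := F) Q s (θ i)))
      (fun i => formPullback q (sectionPull (F := F) Q s (extD (θ i)))) z
      (bundlePullback (fun x => x) (sliceField (F := F) q Q s γ) (extD (θ j))) := by
  obtain ⟨C, D, hCD⟩ := exists_twist h.frame.smooth h.frame.finrank (f := fun x y => γ x • y)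
    (φ := fun x => s (q x)) (A := sectionField (F := F) q Q s) (x₀ := z)
    (by
      rw [nhds_prod_eq]
      exact (hγ.prod_inl _).mono fun p hp => hp.2 p.2)
    ((h.eventually_isLocalSection hs).mono fun x hx => h.smoothFieldAt_sectionField hx) j
    (fun x y => h.invariant (γ x) j y)
  refine ⟨D, C, ?_⟩
  filter_upwards [hCD, hγ] with x hx hγx
  refine ⟨hx.2.1, hx.1, Eq.trans ?_ hx.2.2.2⟩
  exact bundlePullback_congr_at hγx.1.symm rfl _

end Local

variable [T2Space M] [SigmaCompactSpace M] [T2Space N] [SigmaCompactSpace N]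

theorem glueForm_extD_mem (h : IsAdaptedSplitting (F := F) K q S θ r Q)
    (hsl : HasSmoothSlices (E := E) (F := F) K q) {U : N → Set N} (C : Colouring (E := F) U)
    {s : N → N → M} (hs : ∀ z, ∀ y ∈ U z, IsLocalSection (E := E) (F := F) q (s z) y)
    (c : Fin C.num) (j : ι) :
    C.glueForm c (fun z => sectionPull (F := F) Q (s z) (extD (θ j))) ∈
      (reduction q S : FormSet F N) 2 := by
  have hdS : ∀ i, extD (θ i) ∈ S 2 := fun i => (h.frame.smooth_extD_mem (h.frame.form_mem i)).2
  refine ⟨C.isSmoothForm_glueForm c fun z y hy =>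
    h.smoothFormAt_sectionPull (hs z y hy) (h.frame.smooth j).extD,
    LocallyGenerated.mem h.frame.isIdealSet h.frame.form_mem hdS fun z => ?_⟩
  have hqc := h.orbit.submersion.1.continuous.continuousAt (x := z)
  rcases C.zero_or_mem c (q z) with h0 | ⟨h0, h1⟩
  · refine (LocallyGenerated.zero _ _ _).congr ((hqc.eventually h0).mono fun x hx => ?_)
    change 0 = C.b c (q x) • (formPullback q (sectionPull (F := F) Q (s (C.p c (q x))) (extD (θ j))) :
      DForm E M 2) x
    rw [hx, zero_smul]
  · have hs' := hs _ _ h0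
    obtain ⟨γ, hγ⟩ := hsl _ z hs'
    refine ((h.locallyGenerated_formPullback hs' hγ j).smul (Filter.Eventually.of_forall fun x =>
      ((C.smooth c).comp h.orbit.submersion.1) x)).congr ((hqc.eventually h1).mono fun x hx => ?_)
    change C.b c (q x) • (formPullback q (sectionPull (F := F) Q (s (C.p c (q z))) (extD (θ j))) :
      DForm E M 2) x = C.b c (q x) •
        (formPullback q (sectionPull (F := F) Q (s (C.p c (q x))) (extD (θ j))) : DForm E M 2) x
    rw [hx]

/-- Decompose `dθ j` into its `sliceField`-pullback and the difference from it. The difference is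
generated by `θ`, the pullback by `q`-pullbacks of forms descended along a local section. After
multiplication by the cutoff of a colour the latter are global elements of `q^*(S/q)`. -/
theorem extD_form_mem_extensionIdeal (h : IsAdaptedSplitting (F := F) K q S θ r Q)
    (hsl : HasSmoothSlices (E := E) (F := F) K q) (j : ι) :
    extD (θ j) ∈ extensionIdeal F q S Q 2 := by
  obtain ⟨U, C, s, hs⟩ := exists_coloured_sections h.orbit.submersion h.orbit.surjective
  have hB := isIdealSet_extensionIdeal (F := F) (q := q) (S := S) (Q := Q)
  refine h.mem_of_mul_colouring C hB fun c => ?_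
  let η : ι → DForm E M 1 := fun i =>
    formPullback q (C.glueForm c fun z => sectionPull (F := F) Q (s z) (θ i))
  let ζ : ι → DForm E M 2 := fun i =>
    formPullback q (C.glueForm c fun z => sectionPull (F := F) Q (s z) (extD (θ i)))
  -- Both kinds of generators share one index type; the summand belonging to `θ` requires no
  -- 2-forms, which are filled in by zero.
  refine LocallyGenerated.mem (σ := Sum.elim θ η) (τ := Sum.elim (0 : ι → DForm E M 2) ζ) hB ?_ ?_
    fun z => ?_
  · rintro (i | i)
    · exact h.form_mem_extensionIdeal i
    · exact formPullback_mem_extensionIdeal (h.glueForm_sectionPull_mem C hs c i)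
  · rintro (i | i)
    · exact hB.zero_mem 2
    · exact formPullback_mem_extensionIdeal (h.glueForm_extD_mem hsl C hs c i)
  have hqc := h.orbit.submersion.1.continuous.continuousAt (x := z)
  rcases C.zero_or_mem c (q z) with h0 | ⟨h0, h1⟩
  · refine (LocallyGenerated.zero _ _ _).congr ((hqc.eventually h0).mono fun x hx => ?_)
    change 0 = C.b c (q x) • extD (θ j) x
    rw [hx, zero_smul]
  · have hs' := hs _ _ h0
    obtain ⟨γ, hγ⟩ := hsl _ z hs'
    have hγ' : ∀ᶠ x in 𝓝 z, γ x • s (C.p c (q z)) (q x) = x ∧ ∀ y : M,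
        ContMDiffAt (𝓘(ℝ, E).prod 𝓘(ℝ, E)) 𝓘(ℝ, E) ∞ (fun p : M × M => γ p.1 • p.2) (x, y) :=
      hγ.mono fun x hx => ⟨hx.1, fun y => (hx.2 y).1⟩
    have hb : ∀ᶠ x in 𝓝 z, ContMDiffAt 𝓘(ℝ, E) 𝓘(ℝ, ℝ) ∞ (fun x => C.b c (q x)) x :=
      Filter.Eventually.of_forall fun x => ((C.smooth c).comp h.orbit.submersion.1) x
    have h2 : LocallyGenerated (Sum.elim θ η) (Sum.elim (0 : ι → DForm E M 2) ζ) z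
        (formSmul (fun x => C.b c (q x)) (extD (θ j) - bundlePullback (fun x => x)
          (sliceField (F := F) q Q (s (C.p c (q z))) γ) (extD (θ j)))) :=
      ((h.locallyGenerated_sub hs' hγ' 0 (h.frame.smooth j).extD).smul hb).trans
        (fun i => LocallyGenerated.exists_coeff_single (Sum.elim θ η) z (Sum.inl i))
        (fun i => LocallyGenerated.single (Sum.elim (0 : ι → DForm E M 2) ζ) z (Sum.inl i))
    have h3 : LocallyGenerated η ζ z (formSmul (fun x => C.b c (q x)) (bundlePullback (fun x => x)
          (sliceField (F := F) q Q (s (C.p c (q z))) γ) (extD (θ j)))) := by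
      refine (h.locallyGenerated_sliceField hs' hγ' j).smul_gens
        ((hqc.eventually h1).mono fun x hx i => ?_) ((hqc.eventually h1).mono fun x hx i => ?_)
      · change C.b c (q x) • (formPullback q (sectionPull (F := F) Q (s (C.p c (q x))) (θ i)) :
          DForm E M 1) x = _
        rw [hx]
      · change C.b c (q x) • (formPullback q (sectionPull (F := F) Q (s (C.p c (q x)))
          (extD (θ i))) : DForm E M 2) x = _
        rw [hx]
    refine (h2.add (h3.trans
        (fun i => LocallyGenerated.exists_coeff_single (Sum.elim θ η) z (Sum.inr i))
        (fun i => LocallyGenerated.single (Sum.elim (0 : ι → DForm E M 2) ζ) z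
          (Sum.inr i)))).congr (Filter.Eventually.of_forall fun x => ?_)
    rw [← formSmul_add, sub_add_cancel]

theorem eq_extensionIdeal (h : IsAdaptedSplitting (F := F) K q S θ r Q)
    (hsl : HasSmoothSlices (E := E) (F := F) K q) : S = extensionIdeal F q S Q := by
  funext k
  refine Set.Subset.antisymm ?_ (h.extensionIdeal_subset k)
  have hB := isIdealSet_extensionIdeal (F := F) (q := q) (S := S) (Q := Q)
  conv_lhs => rw [h.frame.eq_algIdeal]
  refine algIdeal_subset hB (fun k => ?_) k
  rintro β hβ
  cases hβ with
  | form i => exact h.form_mem_extensionIdeal i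
  | diff i => exact h.extD_form_mem_extensionIdeal hsl i

end IsAdaptedSplitting

end Slices
end

noncomputable section

set_option linter.unusedSectionVars false

/-! ### Passing the extension property to an intermediate quotient -/

section Extensions

variable {E : Type*} [NormedAddCommGroup E] [NormedSpace ℝ E] [FiniteDimensional ℝ E]
  {F : Type*} [NormedAddCommGroup F] [NormedSpace ℝ F] [FiniteDimensional ℝ F]
  {F' : Type*} [NormedAddCommGroup F'] [NormedSpace ℝ F'] [FiniteDimensional ℝ F']
  {M : Type*} [TopologicalSpace M] [ChartedSpace E M] [IsManifold 𝓘(ℝ, E) ∞ M]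
  {N : Type*} [TopologicalSpace N] [ChartedSpace F N] [IsManifold 𝓘(ℝ, F) ∞ N]
  {N' : Type*} [TopologicalSpace N'] [ChartedSpace F' N'] [IsManifold 𝓘(ℝ, F') ∞ N'] {k : ℕ}

section SectionPull

variable {Q : M → E →L[ℝ] E} {q : M → N} {p : N → N'} {s : N → M} {y : N}

theorem sectionPull_wedge {l : ℕ} (Q : M → E →L[ℝ] E) (s : N → M) (β : DForm E M k)
    (η : DForm E M l) : (sectionPull (F := F) Q s (formWedge β η) : DForm F N (k + l)) =
      formWedge (sectionPull (F := F) Q s β) (sectionPull (F := F) Q s η) :=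
  bundlePullback_wedge _ _ β η

/-- Here `Q` projects onto the vertical spaces of `p ∘ q`, not of `q`. So `1 - Q` may change the
projection of a lift to `N`, but not its further projection to `N'`. -/
theorem tangentField_comp_sub (hp : ContMDiff 𝓘(ℝ, F) 𝓘(ℝ, F') ∞ p)
    (hq : ContMDiff 𝓘(ℝ, E) 𝓘(ℝ, F) ∞ q)
    (hQ : IsSplitting (F := F') (fun x => p (q x)) Q)
    (hs : IsLocalSection (E := E) (F := F) q s y) (v : F) :
    tangentField (E := F) (F := F') p y (tangentField (E := E) (F := F) q (s y)
      ((ContinuousLinearMap.id ℝ E - Q (s y)) (tangentField (E := F) (F := E) s y v))) =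
      tangentField (E := F) (F := F') p y v := by
  have h1 := tangentField_comp (E := E) (F := F) (F' := F') (x := s y) (hp (q (s y))) (hq (s y))
  rw [hs.apply_eq] at h1
  have h2 : ∀ w, tangentField (E := F) (F := F') p y (tangentField (E := E) (F := F) q (s y) w) =
      tangentField (E := E) (F := F') (fun x => p (q x)) (s y) w := fun w =>
    (DFunLike.congr_fun h1 w).symm
  rw [h2, sub_apply, map_sub, hQ.vert, sub_zero, ← h2]
  exact congrArg (tangentField (E := F) (F := F') p y) (hs.tangentField_apply hq v)

/-- With the next two lemmas this describes the effect of `sectionPull` along sections of `q` on the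
generators over `N'`. Together they carry an ideal decomposition on `M` over to `N`. -/
theorem sectionPull_formPullback_comp (hp : ContMDiff 𝓘(ℝ, F) 𝓘(ℝ, F') ∞ p)
    (hq : ContMDiff 𝓘(ℝ, E) 𝓘(ℝ, F) ∞ q) (hQ : IsSplitting (F := F') (fun x => p (q x)) Q)
    (hs : IsLocalSection (E := E) (F := F) q s y) (τ : DForm F' N' k) :
    sectionPull (F := F) Q s (formPullback (fun x => p (q x)) τ : DForm E M k) y =
      (formPullback p τ : DForm F N k) y := by
  rw [formPullback_comp_smooth hq hp]
  change bundlePullback (fun y => p (q (s y))) (fun y =>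
    (tangentField (E := F) (F := F') p (q (s y))).comp ((tangentField (E := E) (F := F) q (s y)).comp
      ((ContinuousLinearMap.id ℝ E - Q (s y)).comp (tangentField (E := F) (F := E) s y)))) τ y =
    bundlePullback p (tangentField (E := F) (F := F') p) τ y
  refine bundlePullback_congr_at (by rw [hs.apply_eq]) ?_ τ
  rw [hs.apply_eq]
  exact ContinuousLinearMap.ext fun v => tangentField_comp_sub hp hq hQ hs v

/-- The operation alters tangent vectors of `N` only by vectors vertical for `p`, and `1 - P` does
not see these. -/
theorem sectionPull_formPullback_bundlePullback (hp : ContMDiff 𝓘(ℝ, F) 𝓘(ℝ, F') ∞ p)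
    (hq : ContMDiff 𝓘(ℝ, E) 𝓘(ℝ, F) ∞ q) (hQ : IsSplitting (F := F') (fun x => p (q x)) Q)
    {P : N → F →L[ℝ] F} (hP : IsSplitting (F := F') p P)
    (hs : IsLocalSection (E := E) (F := F) q s y) (α : DForm F N k) :
    sectionPull (F := F) Q s (formPullback q (bundlePullback (fun y => y)
      (fun y => ContinuousLinearMap.id ℝ F - P y) α) : DForm E M k) y =
      bundlePullback (fun y => y) (fun y => ContinuousLinearMap.id ℝ F - P y) α y := by
  change bundlePullback (fun y => q (s y)) (fun y =>
    (ContinuousLinearMap.id ℝ F - P (q (s y))).comp ((tangentField (E := E) (F := F) q (s y)).comp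
      ((ContinuousLinearMap.id ℝ E - Q (s y)).comp (tangentField (E := F) (F := E) s y)))) α y =
    bundlePullback (fun y => y) (fun y => ContinuousLinearMap.id ℝ F - P y) α y
  refine bundlePullback_congr_at hs.apply_eq ?_ α
  rw [hs.apply_eq]
  refine ContinuousLinearMap.ext fun v => ?_
  let u : F := tangentField (E := E) (F := F) q (s y)
      ((ContinuousLinearMap.id ℝ E - Q (s y)) (tangentField (E := F) (F := E) s y v))
  have h1 := hP.fix y (u - v) (by rw [map_sub, tangentField_comp_sub hp hq hQ hs v, sub_self])
  change u - P y u = v - P y v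
  rw [map_sub] at h1
  rw [sub_eq_sub_iff_sub_eq_sub, h1]

/-- The projection `1 - Q` takes values in the kernel of `Q`, where forms factoring through `Q`
vanish. -/
theorem sectionPull_eq_zero [T2Space M] [SigmaCompactSpace M]
    (hQ : IsSplitting (F := F') (fun x => p (q x)) Q) {β : DForm E M 1}
    (hβ : ∀ x, β x ∈ splitBundle Q x) (s : N → M) :
    (sectionPull (F := F) Q s β : DForm F N 1) = 0 := by
  funext y
  refine form_one_ext fun v => ?_
  let u : E := tangentField (E := F) (F := E) s y v
  have hu : Q (s y) (u - Q (s y) u) = 0 := by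
    rw [map_sub, hQ.fix _ _ (hQ.vert _ _), sub_self]
  exact apply_eq_zero_of_mem_splitBundle hu (hβ (s y))

end SectionPull

theorem formWedge_smul_smul {l : ℕ} (u v : M → ℝ) (β : DForm E M k) (η : DForm E M l) :
    formWedge (formSmul u β) (formSmul v η) = formSmul (fun x => u x * v x) (formWedge β η) := by
  funext x
  have h : ∀ (t t' : ℝ) (a : E [⋀^Fin k]→L[ℝ] ℝ) (b : E [⋀^Fin l]→L[ℝ] ℝ),
      altWedge (t • a) (t' • b) = (t * t') • altWedge a b := fun t t' a b => by
    rw [altWedge_smul_left, altWedge_smul_right, smul_smul]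
  exact h _ _ _ _

theorem IsSplitting.bundlePullback_mem_sectionsOf [T2Space M] [SigmaCompactSpace M] {q : M → N}
    {Q : M → E →L[ℝ] E} (hQ : IsSplitting (F := F) q Q) {β : DForm E M 1} (hβ : IsSmoothForm β) :
    bundlePullback (fun x => x) Q β ∈ sectionsOf (splitBundle Q) 1 :=
  SectionOf.mk (isSmoothForm_iff.2 fun x => SmoothFieldAt.bundlePullback (hQ.smooth x)
    (isSmoothForm_iff.1 hβ x)) fun x => bundlePullback_mem_splitBundle Q β x

theorem IsSplitting.sub_bundlePullback_mem [T2Space M] [SigmaCompactSpace M] {q : M → N}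
    {Q : M → E →L[ℝ] E} (hQ : IsSplitting (F := F) q Q) {β : DForm E M k} (hβ : IsSmoothForm β) :
    β - bundlePullback (fun x => x) (fun x => ContinuousLinearMap.id ℝ E - Q x) β ∈
      algIdeal (sectionsOf (splitBundle Q)) k := by
  have h := _root_.sub_bundlePullback_mem (isIdealSet_algIdeal (sectionsOf (splitBundle Q)))
    (b := fun _ => 1) contMDiff_const (Q := Q) (fun x => Or.inr (hQ.smooth x)) (fun c hc => by
      simp only [one_smul]
      exact AlgGen.of (hQ.bundlePullback_mem_sectionsOf hc)) k β hβ
  have h1 : ∀ η : DForm E M k, formSmul (fun _ : M => (1 : ℝ) ^ k) η = η := fun η => by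
    funext x
    simp only [formSmul, one_pow, one_smul]
  rwa [h1] at h

theorem IsSplitting.isIntegrableExtension [T2Space M] [SigmaCompactSpace M] {q : M → N}
    {Q : M → E →L[ℝ] E} (hQ : IsSplitting (F := F) q Q)
    (hq : IsSmoothSubmersion (E := E) (F := F) q) (hqs : Function.Surjective q) {S : FormSet E M}
    {T : FormSet F N} (hS : IsEDS S) (hT : IsEDS T)
    (hST : S = algIdeal fun k => pullbackSet q T k ∪ sectionsOf (splitBundle Q) k) :
    IsIntegrableExtension q S T :=
  ⟨hqs, hq, hS, hT, splitBundle Q, hQ.isSubbundle hq.2, fun _ _ h hv => hQ.eq_zero h hv, hST⟩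

section Tower

variable {ι : Type*} [Fintype ι] {S : FormSet E M} {θ : ι → DForm E M 1} {r : ℕ} {q : M → N}
  {p : N → N'} {Q : M → E →L[ℝ] E} {K : Type*} [Group K] [MulAction K M]
  [T2Space M] [SigmaCompactSpace M] [T2Space N] [SigmaCompactSpace N]

/-- If a system is an extension of its reduction to `N'`, it is an extension of its reduction to an
intermediate quotient `N`. -/
theorem IsAdaptedSplitting.eq_extensionIdeal_of_comp {R : M → E →L[ℝ] E}
    (h : IsAdaptedSplitting (F := F) K q S θ r R) (hp : ContMDiff 𝓘(ℝ, F) 𝓘(ℝ, F') ∞ p)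
    (hS : S = extensionIdeal F' (fun x => p (q x)) S Q) : S = extensionIdeal F q S R := by
  funext k
  refine Set.Subset.antisymm ?_ (h.extensionIdeal_subset k)
  conv_lhs => rw [hS]
  refine algIdeal_subset (isIdealSet_extensionIdeal (F := F)) (fun k => ?_) k
  rintro β (⟨τ, hτ, rfl⟩ | hβ)
  · rw [reduction_comp h.orbit.submersion.1 hp] at hτ
    change formPullback (fun x => p (q x)) τ ∈ _
    rw [formPullback_comp_smooth h.orbit.submersion.1 hp]
    exact IsAdaptedSplitting.formPullback_mem_extensionIdeal hτ.2
  · have hβS : β ∈ S k := by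
      rw [hS]
      exact AlgGen.of (Or.inr hβ)
    cases hβ with
    | mk hsm hJ => exact h.mem_extensionIdeal_of_span hsm (h.frame.mem_span _ hβS)

/-- A splitting over an intermediate quotient which annihilates the images of the integral elements
of the system. -/
theorem exists_splitting_of_comp (hq : IsSmoothSubmersion (E := E) (F := F) q)
    (hqs : Function.Surjective q) (hp : ContMDiff 𝓘(ℝ, F) 𝓘(ℝ, F') ∞ p)
    (hQ : IsSplitting (F := F') (fun x => p (q x)) Q)
    (htr : ∀ {x x' : M} {v : E}, q x = q x' → (∀ i, θ i x (fun _ => v) = 0) →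
      ∃ w : E, (∀ i, θ i x' (fun _ => w) = 0) ∧
        tangentField (E := E) (F := F) q x' w = tangentField (E := E) (F := F) q x v)
    (hker : ∀ (x : M) (v : E), (∀ i, θ i x (fun _ => v) = 0) → Q x v = 0) :
    ∃ P : N → F →L[ℝ] F, IsSplitting (F := F') p P ∧ ∀ (x : M) (v : E),
      (∀ i, θ i x (fun _ => v) = 0) → P (q x) (tangentField (E := E) (F := F) q x v) = 0 := by
  have hcomp : ∀ x w, tangentField (E := E) (F := F') (fun x => p (q x)) x w =
      tangentField (E := F) (F := F') p (q x) (tangentField (E := E) (F := F) q x w) := fun x w =>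
    DFunLike.congr_fun (tangentField_comp (E := E) (F := F) (F' := F') (hp (q x)) (hq.1 x)) w
  obtain ⟨P, hP, hP'⟩ := exists_splitting_of_local (E := F) (F := F') (q := p)
    (P := fun y A => ∀ x, q x = y → ∀ v : E, (∀ i, θ i x (fun _ => v) = 0) →
      A (tangentField (E := E) (F := F) q x v) = 0)
    (fun y n b A hA x hx v hv => by
      rw [sum_apply]
      refine Finset.sum_eq_zero fun c _ => ?_
      rw [smul_apply]
      rcases hA c with h0 | h0
      · rw [h0, zero_smul]
      · rw [h0 x hx v hv, smul_zero])
    (fun y₀ => by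
      obtain ⟨x₀, rfl⟩ := hqs y₀
      obtain ⟨s, -, hs⟩ := exists_smooth_section (E := E) (F := F) (p := q) (x₀ := x₀)
        (Filter.Eventually.of_forall fun x => hq.1 x) (hq.2 x₀)
      -- The local candidate is `q_* ∘ Q ∘ s_*`. It depends on the section `s`, but the properties
      -- required of it are preserved when local choices are averaged.
      refine ⟨fun y => (tangentField (E := E) (F := F) q (s y)).comp
        ((Q (s y)).comp (tangentField (E := F) (F := E) s y)), ?_⟩
      filter_upwards [IsLocalSection.eventually hs] with y hy
      have hpy : ∀ w, tangentField (E := F) (F := F') p y (tangentField (E := E) (F := F) q (s y) w) =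
          tangentField (E := E) (F := F') (fun x => p (q x)) (s y) w := fun w => by
        rw [hcomp, hy.apply_eq]
      refine ⟨?_, fun v => ?_, fun v hv => ?_, fun x hx v hv => ?_⟩
      · have h1 : SmoothFieldAt s (fun y => (Q (s y)).comp (tangentField (E := F) (F := E) s y)) y :=
          (hQ.smooth (s y)).comp (smoothFieldAt_tangentField (hy.mono fun _ hz => hz.1))
        have h2 : SmoothFieldAt q (tangentField (E := E) (F := F) q) (s y) :=
          smoothFieldAt_tangentField (Filter.Eventually.of_forall fun x => hq.1 x)
        exact (h2.comp h1).congr (hy.mono fun _ hz => hz.2) (Filter.Eventually.of_forall fun _ => rfl)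
      · exact (hpy _).trans (hQ.vert _ _)
      · have h1 : Q (s y) (tangentField (E := F) (F := E) s y v) =
            tangentField (E := F) (F := E) s y v := hQ.fix _ _ (by
          rw [← hpy, hy.tangentField_apply hq.1, hv])
        refine Eq.trans ?_ (hy.tangentField_apply hq.1 v)
        exact congrArg (tangentField (E := E) (F := F) q (s y)) h1
      · obtain ⟨w, hw, hwv⟩ := htr (x' := s y) (hx.trans hy.apply_eq.symm) hv
        -- The lift `u` and the transported integral vector `w` have the same projection, so `u - w`
        -- is vertical for `q` and hence for `p ∘ q`. Thus `Q` fixes `u - w` and kills `w`, giving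
        -- `Q u = u - w`, which `q_*` annihilates.
        let u : E := tangentField (E := F) (F := E) s y (tangentField (E := E) (F := F) q x v)
        have hu : tangentField (E := E) (F := F) q (s y) (u - w) = 0 := by
          rw [map_sub, hwv, hy.tangentField_apply hq.1, sub_self]
        have h1 := hQ.fix (s y) (u - w) (by rw [hcomp, hu, map_zero])
        rw [map_sub, hker _ w hw, sub_zero] at h1
        change tangentField (E := E) (F := F) q (s y) (Q (s y) u) = 0
        rw [h1, hu])
  exact ⟨P, hP, fun x v hv => hP' (q x) x rfl v hv⟩

/-- The forms on `N` obtained from an element of the extension ideal of `p ∘ q` by means of local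
sections of `q` belong locally to the extension ideal of `p`. -/
theorem exists_pow_glueForm_mem (hq : ContMDiff 𝓘(ℝ, E) 𝓘(ℝ, F) ∞ q)
    (hp : ContMDiff 𝓘(ℝ, F) 𝓘(ℝ, F') ∞ p)
    (hQ : IsSplitting (F := F') (fun x => p (q x)) Q) {U : N → Set N}
    (C : Colouring (E := F) U) {s : N → N → M}
    (hs : ∀ z, ∀ y ∈ U z, IsLocalSection (E := E) (F := F) q (s z) y) {B : FormSet F N}
    (hB : IsIdealSet B)
    (hpB : ∀ k, pullbackSet p (reduction (fun x => p (q x)) S : FormSet F' N') k ⊆ B k)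
    {β : DForm E M k} (hβ : β ∈ extensionIdeal F' (fun x => p (q x)) S Q k) :
    ∃ n, ∀ c, formSmul (fun y => C.b c y ^ n)
      (C.glueForm c fun z => sectionPull (F := F) Q (s z) β) ∈ B k := by
  have hsm : ∀ {l : ℕ} {α : DForm E M l} (c : Fin C.num), IsSmoothForm α →
      IsSmoothForm (C.glueForm c fun z => sectionPull (F := F) Q (s z) α) := fun c hα =>
    C.isSmoothForm_glueForm c fun z y hy =>
      (hs z y hy).smoothFormAt (hQ.smooth _) (isSmoothForm_iff.1 hα _)
  -- Every glued form carries one cutoff, so a product of two needs one more than the glued product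
  -- supplies. This extra factor is the `+ 1` in the exponent, and the reason why powers appear at
  -- all.
  have hwedge : ∀ {k l : ℕ} (β : DForm E M k) (α : DForm E M l) (c : Fin C.num) (n m : ℕ),
      formSmul (fun y => C.b c y ^ (n + m + 1))
        (C.glueForm c fun z => sectionPull (F := F) Q (s z) (formWedge β α)) =
      formWedge (formSmul (fun y => C.b c y ^ n) (C.glueForm c fun z => sectionPull (F := F) Q (s z) β))
        (formSmul (fun y => C.b c y ^ m)
          (C.glueForm c fun z => sectionPull (F := F) Q (s z) α)) := by
    intro k l β α c n m
    have h1 : ∀ {j : ℕ} (η : DForm E M j), (C.glueForm c fun z => sectionPull (F := F) Q (s z) η) =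
        formSmul (C.b c) fun y => sectionPull (F := F) Q (s (C.p c y)) η y := fun η => rfl
    rw [h1, h1, h1, formSmul_formSmul, formSmul_formSmul, formSmul_formSmul, formWedge_smul_smul]
    funext y
    have h2 : C.b c y ^ (n + m + 1) * C.b c y = C.b c y ^ n * C.b c y * (C.b c y ^ m * C.b c y) := by
      ring
    simp only [formSmul, h2, sectionPull_wedge]
    rfl
  have h0 : ∀ {j : ℕ} (η : DForm F N j) (c : Fin C.num),
      formSmul (fun y => C.b c y ^ 0) η = η := fun η c => by
    funext y
    simp only [formSmul, pow_zero, one_smul]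
  change AlgGen _ _ _ at hβ
  induction hβ with
  | @of j β h =>
    refine ⟨0, fun c => ?_⟩
    rw [h0]
    rcases h with ⟨τ, hτ, rfl⟩ | h
    · have h1 : (C.glueForm c fun z => sectionPull (F := F) Q (s z)
          (formPullback (fun x => p (q x)) τ : DForm E M _)) = formSmul (C.b c) (formPullback p τ) := by
        funext y
        rcases C.zero_or_mem' c y with h0 | h0
        · simp only [Colouring.glueForm, formSmul, h0, zero_smul]
        · simp only [Colouring.glueForm, formSmul,
            sectionPull_formPullback_comp hp hq hQ (hs _ _ h0)]
      change (C.glueForm c fun z => sectionPull (F := F) Q (s z)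
          (formPullback (fun x => p (q x)) τ : DForm E M _)) ∈ _
      rw [h1]
      exact hB.smul_mem (C.smooth c) (hpB _ ⟨τ, hτ, rfl⟩)
    · cases h with
      | @mk β hsm hJ =>
        have h1 : (C.glueForm c fun z => sectionPull (F := F) Q (s z) β) = 0 := funext fun y =>
          (congrArg (fun η : DForm F N 1 => C.b c y • η y)
            (sectionPull_eq_zero hQ hJ (s (C.p c y)))).trans
              (smul_zero (A := F [⋀^Fin 1]→L[ℝ] ℝ) (C.b c y))
        rw [h1]
        exact hB.zero_mem 1
  | zero k =>
    refine ⟨0, fun c => ?_⟩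
    have h1 : (C.glueForm c fun z => sectionPull (F := F) Q (s z) (0 : DForm E M k)) = 0 := by
      funext y
      exact smul_zero (C.b c y)
    rw [h0, h1]
    exact hB.zero_mem k
  | @add k β η _ _ ih ih' =>
    obtain ⟨n, hn⟩ := ih
    obtain ⟨m, hm⟩ := ih'
    -- A common exponent for both summands, reached by multiplying each with the missing power.
    refine ⟨n + m, fun c => ?_⟩
    have h1 : (C.glueForm c fun z => sectionPull (F := F) Q (s z) (β + η)) =
        (C.glueForm c fun z => sectionPull (F := F) Q (s z) β) +
          C.glueForm c fun z => sectionPull (F := F) Q (s z) η := by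
      have hgen : ∀ (t : ℝ) (a b : F [⋀^Fin k]→L[ℝ] ℝ), t • (a + b) = t • a + t • b := smul_add
      exact funext fun y => hgen (C.b c y) (sectionPull (F := F) Q (s (C.p c y)) β y)
        (sectionPull (F := F) Q (s (C.p c y)) η y)
    have h2 := hB.add_mem (hB.smul_mem ((C.smooth c).pow m) (hn c))
      (hB.smul_mem ((C.smooth c).pow n) (hm c))
    rw [formSmul_formSmul, formSmul_formSmul] at h2
    rw [h1, formSmul_add]
    convert h2 using 3 with y
    · exact funext fun y => by simp [pow_add, mul_comm]
    · exact funext fun y => by simp [pow_add]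
  | @wedge_right k l β α _ hα ih =>
    obtain ⟨n, hn⟩ := ih
    refine ⟨n + 0 + 1, fun c => ?_⟩
    have h2 := hwedge β α c n 0
    rw [h0] at h2
    exact Set.mem_of_eq_of_mem h2 (hB.wedge_right (hn c) (hsm c hα))
  | @wedge_left k l β α _ hα ih =>
    obtain ⟨n, hn⟩ := ih
    refine ⟨0 + n + 1, fun c => ?_⟩
    have h2 := hwedge α β c 0 n
    rw [h0] at h2
    exact Set.mem_of_eq_of_mem h2 (hB.wedge_left (hn c) (hsm c hα))

/-- An `α` in the reduction may be replaced by its pullback under `1 - P`, from which it differs by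
the ideal of sections of the bundle of `P`, themselves in the reduction. The `q`-pullback of the new
form lies in `S`, that is, in the extension ideal over `N'`. Descending along local sections of `q`
reproduces the form, turns pullbacks from `N'` into `p`-pullbacks, and kills the sections of the
bundle of `Q`. -/
theorem reduction_eq_extensionIdeal (hq : IsSmoothSubmersion (E := E) (F := F) q)
    (hqs : Function.Surjective q) (hp : ContMDiff 𝓘(ℝ, F) 𝓘(ℝ, F') ∞ p) (hSE : IsEDS S)
    (hQ : IsSplitting (F := F') (fun x => p (q x)) Q)
    (hSQ : S = extensionIdeal F' (fun x => p (q x)) S Q) (hfr : IsPfaffianFrame S θ r)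
    {P : N → F →L[ℝ] F} (hP : IsSplitting (F := F') p P)
    (hPθ : ∀ (x : M) (v : E), (∀ i, θ i x (fun _ => v) = 0) →
      P (q x) (tangentField (E := E) (F := F) q x v) = 0) :
    (reduction q S : FormSet F N) = extensionIdeal F' p (reduction q S : FormSet F N) P := by
  have hT : IsEDS (reduction q S : FormSet F N) := hSE.reduction hq.1
  have hB : IsIdealSet (extensionIdeal F' p (reduction q S : FormSet F N) P) :=
    isIdealSet_algIdeal _
  have hJ : ∀ k, sectionsOf (splitBundle P) k ⊆ (reduction q S : FormSet F N) k := by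
    rintro _ β (hβ' : SectionOf _ _ β)
    obtain ⟨hβ, hβJ⟩ := hβ'
    refine ⟨hβ, hfr.mem_of_span (hβ.pullback hq.1) fun x => form_mem_span_of_ker fun v hv => ?_⟩
    exact apply_eq_zero_of_mem_splitBundle (hPθ x v hv) (hβJ (q x))
  funext k
  refine Set.Subset.antisymm (fun α hα => ?_) ?_
  · have h1 := hP.sub_bundlePullback_mem hα.1
    have h2 := algIdeal_subset hT.isIdealSet hJ k h1
    have h3 := algIdeal_subset hB (fun k η hη => AlgGen.of (Or.inr hη)) k h1
    have h4 := hT.isIdealSet.sub_mem hα h2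
    rw [sub_sub_cancel] at h4
    suffices h5 : bundlePullback (fun y => y) (fun y => ContinuousLinearMap.id ℝ F - P y) α ∈
        extensionIdeal F' p (reduction q S : FormSet F N) P k by
      have h6 := hB.add_mem h3 h5
      rwa [sub_add_cancel] at h6
    obtain ⟨U, C, s, hs⟩ := exists_coloured_sections hq hqs
    have h5 := h4.2
    rw [hSQ] at h5
    obtain ⟨n, hn⟩ := exists_pow_glueForm_mem hq.1 hp hQ C hs hB (fun k => by
      rw [reduction_comp hq.1 hp]
      exact fun η hη => AlgGen.of (Or.inl hη)) h5
    refine hB.mem_of_colouring C (n := n + 1) fun c => ?_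
    convert hn c using 1
    funext y
    change C.b c y ^ (n + 1) • _ = C.b c y ^ n • C.b c y • _
    rw [smul_smul, ← pow_succ]
    rcases C.zero_or_mem' c y with h0 | h0
    · rw [h0, zero_pow (Nat.succ_ne_zero n), zero_smul, zero_smul]
    · beta_reduce
      rw [sectionPull_formPullback_bundlePullback hp hq.1 hQ hP (hs _ _ h0)]
  · refine algIdeal_subset hT.isIdealSet (fun k => ?_) k
    rintro β (hβ | hβ)
    · exact pullbackSet_reduction_subset p _ k hβ
    · exact hJ k hβ

end Tower

end Extensions
end

noncomputable section

set_option linter.unusedSectionVars false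

/-! ### Orbit spaces and integrable extensions -/

section Quotients

variable {E : Type*} [NormedAddCommGroup E] [NormedSpace ℝ E] [FiniteDimensional ℝ E]
  {F : Type*} [NormedAddCommGroup F] [NormedSpace ℝ F] [FiniteDimensional ℝ F]
  {F' : Type*} [NormedAddCommGroup F'] [NormedSpace ℝ F'] [FiniteDimensional ℝ F']
  {M : Type*} [TopologicalSpace M] [ChartedSpace E M] [IsManifold 𝓘(ℝ, E) ∞ M]
  {N : Type*} [TopologicalSpace N] [ChartedSpace F N] [IsManifold 𝓘(ℝ, F) ∞ N]
  {N' : Type*} [TopologicalSpace N'] [ChartedSpace F' N'] [IsManifold 𝓘(ℝ, F') ∞ N']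

/-- Locally `p` is `p ∘ q` composed with a smooth section of `q`, hence smooth; its differential is
onto because that of `p ∘ q` factors through it. -/
theorem IsSmoothSubmersion.of_comp {q : M → N} {p : N → N'}
    (hq : IsSmoothSubmersion (E := E) (F := F) q) (hqs : Function.Surjective q)
    (hpq : IsSmoothSubmersion (E := E) (F := F') fun x => p (q x)) :
    IsSmoothSubmersion (E := F) (F := F') p := by
  have hp : ContMDiff 𝓘(ℝ, F) 𝓘(ℝ, F') ∞ p := fun y => by
    obtain ⟨x, rfl⟩ := hqs y
    obtain ⟨s, -, hs⟩ := exists_smooth_section (E := E) (F := F) (p := q) (x₀ := x)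
      (Filter.Eventually.of_forall fun x => hq.1 x) (hq.2 x)
    refine ((hpq.1 (s (q x))).comp (q x) hs.self_of_nhds.1).congr_of_eventuallyEq ?_
    filter_upwards [hs] with y hy
    change p y = p (q (s y))
    rw [hy.2]
  refine ⟨hp, fun y w => ?_⟩
  obtain ⟨x, rfl⟩ := hqs y
  obtain ⟨v, hv⟩ := hpq.2 x w
  refine ⟨tangentField (E := E) (F := F) q x v, Eq.trans ?_ hv⟩
  exact (DFunLike.congr_fun (tangentField_comp (E := E) (F := F) (F' := F') (hp (q x)) (hq.1 x))
    v).symm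

theorem IsSmoothSubmersion.sigmaCompactSpace [SigmaCompactSpace M] {q : M → N}
    (hq : IsSmoothSubmersion (E := E) (F := F) q) (hqs : Function.Surjective q) :
    SigmaCompactSpace N := by
  rw [← isSigmaCompact_univ_iff, ← hqs.range_eq, ← Set.image_univ]
  exact isSigmaCompact_univ.image hq.1.continuous

theorem isOrbitSubmersion_orbitProj {K : Type*} [Group K] [MulAction K M]
    [ChartedSpace F (MulAction.orbitRel.Quotient K M)]
    (hK : ∀ g : K, ContMDiff 𝓘(ℝ, E) 𝓘(ℝ, E) ∞ (fun x : M => g • x))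
    (hq : IsSmoothSubmersion (E := E) (F := F) (orbitProj K M)) :
    IsOrbitSubmersion (E := E) (F := F) K (orbitProj K M) where
  contMDiff_smul := hK
  submersion := hq
  surjective := Quotient.mk_surjective
  apply_smul g x := Quotient.sound ⟨g, rfl⟩
  exists_smul x y h := by
    obtain ⟨g, hg⟩ := Quotient.exact h
    exact ⟨g⁻¹, inv_smul_eq_iff.2 hg.symm⟩

section LieGroup

variable {V : Type*} [NormedAddCommGroup V] [NormedSpace ℝ V] [FiniteDimensional ℝ V]
  {G : Type*} [TopologicalSpace G] [SecondCountableTopology G] [ChartedSpace V G] [Group G]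
  [LieGroup 𝓘(ℝ, V) ∞ G] [MulAction G M] [ContMDiffSMul 𝓘(ℝ, V) 𝓘(ℝ, E) ∞ G M]

theorem IsOrbitSubmersion.hasSmoothSlices {q : M → N}
    (h : IsOrbitSubmersion (E := E) (F := F) G q) (V : Type*) [NormedAddCommGroup V]
    [NormedSpace ℝ V] [FiniteDimensional ℝ V] [ChartedSpace V G] [LieGroup 𝓘(ℝ, V) ∞ G]
    [ContMDiffSMul 𝓘(ℝ, V) 𝓘(ℝ, E) ∞ G M] : HasSmoothSlices (E := E) (F := F) G q := by
  intro s z hs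
  obtain ⟨γ, hγ⟩ := exists_slice (V := V) h.submersion h.apply_smul h.exists_smul
    (exists_tangentField_orbitMap_eq h.submersion h.apply_smul h.exists_smul) hs z rfl
  refine ⟨γ, hγ.mono fun x hx => ⟨hx.2, fun y => ?_⟩⟩
  have h1 : ContMDiffAt (𝓘(ℝ, E).prod 𝓘(ℝ, E)) 𝓘(ℝ, V) ∞ (fun p : M × M => γ p.1) (x, y) :=
    ContMDiffAt.comp (x, y) hx.1 contMDiffAt_fst
  exact ⟨h1.smul contMDiffAt_snd, h1.inv.smul contMDiffAt_snd⟩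

variable {ι : Type*} {S : FormSet E M} {θ : ι → DForm E M 1} {r : ℕ}

/-- All 1-forms of `S` take values in the span of `θ`, and vertical vectors are generators, so
transversality becomes a condition on `θ` and the differential of `q`. -/
theorem IsTransverse.eq_zero (hT : IsTransverse (V := V) G S) (hθ : IsPfaffianFrame S θ r)
    {q : M → N} (h : IsOrbitSubmersion (E := E) (F := F) G q) (x : M) (v : E)
    (hv : ∀ i, θ i x (fun _ => v) = 0) (hqv : tangentField (E := E) (F := F) q x v = 0) : v = 0 :=
  hT x v (fun β hβ => form_apply_eq_zero_of_mem_span (hθ.mem_span β hβ x) hv)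
    (exists_tangentField_orbitMap_eq (V := V) h.submersion h.apply_smul h.exists_smul x v hqv)

end LieGroup

theorem IsSymmetryGroup.mem_span {K : Type*} [Group K] [MulAction K M] {ι : Type*}
    {S : FormSet E M} {θ : ι → DForm E M 1} {r : ℕ} [T2Space M] [SigmaCompactSpace M]
    (hS : IsSymmetryGroup K S) (hθ : IsPfaffianFrame S θ r) (g : K) (j : ι) (y : M) :
    (formPullback (fun x : M => g • x) (θ j) : DForm E M 1) y ∈
      Submodule.span ℝ (Set.range fun i => θ i y) := by
  refine hθ.mem_span _ ?_ y
  have h1 : (formPullback (fun x : M => g • x) (θ j) : DForm E M 1) ∈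
      pullbackSet (fun x : M => g • x) S 1 := ⟨θ j, hθ.form_mem j, rfl⟩
  rwa [hS g] at h1

section Pair

variable [T2Space M] [SigmaCompactSpace M] [T2Space N] [SigmaCompactSpace N] [T2Space N']
  [SigmaCompactSpace N']
  {V : Type*} [NormedAddCommGroup V] [NormedSpace ℝ V] [FiniteDimensional ℝ V]
  {G : Type*} [TopologicalSpace G] [SecondCountableTopology G] [ChartedSpace V G] [Group G]
  [LieGroup 𝓘(ℝ, V) ∞ G] [MulAction G M] [ContMDiffSMul 𝓘(ℝ, V) 𝓘(ℝ, E) ∞ G M]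
  {K : Type*} [Group K] [MulAction K M] {S : FormSet E M} {q : M → N} {p : N → N'}

/-- For a transverse group `G` and a subgroup `K`, the projections between `M` and the two
quotients are integrable extensions. -/
theorem isIntegrableExtension_of_isTransverse (hS : IsPfaffianSystem S)
    (hK : IsOrbitSubmersion (E := E) (F := F) K q)
    (hG : IsOrbitSubmersion (E := E) (F := F') G fun x => p (q x))
    (hKS : IsSymmetryGroup K S) (hGS : IsSymmetryGroup G S) (hT : IsTransverse (V := V) G S) :
    IsIntegrableExtension q S (reduction q S : FormSet F N) ∧
      IsIntegrableExtension (fun x => p (q x)) S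
        (reduction (fun x => p (q x)) S : FormSet F' N') ∧
      IsIntegrableExtension p (reduction q S : FormSet F N)
        (reduction (fun x => p (q x)) S : FormSet F' N') := by
  have hp := hK.submersion.of_comp hK.surjective hG.submersion
  obtain ⟨ι, _, θ, r, hθ⟩ := exists_isPfaffianFrame hS
  have hcomp : ∀ x w, tangentField (E := E) (F := F') (fun x => p (q x)) x w =
      tangentField (E := F) (F := F') p (q x) (tangentField (E := E) (F := F) q x w) := fun x w =>
    DFunLike.congr_fun (tangentField_comp (E := E) (F := F) (F' := F') (hp.1 (q x))
      (hK.submersion.1 x)) w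
  have hinj := hT.eq_zero hθ hG
  obtain ⟨Q, hQ, hQθ⟩ := exists_splitting hG.submersion hθ.smooth hinj
  -- Vectors vertical for `q` are vertical for `p ∘ q`, so transversality of `G` also supplies a
  -- splitting for `q`.
  obtain ⟨R, hR, hRθ⟩ := exists_splitting hK.submersion hθ.smooth
    fun x v hv hqv => hinj x v hv (by rw [hcomp, hqv, map_zero])
  have hQa : IsAdaptedSplitting (F := F') G (fun x => p (q x)) S θ r Q :=
    ⟨hG, hθ, hGS.mem_span hθ, hQ, hQθ⟩
  have hRa : IsAdaptedSplitting (F := F) K q S θ r R := ⟨hK, hθ, hKS.mem_span hθ, hR, hRθ⟩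
  have hSQ := hQa.eq_extensionIdeal (hG.hasSmoothSlices V)
  -- No topology is assumed on `K`, so slices are used only for `G`, and the equality for `q` is
  -- deduced from the one for `p ∘ q`.
  have hSR := hRa.eq_extensionIdeal_of_comp hp.1 hSQ
  obtain ⟨P, hP, hPθ⟩ := exists_splitting_of_comp hK.submersion hK.surjective hp.1 hQ
    (fun hx hv => hRa.exists_transport hx hv) hQθ
  have hSP := reduction_eq_extensionIdeal hK.submersion hK.surjective hp.1 hθ.isEDS hQ hSQ hθ hP hPθ
  have hred := reduction_comp hK.submersion.1 hp.1 S
  have hEK : IsEDS (reduction q S : FormSet F N) := hθ.isEDS.reduction hK.submersion.1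
  refine ⟨hR.isIntegrableExtension hK.submersion hK.surjective hθ.isEDS hEK hSR,
    hQ.isIntegrableExtension hG.submersion hG.surjective hθ.isEDS
      (hθ.isEDS.reduction hG.submersion.1) hSQ, ?_⟩
  rw [hred]
  refine hP.isIntegrableExtension hp (fun z => ?_) hEK (hEK.reduction hp.1) hSP
  obtain ⟨x, rfl⟩ := hG.surjective z
  exact ⟨q x, rfl⟩

end Pair

end Quotients
end

/-! ### The diagram of quotients for the two groups -/

theorem mainTheorem1
    -- the manifold `M`
    {E : Type*} [NormedAddCommGroup E] [NormedSpace ℝ E] [FiniteDimensional ℝ E]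
    {M : Type*} [TopologicalSpace M] [T2Space M] [SecondCountableTopology M]
    [ChartedSpace E M] [IsManifold 𝓘(ℝ, E) ∞ M]
    -- the Lie group `G₁`, acting smoothly on `M`
    {V₁ : Type*} [NormedAddCommGroup V₁] [NormedSpace ℝ V₁] [FiniteDimensional ℝ V₁]
    {G₁ : Type*} [TopologicalSpace G₁] [T2Space G₁] [SecondCountableTopology G₁]
    [ChartedSpace V₁ G₁] [Group G₁] [LieGroup 𝓘(ℝ, V₁) ∞ G₁]
    [MulAction G₁ M] [ContMDiffSMul 𝓘(ℝ, V₁) 𝓘(ℝ, E) ∞ G₁ M]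
    -- the Lie group `G₂`, acting smoothly on `M`
    {V₂ : Type*} [NormedAddCommGroup V₂] [NormedSpace ℝ V₂] [FiniteDimensional ℝ V₂]
    {G₂ : Type*} [TopologicalSpace G₂] [T2Space G₂] [SecondCountableTopology G₂]
    [ChartedSpace V₂ G₂] [Group G₂] [LieGroup 𝓘(ℝ, V₂) ∞ G₂]
    [MulAction G₂ M] [ContMDiffSMul 𝓘(ℝ, V₂) 𝓘(ℝ, E) ∞ G₂ M]
    -- the common subgroup `H`, acting through `G₁` and through `G₂` in the same way
    {H : Type*} [Group H] [MulAction H M]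
    (ι₁ : H →* G₁) (ι₂ : H →* G₂)
    (hι₁ : Function.Injective ι₁) (hι₂ : Function.Injective ι₂)
    (hact₁ : ∀ (h : H) (x : M), ι₁ h • x = h • x)
    (hact₂ : ∀ (h : H) (x : M), ι₂ h • x = h • x)
    -- the orbit spaces are smooth manifolds with smooth quotient maps
    {F : Type*} [NormedAddCommGroup F] [NormedSpace ℝ F] [FiniteDimensional ℝ F]
    [ChartedSpace F (MulAction.orbitRel.Quotient H M)]
    [IsManifold 𝓘(ℝ, F) ∞ (MulAction.orbitRel.Quotient H M)]
    [T2Space (MulAction.orbitRel.Quotient H M)]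
    {F₁ : Type*} [NormedAddCommGroup F₁] [NormedSpace ℝ F₁] [FiniteDimensional ℝ F₁]
    [ChartedSpace F₁ (MulAction.orbitRel.Quotient G₁ M)]
    [IsManifold 𝓘(ℝ, F₁) ∞ (MulAction.orbitRel.Quotient G₁ M)]
    [T2Space (MulAction.orbitRel.Quotient G₁ M)]
    {F₂ : Type*} [NormedAddCommGroup F₂] [NormedSpace ℝ F₂] [FiniteDimensional ℝ F₂]
    [ChartedSpace F₂ (MulAction.orbitRel.Quotient G₂ M)]
    [IsManifold 𝓘(ℝ, F₂) ∞ (MulAction.orbitRel.Quotient G₂ M)]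
    [T2Space (MulAction.orbitRel.Quotient G₂ M)]
    (hqH : IsSmoothSubmersion (E := E) (F := F) (orbitProj H M))
    (hq₁ : IsSmoothSubmersion (E := E) (F := F₁) (orbitProj G₁ M))
    (hq₂ : IsSmoothSubmersion (E := E) (F := F₂) (orbitProj G₂ M))
    -- the Pfaffian system and its symmetries
    (S : FormSet E M) (hS : IsPfaffianSystem S)
    (hsym₁ : IsSymmetryGroup G₁ S) (hsym₂ : IsSymmetryGroup G₂ S) :
    -- the reduced systems `S/H`, `S/G₁`, `S/G₂`
    let SH : FormSet F (MulAction.orbitRel.Quotient H M) := reduction (orbitProj H M) S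
    let S₁ : FormSet F₁ (MulAction.orbitRel.Quotient G₁ M) := reduction (orbitProj G₁ M) S
    let S₂ : FormSet F₂ (MulAction.orbitRel.Quotient G₂ M) := reduction (orbitProj G₂ M) S
    ∃ (p₁ : MulAction.orbitRel.Quotient H M → MulAction.orbitRel.Quotient G₁ M)
      (p₂ : MulAction.orbitRel.Quotient H M → MulAction.orbitRel.Quotient G₂ M),
      -- `p_a (H x) = G_a x`; in particular the diagram of maps commutes
      (∀ x : M, p₁ (orbitProj H M x) = orbitProj G₁ M x) ∧
      (∀ x : M, p₂ (orbitProj H M x) = orbitProj G₂ M x) ∧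
      -- the diagram is a diagram of exterior differential systems
      (IsEDS S ∧ IsEDS SH ∧ IsEDS S₁ ∧ IsEDS S₂ ∧
        IsEDSMap (orbitProj H M) S SH ∧
        IsEDSMap (orbitProj G₁ M) S S₁ ∧ IsEDSMap (orbitProj G₂ M) S S₂ ∧
        IsEDSMap p₁ SH S₁ ∧ IsEDSMap p₂ SH S₂ ∧
        Function.Surjective p₁ ∧ Function.Surjective p₂ ∧
        IsSmoothSubmersion (E := F) (F := F₁) p₁ ∧ IsSmoothSubmersion (E := F) (F := F₂) p₂ ∧
        S₁ = reduction p₁ SH ∧ S₂ = reduction p₂ SH) ∧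
      -- the transverse case
      (IsTransverse (V := V₁) G₁ S → IsTransverse (V := V₂) G₂ S →
        IsIntegrableExtension (orbitProj H M) S SH ∧
        IsIntegrableExtension (orbitProj G₁ M) S S₁ ∧
        IsIntegrableExtension (orbitProj G₂ M) S S₂ ∧
        IsIntegrableExtension p₁ SH S₁ ∧
        IsIntegrableExtension p₂ SH S₂ ∧
        IsBacklundTransformation SH S₁ S₂) := by
  have : LocallyCompactSpace M := Manifold.locallyCompact_of_finiteDimensional 𝓘(ℝ, E)
  -- The group `H` carries no smooth structure; its elements act by smooth symmetries because they
  -- act as elements of `G₁`.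
  have hH : ∀ h : H, ContMDiff 𝓘(ℝ, E) 𝓘(ℝ, E) ∞ (fun x : M => h • x) := fun h => by
    simp only [← hact₁]
    exact contMDiff_translation V₁ (ι₁ h)
  have hHS : IsSymmetryGroup H S := fun h => by
    simp only [← hact₁]
    exact hsym₁ (ι₁ h)
  have oH := isOrbitSubmersion_orbitProj hH hqH
  have o₁ := isOrbitSubmersion_orbitProj (contMDiff_translation V₁) hq₁
  have o₂ := isOrbitSubmersion_orbitProj (contMDiff_translation V₂) hq₂
  have := hqH.sigmaCompactSpace oH.surjective
  have := hq₁.sigmaCompactSpace o₁.surjective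
  have := hq₂.sigmaCompactSpace o₂.surjective
  intro SH S₁ S₂
  let p₁ : MulAction.orbitRel.Quotient H M → MulAction.orbitRel.Quotient G₁ M :=
    Quotient.lift (orbitProj G₁ M) fun a b ⟨h, hb⟩ => Quotient.sound ⟨ι₁ h, (hact₁ h b).trans hb⟩
  let p₂ : MulAction.orbitRel.Quotient H M → MulAction.orbitRel.Quotient G₂ M :=
    Quotient.lift (orbitProj G₂ M) fun a b ⟨h, hb⟩ => Quotient.sound ⟨ι₂ h, (hact₂ h b).trans hb⟩
  have hp₁ : IsSmoothSubmersion (E := F) (F := F₁) p₁ := hqH.of_comp oH.surjective hq₁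
  have hp₂ : IsSmoothSubmersion (E := F) (F := F₂) p₂ := hqH.of_comp oH.surjective hq₂
  have hps₁ : Function.Surjective p₁ := Function.Surjective.of_comp (g := orbitProj H M) o₁.surjective
  have hps₂ : Function.Surjective p₂ := Function.Surjective.of_comp (g := orbitProj H M) o₂.surjective
  obtain ⟨ι, _, θ, r, hθ⟩ := exists_isPfaffianFrame hS
  have hE := hθ.isEDS
  have hr₁ : S₁ = reduction p₁ SH := reduction_comp hqH.1 hp₁.1 S
  have hr₂ : S₂ = reduction p₂ SH := reduction_comp hqH.1 hp₂.1 S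
  refine ⟨p₁, p₂, fun _ => rfl, fun _ => rfl,
    ⟨hE, hE.reduction hqH.1, hE.reduction hq₁.1, hE.reduction hq₂.1,
      ⟨hqH.1, pullbackSet_reduction_subset _ S⟩, ⟨hq₁.1, pullbackSet_reduction_subset _ S⟩,
      ⟨hq₂.1, pullbackSet_reduction_subset _ S⟩,
      ⟨hp₁.1, by rw [hr₁]; exact pullbackSet_reduction_subset _ SH⟩,
      ⟨hp₂.1, by rw [hr₂]; exact pullbackSet_reduction_subset _ SH⟩,
      hps₁, hps₂, hp₁, hp₂, hr₁, hr₂⟩, fun ht₁ ht₂ => ?_⟩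
  obtain ⟨h, h₁, h₁'⟩ :=
    isIntegrableExtension_of_isTransverse (p := p₁) hS oH o₁ hHS hsym₁ ht₁
  -- The extension property of the projection to `M/H` has already been obtained through `G₁`.
  obtain ⟨-, h₂, h₂'⟩ :=
    isIntegrableExtension_of_isTransverse (p := p₂) hS oH o₂ hHS hsym₂ ht₂
  exact ⟨h, h₁, h₂, h₁', h₂', p₁, p₂, h₁', h₂'⟩
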